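/- Let $\Bbbk$ be a commutative ring with identity. All dga's $A=\bigoplus_{n\ge 0}A^n$ are unital, associative, with differential $d$ of degree $+1$ and $d(ab)=da\cdot b+(-1)^{|a|}a\cdot db$, and are 1-reduced: $A^0=\Bbbk$, $A^1=0$. "$\Bbbk$-free" means that every $A^n$ is a free $\Bbbk$-module. For homogeneous $a_1,a_2,\dots$ put $\epsilon_i=\epsilon^a_i=|a_1|+\dots+|a_i|+i$. **Bar and Hochschild complexes.** $BA=\bigoplus_{n\ge0}(s^{-1}A_{>0})^{\otimes n}$ is spanned by the words $[\bar a_1|\cdots|\bar a_n]$, with $$d[\bar a_1|\cdots|\bar a_n]=-\sum_{i=1}^n(-1)^{\epsilon_{i-1}}[\cdots|\overline{da_i}|\cdots]-\sum_{i=1}^{n-1}(-1)^{\epsilon_i}[\cdots|\overline{a_ia_{i+1}}|\cdots].$$ $\Lambda A=A\otimes BA$ has the differential $$d(u\otimes w)=du\otimes w+(-1)^{|u|}u\otimes dw-(-1)^{|u|}ua_1\otimes[\bar a_2|\cdots|\bar a_n]+(-1)^{(|a_n|+1)(|u|+\epsilon_{n-1})}a_nu\otimes[\bar a_1|\cdots|\bar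 a_{n-1}]$$ for $w=[\bar a_1|\cdots|\bar a_n]$ (without the last two terms if $n=0$), and $HH(A)=H(\Lambda A,d)$. **Homotopy $G$-algebras.** An hga is a 1-reduced dga with operations $E_{k}=E_{k,1}:(A_{>0})^{\otimes k}\otimes A\to A$, $k\ge0$, of degree $-k$, with $E_{0}=\mathrm{id}$ (normalization: $E_k(a_1,\dots,a_k;b)$ is taken to be $0$ if some $a_i\in A^0$), such that for $k\ge1$ $$\begin{aligned}dE_k(a_1,\dots,a_k;b)={}&\sum_{i=1}^k(-1)^{\epsilon_{i-1}}E_k(\dots,da_i,\dots;b)+(-1)^{\epsilon_k}E_k(a_1,\dots,a_k;db)+\sum_{i=1}^{k-1}(-1)^{\epsilon_i}E_{k-1}(\dots,a_ia_{i+1},\dots;b)\\&+(-1)^{\epsilon_k+|a_k||b|}E_{k-1}(a_1,\dots,a_{k-1};b)\cdot a_k+(-1)^{|a_1|}a_1\cdot E_{k-1}(a_2,\dots,a_k;b),\end{aligned}$$ $$E_k(a_1,\dots,a_k;bc)=\sum_{i=0}^k(-1)^{|b|(\epsilon_i+\epsilon_k)}E_i(a_1,\dots,a_i;b)\cdot E_{k-i}(a_{i+1},\dots,a_k;c),$$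 and $E(\mu_E(w\otimes w');c)=E(w;E(w';c))$ for all words $w,w'$, where $E([\bar a_1|\cdots|\bar a_k];b)=E_k(a_1,\dots,a_k;b)$ and $\mu_E:BA\otimes BA\to BA$ is given by $\mu_E(w\otimes[\,])=w$ and $$\mu_E([\bar a_1|\cdots|\bar a_m]\otimes[\bar b_1|w'])=\sum_{0\le i\le j\le m}(-1)^{(|b_1|+1)(\epsilon_m-\epsilon_j)}\bigl[\bar a_1|\cdots|\bar a_i|\overline{E(a_{i+1},\dots,a_j;b_1)}\,\big|\,\mu_E([\bar a_{j+1}|\cdots|\bar a_m]\otimes w')\bigr].$$ **The product.** $\lambda_E:\Lambda A\otimes\Lambda A\to\Lambda A$ sends $(u\otimes[\bar a_1|\cdots|\bar a_m])\otimes(v\otimes[\bar b_1|\cdots|\bar b_n])$ to $$\begin{aligned}&\sum_{p=0}^m(-1)^{\varepsilon_1}u\cdot E(a_1,\dots,a_p;v)\otimes\mu_E([\bar a_{p+1}|\cdots|\bar a_m]\otimes[\bar b_1|\cdots|\bar b_n])\\&+\sum_{0\le i\le j\le k\le m}(-1)^{\varepsilon_2}E(a_{k+1},\dots,a_m,u,a_1,\dots,a_i;b_n)\cdot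 E(a_{i+1},\dots,a_j;v)\otimes\mu_E([\bar a_{j+1}|\cdots|\bar a_k]\otimes[\bar b_1|\cdots|\bar b_{n-1}])\end{aligned}$$ (no second sum if $n=0$), where $\varepsilon_1=\epsilon^a_p+(\epsilon^a_p+\epsilon^a_m)|v|$ and $$\varepsilon_2=\epsilon^a_i+\epsilon^a_m+(|u|+\epsilon^a_k)(\epsilon^a_k+\epsilon^a_m)+(|v|+\epsilon^b_{n-1}+\epsilon^a_i+\epsilon^a_k)(|b_n|+1)+(\epsilon^a_j+\epsilon^a_k)(|v|+1).$$ **Proposition.** Let $A,A'$ be $\Bbbk$-free hga's and $f:A\to A'$ a dga map. Assume that there are maps $s_k=s_{k,1}:(A_{>0})^{\otimes k}\otimes A\to A'$, $k\ge1$, of degree $-k-1$ (put $s_0=0$), such that for $k\ge1$ $$\begin{aligned}fE_k(a_1,\dots,a_k;b)-E'_k(fa_1,\dots,fa_k;fb)={}&-(s_k+s_{k-1})D(a_1,\dots,a_k;b)-d's_k(a_1,\dots,a_k;b)\\&-fa_1\cdot s_{k-1}(a_2,\dots,a_k;b)-(-1)^{\epsilon_k+|a_k||b|}s_{k-1}(a_1,\dots,a_{k-1};b)\cdot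 fa_k,\end{aligned}$$ where $D(a_1,\dots,a_k;b)=\sum_{i=1}^k(-1)^{\epsilon_{i-1}}(a_1,\dots,da_i,\dots,a_k;b)+(-1)^{\epsilon_k}(a_1,\dots,a_k;db)+\sum_{i=1}^{k-1}(-1)^{\epsilon_i}(a_1,\dots,a_ia_{i+1},\dots,a_k;b)$, and $$\begin{aligned}s(a_1,\dots,a_k;bc)={}&\sum_{i=0}^{k-1}(-1)^{(|b|+1)\epsilon_i+|b|(\epsilon_k+1)}E'(fa_1,\dots,fa_i;fb)\cdot s(a_{i+1},\dots,a_k;c)\\&+\sum_{j=1}^k(-1)^{|b|(\epsilon_j+\epsilon_k)}s(a_1,\dots,a_j;b)\cdot fE(a_{j+1},\dots,a_k;c).\end{aligned}$$ Then $\lambda_E$ and $\lambda_{E'}$ induce well-defined bilinear products on $HH(A)$ and $HH(A')$ (products of cycles are cycles, and $[x][y]=[\lambda_E(x\otimes y)]$), and the map $HH(f):HH(A)\to HH(A')$ induced by the chain map $\Lambda f=f\otimes Bf$ is an algebra map: it preserves these products and the unit class $[1\otimes[\,]]$. Moreover, if $H(f):H(A)\to H(A')$ is an isomorphism, then so is $HH(f)$.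 -/

import Mathlib

open scoped TensorProduct DirectSum

noncomputable section

namespace HGA

/-! ### Homology of a module with an endomorphism `d` (used with `d ∘ d = 0`) -/

section Homology

variable {k M M' : Type*} [CommRing k] [AddCommGroup M] [Module k M]
  [AddCommGroup M'] [Module k M']

/-- `H(M, d) = ker d / im d`. -/
abbrev Homology (d : M →ₗ[k] M) : Type _ :=
  LinearMap.ker d ⧸ (LinearMap.range d).submoduleOf (LinearMap.ker d)

/-- The homology class of a cycle. -/
def Homology.mk (d : M →ₗ[k] M) (x : M) (hx : d x = 0) : Homology d :=
  Submodule.Quotient.mk ⟨x, LinearMap.mem_ker.2 hx⟩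

/-- The map induced on homology by a chain map. -/
def Homology.map {d : M →ₗ[k] M} {d' : M' →ₗ[k] M'} (f : M →ₗ[k] M')
    (hf : ∀ x, f (d x) = d' (f x)) : Homology d →ₗ[k] Homology d' :=
  Submodule.mapQ _ _
    (f.restrict (p := LinearMap.ker d) (q := LinearMap.ker d') (fun x hx => by
      rw [LinearMap.mem_ker] at hx ⊢
      rw [← hf, hx, map_zero]))
    (by
      rintro ⟨x, hx⟩ ⟨y, hy⟩
      exact ⟨f y, by rw [← hf, hy]; rfl⟩)

end Homology

/-! ### Signs and the bar coalgebra of a graded algebra -/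

section Bar

variable {k A : Type*} [CommRing k] [Ring A] [Algebra k A]
variable (𝒜 : ℕ → Submodule k A) [GradedAlgebra 𝒜]

/-- The projection of `A` onto the part of degree parity `p`. -/
def par (p : ZMod 2) : A →ₗ[k] A :=
  (DirectSum.toModule k ℕ A fun n => if (n : ZMod 2) = p then (𝒜 n).subtype else 0) ∘ₗ
    (DirectSum.decomposeLinearEquiv 𝒜).toLinearMap

/-- The grading involution `a ↦ (-1)^|a| a`. -/
def sgn : Module.End k A := par 𝒜 0 - par 𝒜 1

/-- The part `A_{>0}` of positive degree. -/
abbrev Pos : Submodule k A := LinearMap.ker (GradedAlgebra.proj 𝒜 0)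

/-- The projection of `A` onto `A_{>0}` that kills `A⁰`. -/
def toPos : A →ₗ[k] Pos 𝒜 :=
  (LinearMap.id - GradedAlgebra.proj 𝒜 0).codRestrict (Pos 𝒜) fun a => by
    simp [LinearMap.mem_ker, GradedAlgebra.proj_apply]

theorem coe_toPos (a : A) : ((toPos 𝒜 a : Pos 𝒜) : A) = a - GradedAlgebra.proj 𝒜 0 a := rfl

/-- The underlying module `T(s⁻¹ A_{>0})` of the bar construction `BA`; the word
`[ā₁|⋯|āₙ]` is the product of the letters `[āᵢ]`. The letter `[ā]` counts with the
degree `|a| + 1` modulo two. -/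
abbrev Bar : Type _ := TensorAlgebra k (Pos 𝒜)

/-- The one-letter word `[ā]`; it is zero for `a ∈ A⁰` (normalization). -/
def letter : A →ₗ[k] Bar 𝒜 := TensorAlgebra.ι k ∘ₗ toPos 𝒜

/-- The word `[ā₁|⋯|āₙ]`. -/
def word (l : List A) : Bar 𝒜 := (l.map (letter 𝒜)).prod

/-- The universal twisting cochain `τ : BA → A`: `τ [ā] = a` for `a ∈ A_{>0}`, and `τ`
vanishes on words of length `≠ 1`. -/
def tau : Bar 𝒜 →ₗ[k] A := (Pos 𝒜).subtype ∘ₗ TensorAlgebra.ιInv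

/-- The sign involution `[ā₁|⋯|āₙ] ↦ (-1)^ε [ā₁|⋯|āₙ]`, `ε = |a₁| + ⋯ + |aₙ| + n`. -/
def sgnBar : Module.End k (Bar 𝒜) :=
  (TensorAlgebra.lift k (-(letter 𝒜 ∘ₗ sgn 𝒜 ∘ₗ (Pos 𝒜).subtype))).toLinearMap

/-- The projection of `BA` onto the span of the words with
`|a₁| + ⋯ + |aₙ| + n ≡ p` modulo two. -/
def parBar (p : ZMod 2) : Bar 𝒜 →ₗ[k] Bar 𝒜 :=
  Finsupp.lapply p ∘ₗ (AddMonoidAlgebra.coeffLinearEquiv k).toLinearMap ∘ₗ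
    (TensorAlgebra.lift k (A := AddMonoidAlgebra (Bar 𝒜) (ZMod 2))
      (∑ q : ZMod 2, (AddMonoidAlgebra.coeffLinearEquiv k).symm.toLinearMap ∘ₗ
        Finsupp.lsingle (q + 1) ∘ₗ letter 𝒜 ∘ₗ par 𝒜 q ∘ₗ (Pos 𝒜).subtype)).toLinearMap

/-- One step of the recursion defining deconcatenation: prepending a letter `[ā]` sends
`(w, Δ w)` to `([ā] w, 1 ⊗ [ā] w + ([ā] ⊗ 1) Δ w)`. -/
def deconcStep : Pos 𝒜 →ₗ[k] Module.End k (Bar 𝒜 × (Bar 𝒜 ⊗[k] Bar 𝒜)) where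
  toFun a :=
    { toFun := fun x => (TensorAlgebra.ι k a * x.1,
        1 ⊗ₜ (TensorAlgebra.ι k a * x.1) + (TensorAlgebra.ι k a ⊗ₜ 1) * x.2)
      map_add' := fun x y => by
        ext1 <;> simp only [Prod.fst_add, Prod.snd_add, mul_add, TensorProduct.tmul_add]
        abel
      map_smul' := fun c x => by
        ext1 <;> simp [TensorProduct.tmul_smul] }
  map_add' a b := by
    refine LinearMap.ext fun x => Prod.ext ?_ ?_
    · simp [add_mul]
    · simp [add_mul, TensorProduct.add_tmul, TensorProduct.tmul_add]
      abel
  map_smul' c a := by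
    refine LinearMap.ext fun x => Prod.ext ?_ ?_
    · simp
    · simp [← TensorProduct.smul_tmul', TensorProduct.tmul_smul]

/-- The deconcatenation coproduct `Δ [ā₁|⋯|āₙ] = ∑ᵢ [ā₁|⋯|āᵢ] ⊗ [āᵢ₊₁|⋯|āₙ]` of `BA`. -/
def deconc : Bar 𝒜 →ₗ[k] Bar 𝒜 ⊗[k] Bar 𝒜 :=
  LinearMap.snd k _ _ ∘ₗ LinearMap.applyₗ ((1 : Bar 𝒜), (1 : Bar 𝒜) ⊗ₜ[k] (1 : Bar 𝒜)) ∘ₗ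
    (TensorAlgebra.lift k (deconcStep 𝒜)).toLinearMap

variable {M : Type*} [AddCommMonoid M] [Module k M]

/-- The sum `∑ φ(w', w'')` over all cuts `w = w' w''` of a word into two (possibly empty)
consecutive pieces. -/
def cut : (Bar 𝒜 →ₗ[k] Bar 𝒜 →ₗ[k] M) →ₗ[k] Bar 𝒜 →ₗ[k] M :=
  LinearMap.lcomp k M (deconc 𝒜) ∘ₗ TensorProduct.uncurry (RingHom.id k) (Bar 𝒜) (Bar 𝒜) M

/-- The sum `∑ φ(w', w'', w''')` over all cuts `w = w' w'' w'''` of a word into three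
(possibly empty) consecutive pieces. -/
def cut₃ : (Bar 𝒜 →ₗ[k] Bar 𝒜 →ₗ[k] Bar 𝒜 →ₗ[k] M) →ₗ[k] Bar 𝒜 →ₗ[k] M :=
  cut 𝒜 ∘ₗ LinearMap.compRight k (cut 𝒜)

variable {𝒜}

theorem deconcStep_apply (a : Pos 𝒜) (x : Bar 𝒜 × (Bar 𝒜 ⊗[k] Bar 𝒜)) :
    deconcStep 𝒜 a x = (TensorAlgebra.ι k a * x.1,
      1 ⊗ₜ (TensorAlgebra.ι k a * x.1) + (TensorAlgebra.ι k a ⊗ₜ 1) * x.2) := rfl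

theorem deconc_fst (w x : Bar 𝒜) (y : Bar 𝒜 ⊗[k] Bar 𝒜) :
    (TensorAlgebra.lift k (deconcStep 𝒜) w (x, y)).1 = w * x := by
  induction w using TensorAlgebra.induction generalizing x y with
  | algebraMap r => simp [Algebra.algebraMap_eq_smul_one]
  | ι a => simp [deconcStep]
  | mul a b ha hb =>
    have h := hb x y
    rw [map_mul, Module.End.mul_apply]
    exact (ha _ _).trans ((congrArg (a * ·) h).trans (mul_assoc a b x).symm)
  | add a b ha hb => simp [ha, hb, add_mul]

@[simp] theorem deconc_one : deconc 𝒜 1 = 1 ⊗ₜ 1 := by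
  simp [deconc]

theorem deconc_letter_mul (a : A) (w : Bar 𝒜) :
    deconc 𝒜 (letter 𝒜 a * w) =
      1 ⊗ₜ (letter 𝒜 a * w) + (letter 𝒜 a ⊗ₜ 1) * deconc 𝒜 w := by
  have h := deconc_fst (𝒜 := 𝒜) w 1 (1 ⊗ₜ 1)
  simp only [deconc, letter, LinearMap.comp_apply, AlgHom.toLinearMap_apply, map_mul,
    Module.End.mul_apply, LinearMap.applyₗ_apply_apply, LinearMap.snd_apply,
    TensorAlgebra.lift_ι_apply]
  rw [mul_one] at h
  rw [deconcStep_apply, h]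

theorem cut_apply (φ : Bar 𝒜 →ₗ[k] Bar 𝒜 →ₗ[k] M) (w : Bar 𝒜) :
    cut 𝒜 φ w = TensorProduct.lift φ (deconc 𝒜 w) := rfl

/-- On words, `cut` is the sum over the two-piece cuts. -/
theorem cut_word (φ : Bar 𝒜 →ₗ[k] Bar 𝒜 →ₗ[k] M) (l : List A) :
    cut 𝒜 φ (word 𝒜 l) =
      ∑ i ∈ Finset.range (l.length + 1), φ (word 𝒜 (l.take i)) (word 𝒜 (l.drop i)) := by
  induction l generalizing φ with
  | nil => simp [cut_apply, word]
  | cons a l ih =>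
    have h : TensorProduct.lift φ ((letter 𝒜 a ⊗ₜ 1) * deconc 𝒜 (word 𝒜 l)) =
        cut 𝒜 (φ ∘ₗ LinearMap.mulLeft k (letter 𝒜 a)) (word 𝒜 l) := by
      rw [cut_apply]
      induction deconc 𝒜 (word 𝒜 l) using TensorProduct.induction_on with
      | zero => simp
      | tmul x y => simp
      | add x y hx hy => rw [mul_add, map_add, map_add, hx, hy]
    have hw : word 𝒜 (a :: l) = letter 𝒜 a * word 𝒜 l := by simp [word]
    rw [List.length_cons, Finset.sum_range_succ', cut_apply, hw, deconc_letter_mul, map_add, h, ih,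
      add_comm]
    simp [word]

end Bar

/-! ### Connected dg algebras, the bar differential and the Hochschild complex -/

section Hochschild

variable {k A : Type*} [CommRing k] [Ring A] [Algebra k A]
variable (𝒜 : ℕ → Submodule k A) [GradedAlgebra 𝒜]

/-- A 1-reduced differential graded algebra `(A, d)` with `d` of degree `+1`: a graded algebra
with `A⁰ = k` and `A¹ = 0`. -/
structure DGA where
  d : A →ₗ[k] A
  d_mem : ∀ (n : ℕ) (a : A), a ∈ 𝒜 n → d a ∈ 𝒜 (n + 1)
  d_d : ∀ a : A, d (d a) = 0
  d_mul : ∀ a b : A, d (a * b) = d a * b + sgn 𝒜 a * d b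
  algebraMap_injective : Function.Injective (algebraMap k A)
  degree_zero : ∀ a ∈ 𝒜 0, ∃ c : k, algebraMap k A c = a
  degree_one : 𝒜 1 = ⊥

/-- The product `x y z` of three elements of `BA` under concatenation. -/
def mul₃ : Bar 𝒜 →ₗ[k] Bar 𝒜 →ₗ[k] Bar 𝒜 →ₗ[k] Bar 𝒜 :=
  LinearMap.mk₂ k (fun x y => LinearMap.mulLeft k (x * y))
    (fun x x' y => by ext; simp [add_mul, mul_assoc]) (fun c x y => by ext; simp [mul_assoc])
    (fun x y y' => by ext; simp [mul_add, add_mul, mul_assoc]) (fun c x y => by ext; simp [mul_assoc])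

/-- The Hochschild complex `ΛA = A ⊗ BA` as a module. -/
abbrev Hoch : Type _ := A ⊗[k] Bar 𝒜

/-- Left multiplication on the first factor, `x · (u ⊗ w) = x u ⊗ w`. -/
def act : A →ₗ[k] Hoch 𝒜 →ₗ[k] Hoch 𝒜 :=
  (Algebra.lsmul k k (Hoch 𝒜)).toLinearMap

variable {𝒜}
variable (D : DGA 𝒜)

/-- The component `BA → A` of the bar differential:
`[ā] ↦ -da`, `[ā|b̄] ↦ -(-1)^(|a|+1) ab`, and zero on words of other lengths. -/
def barDelta : Bar 𝒜 →ₗ[k] A :=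
  -(D.d ∘ₗ tau 𝒜) -
    cut 𝒜 ((LinearMap.mul k A).compl₁₂ (tau 𝒜 ∘ₗ sgnBar 𝒜) (tau 𝒜))

/-- The differential of the bar construction, with `εᵢ = |a₁| + ⋯ + |aᵢ| + i`:
`d [ā₁|⋯|āₙ] = -∑ (-1)^εᵢ₋₁ [ā₁|⋯|d aᵢ|⋯|āₙ] - ∑ (-1)^εᵢ [ā₁|⋯|aᵢ aᵢ₊₁|⋯|āₙ]`. -/
def barD : Bar 𝒜 →ₗ[k] Bar 𝒜 :=
  cut₃ 𝒜 ((mul₃ 𝒜).compl₁₂ (sgnBar 𝒜) (letter 𝒜 ∘ₗ barDelta D))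

/-- `θ¹ (u ⊗ [ā₁|⋯|āₙ]) = -(-1)^|u| u a₁ ⊗ [ā₂|⋯|āₙ]`. -/
def theta₁ : A →ₗ[k] Bar 𝒜 →ₗ[k] Hoch 𝒜 :=
  -(act 𝒜).compl₁₂ (sgn 𝒜) (cut 𝒜 (TensorProduct.mk k A (Bar 𝒜) ∘ₗ tau 𝒜))

/-- `θ² (u ⊗ [ā₁|⋯|āₙ]) = (-1)^((|aₙ|+1)(|u|+εₙ₋₁)) aₙ u ⊗ [ā₁|⋯|āₙ₋₁]`. In the sum, `p` is
the parity of `|aₙ|`. -/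
def theta₂ : A →ₗ[k] Bar 𝒜 →ₗ[k] Hoch 𝒜 where
  toFun u := cut 𝒜 (∑ p : ZMod 2, ((act 𝒜).compl₁₂ (par 𝒜 p ∘ₗ tau 𝒜)
    (TensorProduct.mk k A (Bar 𝒜) ((sgn 𝒜 ^ (p + 1).val) u) ∘ₗ
      (sgnBar 𝒜 ^ (p + 1).val : Module.End k (Bar 𝒜)))).flip)
  map_add' u v := by
    rw [← map_add, ← Finset.sum_add_distrib]
    refine congrArg _ (Finset.sum_congr rfl fun p _ => ?_)
    refine LinearMap.ext₂ fun x y => ?_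
    simp
  map_smul' c u := by
    rw [← map_smul, Finset.smul_sum]
    refine congrArg _ (Finset.sum_congr rfl fun p _ => ?_)
    refine LinearMap.ext₂ fun x y => ?_
    simp

/-- The differential `d_A ⊗ 1 + 1 ⊗ d_{BA} + θ¹ + θ²` of the Hochschild complex. -/
def hochD : Hoch 𝒜 →ₗ[k] Hoch 𝒜 :=
  TensorProduct.lift
    (TensorProduct.mk k A (Bar 𝒜) ∘ₗ D.d +
      (TensorProduct.mk k A (Bar 𝒜)).compl₁₂ (sgn 𝒜) (barD D) + theta₁ + theta₂)

/-- The Hochschild homology `HH(A)`. -/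
abbrev HH : Type _ := Homology (hochD D)

end Hochschild

/-! ### Homotopy G-algebras and the product on the Hochschild complex -/

section Product

variable {k A : Type*} [CommRing k] [Ring A] [Algebra k A]
variable {𝒜 : ℕ → Submodule k A} [GradedAlgebra 𝒜]
variable (E : Bar 𝒜 →ₗ[k] A →ₗ[k] A)

/-- One step of the recursion for `μ_E`: from `g = μ_E(- ⊗ w)` to `μ_E(- ⊗ [b̄|w])`,
`[ā₁|⋯|āₘ] ↦ ∑ (-1)^((|b|+1)(εₘ-εⱼ)) [ā₁|⋯|āᵢ|E(aᵢ₊₁,…,aⱼ; b)| g [āⱼ₊₁|⋯|āₘ]]`, the sum over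
`0 ≤ i ≤ j ≤ m`. In the sum, `p` is the parity of `|b|`. -/
def muStep : Pos 𝒜 →ₗ[k] Module.End k (Module.End k (Bar 𝒜)) :=
  LinearMap.mk₂ k (fun b g => cut₃ 𝒜 (∑ p : ZMod 2,
      ((mul₃ 𝒜).compl₁₂ LinearMap.id (letter 𝒜 ∘ₗ E.flip (par 𝒜 p b))).compr₂
        (LinearMap.lcomp k (Bar 𝒜) (g ∘ₗ (sgnBar 𝒜 ^ (p + 1).val : Module.End k (Bar 𝒜))))))
    (fun b b' g => by
      rw [← map_add, ← Finset.sum_add_distrib]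
      refine congrArg _ (Finset.sum_congr rfl fun p _ => LinearMap.ext₂ fun x y => ?_)
      refine LinearMap.ext fun z => ?_
      simp)
    (fun c b g => by
      rw [← map_smul, Finset.smul_sum]
      refine congrArg _ (Finset.sum_congr rfl fun p _ => LinearMap.ext₂ fun x y => ?_)
      refine LinearMap.ext fun z => ?_
      simp)
    (fun b g g' => by
      rw [← map_add, ← Finset.sum_add_distrib]
      refine congrArg _ (Finset.sum_congr rfl fun p _ => LinearMap.ext₂ fun x y => ?_)
      refine LinearMap.ext fun z => ?_
      simp)
    (fun c b g => by
      rw [← map_smul, Finset.smul_sum]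
      refine congrArg _ (Finset.sum_congr rfl fun p _ => LinearMap.ext₂ fun x y => ?_)
      refine LinearMap.ext fun z => ?_
      simp)

/-- The multiplication `μ_E : BA ⊗ BA → BA`, i.e. the coalgebra map with component `E`. -/
def mu : Bar 𝒜 →ₗ[k] Bar 𝒜 →ₗ[k] Bar 𝒜 :=
  (LinearMap.applyₗ (LinearMap.id : Bar 𝒜 →ₗ[k] Bar 𝒜) ∘ₗ
    (TensorAlgebra.lift k (muStep E)).toLinearMap).flip

/-- The auxiliary operation `K(a; v, b) = ∑ ± E(a₁,…,aₚ; v) ⊗ μ_E([āₚ₊₁|⋯|āₘ] ⊗ b)`, with the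
sign `(-1)^(εₚ + (εₘ-εₚ)|v|)`. In the sum, `p` is the parity of `|v|`. -/
def lamK : Bar 𝒜 →ₗ[k] A →ₗ[k] Bar 𝒜 →ₗ[k] Hoch 𝒜 :=
  cut 𝒜 (∑ p : ZMod 2, LinearMap.mk₂ k
    (fun x y => (TensorProduct.mk k A (Bar 𝒜)).compl₁₂ (E (sgnBar 𝒜 x) ∘ₗ par 𝒜 p)
      (mu E ((sgnBar 𝒜 ^ p.val) y)))
    (fun x x' y => LinearMap.ext₂ fun _ _ => by simp)
    (fun c x y => LinearMap.ext₂ fun _ _ => by simp [TensorProduct.smul_tmul'])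
    (fun x y y' => LinearMap.ext₂ fun _ _ => by simp [TensorProduct.tmul_add])
    (fun c x y => LinearMap.ext₂ fun _ _ => by simp))

/-- The auxiliary operation
`G(c, a; v, [b̄₁|⋯|b̄ₙ]) = ± E(c; bₙ) · K(a; v, [b̄₁|⋯|b̄ₙ₋₁])` (zero for `n = 0`), with the
Koszul sign `(-1)^((|bₙ|+1)(ε(a) + |v| + ε(b₁,…,bₙ₋₁)))`. In the sum, `q` is the parity of
`|bₙ|`. -/
def lamG (c a : Bar 𝒜) (v : A) : Bar 𝒜 →ₗ[k] Hoch 𝒜 :=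
  cut 𝒜 (∑ q : ZMod 2, ((act 𝒜).compl₁₂ (E c ∘ₗ par 𝒜 q ∘ₗ tau 𝒜)
    (lamK E ((sgnBar 𝒜 ^ (q + 1).val) a) ((sgn 𝒜 ^ (q + 1).val) v) ∘ₗ
      (sgnBar 𝒜 ^ (q + 1).val : Module.End k (Bar 𝒜)))).flip)

/-- `lamG` as a multilinear map. -/
def lamGLin : Bar 𝒜 →ₗ[k] Bar 𝒜 →ₗ[k] A →ₗ[k] Bar 𝒜 →ₗ[k] Hoch 𝒜 :=
  LinearMap.mk₂ k
    (fun c a =>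
      { toFun := lamG E c a
        map_add' := fun v v' => by
          unfold lamG
          rw [← map_add, ← Finset.sum_add_distrib]
          refine congrArg _ (Finset.sum_congr rfl fun p _ => LinearMap.ext₂ fun x y => ?_)
          simp
        map_smul' := fun r v => by
          unfold lamG
          rw [← map_smul, Finset.smul_sum]
          refine congrArg _ (Finset.sum_congr rfl fun p _ => LinearMap.ext₂ fun x y => ?_)
          simp })
    (fun c c' a => by
      refine LinearMap.ext fun v => ?_
      change lamG E (c + c') a v = lamG E c a v + lamG E c' a v
      unfold lamG
      rw [← map_add, ← Finset.sum_add_distrib]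
      refine congrArg _ (Finset.sum_congr rfl fun p _ => LinearMap.ext₂ fun x y => ?_)
      simp)
    (fun r c a => by
      refine LinearMap.ext fun v => ?_
      change lamG E (r • c) a v = r • lamG E c a v
      unfold lamG
      rw [← map_smul, Finset.smul_sum]
      refine congrArg _ (Finset.sum_congr rfl fun p _ => LinearMap.ext₂ fun x y => ?_)
      simp)
    (fun c a a' => by
      refine LinearMap.ext fun v => ?_
      change lamG E c (a + a') v = lamG E c a v + lamG E c a' v
      unfold lamG
      rw [← map_add, ← Finset.sum_add_distrib]
      refine congrArg _ (Finset.sum_congr rfl fun p _ => LinearMap.ext₂ fun x y => ?_)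
      simp)
    (fun r c a => by
      refine LinearMap.ext fun v => ?_
      change lamG E c (r • a) v = r • lamG E c a v
      unfold lamG
      rw [← map_smul, Finset.smul_sum]
      refine congrArg _ (Finset.sum_congr rfl fun p _ => LinearMap.ext₂ fun x y => ?_)
      simp)

/-- The summand of the cyclic sum of `λ_E` for a cut `a = x y z`: the term
`G([z|ū|x], y; v, b)` with the Koszul sign `(-1)^(ε(z)(|u| + 1 + ε(x) + ε(y)))` of moving `z`
to the front. In the sum, `p` is the parity of `ε(z)`. -/
def lamCyc (u : A) (x y : Bar 𝒜) : Bar 𝒜 →ₗ[k] A →ₗ[k] Bar 𝒜 →ₗ[k] Hoch 𝒜 :=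
  ∑ p : ZMod 2, (lamGLin E).flip ((sgnBar 𝒜 ^ p.val) y) ∘ₗ
    LinearMap.mulRight k ((sgnBar 𝒜 ^ p.val) (letter 𝒜 u * x)) ∘ₗ parBar 𝒜 p

/-- `lamCyc` as a multilinear map. -/
def lamCycLin (u : A) :
    Bar 𝒜 →ₗ[k] Bar 𝒜 →ₗ[k] Bar 𝒜 →ₗ[k] A →ₗ[k] Bar 𝒜 →ₗ[k] Hoch 𝒜 :=
  LinearMap.mk₂ k (lamCyc E u)
    (fun x x' y => by
      unfold lamCyc
      rw [← Finset.sum_add_distrib]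
      refine Finset.sum_congr rfl fun p _ => LinearMap.ext fun z => ?_
      simp [mul_add])
    (fun c x y => by
      unfold lamCyc
      rw [Finset.smul_sum]
      refine Finset.sum_congr rfl fun p _ => LinearMap.ext fun z => ?_
      simp)
    (fun x y y' => by
      unfold lamCyc
      rw [← Finset.sum_add_distrib]
      refine Finset.sum_congr rfl fun p _ => LinearMap.ext fun z => ?_
      simp)
    (fun c x y => by
      unfold lamCyc
      rw [Finset.smul_sum]
      refine Finset.sum_congr rfl fun p _ => LinearMap.ext fun z => ?_
      simp)

/-- The summands of the cyclic sum, as a linear map in `u`. -/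
def lamCycAll : A →ₗ[k]
    Bar 𝒜 →ₗ[k] Bar 𝒜 →ₗ[k] Bar 𝒜 →ₗ[k] A →ₗ[k] Bar 𝒜 →ₗ[k] Hoch 𝒜 where
  toFun := lamCycLin E
  map_add' u u' := by
    refine LinearMap.ext₂ fun x y => ?_
    change lamCyc E (u + u') x y = lamCyc E u x y + lamCyc E u' x y
    unfold lamCyc
    rw [← Finset.sum_add_distrib]
    refine Finset.sum_congr rfl fun p _ => LinearMap.ext fun z => ?_
    simp [mul_add, add_mul]
  map_smul' c u := by
    refine LinearMap.ext₂ fun x y => ?_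
    change lamCyc E (c • u) x y = c • lamCyc E u x y
    unfold lamCyc
    rw [Finset.smul_sum]
    refine Finset.sum_congr rfl fun p _ => LinearMap.ext fun z => ?_
    simp

/-- The first sum of `λ_E`: the operation `(u, a, v, b) ↦ u · K(a; v, b)`. -/
def lamFirst : A →ₗ[k] Bar 𝒜 →ₗ[k] A →ₗ[k] Bar 𝒜 →ₗ[k] Hoch 𝒜 where
  toFun u := (lamK E).compr₂ (LinearMap.compRight k (act 𝒜 u))
  map_add' u u' := by
    refine LinearMap.ext₂ fun x y => LinearMap.ext fun z => ?_
    simp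
  map_smul' c u := by
    refine LinearMap.ext₂ fun x y => LinearMap.ext fun z => ?_
    simp

/-- The second sum of `λ_E`: the sum of the cyclic terms over all cuts of `a` into three
pieces, as an operation of `(u, a, v, b)`. -/
def lamSecond : A →ₗ[k] Bar 𝒜 →ₗ[k] A →ₗ[k] Bar 𝒜 →ₗ[k] Hoch 𝒜 :=
  cut₃ 𝒜 ∘ₗ lamCycAll E

/-- The product `λ_E : ΛA ⊗ ΛA → ΛA` on the Hochschild complex. On `u ⊗ [ā₁|⋯|āₘ]` and
`v ⊗ [b̄₁|⋯|b̄ₙ]` it is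
`∑_{0≤p≤m} (-1)^ε¹ u E(a₁,…,aₚ; v) ⊗ μ_E([āₚ₊₁|⋯|āₘ] ⊗ [b̄₁|⋯|b̄ₙ])
+ ∑_{0≤i≤j≤k≤m} (-1)^ε² E(aₖ₊₁,…,aₘ,u,a₁,…,aᵢ; bₙ) E(aᵢ₊₁,…,aⱼ; v)
  ⊗ μ_E([āⱼ₊₁|⋯|āₖ] ⊗ [b̄₁|⋯|b̄ₙ₋₁])`,
where `ε¹ = εₚ + (εₘ-εₚ)|v|` and `ε² = (εⱼ-εᵢ) + (εₖ-εⱼ)|v| + (εₘ-εₖ)(|u|+1+εₖ)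
+ (|bₙ|+1)(εₖ-εᵢ+|v|+ε(b₁,…,bₙ₋₁))`; the second sum is absent for `n = 0`. -/
def lam : Hoch 𝒜 →ₗ[k] Hoch 𝒜 →ₗ[k] Hoch 𝒜 :=
  TensorProduct.lift ((lamFirst E + lamSecond E).compr₂
    (TensorProduct.uncurry (RingHom.id k) A (Bar 𝒜) (Hoch 𝒜)))

end Product
/-! ### Maps of dg algebras and their effect on the Hochschild complex -/

section Maps

variable {k A A' : Type*} [CommRing k] [Ring A] [Algebra k A] [Ring A'] [Algebra k A']
variable {𝒜 : ℕ → Submodule k A} [GradedAlgebra 𝒜]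
variable {𝒜' : ℕ → Submodule k A'} [GradedAlgebra 𝒜']

/-- A dga map: a unital algebra map preserving degrees and commuting with the differentials. -/
structure DGAHom (D : DGA 𝒜) (D' : DGA 𝒜') where
  toFun : A →ₐ[k] A'
  map_mem : ∀ (n : ℕ) (a : A), a ∈ 𝒜 n → toFun a ∈ 𝒜' n
  map_d : ∀ a : A, toFun (D.d a) = D'.d (toFun a)

variable {D : DGA 𝒜} {D' : DGA 𝒜'} (f : DGAHom D D')

/-- The map `H(f) : H(A) → H(A')`. -/
def DGAHom.onH : Homology D.d →ₗ[k] Homology D'.d :=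
  Homology.map f.toFun.toLinearMap f.map_d

/-- The map `Bf : BA → BA'`, `[ā₁|⋯|āₙ] ↦ [f a₁|⋯|f aₙ]`. -/
def DGAHom.onBar : Bar 𝒜 →ₐ[k] Bar 𝒜' :=
  TensorAlgebra.lift k (letter 𝒜' ∘ₗ f.toFun.toLinearMap ∘ₗ (Pos 𝒜).subtype)

/-- The map `Λf = f ⊗ Bf : ΛA → ΛA'`. -/
def DGAHom.onHoch : Hoch 𝒜 →ₗ[k] Hoch 𝒜' :=
  TensorProduct.map f.toFun.toLinearMap f.onBar.toLinearMap

theorem DGAHom.proj_map (n : ℕ) (a : A) :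
    GradedAlgebra.proj 𝒜' n (f.toFun a) = f.toFun (GradedAlgebra.proj 𝒜 n a) := by
  simp only [GradedAlgebra.proj_apply]
  induction a using DirectSum.Decomposition.inductionOn 𝒜 with
  | zero => simp
  | @homogeneous i a =>
    rw [DirectSum.decompose_coe, DirectSum.decompose_of_mem 𝒜' (f.map_mem i a a.2)]
    by_cases h : i = n
    · subst h; simp
    · rw [DirectSum.of_eq_of_ne _ _ _ (Ne.symm h), DirectSum.of_eq_of_ne _ _ _ (Ne.symm h)]
      simp
  | add a b ha hb => simp [ha, hb]

theorem DGAHom.par_map (p : ZMod 2) (a : A) : par 𝒜' p (f.toFun a) = f.toFun (par 𝒜 p a) := by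
  induction a using DirectSum.Decomposition.inductionOn 𝒜 with
  | zero => simp
  | @homogeneous i a =>
    simp only [par, LinearMap.comp_apply, LinearEquiv.coe_coe,
      DirectSum.decomposeLinearEquiv_apply]
    rw [DirectSum.decompose_coe, DirectSum.decompose_of_mem 𝒜' (f.map_mem i a a.2)]
    rw [← DirectSum.lof_eq_of k, ← DirectSum.lof_eq_of k, DirectSum.toModule_lof,
      DirectSum.toModule_lof]
    split_ifs <;> simp
  | add a b ha hb => simp [ha, hb]

theorem DGAHom.sgn_pow_map (n : ℕ) (a : A) :
    (sgn 𝒜' ^ n) (f.toFun a) = f.toFun ((sgn 𝒜 ^ n) a) := by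
  induction n generalizing a with
  | zero => simp
  | succ n ih =>
    rw [pow_succ, pow_succ, Module.End.mul_apply, Module.End.mul_apply, ← ih]
    simp [sgn, f.par_map]

theorem DGAHom.onBar_letter (a : A) : f.onBar (letter 𝒜 a) = letter 𝒜' (f.toFun a) := by
  simp only [onBar, letter, LinearMap.comp_apply, TensorAlgebra.lift_ι_apply]
  congr 1
  ext
  simp [coe_toPos, f.proj_map]

theorem DGAHom.onBar_ι (a : Pos 𝒜) :
    f.onBar (TensorAlgebra.ι k a) = letter 𝒜' (f.toFun a) := by
  simp [onBar]

theorem letter_coe (a : Pos 𝒜) : letter 𝒜 (a : A) = TensorAlgebra.ι k a := by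
  have : toPos 𝒜 (a : A) = a := by
    ext
    have := a.2
    rw [LinearMap.mem_ker] at this
    simp [coe_toPos, this]
  simp [letter, this]

theorem DGAHom.sgnBar_map (w : Bar 𝒜) : sgnBar 𝒜' (f.onBar w) = f.onBar (sgnBar 𝒜 w) := by
  have : (TensorAlgebra.lift k (-(letter 𝒜' ∘ₗ sgn 𝒜' ∘ₗ (Pos 𝒜').subtype))).comp f.onBar =
      f.onBar.comp (TensorAlgebra.lift k (-(letter 𝒜 ∘ₗ sgn 𝒜 ∘ₗ (Pos 𝒜).subtype))) := by
    refine TensorAlgebra.hom_ext (LinearMap.ext fun a => ?_)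
    have h : ∀ x : A, letter 𝒜' (f.toFun x) = TensorAlgebra.ι k (toPos 𝒜' (f.toFun x)) :=
      fun _ => rfl
    have h0 : ((toPos 𝒜' (f.toFun (a : A)) : Pos 𝒜') : A') = f.toFun (a : A) := by
      have := a.2
      rw [LinearMap.mem_ker] at this
      simp [coe_toPos, f.proj_map, this]
    have h1 := f.sgn_pow_map 1 (a : A)
    rw [pow_one, pow_one] at h1
    simp only [LinearMap.comp_apply, AlgHom.toLinearMap_apply, AlgHom.comp_apply, f.onBar_ι,
      TensorAlgebra.lift_ι_apply, LinearMap.neg_apply, Submodule.subtype_apply, map_neg,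
      f.onBar_letter]
    rw [h (a : A), TensorAlgebra.lift_ι_apply]
    simp only [LinearMap.comp_apply, LinearMap.neg_apply, Submodule.subtype_apply, h0, h1]
  exact DFunLike.congr_fun this w

theorem DGAHom.sgnBar_pow_map (n : ℕ) (w : Bar 𝒜) :
    (sgnBar 𝒜' ^ n) (f.onBar w) = f.onBar ((sgnBar 𝒜 ^ n) w) := by
  induction n generalizing w with
  | zero => simp
  | succ n ih =>
    rw [pow_succ, pow_succ, Module.End.mul_apply, Module.End.mul_apply, ← ih, f.sgnBar_map]

theorem bar_induction {P : Bar 𝒜 → Prop} (h1 : P 1) (hl : ∀ (a : A) w, P w → P (letter 𝒜 a * w))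
    (hadd : ∀ x y, P x → P y → P (x + y)) (hsmul : ∀ (c : k) x, P x → P (c • x)) (w : Bar 𝒜) :
    P w := by
  suffices h : ∀ v, P v → P (w * v) by simpa using h 1 h1
  induction w using TensorAlgebra.induction with
  | algebraMap r => intro v hv; simpa [Algebra.algebraMap_eq_smul_one] using hsmul r v hv
  | ι a => intro v hv; rw [← letter_coe]; exact hl _ _ hv
  | mul a b ha hb => intro v hv; rw [mul_assoc]; exact ha _ (hb _ hv)
  | add a b ha hb => intro v hv; rw [add_mul]; exact hadd _ _ (ha _ hv) (hb _ hv)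

theorem DGAHom.deconc_map (w : Bar 𝒜) :
    deconc 𝒜' (f.onBar w) =
      TensorProduct.map f.onBar.toLinearMap f.onBar.toLinearMap (deconc 𝒜 w) := by
  induction w using bar_induction with
  | h1 => simp
  | hl a w ih =>
    have : ∀ z : Bar 𝒜 ⊗[k] Bar 𝒜,
        TensorProduct.map f.onBar.toLinearMap f.onBar.toLinearMap ((letter 𝒜 a ⊗ₜ 1) * z) =
        (letter 𝒜' (f.toFun a) ⊗ₜ 1) *
          TensorProduct.map f.onBar.toLinearMap f.onBar.toLinearMap z := by
      intro z
      induction z using TensorProduct.induction_on with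
      | zero => simp
      | tmul x y => simp [f.onBar_letter]
      | add x y hx hy => simp only [mul_add, map_add, hx, hy]
    rw [map_mul, f.onBar_letter, deconc_letter_mul, deconc_letter_mul, map_add, this, ih]
    simp [f.onBar_letter]
  | hadd x y hx hy => simp only [map_add, hx, hy]
  | hsmul c x hx => simp only [map_smul, hx]

theorem tau_ι_mul (a : Pos 𝒜) (w : Bar 𝒜) :
    tau 𝒜 (TensorAlgebra.ι k a * w) = TensorAlgebra.algebraMapInv w • (a : A) := by
  let _ : Module kᵐᵒᵖ (Pos 𝒜) := Module.compHom _ ((RingHom.id k).fromOpposite mul_comm)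
  have _ : IsCentralScalar k (Pos 𝒜) := ⟨fun r m => rfl⟩
  have h : ((TrivSqZeroExt.fstHom k k (Pos 𝒜)).comp TensorAlgebra.toTrivSqZeroExt :
      Bar 𝒜 →ₐ[k] k) = TensorAlgebra.algebraMapInv := by
    refine TensorAlgebra.hom_ext (LinearMap.ext fun x => ?_)
    simp [TensorAlgebra.algebraMapInv]
  have h' := DFunLike.congr_fun h w
  simp only [AlgHom.comp_apply, TrivSqZeroExt.fstHom_apply] at h'
  have h2 : TensorAlgebra.ιInv (TensorAlgebra.ι k a * w) =
      TensorAlgebra.algebraMapInv w • a := by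
    rw [← h']
    change TrivSqZeroExt.snd (TensorAlgebra.toTrivSqZeroExt (TensorAlgebra.ι k a * w)) = _
    simp
  rw [tau, LinearMap.comp_apply, h2]
  rfl

theorem tau_one : tau 𝒜 1 = 0 := by
  let _ : Module kᵐᵒᵖ (Pos 𝒜) := Module.compHom _ ((RingHom.id k).fromOpposite mul_comm)
  have _ : IsCentralScalar k (Pos 𝒜) := ⟨fun r m => rfl⟩
  have : TensorAlgebra.ιInv (1 : Bar 𝒜) = 0 := by
    change TrivSqZeroExt.snd (TensorAlgebra.toTrivSqZeroExt (1 : Bar 𝒜)) = 0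
    simp
  simp [tau, this]

theorem DGAHom.tau_map (w : Bar 𝒜) : tau 𝒜' (f.onBar w) = f.toFun (tau 𝒜 w) := by
  have hc : ∀ w : Bar 𝒜, TensorAlgebra.algebraMapInv (f.onBar w) =
      TensorAlgebra.algebraMapInv w := by
    intro w
    have : TensorAlgebra.algebraMapInv.comp f.onBar =
        (TensorAlgebra.algebraMapInv : Bar 𝒜 →ₐ[k] k) := by
      refine TensorAlgebra.hom_ext (LinearMap.ext fun x => ?_)
      simp [f.onBar_ι, letter, TensorAlgebra.algebraMapInv]
    exact DFunLike.congr_fun this w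
  induction w using bar_induction with
  | h1 => simp [tau_one]
  | hl a w ih =>
    rw [map_mul, f.onBar_letter]
    simp only [letter, LinearMap.comp_apply, tau_ι_mul, hc, map_smul, coe_toPos, map_sub,
      f.proj_map]
  | hadd x y hx hy => simp only [map_add, hx, hy]
  | hsmul c x hx => simp only [map_smul, hx]

variable {M M' : Type*} [AddCommMonoid M] [Module k M] [AddCommMonoid M'] [Module k M']

theorem DGAHom.cut_map (φ : Bar 𝒜 →ₗ[k] Bar 𝒜 →ₗ[k] M) (ψ : Bar 𝒜' →ₗ[k] Bar 𝒜' →ₗ[k] M')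
    (h : M →ₗ[k] M') (hh : ∀ x y, ψ (f.onBar x) (f.onBar y) = h (φ x y)) (w : Bar 𝒜) :
    cut 𝒜' ψ (f.onBar w) = h (cut 𝒜 φ w) := by
  rw [cut_apply, cut_apply, f.deconc_map]
  induction deconc 𝒜 w using TensorProduct.induction_on with
  | zero => simp
  | tmul x y => simp [hh]
  | add x y hx hy => simp only [map_add, hx, hy]

theorem DGAHom.cut₃_map (φ : Bar 𝒜 →ₗ[k] Bar 𝒜 →ₗ[k] Bar 𝒜 →ₗ[k] M)
    (ψ : Bar 𝒜' →ₗ[k] Bar 𝒜' →ₗ[k] Bar 𝒜' →ₗ[k] M') (h : M →ₗ[k] M')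
    (hh : ∀ x y z, ψ (f.onBar x) (f.onBar y) (f.onBar z) = h (φ x y z)) (w : Bar 𝒜) :
    cut₃ 𝒜' ψ (f.onBar w) = h (cut₃ 𝒜 φ w) :=
  f.cut_map (cut 𝒜 ∘ₗ φ) (cut 𝒜' ∘ₗ ψ) h
    (fun x y => f.cut_map (φ x) (ψ (f.onBar x)) h (hh x) y) w

theorem DGAHom.barDelta_map (w : Bar 𝒜) :
    barDelta D' (f.onBar w) = f.toFun (barDelta D w) := by
  have h := f.cut_map ((LinearMap.mul k A).compl₁₂ (tau 𝒜 ∘ₗ sgnBar 𝒜) (tau 𝒜))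
    ((LinearMap.mul k A').compl₁₂ (tau 𝒜' ∘ₗ sgnBar 𝒜') (tau 𝒜')) f.toFun.toLinearMap
    (fun x y => by simp [f.sgnBar_map, f.tau_map]) w
  simp only [barDelta, LinearMap.sub_apply, LinearMap.neg_apply, LinearMap.comp_apply, h,
    f.tau_map, map_sub, map_neg, f.map_d, AlgHom.toLinearMap_apply]

theorem DGAHom.barD_map (w : Bar 𝒜) : barD D' (f.onBar w) = f.onBar (barD D w) :=
  f.cut₃_map _ _ f.onBar.toLinearMap (fun x y z => by
    simp [mul₃, f.sgnBar_map, f.barDelta_map, f.onBar_letter]) w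

theorem DGAHom.act_map (a : A) (z : Hoch 𝒜) :
    f.onHoch (act 𝒜 a z) = act 𝒜' (f.toFun a) (f.onHoch z) := by
  induction z using TensorProduct.induction_on with
  | zero => simp
  | tmul x y => simp [onHoch, act, TensorProduct.smul_tmul']
  | add x y hx hy => simp only [map_add, hx, hy]

theorem DGAHom.hochD_map (z : Hoch 𝒜) : f.onHoch (hochD D z) = hochD D' (f.onHoch z) := by
  induction z using TensorProduct.induction_on with
  | zero => simp
  | add x y hx hy => simp only [map_add, hx, hy]
  | tmul u w =>
    have hs := f.sgn_pow_map 1 u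
    rw [pow_one, pow_one] at hs
    have h1 := f.cut_map (TensorProduct.mk k A (Bar 𝒜) ∘ₗ tau 𝒜)
      (TensorProduct.mk k A' (Bar 𝒜') ∘ₗ tau 𝒜') f.onHoch
      (fun x y => by simp [onHoch, f.tau_map]) w
    have h2 : theta₂ (f.toFun u) (f.onBar w) = f.onHoch (theta₂ u w) :=
      f.cut_map _ _ f.onHoch (fun x y => by
        simp only [LinearMap.sum_apply, LinearMap.flip_apply, LinearMap.compl₁₂_apply, map_sum,
          LinearMap.comp_apply, TensorProduct.mk_apply, f.act_map, f.tau_map, f.par_map,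
          f.sgn_pow_map, f.sgnBar_pow_map]
        rfl) w
    have h0 : f.onHoch (u ⊗ₜ w) = f.toFun u ⊗ₜ f.onBar w := rfl
    rw [h0]
    simp only [hochD, TensorProduct.lift.tmul, LinearMap.add_apply, LinearMap.comp_apply,
      LinearMap.compl₁₂_apply, TensorProduct.mk_apply, map_add, theta₁, LinearMap.neg_apply,
      map_neg, f.act_map, h1, h2, hs, f.barD_map, ← f.map_d]
    rfl

/-- The map `HH(f) : HH(A) → HH(A')` induced by `Λf`. -/
def DGAHom.onHH : HH D →ₗ[k] HH D' := Homology.map f.onHoch f.hochD_map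

/-- The class of `1 ⊗ [ ]`, the unit of `HH(A)`. -/
def HH.one (D : DGA 𝒜) : HH D :=
  Homology.mk (hochD D) (1 ⊗ₜ 1) (by
    have h1 : D.d 1 = 0 := by
      have h := D.d_mem 0 1 (SetLike.GradedOne.one_mem)
      rwa [zero_add, D.degree_one, Submodule.mem_bot] at h
    have h2 : barD D 1 = 0 := by
      simp [barD, cut₃, cut_apply, mul₃, barDelta, tau_one]
    simp [hochD, h1, h2, theta₁, theta₂, cut_apply, tau_one])

end Maps

/-! ### Homotopy G-algebras, and homotopies measuring the failure to preserve `E` -/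

section HGAlgebra

variable {k A A' : Type*} [CommRing k] [Ring A] [Algebra k A] [Ring A'] [Algebra k A']

/-- A homotopy G-algebra: a 1-reduced dga with operations `E_{p,1} : A^{⊗p} ⊗ A → A`, normalized
in the first `p` arguments, written as a single map `E : BA ⊗ A → A`,
`E([ā₁|⋯|āₚ], b) = E_{p,1}(a₁,…,aₚ; b)`. Below `εᵢ = |a₁| + ⋯ + |aᵢ| + i`. -/
structure HGAlgebra (𝒜 : ℕ → Submodule k A) [GradedAlgebra 𝒜] extends DGA 𝒜 where
  E : Bar 𝒜 →ₗ[k] A →ₗ[k] A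
  /-- `E_{0,1} = id`. -/
  E_one : ∀ b : A, E 1 b = b
  /-- `E_{p,1}` has degree `-p`. -/
  E_mem : ∀ (ns : List ℕ) (l : List A), List.Forall₂ (fun n a => a ∈ 𝒜 n) ns l →
    ∀ (n : ℕ) (b : A), b ∈ 𝒜 n → ∀ m : ℕ, m + l.length = ns.sum + n → E (word 𝒜 l) b ∈ 𝒜 m
  /-- `d E(a₁,…,aₚ; b) = ∑ (-1)^εᵢ₋₁ E(…,d aᵢ,…; b) + ∑ (-1)^εᵢ E(…,aᵢ aᵢ₊₁,…; b)
  + (-1)^εₚ E(a₁,…,aₚ; d b) + (-1)^|a₁| a₁ E(a₂,…,aₚ; b)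
  + (-1)^(εₚ+|aₚ||b|) E(a₁,…,aₚ₋₁; b) aₚ` for `p ≥ 1`. The first two sums are
  `-E(d_{BA} [ā₁|⋯|āₚ]; b)`. -/
  d_E : ∀ (n : ℕ) (b : A), b ∈ 𝒜 n → ∀ w : Bar 𝒜,
    d (E w b) = -E (barD toDGA w) b + E (sgnBar 𝒜 w) (d b)
      - cut 𝒜 ((LinearMap.mul k A).compl₁₂ (tau 𝒜 ∘ₗ sgnBar 𝒜) (E.flip b)) w
      + (-1 : k) ^ n • cut 𝒜 ((LinearMap.mul k A).compl₁₂ (E.flip b ∘ₗ sgnBar 𝒜)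
          (tau 𝒜 ∘ₗ (sgnBar 𝒜 ^ (n + 1) : Module.End k (Bar 𝒜)))) w
  /-- `E(a₁,…,aₚ; b c) = ∑ (-1)^(|b|(εᵢ+εₚ)) E(a₁,…,aᵢ; b) E(aᵢ₊₁,…,aₚ; c)`. -/
  E_mul : ∀ (n : ℕ) (b : A), b ∈ 𝒜 n → ∀ (c : A) (w : Bar 𝒜),
    E w (b * c) = cut 𝒜 ((LinearMap.mul k A).compl₁₂ (E.flip b)
      (E.flip c ∘ₗ (sgnBar 𝒜 ^ n : Module.End k (Bar 𝒜)))) w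
  /-- `E(μ_E([ā₁|⋯|āₚ] ⊗ [b̄₁|⋯|b̄_q]); c) = E(a₁,…,aₚ; E(b₁,…,b_q; c))`. -/
  E_assoc : ∀ (w w' : Bar 𝒜) (c : A), E (mu E w w') c = E w (E w' c)

variable {𝒜 : ℕ → Submodule k A} [GradedAlgebra 𝒜]
variable {𝒜' : ℕ → Submodule k A'} [GradedAlgebra 𝒜']

/-- A sequence of homotopies `s_{p,1} : A^{⊗p} ⊗ A → A'`, `p ≥ 1`, between `f E_{p,1}` and
`E'_{p,1} f^{⊗p+1}`, written as a single map `s : BA ⊗ A → A'`. -/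
structure EHomotopy (X : HGAlgebra 𝒜) (X' : HGAlgebra 𝒜') (f : DGAHom X.toDGA X'.toDGA) where
  s : Bar 𝒜 →ₗ[k] A →ₗ[k] A'
  /-- There is no operation `s_{0,1}`. -/
  s_one : ∀ b : A, s 1 b = 0
  /-- `s_{p,1}` has degree `-p-1`. -/
  s_mem : ∀ (ns : List ℕ) (l : List A), List.Forall₂ (fun n a => a ∈ 𝒜 n) ns l →
    ∀ (n : ℕ) (b : A), b ∈ 𝒜 n → ∀ m : ℕ, m + l.length + 1 = ns.sum + n →
      s (word 𝒜 l) b ∈ 𝒜' m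
  /-- `f E(a₁,…,aₚ; b) - E'(f a₁,…,f aₚ; f b) = -(∑ (-1)^εᵢ₋₁ s(…,d aᵢ,…; b)
  + ∑ (-1)^εᵢ s(…,aᵢ aᵢ₊₁,…; b) + (-1)^εₚ s(a₁,…,aₚ; d b)) - d' s(a₁,…,aₚ; b)
  - f a₁ · s(a₂,…,aₚ; b) - (-1)^(εₚ+|aₚ||b|) s(a₁,…,aₚ₋₁; b) · f aₚ`. -/
  homotopy : ∀ (n : ℕ) (b : A), b ∈ 𝒜 n → ∀ w : Bar 𝒜,
    f.toFun (X.E w b) - X'.E (f.onBar w) (f.toFun b) =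
      -(-s (barD X.toDGA w) b + s (sgnBar 𝒜 w) (X.d b)) - X'.d (s w b)
      - cut 𝒜 ((LinearMap.mul k A').compl₁₂ (f.toFun.toLinearMap ∘ₗ tau 𝒜) (s.flip b)) w
      - (-1 : k) ^ n • cut 𝒜 ((LinearMap.mul k A').compl₁₂ (s.flip b ∘ₗ sgnBar 𝒜)
          (f.toFun.toLinearMap ∘ₗ tau 𝒜 ∘ₗ
            (sgnBar 𝒜 ^ (n + 1) : Module.End k (Bar 𝒜)))) w
  /-- `s(a₁,…,aₚ; b c) =
  ∑_{0≤i<p} (-1)^((|b|+1)εᵢ+|b|(εₚ+1)) E'(f a₁,…,f aᵢ; f b) s(aᵢ₊₁,…,aₚ; c)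
  + ∑_{1≤j≤p} (-1)^(|b|(εⱼ+εₚ)) s(a₁,…,aⱼ; b) f E(aⱼ₊₁,…,aₚ; c)`. -/
  s_mul : ∀ (n : ℕ) (b : A), b ∈ 𝒜 n → ∀ (c : A) (w : Bar 𝒜),
    s w (b * c) =
      (-1 : k) ^ n • cut 𝒜 ((LinearMap.mul k A').compl₁₂
        (X'.E.flip (f.toFun b) ∘ₗ f.onBar.toLinearMap ∘ₗ sgnBar 𝒜)
        (s.flip c ∘ₗ (sgnBar 𝒜 ^ n : Module.End k (Bar 𝒜)))) w
      + cut 𝒜 ((LinearMap.mul k A').compl₁₂ (s.flip b)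
        (f.toFun.toLinearMap ∘ₗ X.E.flip c ∘ₗ
          (sgnBar 𝒜 ^ n : Module.End k (Bar 𝒜)))) w

/-- The bilinear product `m` on `HH(A)` is induced by the chain-level product `λ_E`: the product
of cycles is a cycle, and `[x] [y] = [λ_E(x ⊗ y)]`. -/
def IsInducedProduct (X : HGAlgebra 𝒜)
    (m : HH X.toDGA →ₗ[k] HH X.toDGA →ₗ[k] HH X.toDGA) : Prop :=
  ∀ (x y : Hoch 𝒜) (hx : hochD X.toDGA x = 0) (hy : hochD X.toDGA y = 0),
    ∃ h : hochD X.toDGA (lam X.E x y) = 0,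
      m (Homology.mk _ x hx) (Homology.mk _ y hy) = Homology.mk _ (lam X.E x y) h

end HGAlgebra

end HGA
end

open scoped TensorProduct DirectSum

noncomputable section

namespace HGA

/-! ### Sums over the splittings of a list -/

section SplitSum

variable {α M N : Type*} [AddCommMonoid M] [AddCommMonoid N]

/-! The theorem rests on three facts: the product is a chain map, it commutes with strict maps, and
Hochschild homology preserves quasi-isomorphisms. The homotopies `s` are turned into strict data on
an auxiliary algebra, to which these facts apply.

The auxiliary algebra is the mapping path algebra `f.Path` of triples (x, t, y) with x, t in A' and
y in A, where x - f y and t have positive degree, with differential (dx, -dt + x - f y, dy). The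
positivity conditions make it 1-reduced. The constant paths a ↦ (f a, 0, a) embed A. The start point
x and the end point y are dga maps, with fst ∘ const = f and snd ∘ const = id, and the end point is
a quasi-isomorphism. The operations E', s and E are the three components of one operation `pathE`.
The homotopy formula for s is the middle component of the formula for d E, and the product rule for
s is the middle component of the product rule (`EHomotopy.actsOn_pathE`). These identities hold for
constant paths as arguments. Therefore the axioms are packaged as `ActsOn`, which refers only to
arguments in a subalgebra R, while the values of the operation may leave R.

The computational core is `hochD_lam_wd`: if E acts on R, then λ_E is a chain map on words with
letters in R. First, μ_E is a map of coalgebras and its component is compatible with the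
differentials (`barDelta_mu`), hence μ_E is a chain map (`barD_mu`). The two sums of λ_E are not
chain maps separately. They violate the Leibniz rule by the same two expressions with opposite
signs, `defectLeft` and `defectRight` (`hochD_lamFirst`, `hochD_lamSecond`). For R = A this gives
the products on homology.

Let x and y be cycles in ΛA. Then const(λ_E(x, y)) and λ(const x, const y), formed with `pathE`, are
cycles over the path algebra. Both have end point λ_E(x, y), because λ commutes with maps that
strictly respect the operations (`DGAHom.onHoch_lam`). The end point is injective on Hochschild
homology, so the two cycles are homologous. Taking start points shows that Λf(λ_E(x, y)) and λ_E'(Λf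
x, Λf y) are homologous (`EHomotopy.exists_onHoch_lam_sub`).

That Hochschild homology preserves quasi-isomorphisms (`DGAHom.onHH_bijective`) is proved by leading
terms. Up to terms that shorten words, the differential of ΛA is that of the tensor product of A
with the tensor algebra on s⁻¹A_{>0}. There, flatness and an induction on the word length apply, and
`IsQuasiIso.of_leading` restores the remaining terms. This yields the last claim for f, and it is
also applied to the end point map of the path algebra.

All sign computations take place on lists of parity-homogeneous letters. Deconcatenation becomes
`splitSum`, and the twisting cochain `tl` allows sums over single letters to be written as sums over
arbitrary pieces. An identity then reduces to a reindexing of splittings and a sign identity in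
`ZMod 2`, often settled by `decide`. -/

/-- The sum of `F x y` over all ways to write `l = x ++ y`. -/
def splitSum : List α → (List α → List α → M) → M
  | [], F => F [] []
  | a :: l, F => F [] (a :: l) + splitSum l fun x y => F (a :: x) y

/-- The sum of `F x y z` over all ways to write `l = x ++ y ++ z`. -/
def splitSum₃ (l : List α) (F : List α → List α → List α → M) : M :=
  splitSum l fun x y => splitSum y fun y z => F x y z

@[simp] theorem splitSum_nil (F : List α → List α → M) : splitSum [] F = F [] [] := rfl

theorem splitSum_cons (a : α) (l : List α) (F : List α → List α → M) :
    splitSum (a :: l) F = F [] (a :: l) + splitSum l fun x y => F (a :: x) y := rfl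

theorem splitSum_congr {l : List α} {F G : List α → List α → M}
    (h : ∀ x y, x ++ y = l → F x y = G x y) : splitSum l F = splitSum l G := by
  induction l generalizing F G with
  | nil => exact h [] [] rfl
  | cons a l ih =>
    rw [splitSum_cons, splitSum_cons, h [] (a :: l) rfl,
      ih (fun x y hxy => h (a :: x) y (by rw [← hxy]; rfl))]

theorem splitSum_add (l : List α) (F G : List α → List α → M) :
    (splitSum l fun x y => F x y + G x y) = splitSum l F + splitSum l G := by
  induction l generalizing F G with
  | nil => rfl
  | cons a l ih => simp only [splitSum_cons, ih]; abel

theorem splitSum_zero (l : List α) : (splitSum l fun _ _ => (0 : M)) = 0 := by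
  induction l with
  | nil => rfl
  | cons a l ih => simp only [splitSum_cons, ih, add_zero]

theorem map_splitSum {G : Type*} [FunLike G M N] [AddMonoidHomClass G M N] (g : G) (l : List α)
    (F : List α → List α → M) : g (splitSum l F) = splitSum l fun x y => g (F x y) := by
  induction l generalizing F with
  | nil => rfl
  | cons a l ih => simp only [splitSum_cons, map_add, ih]

theorem splitSum_smul {R : Type*} [Semiring R] [Module R M] (c : R) (l : List α)
    (F : List α → List α → M) : (splitSum l fun x y => c • F x y) = c • splitSum l F := by
  induction l generalizing F with
  | nil => rfl
  | cons a l ih => simp only [splitSum_cons, smul_add, ih]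

/-- Coassociativity of deconcatenation: both orders of cutting enumerate the same decompositions
into three pieces. -/
theorem splitSum_assoc (l : List α) (F : List α → List α → List α → M) :
    (splitSum l fun w z => splitSum w fun x y => F x y z) =
      splitSum l fun x w => splitSum w fun y z => F x y z := by
  induction l generalizing F with
  | nil => rfl
  | cons a l ih =>
    simp only [splitSum_cons, splitSum_nil, splitSum_add, ih, add_assoc]

theorem splitSum_comm {β : Type*} (l : List α) (m : List β)
    (F : List α → List α → List β → List β → M) :
    (splitSum l fun x y => splitSum m fun s t => F x y s t) =
      splitSum m fun s t => splitSum l fun x y => F x y s t := by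
  induction l generalizing F with
  | nil => rfl
  | cons a l ih => simp only [splitSum_cons, splitSum_add, ih]

/-- A cut falls either before the marked letter `c` or after it. -/
theorem splitSum_append_cons (x : List α) (c : α) (z : List α) (F : List α → List α → M) :
    splitSum (x ++ c :: z) F =
      (splitSum x fun x₁ x₂ => F x₁ (x₂ ++ c :: z)) +
        splitSum z fun z₁ z₂ => F (x ++ c :: z₁) z₂ := by
  induction x generalizing F with
  | nil => simp [splitSum_cons]
  | cons a x ih => simp only [splitSum_cons, List.cons_append, ih, add_assoc]

theorem splitSum_eq_right (l : List α) (F : List α → List α → M)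
    (h : ∀ x y, x ++ y = l → x ≠ [] → F x y = 0) : splitSum l F = F [] l := by
  cases l with
  | nil => rfl
  | cons a l =>
    rw [splitSum_cons, splitSum_congr (G := fun _ _ => 0), splitSum_zero, add_zero]
    intro x y hxy
    exact h _ _ (by rw [← hxy]; rfl) (by simp)

theorem splitSum_eq_left (l : List α) (F : List α → List α → M)
    (h : ∀ x y, x ++ y = l → y ≠ [] → F x y = 0) : splitSum l F = F l [] := by
  induction l generalizing F with
  | nil => rfl
  | cons a l ih =>
    rw [splitSum_cons, h [] (a :: l) rfl (by simp), zero_add, ih]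
    intro x y hxy hy
    exact h _ _ (by rw [← hxy]; rfl) hy

theorem splitSum_map {β : Type*} (f : β → α) (l : List β) (F : List α → List α → M) :
    splitSum (l.map f) F = splitSum l fun x y => F (x.map f) (y.map f) := by
  induction l generalizing F with
  | nil => rfl
  | cons a l ih => simp only [List.map_cons, splitSum_cons, ih, List.map_nil]

theorem splitSum₃_eq_middle (l : List α) (F : List α → List α → List α → M)
    (h : ∀ x y z, x ++ y ++ z = l → x ≠ [] ∨ z ≠ [] → F x y z = 0) :
    splitSum₃ l F = F [] l [] := by
  rw [splitSum₃, splitSum_eq_right, splitSum_eq_left]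
  · intro x y hxy hy
    exact h _ _ _ (by simpa using hxy) (Or.inr hy)
  · intro x y hxy hx
    rw [splitSum_congr (G := fun _ _ => 0), splitSum_zero]
    intro y z hyz
    exact h _ _ _ (by simp [← hxy, ← hyz]) (Or.inl hx)

end SplitSum

theorem splitSum_neg {α M : Type*} [AddCommGroup M] (l : List α) (F : List α → List α → M) :
    (splitSum l fun x y => - F x y) = - splitSum l F := by
  have := splitSum_add l F (fun x y => - F x y)
  simp only [add_neg_cancel, splitSum_zero] at this
  exact eq_neg_of_add_eq_zero_right this.symm

theorem splitSum_sub {α M : Type*} [AddCommGroup M] (l : List α) (F G : List α → List α → M) :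
    (splitSum l fun x y => F x y - G x y) = splitSum l F - splitSum l G := by
  simp only [sub_eq_add_neg, splitSum_add, splitSum_neg]

/-! ### Signs -/

section Signs

/-- The sign `(-1)^p`. -/
def sign (k : Type*) [CommRing k] (p : ZMod 2) : k := (-1) ^ p.val

variable {k : Type*} [CommRing k]

@[simp] theorem sign_zero : sign k 0 = 1 := by simp [sign]
@[simp] theorem sign_one : sign k 1 = -1 := by simp [sign, ZMod.val_one]

theorem zmod_two_cases (p : ZMod 2) : p = 0 ∨ p = 1 := by revert p; decide

theorem sign_add (p q : ZMod 2) : sign k (p + q) = sign k p * sign k q := by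
  rcases zmod_two_cases p with rfl | rfl <;> rcases zmod_two_cases q with rfl | rfl <;>
    simp [show (1 : ZMod 2) + 1 = 0 from rfl]

theorem sign_natCast (n : ℕ) : sign k (n : ZMod 2) = (-1) ^ n := by
  induction n with
  | zero => simp
  | succ n ih => rw [Nat.cast_succ, sign_add, ih, sign_one, pow_succ]

theorem sign_mul_self (p : ZMod 2) : sign k p * sign k p = 1 := by
  rcases zmod_two_cases p with rfl | rfl <;> simp

theorem sign_add_one (p : ZMod 2) : sign k (p + 1) = - sign k p := by simp [sign_add]

theorem sign_pow (p : ZMod 2) (n : ℕ) : sign k p ^ n = sign k (n * p) := by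
  induction n with
  | zero => simp
  | succ n ih => rw [pow_succ, ih, ← sign_add]; congr 1; push_cast; ring

end Signs

/-! ### Parity-homogeneous elements -/

section Parity

variable {k A : Type*} [CommRing k] [Ring A] [Algebra k A]
variable (𝒜 : ℕ → Submodule k A) [GradedAlgebra 𝒜]

/-- The elements of parity `p`. -/
def homog (p : ZMod 2) : Submodule k A := LinearMap.eqLocus (par 𝒜 p) LinearMap.id

variable {𝒜}

theorem par_of_mem {n : ℕ} {a : A} (ha : a ∈ 𝒜 n) (p : ZMod 2) :
    par 𝒜 p a = if (n : ZMod 2) = p then a else 0 := by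
  simp only [par, LinearMap.comp_apply, LinearEquiv.coe_coe,
    DirectSum.decomposeLinearEquiv_apply]
  rw [DirectSum.decompose_of_mem 𝒜 ha, ← DirectSum.lof_eq_of k, DirectSum.toModule_lof]
  split_ifs <;> simp

theorem graded_induction {P : A → Prop} (h0 : P 0) (ha : ∀ a b, P a → P b → P (a + b))
    (hm : ∀ (n : ℕ) a, a ∈ 𝒜 n → P a) (a : A) : P a := by
  induction a using DirectSum.Decomposition.inductionOn 𝒜 with
  | zero => exact h0
  | @homogeneous i a => exact hm i a a.2
  | add a b h1 h2 => exact ha a b h1 h2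

theorem par_add_par (p : ZMod 2) (a : A) : par 𝒜 p a + par 𝒜 (p + 1) a = a := by
  induction a using graded_induction (𝒜 := 𝒜) with
  | h0 => simp
  | ha a b h1 h2 =>
    rw [map_add, map_add]; nth_rw 3 [← h1]; nth_rw 3 [← h2]; abel
  | hm n a ha =>
    rw [par_of_mem ha, par_of_mem ha]
    generalize (n : ZMod 2) = q
    revert p q
    have : ∀ p q : ZMod 2, (q = p ∧ q ≠ p + 1) ∨ (q ≠ p ∧ q = p + 1) := by decide
    intro p q
    rcases this p q with h | h <;> simp [h]

theorem par_par (p q : ZMod 2) (a : A) :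
    par 𝒜 p (par 𝒜 q a) = if q = p then par 𝒜 q a else 0 := by
  induction a using graded_induction (𝒜 := 𝒜) with
  | h0 => simp
  | ha a b h1 h2 => simp only [map_add, h1, h2]; split_ifs <;> simp
  | hm n a ha =>
    rw [par_of_mem ha]
    split_ifs with h h' h' <;> simp [par_of_mem ha, h, h']

theorem mem_homog {p : ZMod 2} {a : A} : a ∈ homog 𝒜 p ↔ par 𝒜 p a = a := Iff.rfl

theorem par_mem_homog (p : ZMod 2) (a : A) : par 𝒜 p a ∈ homog 𝒜 p := by
  simp [mem_homog, par_par]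

theorem mem_homog_of_mem {n : ℕ} {a : A} (ha : a ∈ 𝒜 n) : a ∈ homog 𝒜 n := by
  simp [mem_homog, par_of_mem ha]

theorem par_of_homog {p : ZMod 2} {a : A} (ha : a ∈ homog 𝒜 p) (q : ZMod 2) :
    par 𝒜 q a = if p = q then a else 0 := by
  rw [← mem_homog.1 ha, par_par]

theorem sgn_of_homog {p : ZMod 2} {a : A} (ha : a ∈ homog 𝒜 p) : sgn 𝒜 a = sign k p • a := by
  rw [sgn, LinearMap.sub_apply, par_of_homog ha, par_of_homog ha]
  rcases zmod_two_cases p with rfl | rfl <;> simp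

theorem sgn_pow_of_homog {p : ZMod 2} {a : A} (ha : a ∈ homog 𝒜 p) (n : ℕ) :
    (sgn 𝒜 ^ n) a = sign k (n * p) • a := by
  rw [← sign_pow]
  induction n with
  | zero => simp
  | succ n ih => rw [pow_succ, Module.End.mul_apply, sgn_of_homog ha, map_smul, ih, smul_smul,
      pow_succ, mul_comm]

/-- An element of parity `p` equals its own projection, and the property is shown for the projection
of an arbitrary element, where induction over the ℕ-grading is available. -/
theorem homog_induction {p : ZMod 2} {P : ∀ a, a ∈ homog 𝒜 p → Prop} (h0 : P 0 (zero_mem _))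
    (ha : ∀ a b ha hb, P a ha → P b hb → P (a + b) (add_mem ha hb))
    (hm : ∀ (n : ℕ) a (ha : a ∈ 𝒜 n) (hn : (n : ZMod 2) = p), P a (hn ▸ mem_homog_of_mem ha))
    {a : A} (h : a ∈ homog 𝒜 p) : P a h := by
  have key : P (par 𝒜 p a) (par_mem_homog p a) := by
    clear h
    induction a using graded_induction (𝒜 := 𝒜) with
    | h0 => simpa
    | ha a b h1 h2 =>
      have := ha _ _ _ _ h1 h2
      simpa using this
    | hm n a hn =>
      by_cases h : (n : ZMod 2) = p
      · simpa [par_of_mem hn, h] using hm n a hn h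
      · simpa [par_of_mem hn, h] using h0
  simpa [mem_homog.1 h] using key

theorem one_mem_homog : (1 : A) ∈ homog 𝒜 0 := by
  simpa using mem_homog_of_mem (SetLike.GradedOne.one_mem (A := 𝒜))

theorem mul_mem_homog {p q : ZMod 2} {a b : A} (ha : a ∈ homog 𝒜 p) (hb : b ∈ homog 𝒜 q) :
    a * b ∈ homog 𝒜 (p + q) := by
  induction ha using homog_induction with
  | h0 => simp
  | ha a b _ _ h1 h2 => rw [add_mul]; exact add_mem h1 h2
  | hm n a ha hn =>
    induction hb using homog_induction with
    | h0 => simp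
    | ha a b _ _ h1 h2 => rw [mul_add]; exact add_mem h1 h2
    | hm m b hb hm =>
      rw [← hn, ← hm, ← Nat.cast_add]
      exact mem_homog_of_mem (SetLike.GradedMul.mul_mem ha hb)

theorem DGA.d_mem_homog (D : DGA 𝒜) {p : ZMod 2} {a : A} (ha : a ∈ homog 𝒜 p) :
    D.d a ∈ homog 𝒜 (p + 1) := by
  induction ha using homog_induction with
  | h0 => simp
  | ha a b _ _ h1 h2 => rw [map_add]; exact add_mem h1 h2
  | hm n a ha hn =>
    rw [← hn, ← Nat.cast_succ]
    exact mem_homog_of_mem (D.d_mem n a ha)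

theorem DGA.d_mul_homog (D : DGA 𝒜) {p : ZMod 2} {a : A} (ha : a ∈ homog 𝒜 p) (b : A) :
    D.d (a * b) = D.d a * b + sign k p • (a * D.d b) := by
  rw [D.d_mul, sgn_of_homog ha, smul_mul_assoc]

theorem mem_pos_iff {a : A} : a ∈ Pos 𝒜 ↔ GradedAlgebra.proj 𝒜 0 a = 0 := LinearMap.mem_ker

theorem mem_pos_of_mem {n : ℕ} {a : A} (ha : a ∈ 𝒜 n) (hn : n ≠ 0) : a ∈ Pos 𝒜 := by
  rw [mem_pos_iff, GradedAlgebra.proj_apply, DirectSum.decompose_of_mem 𝒜 ha,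
    DirectSum.of_eq_of_ne _ _ _ (Ne.symm hn)]
  rfl

theorem proj_zero_mul (a b : A) : GradedAlgebra.proj 𝒜 0 (a * b) =
    GradedAlgebra.proj 𝒜 0 a * GradedAlgebra.proj 𝒜 0 b := by
  simp only [GradedAlgebra.proj_apply]
  exact map_mul (GradedRing.projZeroRingHom 𝒜) a b

theorem mul_mem_pos {a : A} (ha : a ∈ Pos 𝒜) (b : A) : a * b ∈ Pos 𝒜 := by
  rw [mem_pos_iff] at *; rw [proj_zero_mul, ha, zero_mul]

theorem mul_mem_pos' {a : A} (ha : a ∈ Pos 𝒜) (b : A) : b * a ∈ Pos 𝒜 := by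
  rw [mem_pos_iff] at *; rw [proj_zero_mul, ha, mul_zero]

theorem DGA.d_mem_pos (D : DGA 𝒜) (a : A) : D.d a ∈ Pos 𝒜 := by
  induction a using graded_induction (𝒜 := 𝒜) with
  | h0 => simp
  | ha a b h1 h2 => rw [map_add]; exact add_mem h1 h2
  | hm n a ha => exact mem_pos_of_mem (D.d_mem n a ha) (by simp)

theorem letter_of_mem {a : A} (ha : a ∈ Pos 𝒜) :
    letter 𝒜 a = TensorAlgebra.ι k (⟨a, ha⟩ : Pos 𝒜) := letter_coe ⟨a, ha⟩

theorem par_mem_pos {a : A} (ha : a ∈ Pos 𝒜) (p : ZMod 2) : par 𝒜 p a ∈ Pos 𝒜 := by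
  have key : ∀ a : A, GradedAlgebra.proj 𝒜 0 (par 𝒜 p a) =
      par 𝒜 p (GradedAlgebra.proj 𝒜 0 a) := by
    intro a
    induction a using graded_induction (𝒜 := 𝒜) with
    | h0 => simp
    | ha a b h1 h2 => simp only [map_add, h1, h2]
    | hm n a ha =>
      have : GradedAlgebra.proj 𝒜 0 a ∈ 𝒜 n := by
        rw [GradedAlgebra.proj_apply]
        by_cases hn : n = 0
        · subst hn; exact SetLike.coe_mem _
        · rw [DirectSum.decompose_of_mem 𝒜 ha, DirectSum.of_eq_of_ne _ _ _ (Ne.symm hn)]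
          exact zero_mem _
      rw [par_of_mem ha, par_of_mem this]
      split_ifs <;> simp
  rw [mem_pos_iff, key, mem_pos_iff.1 ha, map_zero]

theorem tau_letter {a : A} (ha : a ∈ Pos 𝒜) : tau 𝒜 (letter 𝒜 a) = a := by
  rw [letter_of_mem ha, ← mul_one (TensorAlgebra.ι k _), tau_ι_mul]; simp

theorem tau_letter_mul {a : A} (ha : a ∈ Pos 𝒜) (w : Bar 𝒜) :
    tau 𝒜 (letter 𝒜 a * w) = TensorAlgebra.algebraMapInv w • a := by
  rw [letter_of_mem ha, tau_ι_mul]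

@[simp] theorem counit_letter_mul (a : A) (w : Bar 𝒜) :
    TensorAlgebra.algebraMapInv (letter 𝒜 a * w) = (0 : k) := by
  rw [map_mul]; simp [letter, TensorAlgebra.algebraMapInv]

end Parity

theorem splitSum_mem {α M σ : Type*} [AddCommMonoid M] [SetLike σ M] [AddSubmonoidClass σ M]
    {S : σ} {l : List α} {F : List α → List α → M} (h : ∀ x y, x ++ y = l → F x y ∈ S) :
    splitSum l F ∈ S := by
  induction l generalizing F with
  | nil => exact h [] [] rfl
  | cons a l ih =>
    exact add_mem (h [] (a :: l) rfl) (ih fun x y hxy => h (a :: x) y (by rw [← hxy]; rfl))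

/-! ### Words in homogeneous letters -/

section Words

variable {k A : Type*} [CommRing k] [Ring A] [Algebra k A]
variable (𝒜 : ℕ → Submodule k A) [GradedAlgebra 𝒜]

/-- Homogeneous elements of positive degree of a subalgebra `R`, with their parity. -/
structure Letter (R : Subalgebra k A) where
  val : A
  par : ZMod 2
  mem_homog : val ∈ homog 𝒜 par
  mem_pos : val ∈ Pos 𝒜
  mem : val ∈ R

variable {𝒜} {R : Subalgebra k A}

/-- The word `[ā₁|⋯|āₙ]` of a list of letters. -/
def wd (l : List (Letter 𝒜 R)) : Bar 𝒜 := word 𝒜 (l.map Letter.val)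

/-- The parity of `|a₁| + ⋯ + |aₙ| + n`. -/
def ep (l : List (Letter 𝒜 R)) : ZMod 2 := (l.map fun c => c.par + 1).sum

/-- The twisting cochain on lists of letters. -/
def tl : List (Letter 𝒜 R) → A
  | [c] => c.val
  | _ => 0

@[simp] theorem wd_nil : wd ([] : List (Letter 𝒜 R)) = 1 := rfl

@[simp] theorem wd_cons (c : Letter 𝒜 R) (l : List (Letter 𝒜 R)) :
    wd (c :: l) = letter 𝒜 c.val * wd l := rfl

theorem wd_append (l m : List (Letter 𝒜 R)) : wd (l ++ m) = wd l * wd m := by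
  simp [wd, word]

@[simp] theorem ep_nil : ep ([] : List (Letter 𝒜 R)) = 0 := rfl

@[simp] theorem ep_cons (c : Letter 𝒜 R) (l : List (Letter 𝒜 R)) :
    ep (c :: l) = c.par + 1 + ep l := by simp [ep]

@[simp] theorem ep_append (l m : List (Letter 𝒜 R)) : ep (l ++ m) = ep l + ep m := by simp [ep]

@[simp] theorem tl_nil : tl ([] : List (Letter 𝒜 R)) = 0 := rfl
@[simp] theorem tl_singleton (c : Letter 𝒜 R) : tl [c] = c.val := rfl
@[simp] theorem tl_cons_cons (c c' : Letter 𝒜 R) (l : List (Letter 𝒜 R)) :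
    tl (c :: c' :: l) = 0 := rfl

theorem tl_cons_append_cons (c c' : Letter 𝒜 R) (l m : List (Letter 𝒜 R)) :
    tl (c :: (l ++ c' :: m)) = 0 := by cases l <;> rfl

theorem tl_append_cons_of_ne {x y : List (Letter 𝒜 R)} (h : x ≠ [] ∨ y ≠ []) (c : Letter 𝒜 R) :
    tl (x ++ c :: y) = 0 := by
  rcases x with _ | ⟨a, x⟩
  · rcases y with _ | ⟨b, y⟩
    · simp at h
    · rfl
  · exact tl_cons_append_cons _ _ _ _

/-- In `ep` a letter counts with its degree shifted by one, and the summand `1` undoes that shift.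
-/
theorem tl_mem_homog (l : List (Letter 𝒜 R)) : tl l ∈ homog 𝒜 (ep l + 1) := by
  rcases l with _ | ⟨c, _ | ⟨c', l⟩⟩
  · exact zero_mem _
  · have : ep [c] + 1 = c.par := by
      simp only [ep_cons, ep_nil]; generalize c.par = p; revert p; decide
    rw [this]; exact c.mem_homog
  · exact zero_mem _

theorem tl_mem_pos (l : List (Letter 𝒜 R)) : tl l ∈ Pos 𝒜 := by
  rcases l with _ | ⟨c, _ | ⟨c', l⟩⟩
  · exact zero_mem _
  · exact c.mem_pos
  · exact zero_mem _

theorem tl_mem (l : List (Letter 𝒜 R)) : tl l ∈ R := by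
  rcases l with _ | ⟨c, _ | ⟨c', l⟩⟩
  · exact zero_mem _
  · exact c.mem
  · exact zero_mem _

/-- Among the prefixes of `c :: l` only `[c]` has nonzero twisting cochain. -/
theorem splitSum_tl_left {M : Type*} [AddCommMonoid M] (c : Letter 𝒜 R) (l : List (Letter 𝒜 R))
    (F : List (Letter 𝒜 R) → List (Letter 𝒜 R) → M) (h : ∀ x y, tl x = 0 → F x y = 0) :
    splitSum (c :: l) F = F [c] l := by
  rw [splitSum_cons, h [] _ rfl, zero_add, splitSum_eq_right]
  rintro (_ | ⟨a, x⟩) y - hx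
  · exact (hx rfl).elim
  · exact h _ _ rfl

section Cut

variable {M : Type*} [AddCommMonoid M] [Module k M]

theorem cut_one (φ : Bar 𝒜 →ₗ[k] Bar 𝒜 →ₗ[k] M) : cut 𝒜 φ 1 = φ 1 1 := by simp [cut_apply]

theorem cut_letter_mul (φ : Bar 𝒜 →ₗ[k] Bar 𝒜 →ₗ[k] M) (a : A) (w : Bar 𝒜) :
    cut 𝒜 φ (letter 𝒜 a * w) =
      φ 1 (letter 𝒜 a * w) + cut 𝒜 (φ ∘ₗ LinearMap.mulLeft k (letter 𝒜 a)) w := by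
  have h : TensorProduct.lift φ ((letter 𝒜 a ⊗ₜ 1) * deconc 𝒜 w) =
      cut 𝒜 (φ ∘ₗ LinearMap.mulLeft k (letter 𝒜 a)) w := by
    rw [cut_apply]
    induction deconc 𝒜 w using TensorProduct.induction_on with
    | zero => simp
    | tmul x y => simp
    | add x y hx hy => rw [mul_add, map_add, map_add, hx, hy]
  rw [cut_apply, deconc_letter_mul, map_add, h, TensorProduct.lift.tmul]

theorem cut_wd (φ : Bar 𝒜 →ₗ[k] Bar 𝒜 →ₗ[k] M) (l : List (Letter 𝒜 R)) :
    cut 𝒜 φ (wd l) = splitSum l fun x y => φ (wd x) (wd y) := by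
  induction l generalizing φ with
  | nil => exact cut_one φ
  | cons c l ih => rw [wd_cons, cut_letter_mul, ih, splitSum_cons]; rfl

theorem cut₃_wd (φ : Bar 𝒜 →ₗ[k] Bar 𝒜 →ₗ[k] Bar 𝒜 →ₗ[k] M) (l : List (Letter 𝒜 R)) :
    cut₃ 𝒜 φ (wd l) = splitSum₃ l fun x y z => φ (wd x) (wd y) (wd z) := by
  change cut 𝒜 (cut 𝒜 ∘ₗ φ) (wd l) = _
  rw [cut_wd]
  exact splitSum_congr fun x y _ => cut_wd _ _

/-- The marked letter is an arbitrary element of `A`, because values of `E` need not lie in `R`. A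
cut falls before or after it. -/
theorem cut_wd_mul_letter_mul (φ : Bar 𝒜 →ₗ[k] Bar 𝒜 →ₗ[k] M) (l : List (Letter 𝒜 R)) (a : A)
    (w : Bar 𝒜) : cut 𝒜 φ (wd l * letter 𝒜 a * w) =
      (splitSum l fun x y => φ (wd x) (wd y * letter 𝒜 a * w)) +
        cut 𝒜 (φ ∘ₗ LinearMap.mulLeft k (wd l * letter 𝒜 a)) w := by
  induction l generalizing φ with
  | nil => simp only [wd_nil, one_mul, cut_letter_mul, splitSum_nil]
  | cons c l ih =>
    rw [wd_cons, mul_assoc, mul_assoc, cut_letter_mul, ← mul_assoc (wd l), ih, splitSum_cons,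
      add_assoc]
    congr 1
    · simp [mul_assoc]
    · congr 2
      refine LinearMap.ext fun x => ?_
      simp [mul_assoc]
      rfl

end Cut

theorem sgnBar_letter_mul {p : ZMod 2} {a : A} (ha : a ∈ homog 𝒜 p) (ha' : a ∈ Pos 𝒜)
    (w : Bar 𝒜) : sgnBar 𝒜 (letter 𝒜 a * w) = sign k (p + 1) • (letter 𝒜 a * sgnBar 𝒜 w) := by
  simp only [sgnBar, AlgHom.toLinearMap_apply, map_mul]
  rw [letter_of_mem ha', TensorAlgebra.lift_ι_apply]
  simp only [LinearMap.neg_apply, LinearMap.comp_apply, Submodule.subtype_apply,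
    sgn_of_homog ha, map_smul]
  rw [sign_add_one, neg_smul, neg_mul, smul_mul_assoc, letter_of_mem ha']

theorem sgnBar_wd (l : List (Letter 𝒜 R)) : sgnBar 𝒜 (wd l) = sign k (ep l) • wd l := by
  induction l with
  | nil => simp [sgnBar]
  | cons c l ih =>
    rw [wd_cons, sgnBar_letter_mul c.mem_homog c.mem_pos, ih, mul_smul_comm, smul_smul, ← sign_add,
      ep_cons]

theorem sgnBar_pow_wd (n : ℕ) (l : List (Letter 𝒜 R)) :
    (sgnBar 𝒜 ^ n) (wd l) = sign k (n * ep l) • wd l := by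
  rw [← sign_pow]
  induction n with
  | zero => simp
  | succ n ih => rw [pow_succ, Module.End.mul_apply, sgnBar_wd, map_smul, ih, smul_smul,
      pow_succ, mul_comm]

theorem parBar_wd (p : ZMod 2) (l : List (Letter 𝒜 R)) :
    parBar 𝒜 p (wd l) = if ep l = p then wd l else 0 := by
  -- The map to the group algebra of `ZMod 2` records the parity of a word as an exponent, and
  -- `parBar p` reads off the coefficient at `p`.
  have key : (TensorAlgebra.lift k (A := AddMonoidAlgebra (Bar 𝒜) (ZMod 2))
      (∑ q : ZMod 2, (AddMonoidAlgebra.coeffLinearEquiv k).symm.toLinearMap ∘ₗ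
        Finsupp.lsingle (q + 1) ∘ₗ letter 𝒜 ∘ₗ par 𝒜 q ∘ₗ (Pos 𝒜).subtype)) (wd l) =
      AddMonoidAlgebra.single (ep l) (wd l) := by
    induction l with
    | nil => rw [wd_nil, map_one]; rfl
    | cons c l ih =>
      rw [wd_cons, map_mul, ih, letter_of_mem c.mem_pos, TensorAlgebra.lift_ι_apply]
      rw [LinearMap.sum_apply, Finset.sum_eq_single c.par]
      · simp only [LinearMap.comp_apply, Submodule.subtype_apply, mem_homog.1 c.mem_homog,
          Finsupp.lsingle_apply, letter_of_mem c.mem_pos]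
        rw [ep_cons]
        exact AddMonoidAlgebra.single_mul_single _ _ _ _
      · intro q _ hq
        simp [par_of_homog c.mem_homog, Ne.symm hq]
      · simp
  simp only [parBar, LinearMap.comp_apply, AlgHom.toLinearMap_apply, key]
  change (Finsupp.single (ep l) (wd l)) p = _
  rw [Finsupp.single_apply]

theorem counit_wd (l : List (Letter 𝒜 R)) :
    TensorAlgebra.algebraMapInv (wd l) = if l = [] then (1 : k) else 0 := by
  cases l with
  | nil => simp
  | cons c l => simp

theorem tau_wd (l : List (Letter 𝒜 R)) : tau 𝒜 (wd l) = tl l := by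
  rcases l with _ | ⟨c, _ | ⟨c', l⟩⟩
  · exact tau_one
  · rw [wd_cons, tau_letter_mul c.mem_pos, wd_nil]; simp
  · rw [wd_cons, tau_letter_mul c.mem_pos, counit_wd]; simp

end Words

/-! ### The differentials on words -/

section Differentials

variable {k A : Type*} [CommRing k] [Ring A] [Algebra k A]
variable {𝒜 : ℕ → Submodule k A} [GradedAlgebra 𝒜] {R : Subalgebra k A}
variable (D : DGA 𝒜)

theorem barDelta_wd (l : List (Letter 𝒜 R)) : barDelta D (wd l) =
    - D.d (tl l) - splitSum l fun x y => sign k (ep x) • (tl x * tl y) := by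
  simp only [barDelta, LinearMap.sub_apply, LinearMap.neg_apply, LinearMap.comp_apply, cut_wd,
    LinearMap.compl₁₂_apply, sgnBar_wd, map_smul, tau_wd, LinearMap.smul_apply, LinearMap.mul_apply']

theorem barDelta_wd_mem (hR : ∀ a ∈ R, D.d a ∈ R) (l : List (Letter 𝒜 R)) : barDelta D (wd l) ∈ R := by
  rw [barDelta_wd]
  exact sub_mem (neg_mem (hR _ (tl_mem l))) (splitSum_mem fun x y _ =>
    R.smul_mem (mul_mem (tl_mem x) (tl_mem y)) _)

variable (hR : ∀ a ∈ R, D.d a ∈ R)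

/-- The letter `δ l`, the component of the bar differential of the word `l`; it is nonzero
only for words with one or two letters. -/
def delta (l : List (Letter 𝒜 R)) : Letter 𝒜 R where
  val := barDelta D (wd l)
  par := ep l
  mem_homog := by
    rw [barDelta_wd]
    have two : ∀ p : ZMod 2, p + 1 + 1 = p := by decide
    have h := D.d_mem_homog (tl_mem_homog l)
    rw [two] at h
    refine sub_mem (neg_mem h) (splitSum_mem fun x y hxy => Submodule.smul_mem _ _ ?_)
    have := mul_mem_homog (tl_mem_homog x) (tl_mem_homog y)
    rwa [add_add_add_comm, show (1 : ZMod 2) + 1 = 0 from rfl, add_zero, ← ep_append, hxy] at this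
  mem_pos := by
    rw [barDelta_wd]
    exact sub_mem (neg_mem (D.d_mem_pos _)) (splitSum_mem fun x y _ =>
      Submodule.smul_mem _ _ (mul_mem_pos (tl_mem_pos x) _))
  mem := barDelta_wd_mem D hR l

@[simp] theorem delta_par (l : List (Letter 𝒜 R)) : (delta D hR l).par = ep l := rfl
theorem delta_val (l : List (Letter 𝒜 R)) : (delta D hR l).val =
    - D.d (tl l) - splitSum l fun x y => sign k (ep x) • (tl x * tl y) := barDelta_wd D l

theorem barDelta_wd' (l : List (Letter 𝒜 R)) : barDelta D (wd l) = (delta D hR l).val := rfl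

section Bdry

variable {M : Type*} [AddCommGroup M] [Module k M]

/-- The bar differential acting on functions of lists of letters. -/
def bdry (F : List (Letter 𝒜 R) → M) (l : List (Letter 𝒜 R)) : M :=
  splitSum₃ l fun x y z => sign k (ep x) • F (x ++ delta D hR y :: z)

theorem barD_wd (l : List (Letter 𝒜 R)) : barD D (wd l) = bdry D hR wd l := by
  rw [barD, cut₃_wd]
  refine splitSum_congr fun x w _ => splitSum_congr fun y z _ => ?_
  simp only [LinearMap.compl₁₂_apply, mul₃, LinearMap.mk₂_apply, LinearMap.mulLeft_apply,
    sgnBar_wd, LinearMap.comp_apply, wd_append, wd_cons, barDelta_wd' D hR, smul_mul_assoc,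
    mul_assoc]

theorem map_barD_wd {N : Type*} [AddCommGroup N] [Module k N] (g : Bar 𝒜 →ₗ[k] N)
    (l : List (Letter 𝒜 R)) : g (barD D (wd l)) = bdry D hR (fun l => g (wd l)) l := by
  rw [barD_wd D hR]
  simp only [bdry, splitSum₃, map_splitSum, map_smul]

theorem map_bdry {N : Type*} [AddCommGroup N] [Module k N] (g : M →ₗ[k] N)
    (F : List (Letter 𝒜 R) → M) (l : List (Letter 𝒜 R)) :
    g (bdry D hR F l) = bdry D hR (fun l => g (F l)) l := by
  simp only [bdry, splitSum₃, map_splitSum, map_smul]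

/-- All words in the bar differential of `l` have parity `ep l + 1`. Hence signs that depend on the
parity of the argument can be frozen to constants and moved out of `bdry`. -/
theorem bdry_congr {F G : List (Letter 𝒜 R) → M} {l : List (Letter 𝒜 R)}
    (h : ∀ m, ep m = ep l + 1 → F m = G m) : bdry D hR F l = bdry D hR G l := by
  refine splitSum_congr fun x w hx => splitSum_congr fun y z hy => ?_
  change sign k _ • F _ = sign k _ • G _
  rw [h]
  rw [← hx, ← hy]
  simp only [ep_append, ep_cons, delta_par]
  ring

theorem bdry_smul (c : k) (F : List (Letter 𝒜 R) → M) (l : List (Letter 𝒜 R)) :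
    bdry D hR (fun l => c • F l) l = c • bdry D hR F l :=
  (map_bdry D hR (LinearMap.lsmul k M c) F l).symm

theorem bdry_add (F G : List (Letter 𝒜 R) → M) (l : List (Letter 𝒜 R)) :
    bdry D hR (fun l => F l + G l) l = bdry D hR F l + bdry D hR G l := by
  simp only [bdry, splitSum₃, smul_add, splitSum_add]

/-- The bar differential is a coderivation. -/
theorem bdry_splitSum (F : List (Letter 𝒜 R) → List (Letter 𝒜 R) → M)
    (l : List (Letter 𝒜 R)) : bdry D hR (fun l => splitSum l F) l =
      splitSum l fun x y =>
        bdry D hR (fun x => F x y) x + sign k (ep x) • bdry D hR (F x) y := by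
  -- A cut falls to the left or to the right of the inserted letter `δ y`. In the first case the
  -- sign of `x = x₁ ++ x₂` splits into the sign for passing `x₁` and the sign of the differential
  -- on the second factor.
  have h1 : ∀ x y z, sign k (ep x) • splitSum (x ++ delta D hR y :: z) F =
      (splitSum x fun x₁ x₂ => sign k (ep x₁) • sign k (ep x₂) • F x₁ (x₂ ++ delta D hR y :: z)) +
        splitSum z fun z₁ z₂ => sign k (ep x) • F (x ++ delta D hR y :: z₁) z₂ := by
    intro x y z
    rw [splitSum_append_cons, smul_add, ← splitSum_smul, ← splitSum_smul]
    congr 1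
    refine splitSum_congr fun x₁ x₂ hx => ?_
    rw [← hx, ep_append, sign_add, smul_smul]
  simp only [bdry, splitSum₃, h1, splitSum_add]
  rw [add_comm]
  congr 1
  · conv_rhs => rw [splitSum_assoc]
    refine splitSum_congr fun x w _ => ?_
    rw [splitSum_assoc]
  · simp only [← splitSum_smul]
    refine Eq.trans (splitSum_congr fun x w _ => splitSum_comm _ _ _) ?_
    exact splitSum_assoc l fun x₁ x₂ w => splitSum w fun y z =>
      sign k (ep x₁) • sign k (ep x₂) • F x₁ (x₂ ++ delta D hR y :: z)

end Bdry

/-! ### The Hochschild differential on words -/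

variable {u : A} {p : ZMod 2}

theorem theta₂_apply (u : A) (w : Bar 𝒜) :
    theta₂ u w = cut 𝒜 (∑ p : ZMod 2, ((act 𝒜).compl₁₂ (par 𝒜 p ∘ₗ tau 𝒜)
    (TensorProduct.mk k A (Bar 𝒜) ((sgn 𝒜 ^ (p + 1).val) u) ∘ₗ
      (sgnBar 𝒜 ^ (p + 1).val : Module.End k (Bar 𝒜)))).flip) w := rfl

theorem act_tmul (a u : A) (w : Bar 𝒜) : act 𝒜 a (u ⊗ₜ[k] w) = (a * u) ⊗ₜ[k] w := rfl

theorem act_act (a b : A) (z : Hoch 𝒜) : act 𝒜 a (act 𝒜 b z) = act 𝒜 (a * b) z :=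
  (mul_smul a b z).symm

/-- Only one parity component of `tl l` is nonzero. The argument of `F` is shifted by one because
the Koszul signs involve `|a| + 1`. -/
theorem sum_par_tl {M : Type*} [AddCommGroup M] [Module k M] (F : ZMod 2 → A →ₗ[k] M)
    (l : List (Letter 𝒜 R)) : ∑ q : ZMod 2, F (q + 1) (par 𝒜 q (tl l)) = F (ep l) (tl l) := by
  have two : ∀ p : ZMod 2, p + 1 + 1 = p := by decide
  rw [Finset.sum_eq_single (ep l + 1)]
  · rw [mem_homog.1 (tl_mem_homog l), two]
  · intro q _ hq
    rw [par_of_homog (tl_mem_homog l), if_neg (Ne.symm hq), map_zero]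
  · simp

theorem theta₂_wd (hu : u ∈ homog 𝒜 p) (l : List (Letter 𝒜 R)) :
    theta₂ u (wd l) =
      splitSum l fun x y => sign k (ep y * (p + ep x)) • ((tl y * u) ⊗ₜ[k] wd x) := by
  rw [theta₂_apply, cut_wd]
  refine splitSum_congr fun x y _ => ?_
  simp only [LinearMap.sum_apply, LinearMap.flip_apply, LinearMap.compl₁₂_apply,
    LinearMap.comp_apply, tau_wd, sgn_pow_of_homog hu, sgnBar_pow_wd, TensorProduct.mk_apply,
    ZMod.natCast_val, ZMod.cast_id', id, map_smul, LinearMap.smul_apply, smul_smul, ← sign_add]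
  have := sum_par_tl (fun q => sign k (q * ep x + q * p) • (act 𝒜).flip (u ⊗ₜ[k] wd x)) y
  simp only [LinearMap.smul_apply, LinearMap.flip_apply, act_tmul] at this ⊢
  rw [this]
  congr 2; ring

/-- The Hochschild differential without its cyclic term `θ²`. -/
def hochD₁ : Hoch 𝒜 →ₗ[k] Hoch 𝒜 :=
  TensorProduct.lift
    (TensorProduct.mk k A (Bar 𝒜) ∘ₗ D.d +
      (TensorProduct.mk k A (Bar 𝒜)).compl₁₂ (sgn 𝒜) (barD D) + theta₁)

/-- The cyclic term `θ²` on the Hochschild complex. -/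
def hochTheta₂ : Hoch 𝒜 →ₗ[k] Hoch 𝒜 := TensorProduct.lift theta₂

theorem hochD_eq (z : Hoch 𝒜) : hochD D z = hochD₁ D z + hochTheta₂ z := by
  induction z using TensorProduct.induction_on with
  | zero => simp
  | add x y hx hy => simp only [map_add, hx, hy]; abel
  | tmul u w => rfl

/-- The second factor is an arbitrary element of `BA`, so that values of `μ_E` can be inserted. -/
theorem hochD₁_tmul (hu : u ∈ homog 𝒜 p) (w : Bar 𝒜) :
    hochD₁ D (u ⊗ₜ w) = D.d u ⊗ₜ w + sign k p • (u ⊗ₜ[k] barD D w)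
      - sign k p • cut 𝒜 (TensorProduct.mk k A (Bar 𝒜) ∘ₗ LinearMap.mulLeft k u ∘ₗ tau 𝒜) w := by
  have h : act 𝒜 u (cut 𝒜 (TensorProduct.mk k A (Bar 𝒜) ∘ₗ tau 𝒜) w) =
      cut 𝒜 (TensorProduct.mk k A (Bar 𝒜) ∘ₗ LinearMap.mulLeft k u ∘ₗ tau 𝒜) w := by
    rw [cut_apply, cut_apply]
    induction deconc 𝒜 w using TensorProduct.induction_on with
    | zero => simp
    | add x y hx hy => simp only [map_add, hx, hy]
    | tmul x y => rfl
  simp only [hochD₁, TensorProduct.lift.tmul, LinearMap.add_apply, LinearMap.comp_apply,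
    TensorProduct.mk_apply, LinearMap.compl₁₂_apply, sgn_of_homog hu, theta₁,
    LinearMap.neg_apply, map_smul, LinearMap.smul_apply, h, sub_eq_add_neg]

theorem hochD₁_wd (hu : u ∈ homog 𝒜 p) (l : List (Letter 𝒜 R)) :
    hochD₁ D (u ⊗ₜ wd l) = D.d u ⊗ₜ wd l + sign k p • bdry D hR (fun l => u ⊗ₜ[k] wd l) l
      - sign k p • splitSum l fun x y => (u * tl x) ⊗ₜ[k] wd y := by
  rw [hochD₁_tmul D hu, cut_wd]
  have := map_barD_wd D hR (TensorProduct.mk k A (Bar 𝒜) u) l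
  simp only [TensorProduct.mk_apply] at this
  rw [this]
  simp only [LinearMap.comp_apply, TensorProduct.mk_apply, LinearMap.mulLeft_apply, tau_wd]

theorem hochTheta₂_wd (hu : u ∈ homog 𝒜 p) (l : List (Letter 𝒜 R)) :
    hochTheta₂ (u ⊗ₜ wd l) =
      splitSum l fun x y => sign k (ep y * (p + ep x)) • ((tl y * u) ⊗ₜ[k] wd x) :=
  theta₂_wd hu l

end Differentials

section SplitSum₃

variable {α M : Type*} [AddCommMonoid M]

/-- In this and the following reindexing lemmas the piece that is cut again remains an argument of
`F`, because signs refer to it. After reindexing it appears as a concatenation. -/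
theorem splitSum_splitSum_left (l : List α) (F : List α → List α → List α → List α → M) :
    (splitSum l fun w z => splitSum w fun x y => F w x y z) =
      splitSum l fun x v => splitSum v fun y z => F (x ++ y) x y z := by
  rw [← splitSum_assoc]
  exact splitSum_congr fun w z _ => splitSum_congr fun x y h => by rw [h]

theorem splitSum_splitSum_right (l : List α) (F : List α → List α → List α → List α → M) :
    (splitSum l fun x v => splitSum v fun y z => F v x y z) =
      splitSum l fun w z => splitSum w fun x y => F (y ++ z) x y z := by
  rw [splitSum_assoc]
  exact splitSum_congr fun w z _ => splitSum_congr fun x y h => by rw [h]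

theorem splitSum₃_left (l : List α) (F : List α → List α → List α → List α → List α → M) :
    (splitSum l fun x w => splitSum w fun y z => splitSum x fun x₁ x₂ => F x x₁ x₂ y z) =
      splitSum l fun x₁ v => splitSum v fun x₂ w => splitSum w fun y z =>
        F (x₁ ++ x₂) x₁ x₂ y z :=
  Eq.trans (splitSum_congr fun _ _ _ => splitSum_comm _ _ _)
    (splitSum_splitSum_left l fun x x₁ x₂ w => splitSum w fun y z => F x x₁ x₂ y z)

theorem splitSum₃_middle (l : List α) (F : List α → List α → List α → List α → List α → M) :
    (splitSum l fun x w => splitSum w fun y z => splitSum y fun y₁ y₂ => F x y y₁ y₂ z) =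
      splitSum l fun x v => splitSum v fun y₁ w => splitSum w fun y₂ z =>
        F x (y₁ ++ y₂) y₁ y₂ z :=
  splitSum_congr fun _ _ _ => splitSum_splitSum_left _ _

theorem splitSum₃_right (l : List α) (F : List α → List α → List α → List α → List α → M) :
    (splitSum l fun x w => splitSum w fun y z => splitSum z fun z₁ z₂ => F x y z z₁ z₂) =
      splitSum l fun p z₂ => splitSum p fun x q => splitSum q fun y z₁ =>
        F x y (z₁ ++ z₂) z₁ z₂ := by
  refine Eq.trans (splitSum_congr fun _ _ _ => splitSum_splitSum_right _ _) ?_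
  exact (splitSum_assoc l fun x q z₂ => splitSum q fun y z₁ => F x y (z₁ ++ z₂) z₁ z₂).symm

end SplitSum₃

theorem LinearMap.splitSum_apply {k M N α : Type*} [CommSemiring k] [AddCommMonoid M] [Module k M]
    [AddCommMonoid N] [Module k N] (l : List α) (F : List α → List α → M →ₗ[k] N) (x : M) :
    splitSum l F x = splitSum l fun y z => F y z x :=
  map_splitSum (LinearMap.applyₗ x) l F

theorem mul_splitSum {A α : Type*} [NonUnitalNonAssocSemiring A] (a : A) (l : List α)
    (F : List α → List α → A) : a * splitSum l F = splitSum l fun y z => a * F y z :=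
  map_splitSum (AddMonoidHom.mulLeft a) l F

theorem splitSum_mul {A α : Type*} [NonUnitalNonAssocSemiring A] (a : A) (l : List α)
    (F : List α → List α → A) : splitSum l F * a = splitSum l fun y z => F y z * a :=
  map_splitSum (AddMonoidHom.mulRight a) l F


/-! ### The multiplication on the bar construction -/

section Action

variable {k A : Type*} [CommRing k] [Ring A] [Algebra k A]
variable {𝒜 : ℕ → Submodule k A} [GradedAlgebra 𝒜]

/-- The axioms of a homotopy G-algebra without associativity, required only for arguments
in a subalgebra `R`. -/
structure ActsOn (D : DGA 𝒜) (E : Bar 𝒜 →ₗ[k] A →ₗ[k] A) (R : Subalgebra k A) : Prop where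
  d_mem : ∀ a ∈ R, D.d a ∈ R
  E_one : ∀ b ∈ R, E 1 b = b
  E_homog : ∀ (l : List (Letter 𝒜 R)) (p : ZMod 2), ∀ b ∈ R, b ∈ homog 𝒜 p →
    E (wd l) b ∈ homog 𝒜 (ep l + p)
  E_pos : ∀ (l : List (Letter 𝒜 R)), ∀ b ∈ R, b ∈ Pos 𝒜 → E (wd l) b ∈ Pos 𝒜
  d_E : ∀ (l : List (Letter 𝒜 R)) (p : ZMod 2), ∀ b ∈ R, b ∈ homog 𝒜 p →
    D.d (E (wd l) b) = - E (barD D (wd l)) b + sign k (ep l) • E (wd l) (D.d b)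
      - (splitSum l fun x y => sign k (ep x) • (tl x * E (wd y) b))
      + splitSum l fun x y => sign k (p + ep x + (p + 1) * ep y) • (E (wd x) b * tl y)
  E_mul : ∀ (l : List (Letter 𝒜 R)) (p : ZMod 2), ∀ b ∈ R, b ∈ homog 𝒜 p → ∀ c ∈ R,
    E (wd l) (b * c) = splitSum l fun x y => sign k (p * ep y) • (E (wd x) b * E (wd y) c)

variable {R : Subalgebra k A} (E : Bar 𝒜 →ₗ[k] A →ₗ[k] A)

@[simp] theorem mu_one_right (w : Bar 𝒜) : mu E w 1 = w := by
  simp [mu]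

theorem mu_letter_mul {b : A} {p : ZMod 2} (hb : b ∈ homog 𝒜 p) (hb' : b ∈ Pos 𝒜)
    (l : List (Letter 𝒜 R)) (w : Bar 𝒜) : mu E (wd l) (letter 𝒜 b * w) =
      splitSum₃ l fun x y z => sign k ((p + 1) * ep z) •
        (wd x * letter 𝒜 (E (wd y) b) * mu E (wd z) w) := by
  have h : mu E (wd l) (letter 𝒜 b * w) =
      muStep E ⟨b, hb'⟩ ((mu E).flip w) (wd l) := by
    simp only [mu, LinearMap.flip_apply, LinearMap.flip_flip, LinearMap.comp_apply,
      AlgHom.toLinearMap_apply, map_mul, letter_of_mem hb', TensorAlgebra.lift_ι_apply]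
    rfl
  rw [h, muStep, LinearMap.mk₂_apply, cut₃_wd]
  refine splitSum_congr fun x v _ => splitSum_congr fun y z _ => ?_
  simp only [LinearMap.sum_apply]
  rw [Finset.sum_eq_single p]
  · simp only [par_of_homog hb, if_true, LinearMap.compr₂_apply, LinearMap.compl₁₂_apply,
      LinearMap.lcomp_apply, mul₃, LinearMap.mk₂_apply, LinearMap.comp_apply, LinearMap.id_apply,
      LinearMap.flip_apply, sgnBar_pow_wd, map_smul, LinearMap.mulLeft_apply, ZMod.natCast_val,
      ZMod.cast_id', id]
  · intro q _ hq
    simp [par_of_homog hb, Ne.symm hq]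
  · simp

theorem mu_cons (l m : List (Letter 𝒜 R)) (b : Letter 𝒜 R) : mu E (wd l) (wd (b :: m)) =
      splitSum₃ l fun x y z => sign k ((b.par + 1) * ep z) •
        (wd x * letter 𝒜 (E (wd y) b.val) * mu E (wd z) (wd m)) := by
  rw [wd_cons, mu_letter_mul E b.mem_homog b.mem_pos]

theorem counit_mu (l m : List (Letter 𝒜 R)) :
    TensorAlgebra.algebraMapInv (mu E (wd l) (wd m)) = if l = [] ∧ m = [] then (1 : k) else 0 := by
  cases m with
  | nil => simp [counit_wd]
  | cons b m =>
    rw [mu_cons]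
    change TensorAlgebra.algebraMapInv.toLinearMap (splitSum _ _) = _
    simp only [map_splitSum, map_smul, AlgHom.toLinearMap_apply, map_mul]
    simp [letter, TensorAlgebra.algebraMapInv, splitSum_zero]

/-- The coalgebra map property of `μ_E`. -/
theorem cut_mu {M : Type*} [AddCommGroup M] [Module k M] (φ : Bar 𝒜 →ₗ[k] Bar 𝒜 →ₗ[k] M)
    (l m : List (Letter 𝒜 R)) : cut 𝒜 φ (mu E (wd l) (wd m)) =
      splitSum l fun x y => splitSum m fun s t =>
        sign k (ep y * ep s) • φ (mu E (wd x) (wd s)) (mu E (wd y) (wd t)) := by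
  induction m generalizing l φ with
  | nil => simp [cut_wd]
  | cons b m ih =>
    simp only [splitSum_cons, splitSum_add]
    rw [mu_cons]
    simp only [splitSum₃, map_splitSum, map_smul, cut_wd_mul_letter_mul, ih, smul_add,
      splitSum_add]
    -- A cut before the letter `E(y; b)` leaves the whole second word to the right factor, which is
    -- the term `s = []`. A cut after it gives the terms in which `s` begins with `b`.
    congr 1
    · simp only [← splitSum_smul]
      refine Eq.trans (splitSum₃_left _ _) (splitSum_congr fun x v _ => ?_)
      simp only [mu_cons, splitSum₃, map_splitSum, ep_nil, mul_zero, sign_zero, one_smul,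
        mu_one_right, wd_nil, map_smul]
    · simp only [← splitSum_smul]
      refine Eq.trans (splitSum₃_right _ _) (splitSum_congr fun p z _ => ?_)
      simp only [mu_cons, splitSum₃, map_splitSum, ← splitSum_smul, LinearMap.splitSum_apply]
      rw [splitSum_comm]
      refine splitSum_congr fun x q _ => ?_
      rw [splitSum_comm]
      refine splitSum_congr fun y z' _ => splitSum_congr fun s t _ => ?_
      simp only [map_smul, LinearMap.smul_apply, smul_smul, ← sign_add, ep_append, ep_cons,
        LinearMap.comp_apply, LinearMap.mulLeft_apply]
      congr 2
      ring

theorem tl_cons_of_ne {y : List (Letter 𝒜 R)} (h : y ≠ []) (c : Letter 𝒜 R) :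
    tl (c :: y) = 0 := tl_append_cons_of_ne (x := []) (Or.inr h) c

/-- The part of length one of a product combines length one in one factor with length zero in the
other. -/
theorem tau_mul (w w' : Bar 𝒜) : tau 𝒜 (w * w') =
    TensorAlgebra.algebraMapInv w' • tau 𝒜 w + TensorAlgebra.algebraMapInv w • tau 𝒜 w' := by
  induction w using bar_induction with
  | h1 => simp [tau_one]
  | hl a w ih =>
    have h : letter 𝒜 a = TensorAlgebra.ι k (toPos 𝒜 a) := rfl
    rw [mul_assoc, h, tau_ι_mul, tau_ι_mul, ← h, counit_letter_mul, map_mul, mul_smul, zero_smul,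
      add_zero, smul_comm]
  | hadd x y hx hy => simp only [add_mul, map_add, hx, hy, smul_add, add_smul]; abel
  | hsmul c x hx =>
    simp only [smul_mul_assoc, map_smul, hx, smul_add, smul_assoc, smul_comm c]

/-- `μ_E` of a word with a marked letter in the second factor. -/
theorem mu_append_cons_right (l s t : List (Letter 𝒜 R)) (c : Letter 𝒜 R) :
    mu E (wd l) (wd (s ++ c :: t)) = splitSum₃ l fun x y z =>
      sign k (ep s * (ep y + ep z) + (c.par + 1) * ep z) •
        (mu E (wd x) (wd s) * letter 𝒜 (E (wd y) c.val) * mu E (wd z) (wd t)) := by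
  induction s generalizing l with
  | nil => simp only [List.nil_append, mu_cons, ep_nil, zero_mul, zero_add, wd_nil, mu_one_right]
  | cons b s ih =>
    rw [List.cons_append, mu_cons]
    simp only [ih, mu_cons, splitSum₃, mul_splitSum, splitSum_mul, ← splitSum_smul]
    refine Eq.trans (splitSum₃_right _ _) (splitSum_congr fun p v _ => ?_)
    refine Eq.trans (splitSum_congr fun x q _ => splitSum_comm _ _ _) ?_
    rw [splitSum_comm]
    refine splitSum_congr fun y₂ y₃ hv => splitSum_congr fun x q _ => splitSum_congr fun y z _ => ?_
    simp only [← hv, mul_smul_comm, smul_mul_assoc, smul_smul, ← sign_add, mul_assoc, ep_append, ep_cons]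
    congr 2
    ring

variable {D : DGA 𝒜}
variable {E} (hE : ActsOn D E R)
include hE

/-- A coalgebra map to `BA` is determined by this component. The correction accounts for the empty
second word, on which `μ_E` is the identity. -/
theorem tau_mu (l m : List (Letter 𝒜 R)) :
    tau 𝒜 (mu E (wd l) (wd m)) = E (wd l) (tl m) + if m = [] then tl l else 0 := by
  cases m with
  | nil => simp [tau_wd]
  | cons b m =>
    rw [mu_cons]
    simp only [splitSum₃, map_splitSum, map_smul]
    rw [splitSum_eq_right, splitSum_eq_left]
    · simp only [wd_nil, one_mul]
      rw [tau_letter_mul (hE.E_pos l b.val b.mem b.mem_pos), ← wd_nil (R := R), counit_mu]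
      cases m <;> simp
    · intro x y _ hy
      have := counit_mu E y m
      rw [if_neg (fun h => hy h.1)] at this
      simp only [wd_nil, one_mul]
      rw [tau_letter_mul (hE.E_pos x b.val b.mem b.mem_pos), this, zero_smul, smul_zero]
    · intro x y _ hx
      refine (splitSum_congr fun y z _ => ?_).trans (splitSum_zero _)
      rw [mul_assoc, tau_mul, counit_letter_mul, counit_wd, if_neg hx, zero_smul, zero_smul,
        add_zero, smul_zero]

theorem NE_mem_homog (l m : List (Letter 𝒜 R)) : E (wd l) (tl m) ∈ homog 𝒜 (ep l + ep m + 1) := by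
  rw [add_assoc]; exact hE.E_homog l _ _ (tl_mem m) (tl_mem_homog m)

theorem sgnBar_mu (l m : List (Letter 𝒜 R)) : sgnBar 𝒜 (mu E (wd l) (wd m)) =
    sign k (ep l + ep m) • mu E (wd l) (wd m) := by
  have hmul : ∀ x y, sgnBar 𝒜 (x * y) = sgnBar 𝒜 x * sgnBar 𝒜 y := fun x y => by
    simp [sgnBar]
  induction m generalizing l with
  | nil => simp [sgnBar_wd]
  | cons b m ih =>
    rw [mu_cons]
    simp only [splitSum₃, map_splitSum, ← splitSum_smul, map_smul]
    refine splitSum_congr fun x v hx => splitSum_congr fun y z hy => ?_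
    have h1 := sgnBar_letter_mul (hE.E_homog y _ b.val b.mem b.mem_homog)
      (hE.E_pos y b.val b.mem b.mem_pos) 1
    rw [mul_one] at h1
    rw [hmul, hmul, h1, ih, sgnBar_wd, ← hx, ← hy]
    simp only [smul_mul_assoc, mul_smul_comm, smul_smul, ← sign_add, ep_append, ep_cons]
    have h2 : sgnBar 𝒜 1 = 1 := by simp [sgnBar]
    rw [h2, mul_one]
    congr 2
    ring

theorem sgnBar_pow_mu (n : ℕ) (l m : List (Letter 𝒜 R)) :
    (sgnBar 𝒜 ^ n) (mu E (wd l) (wd m)) = sign k (n * (ep l + ep m)) • mu E (wd l) (wd m) := by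
  rw [← sign_pow]
  induction n with
  | zero => simp
  | succ n ih => rw [pow_succ, Module.End.mul_apply, sgnBar_mu hE, map_smul, ih, smul_smul,
      pow_succ, mul_comm]

theorem tau_mu_singleton (l : List (Letter 𝒜 R)) (b : Letter 𝒜 R) :
    tau 𝒜 (mu E (wd l) (wd [b])) = E (wd l) b.val := by
  rw [tau_mu hE]; simp

theorem tau_mu_cons_cons (l m : List (Letter 𝒜 R)) (b c : Letter 𝒜 R) :
    tau 𝒜 (mu E (wd l) (wd (b :: c :: m))) = 0 := by
  rw [tau_mu hE]; simp

/-- `μ_E` of a word with a marked letter in the first factor. -/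
theorem mu_append_cons_left (x y m : List (Letter 𝒜 R)) (c : Letter 𝒜 R) :
    mu E (wd (x ++ c :: y)) (wd m) = splitSum x fun x₁ x₂ => splitSum y fun y₁ y₂ =>
      splitSum₃ m fun m₁ m₂ m₃ =>
      sign k (ep m₁ * (ep x₂ + (c.par + 1) + ep y₁ + ep y₂) + ep m₂ * ep y₂) •
        (mu E (wd x₁) (wd m₁) * letter 𝒜 (tau 𝒜 (mu E (wd (x₂ ++ c :: y₁)) (wd m₂))) *
          mu E (wd y₂) (wd m₃)) := by
  induction m generalizing x with
  | nil =>
    simp only [splitSum₃, splitSum_nil, wd_nil, mu_one_right, tau_wd, ep_nil, zero_mul, add_zero,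
      sign_zero, one_smul]
    rw [splitSum_eq_left, splitSum_eq_right]
    · simp [wd_append, mul_assoc]
    · intro y₁ y₂ _ h
      simp [tl_cons_of_ne h]
    · intro x₁ x₂ _ h
      refine (splitSum_congr fun y₁ y₂ _ => ?_).trans (splitSum_zero _)
      simp [tl_append_cons_of_ne (Or.inl h)]
  | cons b m ih =>
    -- Pieces `m₂` with two or more letters do not contribute, since `τ ∘ μ_E` vanishes on them. The
    -- remaining terms are sorted by whether `b` lies in `m₃`, is the only letter of `m₂`, or is the
    -- first letter of `m₁`.
    have hm : ∀ G : List (Letter 𝒜 R) → List (Letter 𝒜 R) → List (Letter 𝒜 R) → Bar 𝒜,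
        (∀ b c m m', G [] (b :: c :: m) m' = 0) →
        splitSum₃ (b :: m) G = G [] [] (b :: m) + (G [] [b] m +
          splitSum₃ m fun m₁ m₂ m₃ => G (b :: m₁) m₂ m₃) := by
      intro G hG
      rw [splitSum₃, splitSum_cons, splitSum_cons, add_assoc]
      congr 2
      rw [splitSum_eq_right]
      rintro (_ | ⟨b', m'⟩) m'' - h
      · exact (h rfl).elim
      · exact hG _ _ _ _
    refine Eq.trans ?_ (splitSum_congr fun x₁ x₂ _ => splitSum_congr fun y₁ y₂ _ =>
      (hm _ (fun b c m m' => by rw [tau_mu_cons_cons hE]; simp)).symm)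
    simp only [splitSum_add]
    -- On the left side the letter `E(…; b)` comes after `c`, absorbs `c`, or comes before `c`.
    -- These are the three cases in the same order.
    rw [mu_cons, splitSum₃, splitSum_append_cons, add_comm]
    congr 1
    · symm
      rw [splitSum_eq_left x, splitSum_eq_right y, mu_cons]
      · simp only [splitSum₃, mul_splitSum, ← splitSum_smul]
        refine splitSum_congr fun y₁ v _ => splitSum_congr fun y₂ y₃ _ => ?_
        simp [tau_letter c.mem_pos, wd_append, mul_assoc]
      · intro y₁ y₂ _ h
        simp [tau_letter_mul c.mem_pos, counit_wd, h]
      · intro x₁ x₂ _ h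
        refine (splitSum_congr fun y₁ y₂ _ => ?_).trans (splitSum_zero _)
        simp [tau_wd, tl_append_cons_of_ne (Or.inl h)]
    · simp only [splitSum_append_cons, splitSum_add]
      rw [add_comm]
      congr 1
      · refine splitSum_congr fun x₁ x₂ _ => splitSum_congr fun y₁ y₂ _ => ?_
        rw [tau_mu_singleton hE]
        simp
      · simp only [ih, mu_cons, splitSum₃, mul_splitSum, splitSum_mul, ← splitSum_smul]
        refine Eq.trans (splitSum₃_right _ _) (splitSum_congr fun p x₂ _ => ?_)
        refine Eq.trans (splitSum_congr fun x q _ => splitSum_comm _ _ _) ?_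
        rw [splitSum_comm]
        refine splitSum_congr fun y₁ y₂ hy => ?_
        refine Eq.trans (splitSum_congr fun x q _ => splitSum_comm _ _ _) ?_
        rw [splitSum_comm]
        refine splitSum_congr fun m₁ v _ => ?_
        refine Eq.trans (splitSum_congr fun x q _ => splitSum_comm _ _ _) ?_
        rw [splitSum_comm]
        refine splitSum_congr fun m₂ m₃ _ => splitSum_congr fun x q _ =>
          splitSum_congr fun z₁ z₂ _ => ?_
        simp only [← hy, mul_smul_comm, smul_mul_assoc, smul_smul, ← sign_add, mul_assoc, ep_append, ep_cons]
        congr 2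
        ring

end Action

theorem splitSum_ite_left {α M : Type*} [∀ x : List α, Decidable (x = [])] [AddCommMonoid M] (l : List α)
    (F : List α → List α → M) :
    (splitSum l fun x y => if x = [] then F x y else 0) = F [] l := by
  rw [splitSum_eq_right]
  · simp
  · intro x y _ h; simp [h]

theorem splitSum_ite_right {α M : Type*} [∀ x : List α, Decidable (x = [])] [AddCommMonoid M] (l : List α)
    (F : List α → List α → M) :
    (splitSum l fun x y => if y = [] then F x y else 0) = F l [] := by
  rw [splitSum_eq_left]
  · simp
  · intro x y _ h; simp [h]

/-! ### The multiplication on the bar construction is a chain map -/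

section Action

variable {k A : Type*} [CommRing k] [Ring A] [Algebra k A]
variable {𝒜 : ℕ → Submodule k A} [GradedAlgebra 𝒜] {R : Subalgebra k A} {D : DGA 𝒜}

theorem bdry_tl (hR : ∀ a ∈ R, D.d a ∈ R) (l : List (Letter 𝒜 R)) :
    bdry D hR tl l = barDelta D (wd l) := by
  rw [bdry, splitSum₃_eq_middle]
  · simp [barDelta_wd' D hR]
  · intro x y z _ h
    rw [tl_append_cons_of_ne h, smul_zero]

variable {E : Bar 𝒜 →ₗ[k] A →ₗ[k] A} (hE : ActsOn D E R)
include hE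

theorem bdry_tau_mu_right (l m : List (Letter 𝒜 R)) :
    bdry D hE.d_mem (fun m => tau 𝒜 (mu E (wd l) (wd m))) m =
      E (wd l) (barDelta D (wd m)) := by
  rw [← bdry_tl hE.d_mem, map_bdry]
  refine splitSum_congr fun x v _ => splitSum_congr fun y z _ => ?_
  simp only
  rw [tau_mu hE, if_neg (by simp), add_zero]

theorem bdry_tau_mu_left (l m : List (Letter 𝒜 R)) :
    bdry D hE.d_mem (fun l => tau 𝒜 (mu E (wd l) (wd m))) l =
      E (barD D (wd l)) (tl m) + if m = [] then barDelta D (wd l) else 0 := by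
  simp only [tau_mu hE]
  rw [bdry_add]
  congr 1
  · exact (map_barD_wd D hE.d_mem (E.flip (tl m)) l).symm
  · split_ifs
    · exact bdry_tl hE.d_mem l
    · simp [bdry, splitSum₃, splitSum_zero]

/-- Products of adjacent letters of `m` are expanded by the product rule for `E`. -/
theorem E_barDelta (l m : List (Letter 𝒜 R)) : E (wd l) (barDelta D (wd m)) =
    - E (wd l) (D.d (tl m)) - splitSum l fun x y => splitSum m fun s t =>
      sign k (ep s + (ep s + 1) * ep y) • (E (wd x) (tl s) * E (wd y) (tl t)) := by
  rw [barDelta_wd, map_sub, map_neg, map_splitSum]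
  simp only [map_smul]
  rw [splitSum_congr fun s t _ => congrArg _
    (hE.E_mul l _ _ (tl_mem s) (tl_mem_homog s) _ (tl_mem t))]
  simp only [← splitSum_smul, smul_smul, ← sign_add]
  rw [splitSum_comm]

/-- The component `barDelta` of the differential of a value of `μ_E`. -/
theorem barDelta_mu (l m : List (Letter 𝒜 R)) : barDelta D (mu E (wd l) (wd m)) =
    bdry D hE.d_mem (fun l => tau 𝒜 (mu E (wd l) (wd m))) l +
      sign k (ep l) • bdry D hE.d_mem (fun m => tau 𝒜 (mu E (wd l) (wd m))) m := by
  rw [bdry_tau_mu_left hE, bdry_tau_mu_right hE, E_barDelta hE, barDelta_wd D l]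
  simp only [barDelta, LinearMap.sub_apply, LinearMap.neg_apply, LinearMap.comp_apply, cut_mu E,
    LinearMap.compl₁₂_apply, sgnBar_mu hE, map_smul, LinearMap.smul_apply, LinearMap.mul_apply']
  have h := hE.d_E l _ _ (tl_mem m) (tl_mem_homog m)
  -- Each factor `τ μ_E` is a value of `E` plus a correction for an empty second word, so the
  -- product has four parts. They match the product rule for `E`, the two multiplication terms in `d
  -- E`, and the products of adjacent letters of `l`.
  have hT : (splitSum l fun x y => splitSum m fun s t => sign k (ep y * ep s) •
      sign k (ep x + ep s) • (tau 𝒜 (mu E (wd x) (wd s)) * tau 𝒜 (mu E (wd y) (wd t)))) =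
      (splitSum l fun x y => splitSum m fun s t => sign k (ep y * ep s + (ep x + ep s)) •
        (E (wd x) (tl s) * E (wd y) (tl t))) +
      (splitSum l fun x y => sign k (ep x) • (tl x * E (wd y) (tl m))) +
      (splitSum l fun x y => sign k (ep y * ep m + (ep x + ep m)) • (E (wd x) (tl m) * tl y)) +
      if m = [] then (splitSum l fun x y => sign k (ep x) • (tl x * tl y)) else 0 := by
    simp only [smul_smul, ← sign_add]
    have e : (if m = [] then (splitSum l fun x y => sign k (ep x) • (tl x * tl y)) else 0) =
      splitSum l fun x y => if m = [] then sign k (ep x) • (tl x * tl y) else 0 := by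
      split_ifs
      · rfl
      · rw [splitSum_zero]
    rw [e, ← splitSum_add, ← splitSum_add, ← splitSum_add]
    refine splitSum_congr fun x y _ => ?_
    have e1 := splitSum_ite_left m fun s t => sign k (ep y * ep s + (ep x + ep s)) •
        (tl x * E (wd y) (tl t))
    have e2 := splitSum_ite_right m fun s t => sign k (ep y * ep s + (ep x + ep s)) •
        (E (wd x) (tl s) * tl y)
    have e3 := splitSum_ite_left m fun s t => if t = [] then
      sign k (ep y * ep s + (ep x + ep s)) • (tl x * tl y) else 0
    simp only [ep_nil, mul_zero, zero_add, add_zero] at e1 e2 e3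
    rw [← e1, ← e2, ← e3, ← splitSum_add, ← splitSum_add, ← splitSum_add]
    refine splitSum_congr fun s t _ => ?_
    rw [tau_mu hE, tau_mu hE, add_mul, mul_add, mul_add, smul_add, smul_add, smul_add]
    by_cases hs : s = [] <;> by_cases ht : t = [] <;> simp [hs, ht]
  have hS : (splitSum l fun x y => splitSum m fun s t => sign k (ep y * ep s + (ep x + ep s)) •
        (E (wd x) (tl s) * E (wd y) (tl t))) = sign k (ep l) • splitSum l fun x y =>
        splitSum m fun s t => sign k (ep s + (ep s + 1) * ep y) •
        (E (wd x) (tl s) * E (wd y) (tl t)) := by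
    simp only [← splitSum_smul, smul_smul, ← sign_add]
    refine splitSum_congr fun x y h => splitSum_congr fun s t _ => ?_
    rw [← h, ep_append]
    congr 2
    generalize ep x = a, ep y = b, ep s = c
    decide +revert
  have hS' : (splitSum l fun x y => sign k (ep y * ep m + (ep x + ep m)) •
        (E (wd x) (tl m) * tl y)) =
      - splitSum l fun x y => sign k (ep m + 1 + ep x + (ep m + 1 + 1) * ep y) •
        (E (wd x) (tl m) * tl y) := by
    rw [← splitSum_neg]
    refine splitSum_congr fun x y _ => ?_
    rw [← neg_smul, ← sign_add_one]
    congr 2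
    generalize ep x = a, ep y = b, ep m = c
    decide +revert
  rw [hT, tau_mu hE, map_add, h, hS, hS', smul_sub, smul_neg]
  split_ifs
  · abel
  · simp only [map_zero]
    abel

/-- `μ_E` is a chain map. -/
theorem barD_mu (l m : List (Letter 𝒜 R)) : barD D (mu E (wd l) (wd m)) =
    bdry D hE.d_mem (fun l => mu E (wd l) (wd m)) l +
      sign k (ep l) • bdry D hE.d_mem (fun m => mu E (wd l) (wd m)) m := by
  -- Both sides are coderivations along the coalgebra map `μ_E`, so it suffices to compare
  -- components, which is `barDelta_mu`. To that end all terms are brought into the form of a triple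
  -- cut with the component in the middle.
  have h₀ : barD D (mu E (wd l) (wd m)) =
      splitSum l fun x v => splitSum v fun y z => splitSum m fun s t => splitSum t fun r q =>
        sign k (ep v * ep s + ep z * ep r + ep x + ep s) •
          (mu E (wd x) (wd s) * letter 𝒜 (barDelta D (mu E (wd y) (wd r))) *
            mu E (wd z) (wd q)) := by
    change cut 𝒜 (cut 𝒜 ∘ₗ _) _ = _
    rw [cut_mu E]
    refine splitSum_congr fun x v _ => Eq.trans (splitSum_congr fun s t _ => ?_)
      (splitSum_comm _ _ _)
    rw [LinearMap.comp_apply, cut_mu E]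
    simp only [← splitSum_smul]
    refine splitSum_congr fun y z _ => splitSum_congr fun r q _ => ?_
    simp only [LinearMap.compl₁₂_apply, mul₃, LinearMap.mk₂_apply, LinearMap.mulLeft_apply,
      sgnBar_mu hE, LinearMap.comp_apply, smul_mul_assoc, smul_smul, ← sign_add]
    congr 2
    ring
  rw [h₀]
  simp only [barDelta_mu hE, map_add, mul_add, add_mul, smul_add, splitSum_add]
  congr 1
  · symm
    refine Eq.trans (splitSum_congr fun X w _ => splitSum_congr fun Y Z _ =>
      congrArg _ (mu_append_cons_left hE X Z m _)) ?_
    simp only [splitSum₃, bdry, map_splitSum, mul_splitSum, splitSum_mul, ← splitSum_smul]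
    refine Eq.trans (splitSum₃_left l fun X x₁ x₂ Y Z => splitSum Z fun z₁ z₂ =>
      splitSum m fun m₁ t => splitSum t fun m₂ m₃ => sign k (ep X) • sign k (ep m₁ *
        (ep x₂ + ((delta D hE.d_mem Y).par + 1) + ep z₁ + ep z₂) + ep m₂ * ep z₂) •
      (mu E (wd x₁) (wd m₁) *
        letter 𝒜 (tau 𝒜 (mu E (wd (x₂ ++ delta D hE.d_mem Y :: z₁)) (wd m₂))) *
          mu E (wd z₂) (wd m₃))) (splitSum_congr fun x v _ => ?_)
    refine Eq.trans (splitSum₃_right _ _) (splitSum_congr fun y z₂ hv => ?_)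
    refine Eq.trans (splitSum_congr fun x₂ q _ => splitSum_comm _ _ _) ?_
    rw [splitSum_comm]
    refine splitSum_congr fun m₁ t _ => ?_
    refine Eq.trans (splitSum_congr fun x₂ q _ => splitSum_comm _ _ _) ?_
    rw [splitSum_comm]
    refine splitSum_congr fun m₂ m₃ _ => splitSum_congr fun x₂ q hy =>
      splitSum_congr fun Y z₁ hq => ?_
    simp only [← hv, ← hy, ← hq, smul_smul, ← sign_add, mul_smul_comm, smul_mul_assoc, map_smul,
      ep_append, delta_par]
    congr 2
    generalize ep x = a, ep x₂ = b, ep m₁ = c, ep m₂ = d, ep Y = e, ep z₁ = f, ep z₂ = g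
    decide +revert
  · symm
    refine Eq.trans (congrArg _ (splitSum_congr fun X w _ => splitSum_congr fun Y Z _ =>
      congrArg _ (mu_append_cons_right E l X Z _))) ?_
    simp only [splitSum₃, bdry_tau_mu_right hE, ← splitSum_smul]
    refine Eq.trans (splitSum_congr fun X w _ => splitSum_comm _ _ _) ?_
    rw [splitSum_comm]
    refine splitSum_congr fun x v hl => ?_
    refine Eq.trans (splitSum_congr fun X w _ => splitSum_comm _ _ _) ?_
    rw [splitSum_comm]
    refine splitSum_congr fun y z hv => splitSum_congr fun X w _ => splitSum_congr fun Y Z _ => ?_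
    simp only [← hl, ← hv, smul_smul, ← sign_add, mul_smul_comm, smul_mul_assoc, map_smul,
      ep_append, delta_par, barDelta_wd' D hE.d_mem]
    congr 2
    generalize ep x = a, ep y = b, ep X = c, ep Y = d, ep z = e
    decide +revert

end Action

theorem splitSum_tmul {k M N α : Type*} [CommSemiring k] [AddCommMonoid M] [Module k M]
    [AddCommMonoid N] [Module k N] (l : List α) (F : List α → List α → M) (n : N) :
    splitSum l F ⊗ₜ[k] n = splitSum l fun x y => F x y ⊗ₜ[k] n :=
  map_splitSum ((TensorProduct.mk k M N).flip n) l F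

theorem tmul_splitSum {k M N α : Type*} [CommSemiring k] [AddCommMonoid M] [Module k M]
    [AddCommMonoid N] [Module k N] (l : List α) (F : List α → List α → N) (m : M) :
    m ⊗ₜ[k] splitSum l F = splitSum l fun x y => m ⊗ₜ[k] F x y :=
  map_splitSum (TensorProduct.mk k M N m) l F

/-! ### The operation K and the differential -/

section Action

variable {k A : Type*} [CommRing k] [Ring A] [Algebra k A]
variable {𝒜 : ℕ → Submodule k A} [GradedAlgebra 𝒜] {R : Subalgebra k A} {D : DGA 𝒜}
variable (E : Bar 𝒜 →ₗ[k] A →ₗ[k] A) {p q : ZMod 2} {v c u : A}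

theorem lamK_wd (hv : v ∈ homog 𝒜 p) (l : List (Letter 𝒜 R)) (w : Bar 𝒜) :
    lamK E (wd l) v w = splitSum l fun x y =>
      sign k (ep x + ep y * p) • (E (wd x) v ⊗ₜ[k] mu E (wd y) w) := by
  rw [lamK, cut_wd]
  simp only [LinearMap.splitSum_apply]
  refine splitSum_congr fun x y _ => ?_
  simp only [LinearMap.sum_apply]
  rw [Finset.sum_eq_single p]
  · simp only [LinearMap.mk₂_apply, LinearMap.compl₁₂_apply, LinearMap.comp_apply,
      par_of_homog hv, if_true, sgnBar_wd, sgnBar_pow_wd, map_smul, LinearMap.smul_apply,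
      TensorProduct.mk_apply, smul_smul, ZMod.natCast_val, ZMod.cast_id', id, ← sign_add]
    congr 2
    ring
  · intro r _ hr
    simp [par_of_homog hv, Ne.symm hr]
  · simp

variable {E} (hE : ActsOn D E R)
include hE

theorem tau_mu_mem_homog (l m : List (Letter 𝒜 R)) :
    tau 𝒜 (mu E (wd l) (wd m)) ∈ homog 𝒜 (ep l + ep m + 1) := by
  rw [tau_mu hE]
  refine add_mem (NE_mem_homog hE l m) ?_
  split_ifs with h
  · rw [h, ep_nil, add_zero]; exact tl_mem_homog l
  · exact zero_mem _

/-- The product rule for `E`, with the part of the word that is left for `μ_E` carried along. -/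
theorem lamK_mul (hc : c ∈ homog 𝒜 q) (hcR : c ∈ R) (hv : v ∈ homog 𝒜 p) (hvR : v ∈ R)
    (l : List (Letter 𝒜 R)) (w : Bar 𝒜) : lamK E (wd l) (c * v) w = splitSum l fun x y =>
      sign k (ep x + ep y * q) • act 𝒜 (E (wd x) c) (lamK E (wd y) v w) := by
  rw [lamK_wd E (mul_mem_homog hc hv)]
  simp only [hE.E_mul _ _ c hcR hc v hvR, lamK_wd E hv, map_splitSum, splitSum_tmul,
    ← splitSum_smul]
  refine Eq.trans (splitSum_splitSum_left _ _)
    (splitSum_congr fun x w _ => splitSum_congr fun y z h => ?_)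
  simp only [← h, map_smul, act_tmul, ← TensorProduct.smul_tmul', smul_smul, ← sign_add, ep_append]
  congr 2
  generalize ep x = a, ep y = b, ep z = c, q = q', p = p'
  decide +revert

/-- Since `μ_E` is a coalgebra map, the letter rotated to the front is `τ μ_E` of final pieces of
both words. -/
theorem theta₂_mu (hu : u ∈ homog 𝒜 p) (l m : List (Letter 𝒜 R)) :
    theta₂ u (mu E (wd l) (wd m)) = splitSum l fun x y => splitSum m fun s t =>
      sign k (ep y * ep s + (ep y + ep t) * (p + ep x + ep s)) •
        ((tau 𝒜 (mu E (wd y) (wd t)) * u) ⊗ₜ[k] mu E (wd x) (wd s)) := by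
  rw [theta₂_apply, cut_mu E]
  refine splitSum_congr fun x y _ => splitSum_congr fun s t _ => ?_
  simp only [LinearMap.sum_apply]
  rw [Finset.sum_eq_single (ep y + ep t + 1)]
  · simp only [LinearMap.flip_apply, LinearMap.compl₁₂_apply, LinearMap.comp_apply,
      mem_homog.1 (tau_mu_mem_homog hE y t), sgn_pow_of_homog hu, sgnBar_pow_mu hE,
      TensorProduct.mk_apply, map_smul, LinearMap.smul_apply, smul_smul, ZMod.natCast_val,
      ZMod.cast_id', id, ← sign_add, act_tmul]
    congr 2
    generalize ep y = a, ep s = b, ep t = c, ep x = d, p = p'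
    decide +revert
  · intro r _ hr
    simp [par_of_homog (tau_mu_mem_homog hE y t), Ne.symm hr]
  · simp

theorem hochTheta₂_act_lamK (hu : u ∈ homog 𝒜 q) (hv : v ∈ homog 𝒜 p) (hvR : v ∈ R)
    (l m : List (Letter 𝒜 R)) : hochTheta₂ (act 𝒜 u (lamK E (wd l) v (wd m))) =
      splitSum l fun x y => splitSum m fun s t =>
        sign k ((ep y + ep t) * q + ep x * ep y + ep t * (ep x + p + ep s)) •
          act 𝒜 (tau 𝒜 (mu E (wd y) (wd t)) * u) (lamK E (wd x) v (wd s)) := by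
  have h : ∀ x y, hochTheta₂ ((u * E (wd x) v) ⊗ₜ[k] mu E (wd y) (wd m)) =
    splitSum y fun y₁ y₂ => splitSum m fun s t =>
      sign k (ep y₂ * ep s + (ep y₂ + ep t) * (q + (ep x + p) + ep y₁ + ep s)) •
        ((tau 𝒜 (mu E (wd y₂) (wd t)) * (u * E (wd x) v)) ⊗ₜ[k] mu E (wd y₁) (wd s)) :=
    fun x y => theta₂_mu hE (mul_mem_homog hu (hE.E_homog x p v hvR hv)) y m
  simp only [lamK_wd E hv, map_splitSum, map_smul, act_tmul, h, ← splitSum_smul]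
  refine Eq.trans (splitSum_splitSum_right _ _) (splitSum_congr fun w z _ => ?_)
  rw [splitSum_comm]
  refine splitSum_congr fun s t _ => splitSum_congr fun x y h => ?_
  simp only [← h, smul_smul, ← sign_add, ep_append, mul_assoc]
  congr 2
  generalize ep x = a, ep y = b, ep s = c, ep t = d, ep z = e, p = p', q = q'
  decide +revert

/-- Without the cyclic term of the differential, `K` obeys the Leibniz rule up to the sum in which
the first letter of `l` multiplies from the left; that sum comes from the left multiplication in `d
E`. The right multiplications in `d E` cancel against `θ¹`. -/
theorem hochD₁_lamK (hv : v ∈ homog 𝒜 p) (hvR : v ∈ R) (l m : List (Letter 𝒜 R)) :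
    hochD₁ D (lamK E (wd l) v (wd m)) =
      bdry D hE.d_mem (fun l => lamK E (wd l) v (wd m)) l +
      sign k (ep l) • (lamK E (wd l) (D.d v) (wd m) +
        sign k p • bdry D hE.d_mem (fun m => lamK E (wd l) v (wd m)) m -
        sign k p • splitSum m fun s t => lamK E (wd l) (v * tl s) (wd t)) -
      splitSum l fun x y => act 𝒜 (tl x) (lamK E (wd y) v (wd m)) := by
  have hcut : ∀ x y : List (Letter 𝒜 R), cut 𝒜 (TensorProduct.mk k A (Bar 𝒜) ∘ₗ LinearMap.mulLeft k (E (wd x) v) ∘ₗ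
      tau 𝒜) (mu E (wd y) (wd m)) =
      (splitSum y fun y₁ y₂ => splitSum m fun s t => sign k (ep y₂ * ep s) •
        ((E (wd x) v * E (wd y₁) (tl s)) ⊗ₜ[k] mu E (wd y₂) (wd t))) +
      splitSum y fun y₁ y₂ => (E (wd x) v * tl y₁) ⊗ₜ[k] mu E (wd y₂) (wd m) := by
    intro x y
    rw [cut_mu E, ← splitSum_add]
    refine splitSum_congr fun y₁ y₂ _ => ?_
    have e := splitSum_ite_left m fun s t => sign k (ep y₂ * ep s) •
      ((E (wd x) v * tl y₁) ⊗ₜ[k] mu E (wd y₂) (wd t))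
    rw [ep_nil, mul_zero, sign_zero, one_smul] at e
    rw [← e, ← splitSum_add]
    refine splitSum_congr fun s t _ => ?_
    simp only [LinearMap.comp_apply, tau_mu hE, LinearMap.mulLeft_apply, map_add,
      LinearMap.add_apply, smul_add, TensorProduct.mk_apply]
    split_ifs <;> simp
  -- The differential of one summand, sorted into bar differentials of `x` and `y`, terms that
  -- differentiate or multiply `v` and `m`, left and right multiplications by letters of `x`, and
  -- right multiplication by the first letter of `y`.
  have hd : ∀ x y : List (Letter 𝒜 R), sign k (ep x + ep y * p) •
      hochD₁ D (E (wd x) v ⊗ₜ[k] mu E (wd y) (wd m)) =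
      (sign k (ep x + 1 + ep y * p) • (E (barD D (wd x)) v ⊗ₜ[k] mu E (wd y) (wd m)) +
        sign k (ep x) • sign k (ep x + (ep y + 1) * p) •
          bdry D hE.d_mem (fun y => E (wd x) v ⊗ₜ[k] mu E (wd y) (wd m)) y) +
      (sign k (ep y * p) • (E (wd x) (D.d v) ⊗ₜ[k] mu E (wd y) (wd m)) +
        sign k (p + ep y + ep y * p) •
          bdry D hE.d_mem (fun m => E (wd x) v ⊗ₜ[k] mu E (wd y) (wd m)) m -
        splitSum y fun y₁ y₂ => splitSum m fun s t =>
          sign k (p + (ep y₁ + ep y₂) * p + ep y₂ * ep s) •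
          ((E (wd x) v * E (wd y₁) (tl s)) ⊗ₜ[k] mu E (wd y₂) (wd t))) -
      (splitSum x fun x₁ x₂ => sign k (ep x₂ + ep y * p) •
        ((tl x₁ * E (wd x₂) v) ⊗ₜ[k] mu E (wd y) (wd m))) +
      (splitSum x fun x₁ x₂ => sign k (p + p * ep x₂ + ep y * p) •
        ((E (wd x₁) v * tl x₂) ⊗ₜ[k] mu E (wd y) (wd m))) -
      (splitSum y fun y₁ y₂ => sign k (p + p * ep y₁ + ep y₂ * p) •
        ((E (wd x) v * tl y₁) ⊗ₜ[k] mu E (wd y₂) (wd m))) := by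
    intro x y
    have hb := fun F l => map_bdry D hE.d_mem (TensorProduct.mk k A (Bar 𝒜) (E (wd x) v)) F l
      (R := R)
    simp only [TensorProduct.mk_apply] at hb
    rw [hochD₁_tmul D (hE.E_homog x p v hvR hv), hcut, barD_mu hE, hE.d_E x p v hvR hv]
    simp only [TensorProduct.add_tmul, TensorProduct.sub_tmul, TensorProduct.neg_tmul,
      splitSum_tmul, TensorProduct.tmul_add, smul_add, smul_sub, smul_neg,
      ← TensorProduct.smul_tmul', TensorProduct.tmul_smul, hb, smul_smul, ← sign_add,
      ← splitSum_smul]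
    have e₁ : sign k (ep x + 1 + ep y * p) = - sign k (ep x + ep y * p) := by
      rw [← sign_add_one]; congr 1; ring
    have e₂ : ep x + ep y * p + ep x = ep y * p := by
      generalize ep x = a, ep y * p = b; decide +revert
    have e₃ : (splitSum x fun x₁ x₂ => sign k (ep x + ep y * p + ep x₁) •
        ((tl x₁ * E (wd x₂) v) ⊗ₜ[k] mu E (wd y) (wd m))) =
        splitSum x fun x₁ x₂ => sign k (ep x₂ + ep y * p) •
        ((tl x₁ * E (wd x₂) v) ⊗ₜ[k] mu E (wd y) (wd m)) := splitSum_congr fun x₁ x₂ h => by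
      rw [← h, ep_append]
      congr 2
      generalize ep x₁ = a, ep x₂ = c, ep y * p = b; decide +revert
    have e₄ : (splitSum x fun x₁ x₂ =>
        sign k (ep x + ep y * p + (p + ep x₁ + (p + 1) * ep x₂)) •
        ((E (wd x₁) v * tl x₂) ⊗ₜ[k] mu E (wd y) (wd m))) =
        splitSum x fun x₁ x₂ => sign k (p + p * ep x₂ + ep y * p) •
        ((E (wd x₁) v * tl x₂) ⊗ₜ[k] mu E (wd y) (wd m)) := splitSum_congr fun x₁ x₂ h => by
      rw [← h, ep_append]
      congr 2
      generalize ep x₁ = a, ep x₂ = c, ep y = b, p = p'; decide +revert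
    have e₅ : ep x + ep y * p + (ep x + p) = ep x + (ep x + (ep y + 1) * p) := by ring
    have e₆ : ep x + ep y * p + (ep x + p + ep y) = p + ep y + ep y * p := by
      generalize ep x = a, ep y = b, p = p'; decide +revert
    have e₇ : (splitSum y fun y₁ y₂ => splitSum m fun s t =>
        sign k (ep x + ep y * p + (ep x + p + ep y₂ * ep s)) •
        ((E (wd x) v * E (wd y₁) (tl s)) ⊗ₜ[k] mu E (wd y₂) (wd t))) =
        splitSum y fun y₁ y₂ => splitSum m fun s t =>
          sign k (p + (ep y₁ + ep y₂) * p + ep y₂ * ep s) •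
          ((E (wd x) v * E (wd y₁) (tl s)) ⊗ₜ[k] mu E (wd y₂) (wd t)) :=
      splitSum_congr fun y₁ y₂ h => splitSum_congr fun s t _ => by
      rw [← h, ep_append]
      congr 2
      generalize ep x = a, ep y₁ = b, ep y₂ = c, ep s = d, p = p'; decide +revert
    have e₈ : (splitSum y fun y₁ y₂ => sign k (ep x + (ep x + (ep y + 1) * p)) •
        ((E (wd x) v * tl y₁) ⊗ₜ[k] mu E (wd y₂) (wd m))) =
        splitSum y fun y₁ y₂ => sign k (p + p * ep y₁ + ep y₂ * p) •
        ((E (wd x) v * tl y₁) ⊗ₜ[k] mu E (wd y₂) (wd m)) := splitSum_congr fun y₁ y₂ h => by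
      rw [← h, ep_append]
      congr 2
      generalize ep x = a, ep y₁ = b, ep y₂ = c, p = p'; decide +revert
    rw [e₁, e₂, e₃, e₄, e₅, e₆, e₇, e₈, neg_smul]
    abel
  -- The letter at the cut between `x` and `y` multiplies `E(x; v)` from the right twice: as last
  -- letter of `x` in `d E`, and as first letter of `y` through `θ¹`.
  have hD : (splitSum l fun x y => splitSum x fun x₁ x₂ => sign k (p + p * ep x₂ + ep y * p) •
        ((E (wd x₁) v * tl x₂) ⊗ₜ[k] mu E (wd y) (wd m))) =
      splitSum l fun x y => splitSum y fun y₁ y₂ => sign k (p + p * ep y₁ + ep y₂ * p) •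
        ((E (wd x) v * tl y₁) ⊗ₜ[k] mu E (wd y₂) (wd m)) :=
    splitSum_assoc l fun x y z => sign k (p + p * ep y + ep z * p) •
        ((E (wd x) v * tl y) ⊗ₜ[k] mu E (wd z) (wd m))
  have hA : bdry D hE.d_mem (fun l => lamK E (wd l) v (wd m)) l = splitSum l fun x y =>
      (sign k (ep x + 1 + ep y * p) • (E (barD D (wd x)) v ⊗ₜ[k] mu E (wd y) (wd m)) +
        sign k (ep x) • sign k (ep x + (ep y + 1) * p) •
          bdry D hE.d_mem (fun y => E (wd x) v ⊗ₜ[k] mu E (wd y) (wd m)) y) := by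
    simp only [lamK_wd E hv]
    rw [bdry_splitSum]
    refine splitSum_congr fun x y _ => ?_
    rw [bdry_congr D hE.d_mem (l := x) (G := fun x' => sign k (ep x + 1 + ep y * p) •
      (E (wd x') v ⊗ₜ[k] mu E (wd y) (wd m))) (fun x' hx => by rw [hx]),
      bdry_congr D hE.d_mem (l := y) (G := fun y' => sign k (ep x + (ep y + 1) * p) •
      (E (wd x) v ⊗ₜ[k] mu E (wd y') (wd m))) (fun x' hx => by rw [hx]), bdry_smul, bdry_smul]
    congr 2
    exact (map_barD_wd D hE.d_mem ((TensorProduct.mk k A (Bar 𝒜)).flip (mu E (wd y) (wd m)) ∘ₗ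
      E.flip v) x).symm
  have hB : sign k (ep l) • lamK E (wd l) (D.d v) (wd m) = splitSum l fun x y =>
      sign k (ep y * p) • (E (wd x) (D.d v) ⊗ₜ[k] mu E (wd y) (wd m)) := by
    rw [lamK_wd E (D.d_mem_homog hv), ← splitSum_smul]
    refine splitSum_congr fun x y h => ?_
    rw [smul_smul, ← sign_add, ← h, ep_append]
    congr 2
    generalize ep x = a, ep y = b, p = p'
    decide +revert
  have hG : sign k (ep l) • sign k p • bdry D hE.d_mem (fun m => lamK E (wd l) v (wd m)) m =
      splitSum l fun x y => sign k (p + ep y + ep y * p) •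
        bdry D hE.d_mem (fun m => E (wd x) v ⊗ₜ[k] mu E (wd y) (wd m)) m := by
    have : bdry D hE.d_mem (fun m => lamK E (wd l) v (wd m)) m =
        splitSum l fun x y => sign k (ep x + ep y * p) •
          bdry D hE.d_mem (fun m => E (wd x) v ⊗ₜ[k] mu E (wd y) (wd m)) m := by
      simp only [lamK_wd E hv, bdry, splitSum₃, ← splitSum_smul]
      refine Eq.trans (splitSum_congr fun x w _ => splitSum_comm _ _ _) ?_
      rw [splitSum_comm]
      refine splitSum_congr fun x y _ => splitSum_congr fun s t _ => splitSum_congr fun _ _ _ => ?_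
      rw [smul_comm]
    rw [this]
    simp only [← splitSum_smul, smul_smul, ← sign_add]
    refine splitSum_congr fun x y h => ?_
    rw [← h, ep_append]
    congr 2
    generalize ep x = a, ep y = b, p = p'
    decide +revert
  have hF : sign k (ep l) • sign k p • (splitSum m fun s t => lamK E (wd l) (v * tl s) (wd t)) =
      splitSum l fun x y => splitSum y fun y₁ y₂ => splitSum m fun s t =>
          sign k (p + (ep y₁ + ep y₂) * p + ep y₂ * ep s) •
          ((E (wd x) v * E (wd y₁) (tl s)) ⊗ₜ[k] mu E (wd y₂) (wd t)) := by
    simp only [lamK_mul hE hv hvR (tl_mem_homog _) (tl_mem _), ← splitSum_smul]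
    rw [splitSum_comm]
    refine splitSum_congr fun x y h => Eq.trans (splitSum_congr fun s t _ => ?_)
      (splitSum_comm _ _ _)
    rw [lamK_wd E (tl_mem_homog s)]
    simp only [map_splitSum, ← splitSum_smul]
    refine splitSum_congr fun y₁ y₂ hy => ?_
    simp only [map_smul, act_tmul, smul_smul, ← sign_add, ← h, ← hy, ep_append]
    congr 2
    generalize ep x = a, ep y₁ = b, ep y₂ = c, ep s = d, p = p'
    decide +revert
  have hC : (splitSum l fun x y => act 𝒜 (tl x) (lamK E (wd y) v (wd m))) =
      splitSum l fun x y => splitSum x fun x₁ x₂ => sign k (ep x₂ + ep y * p) •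
        ((tl x₁ * E (wd x₂) v) ⊗ₜ[k] mu E (wd y) (wd m)) := by
    simp only [lamK_wd E hv, map_splitSum, map_smul, act_tmul]
    exact (splitSum_assoc l fun x₁ x₂ y => sign k (ep x₂ + ep y * p) •
        ((tl x₁ * E (wd x₂) v) ⊗ₜ[k] mu E (wd y) (wd m))).symm
  rw [hA, smul_sub, smul_add, hB, hG, hF, hC, lamK_wd E hv, map_splitSum]
  simp only [map_smul, hd, splitSum_add, splitSum_sub, hD]
  abel

end Action

/-! ### The product on words -/

section Lam

variable {k A : Type*} [CommRing k] [Ring A] [Algebra k A]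
variable {𝒜 : ℕ → Submodule k A} [GradedAlgebra 𝒜] {R : Subalgebra k A} {D : DGA 𝒜}
variable (E : Bar 𝒜 →ₗ[k] A →ₗ[k] A) {p q r : ZMod 2} {v c u : A}

theorem sgnBar_mul (x y : Bar 𝒜) : sgnBar 𝒜 (x * y) = sgnBar 𝒜 x * sgnBar 𝒜 y := by
  simp [sgnBar]

theorem sgnBar_pow_mul (n : ℕ) (x y : Bar 𝒜) :
    (sgnBar 𝒜 ^ n) (x * y) = (sgnBar 𝒜 ^ n) x * (sgnBar 𝒜 ^ n) y := by
  induction n generalizing x y with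
  | zero => simp
  | succ n ih => rw [pow_succ, Module.End.mul_apply, sgnBar_mul, ih]; rfl

/-- Letters of degree zero vanish in `BA`, so the positivity assumed in `sgnBar_letter_mul` can be
dropped. -/
theorem sgnBar_letter (hu : u ∈ homog 𝒜 q) : sgnBar 𝒜 (letter 𝒜 u) =
    sign k (q + 1) • letter 𝒜 u := by
  have key : ∀ a : A, sgnBar 𝒜 (letter 𝒜 a) = - letter 𝒜 (sgn 𝒜 a) := by
    intro a
    induction a using graded_induction (𝒜 := 𝒜) with
    | h0 => simp
    | ha a b h1 h2 => simp only [map_add, h1, h2, neg_add]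
    | hm n a ha =>
      rcases Nat.eq_zero_or_pos n with rfl | hn
      · have : letter 𝒜 a = 0 := by
          have : toPos 𝒜 a = 0 := by
            ext
            rw [coe_toPos, GradedAlgebra.proj_apply, DirectSum.decompose_of_mem 𝒜 ha,
              DirectSum.of_eq_same]
            simp
          simp [letter, this]
        rw [sgn_of_homog (mem_homog_of_mem ha), map_smul, this]
        simp
      · have h := sgnBar_letter_mul (mem_homog_of_mem ha) (mem_pos_of_mem ha hn.ne') 1
        rw [mul_one] at h
        rw [h, sgn_of_homog (mem_homog_of_mem ha), map_smul, sign_add_one]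
        simp [sgnBar]
  rw [key, sgn_of_homog hu, map_smul, sign_add_one, neg_smul]

theorem sgnBar_pow_letter (n : ℕ) (hu : u ∈ homog 𝒜 q) : (sgnBar 𝒜 ^ n) (letter 𝒜 u) =
    sign k (n * (q + 1)) • letter 𝒜 u := by
  rw [← sign_pow]
  induction n with
  | zero => simp
  | succ n ih => rw [pow_succ, Module.End.mul_apply, sgnBar_letter hu, map_smul, ih, smul_smul,
      pow_succ, mul_comm]

theorem lamG_wd (c : Bar 𝒜) (hv : v ∈ homog 𝒜 p) (y m : List (Letter 𝒜 R)) :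
    lamG E c (wd y) v (wd m) = splitSum m fun s t =>
      sign k (ep t * (ep y + p + ep s)) •
        act 𝒜 (E c (tl t)) (lamK E (wd y) v (wd s)) := by
  rw [lamG, cut_wd]
  refine splitSum_congr fun s t _ => ?_
  simp only [LinearMap.sum_apply]
  rw [Finset.sum_eq_single (ep t + 1)]
  · simp only [LinearMap.flip_apply, LinearMap.compl₁₂_apply, LinearMap.comp_apply, tau_wd,
      mem_homog.1 (tl_mem_homog t), sgnBar_pow_wd, sgn_pow_of_homog hv, map_smul,
      LinearMap.smul_apply, smul_smul, ZMod.natCast_val, ZMod.cast_id', id, ← sign_add]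
    congr 2
    generalize ep y = a, ep s = b, ep t = c, p = p'
    decide +revert
  · intro r _ hr
    simp [tau_wd, par_of_homog (tl_mem_homog t), Ne.symm hr]
  · simp

/-- The product `λ_E` on words, with the last letter of the second word written as `τ t`. -/
theorem lam_wd (hu : u ∈ homog 𝒜 q) (hv : v ∈ homog 𝒜 p) (l m : List (Letter 𝒜 R)) :
    lam E (u ⊗ₜ wd l) (v ⊗ₜ wd m) = act 𝒜 u (lamK E (wd l) v (wd m)) +
      splitSum₃ l fun x y z => splitSum m fun s t =>
        sign k (ep z * (q + 1 + ep x + ep y) + ep t * (ep y + p + ep s)) •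
          act 𝒜 (E (wd z * letter 𝒜 u * wd x) (tl t)) (lamK E (wd y) v (wd s)) := by
  have h1 : lam E (u ⊗ₜ wd l) (v ⊗ₜ wd m) = lamFirst E u (wd l) v (wd m) +
      lamSecond E u (wd l) v (wd m) := rfl
  rw [h1]
  congr 1
  simp only [lamSecond, LinearMap.comp_apply]
  rw [cut₃_wd]
  simp only [splitSum₃, LinearMap.splitSum_apply]
  refine splitSum_congr fun x w _ => splitSum_congr fun y z _ => ?_
  have h2 : lamCycAll E u (wd x) (wd y) (wd z) v (wd m) =
    (∑ p : ZMod 2, (lamGLin E).flip ((sgnBar 𝒜 ^ p.val) (wd y)) ∘ₗ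
    LinearMap.mulRight k ((sgnBar 𝒜 ^ p.val) (letter 𝒜 u * wd x)) ∘ₗ parBar 𝒜 p)
      (wd z) v (wd m) := rfl
  rw [h2]
  simp only [LinearMap.sum_apply]
  rw [Finset.sum_eq_single (ep z)]
  · simp only [LinearMap.flip_apply, LinearMap.comp_apply, parBar_wd, if_true, sgnBar_pow_wd,
      sgnBar_pow_mul, sgnBar_pow_letter _ hu, LinearMap.mulRight_apply, map_smul, smul_mul_assoc,
      mul_smul_comm, LinearMap.smul_apply, smul_smul, ZMod.natCast_val, ZMod.cast_id', id,
      ← sign_add]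
    have h3 : ∀ c : Bar 𝒜, lamGLin E c (wd y) v (wd m) = lamG E c (wd y) v (wd m) := fun c => rfl
    rw [h3, lamG_wd E _ hv, ← splitSum_smul]
    refine splitSum_congr fun s t _ => ?_
    rw [smul_smul, ← sign_add, mul_assoc]
    congr 2
    ring
  · intro r _ hr
    simp [parBar_wd, Ne.symm hr]
  · simp

end Lam

/-! ### The first sum of the product and the differential -/

section ChainMap

variable {k A : Type*} [CommRing k] [Ring A] [Algebra k A]
variable {𝒜 : ℕ → Submodule k A} [GradedAlgebra 𝒜] {R : Subalgebra k A} {D : DGA 𝒜}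

theorem act_cut (a u : A) (w : Bar 𝒜) :
    act 𝒜 a (cut 𝒜 (TensorProduct.mk k A (Bar 𝒜) ∘ₗ LinearMap.mulLeft k u ∘ₗ tau 𝒜) w) =
      cut 𝒜 (TensorProduct.mk k A (Bar 𝒜) ∘ₗ LinearMap.mulLeft k (a * u) ∘ₗ tau 𝒜) w := by
  rw [cut_apply, cut_apply]
  induction deconc 𝒜 w using TensorProduct.induction_on with
  | zero => simp
  | add x y hx hy => simp only [map_add, hx, hy]
  | tmul x y => simp [act_tmul]

/-- The terms of `hochD₁` other than `d u` act to the right of `u`, so left multiplication obeys a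
derivation rule. The cyclic term `θ²` itself multiplies from the left, which is why it is split off.
-/
theorem hochD₁_act {q : ZMod 2} {u : A} (hu : u ∈ homog 𝒜 q) (z : Hoch 𝒜) :
    hochD₁ D (act 𝒜 u z) = act 𝒜 (D.d u) z + sign k q • act 𝒜 u (hochD₁ D z) := by
  induction z using TensorProduct.induction_on with
  | zero => simp
  | add x y hx hy => simp only [map_add, hx, hy, smul_add]; abel
  | tmul x w =>
    induction x using graded_induction (𝒜 := 𝒜) with
    | h0 => simp
    | ha a b h1 h2 => simp only [TensorProduct.add_tmul, map_add, h1, h2, smul_add]; abel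
    | hm n x hx =>
      have hx := mem_homog_of_mem hx
      rw [act_tmul, hochD₁_tmul D (mul_mem_homog hu hx), hochD₁_tmul D hx, D.d_mul_homog hu,
        act_tmul, map_sub, map_add, map_smul, map_smul, act_cut, act_tmul, act_tmul]
      simp only [TensorProduct.add_tmul, smul_add, smul_sub, smul_smul, ← sign_add,
        ← TensorProduct.smul_tmul']
      abel

variable (E : Bar 𝒜 →ₗ[k] A →ₗ[k] A) (p q : ZMod 2) (u v : A) (l m : List (Letter 𝒜 R))

/-- The terms `E(aₖ₊₁,…,aₘ; bₙ) u ⋯` by which the two summands of `λ_E` fail to be chain maps. -/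
def defectLeft : Hoch 𝒜 :=
  splitSum l fun x y => splitSum m fun s t =>
    sign k ((ep y + ep t) * q + ep x * ep y + ep t * (ep x + p + ep s)) •
      act 𝒜 (E (wd y) (tl t) * u) (lamK E (wd x) v (wd s))

/-- The terms `u E(a₁,…,aᵢ; bₙ) ⋯` by which the two summands of `λ_E` fail to be chain maps. -/
def defectRight : Hoch 𝒜 :=
  splitSum l fun x y => splitSum m fun s t =>
    sign k (q + ep y * ep t + ep t * (p + ep s)) •
      act 𝒜 (u * E (wd x) (tl t)) (lamK E (wd y) v (wd s))

variable {p q u v E}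

theorem lamFirst_apply (w w' : Bar 𝒜) : lamFirst E u w v w' = act 𝒜 u (lamK E w v w') := rfl

theorem lamSecond_wd (hu : u ∈ homog 𝒜 q) (hv : v ∈ homog 𝒜 p) :
    lamSecond E u (wd l) v (wd m) =
      splitSum₃ l fun x y z => splitSum m fun s t =>
        sign k (ep z * (q + 1 + ep x + ep y) + ep t * (ep y + p + ep s)) •
          act 𝒜 (E (wd z * letter 𝒜 u * wd x) (tl t)) (lamK E (wd y) v (wd s)) := by
  have h := lam_wd E hu hv l m
  exact add_left_cancel (a := lamFirst E u (wd l) v (wd m)) h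

/-- A pure reindexing: in the word `z u x` the first letter of `x` is the neighbour of `u` on the
right, and it is also the first letter of `l`. -/
theorem lamSecond_mul_right (hu : u ∈ homog 𝒜 q) (hv : v ∈ homog 𝒜 p) :
    (splitSum l fun x y => lamSecond E (u * tl x) (wd y) v (wd m)) =
      splitSum₃ l fun x y z => splitSum m fun s t => splitSum x fun x₁ x₂ =>
        sign k (ep z * (q + ep x + ep y) + ep t * (ep y + p + ep s)) •
          act 𝒜 (E (wd z * letter 𝒜 (u * tl x₁) * wd x₂) (tl t)) (lamK E (wd y) v (wd s)) := by
  have e : ∀ x y : List (Letter 𝒜 R), lamSecond E (u * tl x) (wd y) v (wd m) = _ := fun x y =>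
    lamSecond_wd (R := R) y m (mul_mem_homog hu (tl_mem_homog x)) hv
  simp only [e, splitSum₃]
  symm
  refine Eq.trans (splitSum_congr fun x w _ => splitSum_congr fun y z _ => splitSum_comm _ _ _) ?_
  refine Eq.trans (splitSum₃_left _ _) ?_
  refine splitSum_congr fun x₁ w _ => splitSum_congr fun x₂ w _ => splitSum_congr fun y z _ =>
    splitSum_congr fun s t _ => ?_
  rw [ep_append]
  congr 2
  generalize ep x₁ = a, ep x₂ = b, ep y = c, ep z = d, ep t = e, ep s = f, q = q', p = p'
  decide +revert

/-- The mirror image of `lamSecond_mul_right`: the last letter of `z` is the neighbour of `u` on the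
left, and it is also the last letter of `l`. -/
theorem lamSecond_mul_left (hu : u ∈ homog 𝒜 q) (hv : v ∈ homog 𝒜 p) :
    (splitSum l fun x y => sign k (ep y * (q + ep x)) • lamSecond E (tl y * u) (wd x) v (wd m)) =
      splitSum₃ l fun x y z => splitSum m fun s t => splitSum z fun z₁ z₂ =>
        sign k (ep z * (q + ep x + ep y) + ep t * (ep y + p + ep s)) •
          act 𝒜 (E (wd z₁ * letter 𝒜 (tl z₂ * u) * wd x) (tl t)) (lamK E (wd y) v (wd s)) := by
  have e : ∀ x y : List (Letter 𝒜 R), lamSecond E (tl y * u) (wd x) v (wd m) = _ := fun x y =>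
    lamSecond_wd (R := R) x m (mul_mem_homog (tl_mem_homog y) hu) hv
  simp only [e, splitSum₃, ← splitSum_smul]
  symm
  refine Eq.trans (splitSum_congr fun x w _ => splitSum_congr fun y z _ => splitSum_comm _ _ _) ?_
  refine Eq.trans (splitSum₃_right _ _) ?_
  refine splitSum_congr fun l₁ z₂ h => splitSum_congr fun x w h' => splitSum_congr fun y z₁ h'' =>
    splitSum_congr fun s t _ => ?_
  rw [smul_smul, ← sign_add, ← h', ← h'', ep_append, ep_append, ep_append]
  congr 2
  generalize ep x = a, ep y = b, ep z₁ = c, ep z₂ = d, ep t = e, ep s = f, q = q', p = p'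
  decide +revert

variable (hE : ActsOn D E R)
include hE

/-- The Leibniz rule fails in two ways. The cyclic term `θ²` moves letters `E(y; bₙ)` in front of
`u`, which gives `defectLeft`. Conversely, the expected terms with `bₙ v` expand by the product rule
to `u E(x; bₙ) ⋯`, which the differential does not produce; they give `defectRight`. -/
theorem hochD_lamFirst (hu : u ∈ homog 𝒜 q) (hv : v ∈ homog 𝒜 p) (hvR : v ∈ R) :
    hochD D (lamFirst E u (wd l) v (wd m)) =
      lamFirst E (D.d u) (wd l) v (wd m) +
      sign k q • bdry D hE.d_mem (fun l => lamFirst E u (wd l) v (wd m)) l -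
      sign k q • (splitSum l fun x y => lamFirst E (u * tl x) (wd y) v (wd m)) +
      (splitSum l fun x y => sign k (ep y * (q + ep x)) • lamFirst E (tl y * u) (wd x) v (wd m)) +
      sign k (q + ep l) • (lamFirst E u (wd l) (D.d v) (wd m) +
        sign k p • bdry D hE.d_mem (fun m => lamFirst E u (wd l) v (wd m)) m -
        sign k p • (splitSum m fun s t => lamFirst E u (wd l) (v * tl s) (wd t)) +
        splitSum m fun s t =>
          sign k (ep t * (p + ep s)) • lamFirst E u (wd l) (tl t * v) (wd s)) +
      defectLeft E p q u v l m - defectRight E p q u v l m := by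
  have h1 : hochTheta₂ (act 𝒜 u (lamK E (wd l) v (wd m))) = defectLeft E p q u v l m +
      splitSum l fun x y =>
        sign k (ep y * (q + ep x)) • act 𝒜 (tl y * u) (lamK E (wd x) v (wd m)) := by
    rw [hochTheta₂_act_lamK hE hu hv hvR, defectLeft, ← splitSum_add]
    refine splitSum_congr fun x y _ => ?_
    have e := splitSum_ite_right m fun s t =>
      sign k ((ep y + ep t) * q + ep x * ep y + ep t * (ep x + p + ep s)) •
        act 𝒜 (tl y * u) (lamK E (wd x) v (wd s))
    simp only [ep_nil, add_zero, zero_mul] at e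
    rw [show ep y * (q + ep x) = ep y * q + ep x * ep y by ring, ← e, ← splitSum_add]
    refine splitSum_congr fun s t _ => ?_
    rw [tau_mu hE, add_mul (E (wd y) (tl t)), map_add, LinearMap.add_apply, smul_add]
    split_ifs <;> simp
  have h2 : defectRight E p q u v l m = sign k (q + ep l) • splitSum m fun s t =>
      sign k (ep t * (p + ep s)) • act 𝒜 u (lamK E (wd l) (tl t * v) (wd s)) := by
    simp only [lamK_mul hE (tl_mem_homog _) (tl_mem _) hv hvR, map_splitSum, ← splitSum_smul]
    rw [splitSum_comm, defectRight]
    refine splitSum_congr fun x y h => splitSum_congr fun s t _ => ?_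
    simp only [← h, map_smul, act_act, smul_smul, ← sign_add, ep_append]
    congr 2
    generalize ep x = a, ep y = b, ep s = c, ep t = d, p = p', q = q'
    decide +revert
  simp only [lamFirst_apply]
  rw [h2, hochD_eq, hochD₁_act hu, h1, hochD₁_lamK hE hv hvR]
  simp only [map_add, map_sub, map_smul, map_splitSum, map_bdry, act_act, smul_add, smul_sub,
    sign_add, smul_smul, mul_assoc]
  abel

end ChainMap

/-! ### Sums over cyclic cuts -/

section CyclicSum

variable {α M : Type*}

/-- The sum over `l = x ++ y ++ z` and `m = s ++ t` that occurs in the second half of `λ_E`. -/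
def cycSum [AddCommMonoid M] (l m : List α)
    (F : List α → List α → List α → List α → List α → M) : M :=
  splitSum₃ l fun x y z => splitSum m fun s t => F x y z s t

theorem cycSum_congr [AddCommMonoid M] {l m : List α}
    {F G : List α → List α → List α → List α → List α → M}
    (h : ∀ x y z s t, x ++ (y ++ z) = l → s ++ t = m → F x y z s t = G x y z s t) :
    cycSum l m F = cycSum l m G :=
  splitSum_congr fun x _ h1 => splitSum_congr fun y z h2 => splitSum_congr fun s t h3 =>
    h x y z s t (by rw [h2, h1]) h3

theorem cycSum_add [AddCommMonoid M] (l m : List α)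
    (F G : List α → List α → List α → List α → List α → M) :
    (cycSum l m fun x y z s t => F x y z s t + G x y z s t) = cycSum l m F + cycSum l m G := by
  simp only [cycSum, splitSum₃, splitSum_add]

theorem cycSum_sub [AddCommGroup M] (l m : List α)
    (F G : List α → List α → List α → List α → List α → M) :
    (cycSum l m fun x y z s t => F x y z s t - G x y z s t) = cycSum l m F - cycSum l m G := by
  simp only [cycSum, splitSum₃, splitSum_sub]

theorem cycSum_neg [AddCommGroup M] (l m : List α)
    (F : List α → List α → List α → List α → List α → M) :
    (cycSum l m fun x y z s t => - F x y z s t) = - cycSum l m F := by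
  simp only [cycSum, splitSum₃, splitSum_neg]

theorem cycSum_smul {k : Type*} [Semiring k] [AddCommMonoid M] [Module k M] (c : k) (l m : List α)
    (F : List α → List α → List α → List α → List α → M) :
    (cycSum l m fun x y z s t => c • F x y z s t) = c • cycSum l m F := by
  simp only [cycSum, splitSum₃, splitSum_smul]

end CyclicSum

/-! ### The bar differential of a word with a marked letter -/

section ChainMap

variable {k A : Type*} [CommRing k] [Ring A] [Algebra k A]
variable {𝒜 : ℕ → Submodule k A} [GradedAlgebra 𝒜] {R : Subalgebra k A} {D : DGA 𝒜}

/-- A piece that contains `c` has nonzero twisting cochain only if it is `[c]`, which forces the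
cuts on both sides. -/
theorem splitSum_tl_append_cons {M : Type*} [AddCommMonoid M] [Module k M] (z x : List (Letter 𝒜 R))
    (c : Letter 𝒜 R) (F : List (Letter 𝒜 R) → List (Letter 𝒜 R) → A → M)
    (hF : ∀ x y, F x y 0 = 0) :
    (splitSum x fun x₁ x₂ => F x₁ x₂ (tl (z ++ c :: x₁))) =
      if z = [] then F [] x c.val else 0 := by
  rw [splitSum_eq_right]
  · split_ifs with h
    · subst h; rfl
    · rw [tl_append_cons_of_ne (Or.inl h), hF]
  · intro x₁ x₂ _ h
    rw [tl_append_cons_of_ne (Or.inr h), hF]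

theorem splitSum_tl_append_cons' {M : Type*} [AddCommMonoid M] [Module k M]
    (z x : List (Letter 𝒜 R))
    (c : Letter 𝒜 R) (F : List (Letter 𝒜 R) → List (Letter 𝒜 R) → A → M)
    (hF : ∀ x y, F x y 0 = 0) :
    (splitSum z fun z₁ z₂ => F z₁ z₂ (tl (z₂ ++ c :: x))) =
      if x = [] then F z [] c.val else 0 := by
  rw [splitSum_eq_left]
  · split_ifs with h
    · subst h; rfl
    · rw [tl_append_cons_of_ne (Or.inr h), hF]
  · intro x₁ x₂ _ h
    rw [tl_append_cons_of_ne (Or.inl h), hF]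

/-- The part of the bar differential of `z ++ c :: x` that involves the letter `c`. -/
theorem splitSum_delta (hR : ∀ a ∈ R, D.d a ∈ R) {M : Type*} [AddCommGroup M] [Module k M]
    (c : Letter 𝒜 R) (z x : List (Letter 𝒜 R)) (g : Bar 𝒜 →ₗ[k] M) :
    (splitSum z fun z₁ z₂ => splitSum x fun x₁ x₂ =>
      sign k (ep z₁) • g (wd (z₁ ++ delta D hR (z₂ ++ c :: x₁) :: x₂))) =
      - sign k (ep z) • g (wd z * letter 𝒜 (D.d c.val) * wd x) -
      sign k (ep z) • (splitSum z fun z₁ z₂ => g (wd z₁ * letter 𝒜 (tl z₂ * c.val) * wd x)) +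
      sign k (ep z + c.par) • splitSum x fun x₁ x₂ =>
        g (wd z * letter 𝒜 (c.val * tl x₁) * wd x₂) := by
  have h1 : ∀ z₁ z₂ x₁ x₂ : List (Letter 𝒜 R), sign k (ep z₁) • g (wd (z₁ ++ delta D hR (z₂ ++ c :: x₁) :: x₂)) =
      - sign k (ep z₁) • g (wd z₁ * letter 𝒜 (D.d (tl (z₂ ++ c :: x₁))) * wd x₂) -
      (splitSum z₂ fun a b => sign k (ep z₁ + ep a) •
        g (wd z₁ * letter 𝒜 (tl a * tl (b ++ c :: x₁)) * wd x₂)) -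
      splitSum x₁ fun a b => sign k (ep z₁ + ep (z₂ ++ c :: a)) •
        g (wd z₁ * letter 𝒜 (tl (z₂ ++ c :: a) * tl b) * wd x₂) := by
    intro z₁ z₂ x₁ x₂
    rw [wd_append, wd_cons, delta_val, splitSum_append_cons]
    simp only [map_sub, map_neg, map_add, map_splitSum, map_smul, mul_sub, sub_mul, mul_add,
      add_mul, neg_mul, mul_neg, smul_sub, smul_add, smul_neg, ← mul_assoc, mul_splitSum,
      splitSum_mul, mul_smul_comm, smul_mul_assoc, ← splitSum_smul, smul_smul, ← sign_add, neg_smul]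
    abel
  have e₁ : (splitSum z fun z₁ z₂ => splitSum x fun x₁ x₂ =>
      - sign k (ep z₁) • g (wd z₁ * letter 𝒜 (D.d (tl (z₂ ++ c :: x₁))) * wd x₂)) =
      - sign k (ep z) • g (wd z * letter 𝒜 (D.d c.val) * wd x) :=
    (splitSum_congr fun z₁ z₂ _ => splitSum_tl_append_cons (k := k) z₂ x c (fun _ x₂ a =>
      - sign k (ep z₁) • g (wd z₁ * letter 𝒜 (D.d a) * wd x₂)) (by simp)).trans
      (splitSum_ite_right z _)
  have e₂ : (splitSum z fun z₁ z₂ => splitSum x fun x₁ x₂ =>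
      splitSum z₂ fun a b => sign k (ep z₁ + ep a) •
        g (wd z₁ * letter 𝒜 (tl a * tl (b ++ c :: x₁)) * wd x₂)) =
      sign k (ep z) • splitSum z fun z₁ z₂ =>
        g (wd z₁ * letter 𝒜 (tl z₂ * c.val) * wd x) := by
    rw [← splitSum_smul]
    refine splitSum_congr fun z₁ z₂ h => ?_
    rw [splitSum_comm]
    refine (splitSum_congr fun a b _ => splitSum_tl_append_cons (k := k) b x c (fun _ x₂ u =>
      sign k (ep z₁ + ep a) • g (wd z₁ * letter 𝒜 (tl a * u) * wd x₂)) (by simp)).trans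
      ((splitSum_ite_right z₂ _).trans ?_)
    rw [← h, ep_append]
  have e₃ : (splitSum z fun z₁ z₂ => splitSum x fun x₁ x₂ =>
      splitSum x₁ fun a b => sign k (ep z₁ + ep (z₂ ++ c :: a)) •
        g (wd z₁ * letter 𝒜 (tl (z₂ ++ c :: a) * tl b) * wd x₂)) =
      sign k (ep z + c.par + 1) • splitSum x fun x₁ x₂ =>
        g (wd z * letter 𝒜 (c.val * tl x₁) * wd x₂) := by
    refine (splitSum_congr fun z₁ z₂ _ => (splitSum_assoc _ _).trans
      (splitSum_tl_append_cons (k := k) z₂ x c (fun a w u => splitSum w fun b x₂ =>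
        sign k (ep z₁ + ep (z₂ ++ c :: a)) •
        g (wd z₁ * letter 𝒜 (u * tl b) * wd x₂)) (by simp [splitSum_zero]))).trans
      ((splitSum_ite_right z _).trans ?_)
    rw [← splitSum_smul]
    simp [add_assoc]
  simp only [h1, splitSum_sub, e₁, e₂, e₃]
  rw [sign_add_one]
  simp only [neg_smul, sub_neg_eq_add]

/-- The piece replaced by its component `δ` lies before `c`, contains `c`, or lies after `c`. -/
theorem map_barD_wd_append_cons (hR : ∀ a ∈ R, D.d a ∈ R) {M : Type*} [AddCommGroup M] [Module k M]
    (c : Letter 𝒜 R) (z x : List (Letter 𝒜 R)) (g : Bar 𝒜 →ₗ[k] M) :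
    g (barD D (wd (z ++ c :: x))) = bdry D hR (fun z => g (wd (z ++ c :: x))) z +
      (- sign k (ep z) • g (wd z * letter 𝒜 (D.d c.val) * wd x) -
      sign k (ep z) • (splitSum z fun z₁ z₂ => g (wd z₁ * letter 𝒜 (tl z₂ * c.val) * wd x)) +
      sign k (ep z + c.par) • splitSum x fun x₁ x₂ =>
        g (wd z * letter 𝒜 (c.val * tl x₁) * wd x₂)) -
      sign k (ep z + c.par) • bdry D hR (fun x => g (wd (z ++ c :: x))) x := by
  rw [map_barD_wd D hR, ← splitSum_delta hR]
  simp only [bdry, splitSum₃, splitSum_append_cons, splitSum_add]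
  rw [sub_eq_add_neg]
  congr 1
  · simp
  · rw [← splitSum_smul, ← splitSum_neg]
    refine splitSum_congr fun a b _ => ?_
    rw [← splitSum_smul, ← splitSum_neg]
    refine splitSum_congr fun b d _ => ?_
    rw [smul_smul, ← sign_add, ← neg_smul, ← sign_add_one, ep_append, ep_cons]
    congr 2
    · ring
    · simp

end ChainMap

/-! ### The differential of a single cyclic term -/

section ChainMap

variable {k A : Type*} [CommRing k] [Ring A] [Algebra k A]
variable {𝒜 : ℕ → Submodule k A} [GradedAlgebra 𝒜] {R : Subalgebra k A} {D : DGA 𝒜}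
variable {E : Bar 𝒜 →ₗ[k] A →ₗ[k] A} {p : ZMod 2} {v : A} (hE : ActsOn D E R)
include hE

/-- The differential of `E(aₖ₊₁,…,aₘ,c,a₁,…,aᵢ; b)`, where `b` is the letter of `t` (if any). -/
theorem d_E_append_cons (c : Letter 𝒜 R) (x z t : List (Letter 𝒜 R)) :
    D.d (E (wd (z ++ c :: x)) (tl t)) =
      - bdry D hE.d_mem (fun z => E (wd (z ++ c :: x)) (tl t)) z +
      sign k (ep z) • E (wd z * letter 𝒜 (D.d c.val) * wd x) (tl t) +
      sign k (ep z) • (splitSum z fun z₁ z₂ =>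
        E (wd z₁ * letter 𝒜 (tl z₂ * c.val) * wd x) (tl t)) -
      sign k (ep z + c.par) • (splitSum x fun x₁ x₂ =>
        E (wd z * letter 𝒜 (c.val * tl x₁) * wd x₂) (tl t)) +
      sign k (ep z + c.par) • bdry D hE.d_mem (fun x => E (wd (z ++ c :: x)) (tl t)) x +
      sign k (ep z + (c.par + 1 + ep x)) • E (wd (z ++ c :: x)) (D.d (tl t)) -
      (splitSum z fun z₁ z₂ => sign k (ep z₁) • (tl z₁ * E (wd (z₂ ++ c :: x)) (tl t))) +
      (if z = [] then sign k c.par • (c.val * E (wd x) (tl t)) else 0) +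
      (if x = [] then sign k (ep t + 1 + ep z + ep t * (c.par + 1)) • (E (wd z) (tl t) * c.val)
        else 0) +
      splitSum x fun x₁ x₂ => sign k (ep t + 1 + (ep z + (c.par + 1 + ep x₁)) + ep t * ep x₂) •
        (E (wd (z ++ c :: x₁)) (tl t) * tl x₂) := by
  have h := map_barD_wd_append_cons hE.d_mem c z x (E.flip (tl t))
  simp only [LinearMap.flip_apply] at h
  rw [hE.d_E _ _ _ (tl_mem t) (tl_mem_homog t), h, splitSum_append_cons, splitSum_append_cons,
    splitSum_tl_append_cons (k := k) z x c (fun x₁ x₂ u => sign k (ep (z ++ c :: x₁)) •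
      (u * E (wd x₂) (tl t))) (by simp),
    splitSum_tl_append_cons' (k := k) z x c (fun z₁ z₂ u =>
      sign k (ep t + 1 + ep z₁ + (ep t + 1 + 1) * ep (z₂ ++ c :: x)) •
      (E (wd z₁) (tl t) * u)) (by simp)]
  have two : ep t + 1 + 1 = ep t := by rw [add_assoc]; exact add_zero _
  have e : (if z = [] then sign k (ep (z ++ [c])) • (c.val * E (wd x) (tl t)) else 0) =
      - if z = [] then sign k c.par • (c.val * E (wd x) (tl t)) else 0 := by
    split_ifs with hz
    · subst hz; simp [sign_add_one]
    · simp
  have e' : (if x = [] then sign k (ep t + 1 + ep z + (ep t + 1 + 1) * ep ([] ++ c :: x)) •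
      (E (wd z) (tl t) * c.val) else 0) = if x = [] then
      sign k (ep t + 1 + ep z + ep t * (c.par + 1)) • (E (wd z) (tl t) * c.val) else 0 := by
    split_ifs with hz
    · subst hz; simp [two]
    · rfl
  rw [e', e]
  simp only [two, ep_append, ep_cons, neg_smul]
  abel

/-- The argument of `hochD` is a summand of the second sum of `λ_E` without its sign. Its
differential combines that of `E(z, c, x; t)` with that of `K` and the cyclic term; the
cancellations in the second sum are between the terms listed here. -/
theorem hochD_act_lamK_append_cons (hv : v ∈ homog 𝒜 p) (hvR : v ∈ R)
    (c : Letter 𝒜 R) (x y z s t : List (Letter 𝒜 R)) :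
    hochD D (act 𝒜 (E (wd (z ++ c :: x)) (tl t)) (lamK E (wd y) v (wd s))) =
      - bdry D hE.d_mem (fun z =>
        act 𝒜 (E (wd (z ++ c :: x)) (tl t)) (lamK E (wd y) v (wd s))) z +
      sign k (ep z) • act 𝒜 (E (wd z * letter 𝒜 (D.d c.val) * wd x) (tl t))
        (lamK E (wd y) v (wd s)) +
      sign k (ep z) • (splitSum z fun z₁ z₂ => act 𝒜
        (E (wd z₁ * letter 𝒜 (tl z₂ * c.val) * wd x) (tl t)) (lamK E (wd y) v (wd s))) -
      sign k (ep z + c.par) • (splitSum x fun x₁ x₂ => act 𝒜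
        (E (wd z * letter 𝒜 (c.val * tl x₁) * wd x₂) (tl t)) (lamK E (wd y) v (wd s))) +
      sign k (ep z + c.par) • bdry D hE.d_mem (fun x => act 𝒜
        (E (wd (z ++ c :: x)) (tl t)) (lamK E (wd y) v (wd s))) x +
      sign k (ep z + (c.par + 1 + ep x)) • act 𝒜 (E (wd (z ++ c :: x)) (D.d (tl t)))
        (lamK E (wd y) v (wd s)) -
      (splitSum z fun z₁ z₂ => sign k (ep z₁) • act 𝒜 (tl z₁ * E (wd (z₂ ++ c :: x)) (tl t))
        (lamK E (wd y) v (wd s))) +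
      (if z = [] then sign k c.par • act 𝒜 (c.val * E (wd x) (tl t))
        (lamK E (wd y) v (wd s)) else 0) +
      (if x = [] then sign k (ep t + 1 + ep z + ep t * (c.par + 1)) •
        act 𝒜 (E (wd z) (tl t) * c.val) (lamK E (wd y) v (wd s)) else 0) +
      (splitSum x fun x₁ x₂ => sign k (ep t + 1 + (ep z + (c.par + 1 + ep x₁)) + ep t * ep x₂) •
        act 𝒜 (E (wd (z ++ c :: x₁)) (tl t) * tl x₂) (lamK E (wd y) v (wd s))) +
      sign k (ep z + c.par + ep x + ep t) • bdry D hE.d_mem (fun y =>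
        act 𝒜 (E (wd (z ++ c :: x)) (tl t)) (lamK E (wd y) v (wd s))) y +
      sign k (ep z + c.par + ep x + ep t + ep y) •
        act 𝒜 (E (wd (z ++ c :: x)) (tl t)) (lamK E (wd y) (D.d v) (wd s)) +
      sign k (ep z + c.par + ep x + ep t + ep y + p) • bdry D hE.d_mem (fun s =>
        act 𝒜 (E (wd (z ++ c :: x)) (tl t)) (lamK E (wd y) v (wd s))) s -
      sign k (ep z + c.par + ep x + ep t + ep y + p) • (splitSum s fun s₁ s₂ =>
        act 𝒜 (E (wd (z ++ c :: x)) (tl t)) (lamK E (wd y) (v * tl s₁) (wd s₂))) -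
      sign k (ep z + c.par + ep x + ep t) • (splitSum y fun y₁ y₂ =>
        act 𝒜 (E (wd (z ++ c :: x)) (tl t) * tl y₁) (lamK E (wd y₂) v (wd s))) +
      (splitSum y fun y₁ y₂ => splitSum s fun s₁ s₂ =>
        sign k ((ep y₂ + ep s₂) * (ep z + c.par + ep x + ep t) + ep y₁ * ep y₂ +
          ep s₂ * (ep y₁ + p + ep s₁)) •
        act 𝒜 (E (wd y₂) (tl s₂) * E (wd (z ++ c :: x)) (tl t)) (lamK E (wd y₁) v (wd s₁))) +
      splitSum y fun y₁ y₂ => sign k (ep y₂ * (ep z + c.par + ep x + ep t) + ep y₁ * ep y₂) •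
        act 𝒜 (tl y₂ * E (wd (z ++ c :: x)) (tl t)) (lamK E (wd y₁) v (wd s)) := by
  have hq : E (wd (z ++ c :: x)) (tl t) ∈ homog 𝒜 (ep z + c.par + ep x + ep t) := by
    have h := hE.E_homog (z ++ c :: x) _ _ (tl_mem t) (tl_mem_homog t)
    rw [ep_append, ep_cons] at h
    convert h using 2
    generalize ep z = a, ep x = b, ep t = d, c.par = e
    decide +revert
  have h₂ : hochTheta₂ (act 𝒜 (E (wd (z ++ c :: x)) (tl t)) (lamK E (wd y) v (wd s))) =
      (splitSum y fun y₁ y₂ => splitSum s fun s₁ s₂ =>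
        sign k ((ep y₂ + ep s₂) * (ep z + c.par + ep x + ep t) + ep y₁ * ep y₂ +
          ep s₂ * (ep y₁ + p + ep s₁)) •
        act 𝒜 (E (wd y₂) (tl s₂) * E (wd (z ++ c :: x)) (tl t)) (lamK E (wd y₁) v (wd s₁))) +
      splitSum y fun y₁ y₂ => sign k (ep y₂ * (ep z + c.par + ep x + ep t) + ep y₁ * ep y₂) •
        act 𝒜 (tl y₂ * E (wd (z ++ c :: x)) (tl t)) (lamK E (wd y₁) v (wd s)) := by
    rw [hochTheta₂_act_lamK hE hq hv hvR, ← splitSum_add]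
    refine splitSum_congr fun y₁ y₂ _ => ?_
    have e := splitSum_ite_right s fun s₁ s₂ =>
      sign k ((ep y₂ + ep s₂) * (ep z + c.par + ep x + ep t) + ep y₁ * ep y₂ +
          ep s₂ * (ep y₁ + p + ep s₁)) •
        act 𝒜 (tl y₂ * E (wd (z ++ c :: x)) (tl t)) (lamK E (wd y₁) v (wd s₁))
    simp only [ep_nil, add_zero, zero_mul] at e
    rw [← e, ← splitSum_add]
    refine splitSum_congr fun s₁ s₂ _ => ?_
    rw [tau_mu hE, add_mul (E (wd y₂) (tl s₂)), map_add, LinearMap.add_apply, smul_add]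
    split_ifs <;> simp
  have hb := fun F l => map_bdry D hE.d_mem ((act 𝒜).flip (lamK E (wd y) v (wd s))) F l (R := R)
  have hb' := fun F l => map_bdry D hE.d_mem (act 𝒜 (E (wd (z ++ c :: x)) (tl t))) F l (R := R)
  have hi : ∀ (P : Prop) [Decidable P] (a : A) (z : Hoch 𝒜), act 𝒜 (if P then a else 0) z =
    if P then act 𝒜 a z else 0 := fun P _ a z => by split_ifs <;> simp
  simp only [LinearMap.flip_apply] at hb
  rw [hochD_eq, hochD₁_act hq, hochD₁_lamK hE hv hvR, h₂, d_E_append_cons hE]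
  simp only [map_add, map_sub, map_neg, map_smul, map_splitSum, hb', act_act, smul_add, smul_sub,
    LinearMap.add_apply, LinearMap.sub_apply, LinearMap.neg_apply, LinearMap.smul_apply, hb, hi,
    LinearMap.splitSum_apply, smul_smul, ← sign_add, ← add_assoc]
  abel

end ChainMap

/-! ### The bar differential on the cyclic sum -/

section ChainMap

variable {k A : Type*} [CommRing k] [Ring A] [Algebra k A]
variable {𝒜 : ℕ → Submodule k A} [GradedAlgebra 𝒜] {R : Subalgebra k A} {D : DGA 𝒜}

theorem map_cycSum {α M N : Type*} [AddCommMonoid M] [AddCommMonoid N] {G : Type*} [FunLike G M N]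
    [AddMonoidHomClass G M N] (g : G) (l m : List α)
    (F : List α → List α → List α → List α → List α → M) :
    g (cycSum l m F) = cycSum l m fun x y z s t => g (F x y z s t) := by
  simp only [cycSum, splitSum₃, map_splitSum]

/-- The parity of the sign in the second half of `λ_E`. -/
def cycSign (q p : ZMod 2) (x y z s t : List (Letter 𝒜 R)) : ZMod 2 :=
  ep z * (q + 1 + ep x + ep y) + ep t * (ep y + p + ep s)

variable {E : Bar 𝒜 →ₗ[k] A →ₗ[k] A} {p q : ZMod 2} {v : A} (c : Letter 𝒜 R)
  (l m : List (Letter 𝒜 R))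

theorem lamSecond_letter (hv : v ∈ homog 𝒜 p) :
    lamSecond E c.val (wd l) v (wd m) = cycSum l m fun x y z s t =>
      sign k (cycSign c.par p x y z s t) •
        act 𝒜 (E (wd (z ++ c :: x)) (tl t)) (lamK E (wd y) v (wd s)) := by
  rw [lamSecond_wd l m c.mem_homog hv]
  refine cycSum_congr fun x y z s t _ _ => ?_
  rw [cycSign, wd_append, wd_cons, mul_assoc]

theorem bdry_zero (hR : ∀ a ∈ R, D.d a ∈ R) {M : Type*} [AddCommGroup M] [Module k M] :
    bdry D hR (fun _ => (0 : M)) l = 0 := by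
  simp [bdry, splitSum₃, splitSum_zero]

theorem bdry_comm_splitSum (hR : ∀ a ∈ R, D.d a ∈ R) {M : Type*} [AddCommGroup M] [Module k M]
    (F : List (Letter 𝒜 R) → List (Letter 𝒜 R) → List (Letter 𝒜 R) → M) :
    bdry D hR (fun l => splitSum m fun s t => F l s t) l =
      splitSum m fun s t => bdry D hR (fun l => F l s t) l := by
  simp only [bdry, splitSum₃, ← splitSum_smul]
  refine Eq.trans (splitSum_congr fun x w _ => splitSum_comm _ _ _) ?_
  rw [splitSum_comm]

theorem bdry_cycSum_left (hR : ∀ a ∈ R, D.d a ∈ R) {M : Type*} [AddCommGroup M] [Module k M]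
    (F : List (Letter 𝒜 R) → List (Letter 𝒜 R) → List (Letter 𝒜 R) → List (Letter 𝒜 R) →
      List (Letter 𝒜 R) → M) :
    bdry D hR (fun l => cycSum l m F) l = cycSum l m fun x y z s t =>
      bdry D hR (fun x => F x y z s t) x + sign k (ep x) • bdry D hR (fun y => F x y z s t) y +
        sign k (ep x + ep y) • bdry D hR (fun z => F x y z s t) z := by
  simp only [cycSum, splitSum₃]
  rw [bdry_splitSum]
  refine splitSum_congr fun x w _ => ?_
  rw [bdry_comm_splitSum, bdry_splitSum, ← splitSum_smul, ← splitSum_add]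
  refine splitSum_congr fun y z _ => ?_
  rw [bdry_comm_splitSum, bdry_comm_splitSum, bdry_comm_splitSum]
  simp only [smul_add, splitSum_add, splitSum_smul, smul_smul, sign_add, add_assoc]

theorem bdry_cycSum_right (hR : ∀ a ∈ R, D.d a ∈ R) {M : Type*} [AddCommGroup M] [Module k M]
    (F : List (Letter 𝒜 R) → List (Letter 𝒜 R) → List (Letter 𝒜 R) → List (Letter 𝒜 R) →
      List (Letter 𝒜 R) → M) :
    bdry D hR (fun m => cycSum l m F) m = cycSum l m fun x y z s t =>
      bdry D hR (fun s => F x y z s t) s + sign k (ep s) • bdry D hR (fun t => F x y z s t) t := by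
  simp only [cycSum, splitSum₃]
  rw [bdry_comm_splitSum]
  refine splitSum_congr fun x w _ => ?_
  rw [bdry_comm_splitSum]
  refine splitSum_congr fun y z _ => ?_
  rw [bdry_splitSum]

variable (hE : ActsOn D E R)
include hE

/-- The bar differential acts as a coderivation on the three pieces `x`, `y`, `z`. The dependence of
the cyclic sign on the varying piece is frozen by `bdry_congr`. -/
theorem bdry_lamSecond_left (hv : v ∈ homog 𝒜 p) :
    sign k c.par • bdry D hE.d_mem (fun l => lamSecond E c.val (wd l) v (wd m)) l =
      (cycSum l m fun x y z s t => sign k (cycSign c.par p x y z s t) • sign k (ep z + c.par) •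
        bdry D hE.d_mem (fun x =>
          act 𝒜 (E (wd (z ++ c :: x)) (tl t)) (lamK E (wd y) v (wd s))) x) +
      (cycSum l m fun x y z s t => sign k (cycSign c.par p x y z s t) •
        sign k (ep z + c.par + ep x + ep t) • bdry D hE.d_mem (fun y =>
          act 𝒜 (E (wd (z ++ c :: x)) (tl t)) (lamK E (wd y) v (wd s))) y) -
      (cycSum l m fun x y z s t => sign k (cycSign c.par p x y z s t) •
        bdry D hE.d_mem (fun z =>
          act 𝒜 (E (wd (z ++ c :: x)) (tl t)) (lamK E (wd y) v (wd s))) z) := by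
  simp only [lamSecond_letter c _ _ hv]
  rw [bdry_cycSum_left, ← cycSum_smul, ← cycSum_add, ← cycSum_sub]
  refine cycSum_congr fun x y z s t _ _ => ?_
  rw [bdry_congr D hE.d_mem (l := x) (G := fun x' => sign k (cycSign c.par p x y z s t + ep z) •
      act 𝒜 (E (wd (z ++ c :: x')) (tl t)) (lamK E (wd y) v (wd s))) (fun x' hx => by
        simp only [cycSign, hx]; congr 2; ring),
    bdry_congr D hE.d_mem (l := y) (G := fun y' =>
      sign k (cycSign c.par p x y z s t + ep z + ep t) •
      act 𝒜 (E (wd (z ++ c :: x)) (tl t)) (lamK E (wd y') v (wd s))) (fun x' hx => by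
        simp only [cycSign, hx]; congr 2; ring),
    bdry_congr D hE.d_mem (l := z) (G := fun z' =>
      sign k (cycSign c.par p x y z s t + (c.par + 1 + ep x + ep y)) •
      act 𝒜 (E (wd (z' ++ c :: x)) (tl t)) (lamK E (wd y) v (wd s))) (fun x' hx => by
        simp only [cycSign, hx]; congr 2; ring), bdry_smul, bdry_smul, bdry_smul]
  simp only [smul_add, smul_smul, ← sign_add]
  rw [sub_eq_add_neg, ← neg_smul, ← sign_add_one]
  generalize cycSign c.par p x y z s t = a
  congr 3
  · congr 1; ring
  · congr 1; generalize ep x = x', ep z = z', ep t = t', c.par = q; decide +revert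
  · generalize ep x = x', ep y = y', c.par = q; decide +revert

/-- On the piece `t` the bar differential differentiates one letter or multiplies two. The product
is expanded by the product rule for `E`, and the last two sums are distinguished by whether `c` goes
to the right or to the left factor. -/
theorem bdry_lamSecond_right (hv : v ∈ homog 𝒜 p) :
    sign k (c.par + ep l + p) • bdry D hE.d_mem (fun m => lamSecond E c.val (wd l) v (wd m)) m =
      (cycSum l m fun x y z s t => sign k (cycSign c.par p x y z s t) •
        sign k (ep z + c.par + ep x + ep t + ep y + p) • bdry D hE.d_mem (fun s =>
          act 𝒜 (E (wd (z ++ c :: x)) (tl t)) (lamK E (wd y) v (wd s))) s) +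
      (cycSum l m fun x y z s t => sign k (cycSign c.par p x y z s t) •
        sign k (ep z + (c.par + 1 + ep x)) • act 𝒜 (E (wd (z ++ c :: x)) (D.d (tl t)))
          (lamK E (wd y) v (wd s))) -
      (cycSum l m fun x y z s t => splitSum z fun z₁ z₂ => splitSum t fun t₁ t₂ =>
        sign k (cycSign c.par p x y z s t + (ep z + c.par + ep x) +
          (ep t₁ + (ep t₁ + 1) * (ep z₂ + (c.par + 1 + ep x)))) •
        act 𝒜 (E (wd z₁) (tl t₁) * E (wd (z₂ ++ c :: x)) (tl t₂)) (lamK E (wd y) v (wd s))) -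
      (cycSum l m fun x y z s t => splitSum x fun x₁ x₂ => splitSum t fun t₁ t₂ =>
        sign k (cycSign c.par p x y z s t + (ep z + c.par + ep x) +
          (ep t₁ + (ep t₁ + 1) * ep x₂)) •
        act 𝒜 (E (wd (z ++ c :: x₁)) (tl t₁) * E (wd x₂) (tl t₂)) (lamK E (wd y) v (wd s))) := by
  simp only [lamSecond_letter c _ _ hv]
  rw [bdry_cycSum_right, ← cycSum_smul, ← cycSum_add, ← cycSum_sub, ← cycSum_sub]
  refine cycSum_congr fun x y z s t h _ => ?_
  rw [bdry_congr D hE.d_mem (l := s) (G := fun s' => sign k (cycSign c.par p x y z s t + ep t) •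
      act 𝒜 (E (wd (z ++ c :: x)) (tl t)) (lamK E (wd y) v (wd s'))) (fun x' hx => by
        simp only [cycSign, hx]; congr 2; ring),
    bdry_congr D hE.d_mem (l := t) (G := fun t' =>
      sign k (cycSign c.par p x y z s t + (ep y + p + ep s)) •
      act 𝒜 (E (wd (z ++ c :: x)) (tl t')) (lamK E (wd y) v (wd s))) (fun x' hx => by
        simp only [cycSign, hx]; congr 2; ring), bdry_smul, bdry_smul]
  have e := map_bdry D hE.d_mem ((act 𝒜).flip (lamK E (wd y) v (wd s)) ∘ₗ
    E (wd (z ++ c :: x))) tl t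
  simp only [LinearMap.comp_apply, LinearMap.flip_apply] at e
  rw [← e, bdry_tl, E_barDelta hE, splitSum_append_cons]
  simp only [map_add, map_sub, map_neg, map_smul, map_splitSum, smul_add, smul_sub,
    LinearMap.add_apply, LinearMap.sub_apply, LinearMap.neg_apply, LinearMap.smul_apply,
    LinearMap.splitSum_apply, smul_smul, ← sign_add, ← splitSum_smul, ep_append, ep_cons, ← h]
  have h1 : ∀ a : ZMod 2, c.par + (ep x + (ep y + ep z)) + p + (ep s + (a + (ep y + p + ep s))) =
      a + (ep z + c.par + ep x) := by
    intro a
    generalize ep x = x', ep y = y', ep z = z', ep s = s', c.par = q, p = p'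
    decide +revert
  have h2 : ∀ a b : ZMod 2, c.par + (ep x + (ep y + ep z)) + p +
      (ep s + (a + (ep y + p + ep s) + b)) = a + (ep z + c.par + ep x) + b := by
    intro a b
    rw [← h1]; ring
  have h3 : ∀ a : ZMod 2, sign k (c.par + (ep x + (ep y + ep z)) + p + (a + ep t)) =
      sign k (a + (ep z + c.par + ep x + ep t + ep y + p)) := by
    intro a; congr 1; ring
  have h4 : ∀ a : ZMod 2, sign k (a + (ep z + (c.par + 1 + ep x))) =
      - sign k (a + (ep z + c.par + ep x)) := by
    intro a; rw [← sign_add_one]; congr 1; ring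
  simp only [h1, h2, h3, h4, neg_smul, smul_neg]
  abel

end ChainMap

/-! ### Reindexing of cyclic sums -/

section CyclicSum

variable {α M : Type*} [AddCommMonoid M] (l m : List α)

theorem cycSum_splitSum_left
    (F : List α → List α → List α → List α → List α → List α → List α → M) :
    (cycSum l m fun x y z s t => splitSum x fun x₁ x₂ => F x x₁ x₂ y z s t) =
      splitSum l fun x₁ v => splitSum₃ v fun x₂ y z => splitSum m fun s t =>
        F (x₁ ++ x₂) x₁ x₂ y z s t :=
  (splitSum_congr fun _ _ _ => splitSum_congr fun _ _ _ => splitSum_comm _ _ _).trans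
    (splitSum₃_left l fun x x₁ x₂ y z => splitSum m fun s t => F x x₁ x₂ y z s t)

theorem cycSum_splitSum_middle
    (F : List α → List α → List α → List α → List α → List α → List α → M) :
    (cycSum l m fun x y z s t => splitSum y fun y₁ y₂ => F x y y₁ y₂ z s t) =
      splitSum l fun x v => splitSum₃ v fun y₁ y₂ z => splitSum m fun s t =>
        F x (y₁ ++ y₂) y₁ y₂ z s t :=
  (splitSum_congr fun _ _ _ => splitSum_congr fun _ _ _ => splitSum_comm _ _ _).trans
    (splitSum₃_middle l fun x y y₁ y₂ z => splitSum m fun s t => F x y y₁ y₂ z s t)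

theorem cycSum_splitSum_right
    (F : List α → List α → List α → List α → List α → List α → List α → M) :
    (cycSum l m fun x y z s t => splitSum z fun z₁ z₂ => F x y z z₁ z₂ s t) =
      splitSum l fun x v => splitSum₃ v fun y z₁ z₂ => splitSum m fun s t =>
        F x y (z₁ ++ z₂) z₁ z₂ s t :=
  splitSum_congr fun _ _ _ => splitSum_congr fun _ _ _ => (splitSum_comm _ _ _).trans
    (splitSum_congr fun _ _ h => by simp only [h])

theorem cycSum_ite_left (F : List α → List α → List α → List α → List α → M)
    [∀ x : List α, Decidable (x = [])] :
    (cycSum l m fun x y z s t => if x = [] then F x y z s t else 0) =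
      splitSum l fun y z => splitSum m fun s t => F [] y z s t := by
  refine Eq.trans (splitSum_congr (G := fun x w => if x = [] then splitSum w fun y z =>
    splitSum m fun s t => F x y z s t else 0) fun x w _ => ?_) (splitSum_ite_left _ _)
  split_ifs with h
  · simp only [h, if_true]
  · simp only [h, if_false, splitSum_zero]

theorem cycSum_ite_right (F : List α → List α → List α → List α → List α → M)
    [∀ x : List α, Decidable (x = [])] :
    (cycSum l m fun x y z s t => if z = [] then F x y z s t else 0) =
      splitSum l fun x y => splitSum m fun s t => F x y [] s t := by
  refine splitSum_congr fun x w _ => ?_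
  refine Eq.trans (splitSum_congr (G := fun y z => if z = [] then
    splitSum m fun s t => F x y z s t else 0) fun y z _ => ?_) (splitSum_ite_right _ _)
  split_ifs with h
  · simp only [h, if_true]
  · simp only [h, if_false, splitSum_zero]

end CyclicSum

/-! ### The second sum of the product and the differential -/

section ChainMap

variable {k A : Type*} [CommRing k] [Ring A] [Algebra k A]
variable {𝒜 : ℕ → Submodule k A} [GradedAlgebra 𝒜] {R : Subalgebra k A} {D : DGA 𝒜}
variable {E : Bar 𝒜 →ₗ[k] A →ₗ[k] A} {p : ZMod 2} {v : A} (c : Letter 𝒜 R)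
  (l m : List (Letter 𝒜 R))
variable (hE : ActsOn D E R)
include hE

-- The Leibniz rule with the defects opposite to those of the first sum. A letter at the boundary of
-- two neighbouring pieces occurs once for each of them, and these terms cancel. Products of two
-- values of `E` cancel against the cyclic term or give the terms with `bₙ v`. The defects remain
-- from the terms in which `c` is at an end of its word.
set_option maxHeartbeats 1000000 in
theorem hochD_lamSecond_letter (hv : v ∈ homog 𝒜 p) (hvR : v ∈ R) :
    hochD D (lamSecond E c.val (wd l) v (wd m)) =
      lamSecond E (D.d c.val) (wd l) v (wd m) +
      sign k c.par • bdry D hE.d_mem (fun l => lamSecond E c.val (wd l) v (wd m)) l -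
      sign k c.par • (splitSum l fun x y => lamSecond E (c.val * tl x) (wd y) v (wd m)) +
      (splitSum l fun x y =>
        sign k (ep y * (c.par + ep x)) • lamSecond E (tl y * c.val) (wd x) v (wd m)) +
      sign k (c.par + ep l) • (lamSecond E c.val (wd l) (D.d v) (wd m) +
        sign k p • bdry D hE.d_mem (fun m => lamSecond E c.val (wd l) v (wd m)) m -
        sign k p • (splitSum m fun s t => lamSecond E c.val (wd l) (v * tl s) (wd t)) +
        splitSum m fun s t =>
          sign k (ep t * (p + ep s)) • lamSecond E c.val (wd l) (tl t * v) (wd s)) +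
      defectRight E p c.par c.val v l m - defectLeft E p c.par c.val v l m := by
  have hc := c.mem_homog
  have m2 : (cycSum l m fun x y z s t => sign k (cycSign c.par p x y z s t) • sign k (ep z) •
      act 𝒜 (E (wd z * letter 𝒜 (D.d c.val) * wd x) (tl t)) (lamK E (wd y) v (wd s))) =
      lamSecond E (D.d c.val) (wd l) v (wd m) := by
    rw [lamSecond_wd l m (D.d_mem_homog hc) hv]
    refine cycSum_congr fun x y z s t _ _ => ?_
    rw [smul_smul, ← sign_add, cycSign]
    congr 2
    ring
  have m3 : (cycSum l m fun x y z s t => sign k (cycSign c.par p x y z s t) • sign k (ep z) •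
      splitSum z fun z₁ z₂ => act 𝒜 (E (wd z₁ * letter 𝒜 (tl z₂ * c.val) * wd x) (tl t))
        (lamK E (wd y) v (wd s))) = splitSum l fun x y =>
        sign k (ep y * (c.par + ep x)) • lamSecond E (tl y * c.val) (wd x) v (wd m) := by
    rw [lamSecond_mul_left l m hc hv]
    refine cycSum_congr fun x y z s t _ _ => ?_
    rw [smul_smul, ← sign_add, cycSign, ← splitSum_smul]
    refine splitSum_congr fun _ _ _ => ?_
    congr 2
    generalize ep x = x', ep y = y', ep z = z', ep t = t', ep s = s', c.par = q, p = p'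
    decide +revert
  have m4 : (cycSum l m fun x y z s t => sign k (cycSign c.par p x y z s t) •
      sign k (ep z + c.par) • splitSum x fun x₁ x₂ =>
        act 𝒜 (E (wd z * letter 𝒜 (c.val * tl x₁) * wd x₂) (tl t)) (lamK E (wd y) v (wd s))) =
      sign k c.par • splitSum l fun x y => lamSecond E (c.val * tl x) (wd y) v (wd m) := by
    rw [lamSecond_mul_right l m hc hv]
    refine Eq.trans ?_ (cycSum_smul (sign k c.par) l m _)
    refine cycSum_congr fun x y z s t _ _ => ?_
    rw [smul_smul, ← sign_add, cycSign, ← splitSum_smul, ← splitSum_smul]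
    refine splitSum_congr fun _ _ _ => ?_
    rw [smul_smul, ← sign_add]
    congr 2
    generalize ep x = x', ep y = y', ep z = z', ep t = t', ep s = s', c.par = q, p = p'
    decide +revert
  -- The letter between `y` and `z` multiplies `E` from the left twice: as first letter of `z` in `d
  -- E`, and as last letter of `y` through `θ²`.
  have m7 : (cycSum l m fun x y z s t => sign k (cycSign c.par p x y z s t) •
      splitSum z fun z₁ z₂ => sign k (ep z₁) • act 𝒜 (tl z₁ * E (wd (z₂ ++ c :: x)) (tl t))
        (lamK E (wd y) v (wd s))) =
      cycSum l m fun x y z s t => sign k (cycSign c.par p x y z s t) •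
        splitSum y fun y₁ y₂ =>
          sign k (ep y₂ * (ep z + c.par + ep x + ep t) + ep y₁ * ep y₂) •
        act 𝒜 (tl y₂ * E (wd (z ++ c :: x)) (tl t)) (lamK E (wd y₁) v (wd s)) := by
    simp only [← splitSum_smul, cycSum_splitSum_right l m fun x y z z₁ z₂ s t =>
      sign k (cycSign c.par p x y z s t) • sign k (ep z₁) •
        act 𝒜 (tl z₁ * E (wd (z₂ ++ c :: x)) (tl t)) (lamK E (wd y) v (wd s)),
      cycSum_splitSum_middle l m fun x y y₁ y₂ z s t =>
        sign k (cycSign c.par p x y z s t) •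
          sign k (ep y₂ * (ep z + c.par + ep x + ep t) + ep y₁ * ep y₂) •
        act 𝒜 (tl y₂ * E (wd (z ++ c :: x)) (tl t)) (lamK E (wd y₁) v (wd s))]
    refine splitSum_congr fun x _ _ => splitSum_congr fun y _ _ => splitSum_congr fun z₁ z₂ _ =>
      splitSum_congr fun s t _ => ?_
    simp only [smul_smul, ← sign_add, cycSign, ep_append]
    congr 2
    generalize ep x = x', ep y = y', ep z₁ = z', ep z₂ = w', ep t = t', ep s = s', c.par = q,
      p = p'
    decide +revert
  -- For empty `z` the letter `c` begins its word, and `d E` multiplies by it from the left.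
  have m8 : (cycSum l m fun x y z s t => sign k (cycSign c.par p x y z s t) •
      if z = [] then sign k c.par • act 𝒜 (c.val * E (wd x) (tl t))
        (lamK E (wd y) v (wd s)) else 0) = defectRight E p c.par c.val v l m := by
    simp only [smul_ite, smul_zero]
    rw [cycSum_ite_right]
    refine splitSum_congr fun x y _ => splitSum_congr fun s t _ => ?_
    simp only [smul_smul, ← sign_add, cycSign, ep_nil]
    congr 2
    ring
  -- For empty `x` the letter `c` ends its word, and `d E` multiplies by it from the right.
  have m9 : (cycSum l m fun x y z s t => sign k (cycSign c.par p x y z s t) •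
      if x = [] then sign k (ep t + 1 + ep z + ep t * (c.par + 1)) •
        act 𝒜 (E (wd z) (tl t) * c.val) (lamK E (wd y) v (wd s)) else 0) =
      - defectLeft E p c.par c.val v l m := by
    simp only [smul_ite, smul_zero]
    rw [cycSum_ite_left, defectLeft, ← splitSum_neg]
    refine splitSum_congr fun x y _ => ?_
    rw [← splitSum_neg]
    refine splitSum_congr fun s t _ => ?_
    simp only [smul_smul, ← sign_add, cycSign, ep_nil, ← neg_smul, ← sign_add_one]
    congr 2
    generalize ep x = x', ep y = y', ep t = t', ep s = s', c.par = q, p = p'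
    decide +revert
  -- The letter between `x` and `y` multiplies `E` from the right twice: as last letter of `x` in `d
  -- E`, and as first letter of `y` in the differential of `K`.
  have m10 : (cycSum l m fun x y z s t => sign k (cycSign c.par p x y z s t) •
      splitSum x fun x₁ x₂ => sign k (ep t + 1 + (ep z + (c.par + 1 + ep x₁)) + ep t * ep x₂) •
        act 𝒜 (E (wd (z ++ c :: x₁)) (tl t) * tl x₂) (lamK E (wd y) v (wd s))) =
      cycSum l m fun x y z s t => sign k (cycSign c.par p x y z s t) •
      sign k (ep z + c.par + ep x + ep t) • splitSum y fun y₁ y₂ =>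
        act 𝒜 (E (wd (z ++ c :: x)) (tl t) * tl y₁) (lamK E (wd y₂) v (wd s)) := by
    simp only [← splitSum_smul, cycSum_splitSum_left l m fun x x₁ x₂ y z s t =>
      sign k (cycSign c.par p x y z s t) •
        sign k (ep t + 1 + (ep z + (c.par + 1 + ep x₁)) + ep t * ep x₂) •
        act 𝒜 (E (wd (z ++ c :: x₁)) (tl t) * tl x₂) (lamK E (wd y) v (wd s)),
      cycSum_splitSum_middle l m fun x y y₁ y₂ z s t =>
        sign k (cycSign c.par p x y z s t) • sign k (ep z + c.par + ep x + ep t) •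
        act 𝒜 (E (wd (z ++ c :: x)) (tl t) * tl y₁) (lamK E (wd y₂) v (wd s))]
    refine splitSum_congr fun x₁ _ _ => splitSum_congr fun x₂ _ _ => splitSum_congr fun y z _ =>
      splitSum_congr fun s t _ => ?_
    simp only [smul_smul, ← sign_add, cycSign, ep_append]
    congr 2
    generalize ep x₁ = x', ep x₂ = x'', ep y = y', ep z = z', ep t = t', ep s = s', c.par = q,
      p = p'
    decide +revert
  have m12 : (cycSum l m fun x y z s t => sign k (cycSign c.par p x y z s t) •
      sign k (ep z + c.par + ep x + ep t + ep y) •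
        act 𝒜 (E (wd (z ++ c :: x)) (tl t)) (lamK E (wd y) (D.d v) (wd s))) =
      sign k (c.par + ep l) • lamSecond E c.val (wd l) (D.d v) (wd m) := by
    rw [lamSecond_letter c l m (D.d_mem_homog hv), ← cycSum_smul]
    refine cycSum_congr fun x y z s t h _ => ?_
    rw [smul_smul, smul_smul, ← sign_add, ← sign_add, cycSign, cycSign, ← h, ep_append, ep_append]
    congr 2
    generalize ep x = x', ep y = y', ep z = z', ep t = t', ep s = s', c.par = q, p = p'
    decide +revert
  have m14 : (cycSum l m fun x y z s t => sign k (cycSign c.par p x y z s t) •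
      sign k (ep z + c.par + ep x + ep t + ep y + p) • splitSum s fun s₁ s₂ =>
        act 𝒜 (E (wd (z ++ c :: x)) (tl t)) (lamK E (wd y) (v * tl s₁) (wd s₂))) =
      sign k (c.par + ep l) • sign k p •
        splitSum m fun s t => lamSecond E c.val (wd l) (v * tl s) (wd t) := by
    simp only [lamSecond_letter c l _ (mul_mem_homog hv (tl_mem_homog _)), ← splitSum_smul,
      ← cycSum_smul]
    simp only [cycSum, splitSum₃]
    conv_rhs => rw [splitSum_comm]
    refine splitSum_congr fun x w hx => ?_
    conv_rhs => rw [splitSum_comm]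
    refine splitSum_congr fun y z hy => ?_
    rw [splitSum_splitSum_left]
    refine splitSum_congr fun s₁ _ _ => splitSum_congr fun s₂ t _ => ?_
    simp only [smul_smul, ← sign_add, cycSign, ep_append, ← hx, ← hy]
    congr 2
    generalize ep x = x', ep y = y', ep z = z', ep t = t', ep s₁ = s', ep s₂ = s'', c.par = q,
      p = p'
    decide +revert
  -- The cyclic term puts the value `E(y₂; s₂)` in front. The same product occurs in the product
  -- rule when `c` goes to the right factor, with `y₂` and `s₂` as initial pieces of `z` and `t`.
  have m17 : (cycSum l m fun x y z s t => sign k (cycSign c.par p x y z s t) •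
      splitSum y fun y₁ y₂ => splitSum s fun s₁ s₂ =>
        sign k ((ep y₂ + ep s₂) * (ep z + c.par + ep x + ep t) + ep y₁ * ep y₂ +
          ep s₂ * (ep y₁ + p + ep s₁)) •
        act 𝒜 (E (wd y₂) (tl s₂) * E (wd (z ++ c :: x)) (tl t)) (lamK E (wd y₁) v (wd s₁))) =
      - cycSum l m fun x y z s t => splitSum z fun z₁ z₂ => splitSum t fun t₁ t₂ =>
        sign k (cycSign c.par p x y z s t + (ep z + c.par + ep x) +
          (ep t₁ + (ep t₁ + 1) * (ep z₂ + (c.par + 1 + ep x)))) •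
        act 𝒜 (E (wd z₁) (tl t₁) * E (wd (z₂ ++ c :: x)) (tl t₂)) (lamK E (wd y) v (wd s)) := by
    simp only [← cycSum_neg, ← splitSum_neg, ← splitSum_smul,
      cycSum_splitSum_right l m fun x y z z₁ z₂ s t => splitSum t fun t₁ t₂ =>
      -(sign k (cycSign c.par p x y z s t + (ep z + c.par + ep x) +
          (ep t₁ + (ep t₁ + 1) * (ep z₂ + (c.par + 1 + ep x)))) •
        act 𝒜 (E (wd z₁) (tl t₁) * E (wd (z₂ ++ c :: x)) (tl t₂)) (lamK E (wd y) v (wd s))),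
      cycSum_splitSum_middle l m fun x y y₁ y₂ z s t => splitSum s fun s₁ s₂ =>
        sign k (cycSign c.par p x y z s t) •
        sign k ((ep y₂ + ep s₂) * (ep z + c.par + ep x + ep t) + ep y₁ * ep y₂ +
          ep s₂ * (ep y₁ + p + ep s₁)) •
        act 𝒜 (E (wd y₂) (tl s₂) * E (wd (z ++ c :: x)) (tl t)) (lamK E (wd y₁) v (wd s₁))]
    refine splitSum_congr fun x _ _ => splitSum_congr fun y _ _ => splitSum_congr fun z₁ z₂ _ =>
      (splitSum_splitSum_left _ _).trans (splitSum_congr fun s _ _ => splitSum_congr fun t₁ t₂ h => ?_)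
    rw [← neg_smul, ← sign_add_one, smul_smul, ← sign_add, cycSign, cycSign, ← h]
    simp only [ep_append]
    congr 2
    generalize ep x = x', ep y = y', ep z₁ = z', ep z₂ = z'', ep t₁ = t', ep t₂ = t'', ep s = s',
      c.par = q, p = p'
    decide +revert
  -- If `c` goes to the left factor, then the right factor `E(x₂; t₂)` together with `K(y; v)` is
  -- part of `K` evaluated at a product `b v`, by `lamK_mul`.
  have m18 : (cycSum l m fun x y z s t => splitSum x fun x₁ x₂ => splitSum t fun t₁ t₂ =>
        sign k (cycSign c.par p x y z s t + (ep z + c.par + ep x) +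
          (ep t₁ + (ep t₁ + 1) * ep x₂)) •
        act 𝒜 (E (wd (z ++ c :: x₁)) (tl t₁) * E (wd x₂) (tl t₂)) (lamK E (wd y) v (wd s))) =
      sign k (c.par + ep l) • splitSum m fun s t =>
          sign k (ep t * (p + ep s)) • lamSecond E c.val (wd l) (tl t * v) (wd s) := by
    simp only [lamSecond_letter c l _ (mul_mem_homog (tl_mem_homog _) hv),
      lamK_mul hE (tl_mem_homog _) (tl_mem _) hv hvR, map_splitSum, ← splitSum_smul, ← cycSum_smul,
      cycSum_splitSum_left l m fun x x₁ x₂ y z s t => splitSum t fun t₁ t₂ =>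
        sign k (cycSign c.par p x y z s t + (ep z + c.par + ep x) +
          (ep t₁ + (ep t₁ + 1) * ep x₂)) •
        act 𝒜 (E (wd (z ++ c :: x₁)) (tl t₁) * E (wd x₂) (tl t₂)) (lamK E (wd y) v (wd s))]
    symm
    refine (splitSum_congr fun w t₂ _ => cycSum_splitSum_middle l w fun x y y₁ y₂ z s t =>
      sign k (c.par + ep l) • sign k (ep t₂ * (p + ep w)) •
        sign k (cycSign c.par (ep t₂ + 1 + p) x y z s t) •
        act 𝒜 (E (wd (z ++ c :: x)) (tl t)) (sign k (ep y₁ + ep y₂ * (ep t₂ + 1)) •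
          act 𝒜 (E (wd y₁) (tl t₂)) (lamK E (wd y₂) v (wd s)))).trans ?_
    rw [splitSum_comm]
    refine splitSum_congr fun x₁ _ h₁ => ?_
    simp only [splitSum₃]
    rw [splitSum_comm]
    refine splitSum_congr fun x₂ _ h₂ => ?_
    rw [splitSum_comm]
    refine splitSum_congr fun y z h₃ => ?_
    refine (splitSum_splitSum_left _ _).trans (splitSum_congr fun s _ _ =>
      splitSum_congr fun t₁ t₂ h => ?_)
    simp only [map_smul, act_act, smul_smul, ← sign_add, cycSign, ep_append, ← h₁, ← h₂, ← h₃, ← h]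
    congr 2
    generalize ep x₁ = x', ep x₂ = x'', ep y = y', ep z = z', ep t₁ = t', ep t₂ = t'', ep s = s',
      c.par = q, p = p'
    decide +revert
  have b1 := bdry_lamSecond_left c l m hE hv
  have b2 := bdry_lamSecond_right c l m hE hv
  rw [smul_add, smul_sub, smul_add, smul_smul _ (sign k p) (bdry _ _ _ _), ← sign_add,
    b1, b2, ← m18]
  rw [lamSecond_letter c l m hv, map_cycSum]
  simp only [map_smul, hochD_act_lamK_append_cons hE hv hvR, smul_add, smul_sub, smul_neg,
    cycSum_add, cycSum_sub, cycSum_neg]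
  rw [m2, m3, m4, m7, m8, m9, m10, m12, m14, m17]
  abel

end ChainMap

/-! ### The product is a chain map -/

section ChainMap

variable {k A : Type*} [CommRing k] [Ring A] [Algebra k A]
variable {𝒜 : ℕ → Submodule k A} [GradedAlgebra 𝒜] {R : Subalgebra k A} {D : DGA 𝒜}
variable {E : Bar 𝒜 →ₗ[k] A →ₗ[k] A} {p q : ZMod 2} {u v : A}
  (l m : List (Letter 𝒜 R))

theorem letter_one : letter 𝒜 (1 : A) = 0 := by
  have h : toPos 𝒜 (1 : A) = 0 := by
    ext
    rw [coe_toPos, GradedAlgebra.proj_apply, DirectSum.decompose_of_mem 𝒜 SetLike.GradedOne.one_mem,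
      DirectSum.of_eq_same]
    simp
  rw [letter, LinearMap.comp_apply, h, map_zero]

/-- Each term contains the letter of `1`, which is zero by normalization. -/
theorem lamSecond_one : lamSecond E (1 : A) (wd l) v (wd m) = 0 := by
  induction v using graded_induction (𝒜 := 𝒜) with
  | h0 => simp
  | ha a b h1 h2 => rw [map_add, LinearMap.add_apply, h1, h2, add_zero]
  | hm n v hv =>
    rw [lamSecond_wd l m one_mem_homog (mem_homog_of_mem hv)]
    simp [letter_one, splitSum₃, splitSum_zero]

theorem splitSum_letter_tl_mul :
    (splitSum l fun x y => letter 𝒜 (tl x) * wd y) = wd l - if l = [] then 1 else 0 := by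
  cases l with
  | nil => simp
  | cons c l =>
    rw [splitSum_tl_left]
    · simp
    · intro x y h; simp [h]

theorem splitSum_mul_letter_tl :
    (splitSum l fun x y => wd x * letter 𝒜 (tl y)) = wd l - if l = [] then 1 else 0 := by
  induction l with
  | nil => simp
  | cons c l ih =>
    simp only [splitSum_cons, wd_cons, mul_assoc]
    rw [← mul_splitSum, ih]
    cases l with
    | nil => simp
    | cons c' l => simp

/-- For `u = 1`, multiplication by the first letter of `x` and by the last letter of `z` both
produce the word `z x`. The two sums therefore cancel up to the terms with empty `x` or empty `z`,
and these are the defects. -/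
theorem splitSum_lamSecond_tl (hv : v ∈ homog 𝒜 p) :
    (splitSum l fun x y => lamSecond E (1 * tl x) (wd y) v (wd m)) -
      (splitSum l fun x y => sign k (ep y * (0 + ep x)) •
        lamSecond E (tl y * 1) (wd x) v (wd m)) =
      defectRight E p 0 1 v l m - defectLeft E p 0 1 v l m := by
  have h1 : ∀ x y z s t : List (Letter 𝒜 R), (splitSum x fun x₁ x₂ =>
        sign k (ep z * (0 + ep x + ep y) + ep t * (ep y + p + ep s)) •
          act 𝒜 (E (wd z * letter 𝒜 (1 * tl x₁) * wd x₂) (tl t)) (lamK E (wd y) v (wd s))) =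
      sign k (ep z * (0 + ep x + ep y) + ep t * (ep y + p + ep s)) •
          act 𝒜 (E (wd z * wd x) (tl t)) (lamK E (wd y) v (wd s)) - if x = [] then
          sign k (ep z * (0 + ep x + ep y) + ep t * (ep y + p + ep s)) •
          act 𝒜 (E (wd z) (tl t)) (lamK E (wd y) v (wd s)) else 0 := by
    intro x y z s t
    have e := congrArg (fun w => act 𝒜 (E (wd z * w) (tl t)) (lamK E (wd y) v (wd s)))
      (splitSum_letter_tl_mul x)
    simp only [mul_splitSum, map_splitSum, LinearMap.splitSum_apply, mul_sub, map_sub,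
      LinearMap.sub_apply, ← mul_assoc] at e
    simp only [one_mul]
    rw [splitSum_smul, e, smul_sub]
    split_ifs <;> simp
  have h2 : ∀ x y z s t : List (Letter 𝒜 R), (splitSum z fun z₁ z₂ =>
        sign k (ep z * (0 + ep x + ep y) + ep t * (ep y + p + ep s)) •
          act 𝒜 (E (wd z₁ * letter 𝒜 (tl z₂ * 1) * wd x) (tl t)) (lamK E (wd y) v (wd s))) =
      sign k (ep z * (0 + ep x + ep y) + ep t * (ep y + p + ep s)) •
          act 𝒜 (E (wd z * wd x) (tl t)) (lamK E (wd y) v (wd s)) - if z = [] then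
          sign k (ep z * (0 + ep x + ep y) + ep t * (ep y + p + ep s)) •
          act 𝒜 (E (wd x) (tl t)) (lamK E (wd y) v (wd s)) else 0 := by
    intro x y z s t
    have e := congrArg (fun w => act 𝒜 (E (w * wd x) (tl t)) (lamK E (wd y) v (wd s)))
      (splitSum_mul_letter_tl z)
    simp only [splitSum_mul, map_splitSum, LinearMap.splitSum_apply, sub_mul, map_sub,
      LinearMap.sub_apply] at e
    simp only [mul_one]
    rw [splitSum_smul, e, smul_sub]
    split_ifs <;> simp
  have e1 := cycSum_ite_right l m fun x y z s t =>
    sign k (ep z * (0 + ep x + ep y) + ep t * (ep y + p + ep s)) •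
          act 𝒜 (E (wd x) (tl t)) (lamK E (wd y) v (wd s))
  have e2 := cycSum_ite_left l m fun x y z s t =>
    sign k (ep z * (0 + ep x + ep y) + ep t * (ep y + p + ep s)) •
          act 𝒜 (E (wd z) (tl t)) (lamK E (wd y) v (wd s))
  rw [lamSecond_mul_right l m one_mem_homog hv, lamSecond_mul_left l m one_mem_homog hv]
  simp only [h1, h2, splitSum₃, splitSum_sub]
  simp only [cycSum, splitSum₃] at e1 e2
  rw [e1, e2, defectRight, defectLeft, sub_sub_sub_cancel_left]
  congr 1
  · refine splitSum_congr fun x y _ => splitSum_congr fun s t _ => ?_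
    rw [one_mul]
    congr 2
    simp; ring
  · refine splitSum_congr fun x y _ => splitSum_congr fun s t _ => ?_
    rw [mul_one]
    congr 2
    simp; ring

theorem homog_of_eq_one_or (hu : u = 1 ∧ q = 0 ∨ ∃ c : Letter 𝒜 R, c.val = u ∧ c.par = q) :
    u ∈ homog 𝒜 q := by
  obtain ⟨rfl, rfl⟩ | ⟨c, rfl, rfl⟩ := hu
  · exact one_mem_homog
  · exact c.mem_homog

variable (hE : ActsOn D E R)
include hE

theorem hochD_lamSecond (hu : u = 1 ∧ q = 0 ∨ ∃ c : Letter 𝒜 R, c.val = u ∧ c.par = q)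
    (hv : v ∈ homog 𝒜 p) (hvR : v ∈ R) :
    hochD D (lamSecond E u (wd l) v (wd m)) =
      lamSecond E (D.d u) (wd l) v (wd m) +
      sign k q • bdry D hE.d_mem (fun l => lamSecond E u (wd l) v (wd m)) l -
      sign k q • (splitSum l fun x y => lamSecond E (u * tl x) (wd y) v (wd m)) +
      (splitSum l fun x y =>
        sign k (ep y * (q + ep x)) • lamSecond E (tl y * u) (wd x) v (wd m)) +
      sign k (q + ep l) • (lamSecond E u (wd l) (D.d v) (wd m) +
        sign k p • bdry D hE.d_mem (fun m => lamSecond E u (wd l) v (wd m)) m -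
        sign k p • (splitSum m fun s t => lamSecond E u (wd l) (v * tl s) (wd t)) +
        splitSum m fun s t =>
          sign k (ep t * (p + ep s)) • lamSecond E u (wd l) (tl t * v) (wd s)) +
      defectRight E p q u v l m - defectLeft E p q u v l m := by
  obtain ⟨rfl, rfl⟩ | ⟨c, rfl, rfl⟩ := hu
  · have h1 : D.d 1 = 0 := by
      have h := D.d_mem 0 1 (SetLike.GradedOne.one_mem)
      rwa [zero_add, D.degree_one, Submodule.mem_bot] at h
    simp only [lamSecond_one, map_zero, h1, LinearMap.zero_apply, bdry_zero, smul_zero,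
      splitSum_zero, sign_zero, one_smul]
    have e := splitSum_lamSecond_tl (E := E) l m hv
    rw [sub_eq_iff_eq_add] at e
    rw [e]
    abel
  · exact hochD_lamSecond_letter c l m hE hv hvR

set_option maxHeartbeats 1000000 in
/-- The product `λ_E` is a chain map. -/
theorem hochD_lam_wd (hu : u = 1 ∧ q = 0 ∨ ∃ c : Letter 𝒜 R, c.val = u ∧ c.par = q)
    (hv : v ∈ homog 𝒜 p) (hvR : v ∈ R) :
    hochD D (lam E (u ⊗ₜ wd l) (v ⊗ₜ wd m)) =
      lam E (hochD D (u ⊗ₜ wd l)) (v ⊗ₜ wd m) +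
      sign k (q + ep l) • lam E (u ⊗ₜ wd l) (hochD D (v ⊗ₜ wd m)) := by
  have hu' := homog_of_eq_one_or hu
  have hl : ∀ (u v : A) (w w' : Bar 𝒜), lam E (u ⊗ₜ w) (v ⊗ₜ w') =
    lamFirst E u w v w' + lamSecond E u w v w' := fun _ _ _ _ => rfl
  have b1 := map_bdry D hE.d_mem ((lam E).flip (v ⊗ₜ wd m)) (fun l => u ⊗ₜ wd l) l
  have b2 := map_bdry D hE.d_mem (lam E (u ⊗ₜ wd l)) (fun m => v ⊗ₜ wd m) m
  simp only [LinearMap.flip_apply, hl, bdry_add] at b1 b2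
  rw [hl, map_add, hochD_lamFirst l m hE hu' hv hvR, hochD_lamSecond l m hE hu hv hvR, hochD_eq,
    hochD_eq, hochD₁_wd D hE.d_mem hu', hochTheta₂_wd hu', hochD₁_wd D hE.d_mem hv,
    hochTheta₂_wd hv]
  simp only [map_add, map_sub, map_smul, map_splitSum, LinearMap.add_apply, LinearMap.sub_apply,
    LinearMap.smul_apply, LinearMap.splitSum_apply, hl, b1, b2, splitSum_add, smul_add, smul_sub]
  abel

end ChainMap

/-! ### Reduction of identities to words -/

section Spanning

variable {k A A' : Type*} [CommRing k] [Ring A] [Algebra k A] [Ring A'] [Algebra k A']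
variable {𝒜 : ℕ → Submodule k A} [GradedAlgebra 𝒜]
variable {𝒜' : ℕ → Submodule k A'} [GradedAlgebra 𝒜']

/-- The letter of a homogeneous element of positive degree. -/
def Letter.ofMem {n : ℕ} {a : A} (ha : a ∈ 𝒜 n) (hn : n ≠ 0) : Letter 𝒜 (⊤ : Subalgebra k A) where
  val := a
  par := n
  mem_homog := mem_homog_of_mem ha
  mem_pos := mem_pos_of_mem ha hn
  mem := trivial

theorem letter_of_mem_zero {a : A} (ha : a ∈ 𝒜 0) : letter 𝒜 a = 0 := by
  have h : toPos 𝒜 a = 0 := by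
    ext
    rw [coe_toPos, GradedAlgebra.proj_apply, DirectSum.decompose_of_mem 𝒜 ha,
      DirectSum.of_eq_same]
    simp
  rw [letter, LinearMap.comp_apply, h, map_zero]

/-- The words in letters that are homogeneous for the `ℕ`-grading span `BA`. -/
theorem mem_of_wd_mem {S : Submodule k (Bar 𝒜)}
    (h : ∀ l : List (Letter 𝒜 (⊤ : Subalgebra k A)),
      (∀ c ∈ l, ∃ n ≠ 0, c.val ∈ 𝒜 n ∧ c.par = n) → wd l ∈ S)
    (w : Bar 𝒜) : w ∈ S := by
  let T : Submodule k (Bar 𝒜) := Submodule.span k (wd '' {l : List (Letter 𝒜 (⊤ : Subalgebra k A)) |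
    ∀ c ∈ l, ∃ n ≠ 0, c.val ∈ 𝒜 n ∧ c.par = n})
  have hT : T ≤ S := Submodule.span_le.2 (by rintro _ ⟨l, hl, rfl⟩; exact h l hl)
  refine hT ?_
  induction w using bar_induction with
  | h1 => exact Submodule.subset_span ⟨[], by simp, rfl⟩
  | hadd x y hx hy => exact add_mem hx hy
  | hsmul c x hx => exact Submodule.smul_mem _ _ hx
  | hl a w hw =>
    induction a using graded_induction (𝒜 := 𝒜) with
    | h0 => simp
    | ha a b h1 h2 => rw [map_add, add_mul]; exact add_mem h1 h2
    | hm n a ha =>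
      rcases eq_or_ne n 0 with rfl | hn
      · rw [letter_of_mem_zero ha, zero_mul]; exact zero_mem _
      · have : T ≤ T.comap (LinearMap.mulLeft k (letter 𝒜 a)) := Submodule.span_le.2 (by
          rintro _ ⟨l, hl, rfl⟩
          exact Submodule.subset_span ⟨Letter.ofMem ha hn :: l, by
            intro c hc
            rcases List.mem_cons.1 hc with rfl | hc
            · exact ⟨n, hn, ha, rfl⟩
            · exact hl c hc, rfl⟩)
        exact this hw

theorem mem_of_letter_mem (D : DGA 𝒜) {S : Submodule k A} (h1 : 1 ∈ S)
    (h : ∀ c : Letter 𝒜 (⊤ : Subalgebra k A), c.val ∈ S) (a : A) : a ∈ S := by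
  induction a using graded_induction (𝒜 := 𝒜) with
  | h0 => simp
  | ha a b h1 h2 => exact add_mem h1 h2
  | hm n a ha =>
    rcases eq_or_ne n 0 with rfl | hn
    · obtain ⟨c, rfl⟩ := D.degree_zero a ha
      rw [Algebra.algebraMap_eq_smul_one]
      exact S.smul_mem _ h1
    · exact h (Letter.ofMem ha hn)

/-- An element is `1` or a letter, of parity `q`. -/
def IsGenerator (R : Subalgebra k A) (u : A) (q : ZMod 2) : Prop :=
  u = 1 ∧ q = 0 ∨ ∃ c : Letter 𝒜 R, c.val = u ∧ c.par = q

/-- Since `A⁰ = k`, the left factor may be taken to be `1` or a letter. -/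
theorem hoch_mem_of_tmul_wd_mem (D : DGA 𝒜) {S : Submodule k (Hoch 𝒜)}
    (h : ∀ u q, IsGenerator (𝒜 := 𝒜) (⊤ : Subalgebra k A) u q →
      ∀ l : List (Letter 𝒜 (⊤ : Subalgebra k A)), u ⊗ₜ[k] wd l ∈ S) (z : Hoch 𝒜) : z ∈ S := by
  induction z using TensorProduct.induction_on with
  | zero => exact zero_mem _
  | add x y hx hy => exact add_mem hx hy
  | tmul u w =>
    refine mem_of_letter_mem D (S := S.comap ((TensorProduct.mk k A (Bar 𝒜)).flip w)) ?_ ?_ u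
    · exact mem_of_wd_mem (S := S.comap (TensorProduct.mk k A (Bar 𝒜) 1))
        (fun l _ => h 1 0 (Or.inl ⟨rfl, rfl⟩) l) w
    · intro c
      exact mem_of_wd_mem (S := S.comap (TensorProduct.mk k A (Bar 𝒜) c.val))
        (fun l _ => h c.val c.par (Or.inr ⟨c, rfl, rfl⟩) l) w

variable {D : DGA 𝒜} {D' : DGA 𝒜'} (f : DGAHom D D')

theorem DGAHom.map_mem_homog {p : ZMod 2} {a : A} (ha : a ∈ homog 𝒜 p) :
    f.toFun a ∈ homog 𝒜' p := by
  rw [mem_homog, f.par_map, mem_homog.1 ha]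

theorem DGAHom.map_mem_pos {a : A} (ha : a ∈ Pos 𝒜) : f.toFun a ∈ Pos 𝒜' := by
  rw [mem_pos_iff, f.proj_map, mem_pos_iff.1 ha, map_zero]

/-- The image of a letter under a dga map. -/
def DGAHom.mapLetter (c : Letter 𝒜 (⊤ : Subalgebra k A)) : Letter 𝒜' f.toFun.range where
  val := f.toFun c.val
  par := c.par
  mem_homog := f.map_mem_homog c.mem_homog
  mem_pos := f.map_mem_pos c.mem_pos
  mem := ⟨c.val, rfl⟩

theorem DGAHom.wd_map (l : List (Letter 𝒜 (⊤ : Subalgebra k A))) :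
    wd (l.map f.mapLetter) = f.onBar (wd l) := by
  induction l with
  | nil => simp
  | cons c l ih =>
    rw [List.map_cons, wd_cons, ih, wd_cons, map_mul, f.onBar_letter]
    rfl

theorem DGAHom.ep_map (l : List (Letter 𝒜 (⊤ : Subalgebra k A))) :
    ep (l.map f.mapLetter) = ep l := by
  induction l with
  | nil => simp
  | cons c l ih => rw [List.map_cons, ep_cons, ih, ep_cons]; rfl

theorem DGAHom.tl_map (l : List (Letter 𝒜 (⊤ : Subalgebra k A))) :
    tl (l.map f.mapLetter) = f.toFun (tl l) := by
  rw [← tau_wd, f.wd_map, f.tau_map, tau_wd]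

theorem DGAHom.isGenerator_map {u : A} {q : ZMod 2}
    (h : IsGenerator (𝒜 := 𝒜) (⊤ : Subalgebra k A) u q) :
    IsGenerator (𝒜 := 𝒜') f.toFun.range (f.toFun u) q := by
  obtain ⟨rfl, rfl⟩ | ⟨c, rfl, rfl⟩ := h
  · exact Or.inl ⟨map_one _, rfl⟩
  · exact Or.inr ⟨f.mapLetter c, rfl, rfl⟩

theorem DGAHom.onHoch_tmul (u : A) (w : Bar 𝒜) :
    f.onHoch (u ⊗ₜ w) = f.toFun u ⊗ₜ f.onBar w := rfl

variable (𝒜) in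
/-- The sign involution of `ΛA`. -/
def hochSgn : Module.End k (Hoch 𝒜) := TensorProduct.map (sgn 𝒜) (sgnBar 𝒜)

theorem hochSgn_tmul_wd {u : A} {q : ZMod 2} {R : Subalgebra k A} (hu : u ∈ homog 𝒜 q)
    (l : List (Letter 𝒜 R)) : hochSgn 𝒜 (u ⊗ₜ wd l) = sign k (q + ep l) • (u ⊗ₜ wd l) := by
  rw [hochSgn, TensorProduct.map_tmul, sgn_of_homog hu, sgnBar_wd, TensorProduct.smul_tmul_smul,
    sign_add]

theorem hochSgn_hochSgn (D : DGA 𝒜) (z : Hoch 𝒜) : hochSgn 𝒜 (hochSgn 𝒜 z) = z := by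
  refine hoch_mem_of_tmul_wd_mem D (S := LinearMap.eqLocus (hochSgn 𝒜 ∘ₗ hochSgn 𝒜) LinearMap.id)
    (fun u q h l => ?_) z
  have hu := homog_of_eq_one_or h
  rw [LinearMap.mem_eqLocus, LinearMap.comp_apply, hochSgn_tmul_wd hu, map_smul,
    hochSgn_tmul_wd hu, smul_smul, sign_mul_self, one_smul]
  rfl

theorem hochD_hochSgn (D : DGA 𝒜) (z : Hoch 𝒜) :
    hochD D (hochSgn 𝒜 z) = - hochSgn 𝒜 (hochD D z) := by
  refine hoch_mem_of_tmul_wd_mem D (S := LinearMap.eqLocus (hochD D ∘ₗ hochSgn 𝒜)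
    (-(hochSgn 𝒜 ∘ₗ hochD D))) (fun u q h l => ?_) z
  have hu := homog_of_eq_one_or h
  have hR : ∀ a ∈ (⊤ : Subalgebra k A), D.d a ∈ (⊤ : Subalgebra k A) := fun _ _ => trivial
  rw [LinearMap.mem_eqLocus, LinearMap.comp_apply, LinearMap.neg_apply, LinearMap.comp_apply,
    hochSgn_tmul_wd hu, map_smul]
  have hn : ∀ z : Hoch 𝒜, hochSgn 𝒜 z = sign k (q + ep l + 1) • z →
      sign k (q + ep l) • z = - hochSgn 𝒜 z := fun z hz => by
    rw [hz, sign_add_one, neg_smul, neg_neg]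
  refine hn _ ?_
  rw [hochD_eq, hochD₁_wd D hR hu, hochTheta₂_wd hu]
  simp only [map_add, map_sub, map_smul, map_bdry, map_splitSum, smul_add, smul_sub]
  congr 1
  · congr 1
    · congr 1
      · rw [hochSgn_tmul_wd (D.d_mem_homog hu)]
        congr 2; ring
      · rw [smul_comm, ← bdry_smul D hR (sign k (q + ep l + 1))]
        refine congrArg (fun z : Hoch 𝒜 => sign k q • z) (bdry_congr D hR fun m hm => ?_)
        rw [hochSgn_tmul_wd hu, hm, add_assoc]
    · rw [smul_comm]
      congr 1
      rw [← splitSum_smul]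
      refine splitSum_congr fun x y hl => ?_
      rw [hochSgn_tmul_wd (mul_mem_homog hu (tl_mem_homog x)), ← hl, ep_append]
      congr 2; ring
  · rw [← splitSum_smul]
    refine splitSum_congr fun x y hl => ?_
    rw [hochSgn_tmul_wd (mul_mem_homog (tl_mem_homog y) hu), ← hl, ep_append, smul_smul,
      smul_smul, ← sign_add, ← sign_add]
    congr 2; ring

variable {E : Bar 𝒜' →ₗ[k] A' →ₗ[k] A'} (hE : ActsOn D' E f.toFun.range)
include hE

/-- Images of words under `f` are words in letters of `f(A)`, where `E` satisfies its axioms, so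
`hochD_lam_wd` applies; the general case follows by bilinearity. The values of `E` may lie outside
`f(A)`. -/
theorem DGAHom.hochD_lam (x y : Hoch 𝒜) :
    hochD D' (lam E (f.onHoch x) (f.onHoch y)) =
      lam E (f.onHoch (hochD D x)) (f.onHoch y) +
        lam E (f.onHoch (hochSgn 𝒜 x)) (f.onHoch (hochD D y)) := by
  let Φ : Hoch 𝒜 →ₗ[k] Hoch 𝒜 →ₗ[k] Hoch 𝒜' := (lam E).compl₁₂ f.onHoch f.onHoch
  refine hoch_mem_of_tmul_wd_mem D (S := LinearMap.eqLocus ((hochD D') ∘ₗ Φ x)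
    (Φ (hochD D x) + Φ (hochSgn 𝒜 x) ∘ₗ hochD D)) (fun v p hv m => ?_) y
  refine hoch_mem_of_tmul_wd_mem D (S := LinearMap.eqLocus ((hochD D') ∘ₗ Φ.flip (v ⊗ₜ wd m))
    (Φ.flip (v ⊗ₜ wd m) ∘ₗ hochD D + Φ.flip (hochD D (v ⊗ₜ wd m)) ∘ₗ hochSgn 𝒜))
    (fun u q hu l => ?_) x
  have hu' := homog_of_eq_one_or hu
  have hv' := homog_of_eq_one_or hv
  rw [LinearMap.mem_eqLocus]
  simp only [LinearMap.comp_apply, LinearMap.flip_apply, LinearMap.add_apply, Φ,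
    LinearMap.compl₁₂_apply, f.hochD_map, hochSgn_tmul_wd hu', map_smul]
  have h := hochD_lam_wd (l.map f.mapLetter) (m.map f.mapLetter) hE (f.isGenerator_map hu)
    (f.map_mem_homog hv') ⟨v, rfl⟩
  rwa [f.wd_map, f.wd_map, f.ep_map] at h

theorem DGAHom.hochD_lam_of_cycle {x y : Hoch 𝒜} (hx : hochD D x = 0) (hy : hochD D y = 0) :
    hochD D' (lam E (f.onHoch x) (f.onHoch y)) = 0 := by
  rw [f.hochD_lam hE, hx, hy]; simp

theorem DGAHom.lam_hochD_left (x : Hoch 𝒜) {y : Hoch 𝒜} (hy : hochD D y = 0) :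
    lam E (f.onHoch (hochD D x)) (f.onHoch y) =
      hochD D' (lam E (f.onHoch x) (f.onHoch y)) := by
  rw [f.hochD_lam hE, hy]; simp

/-- The sign involution anticommutes with the differential, so it preserves cycles; as its square is
the identity, it can be moved into the chain whose boundary is taken. -/
theorem DGAHom.lam_hochD_right {x : Hoch 𝒜} (y : Hoch 𝒜) (hx : hochD D x = 0) :
    lam E (f.onHoch x) (f.onHoch (hochD D y)) =
      hochD D' (lam E (f.onHoch (hochSgn 𝒜 x)) (f.onHoch y)) := by
  rw [f.hochD_lam hE, hochD_hochSgn, hx, hochSgn_hochSgn D]; simp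

end Spanning

/-! ### Degrees of the operations -/

section Operations

variable {k A A' : Type*} [CommRing k] [Ring A] [Algebra k A] [Ring A'] [Algebra k A']
variable {𝒜 : ℕ → Submodule k A} [GradedAlgebra 𝒜]
variable {𝒜' : ℕ → Submodule k A'} [GradedAlgebra 𝒜']

theorem DGA.eq_zero_of_mem_one (D : DGA 𝒜) {a : A} (ha : a ∈ 𝒜 1) : a = 0 := by
  rwa [D.degree_one, Submodule.mem_bot] at ha

/-- A word in letters of positive degree vanishes or has letters of degree at least two. -/
theorem DGA.exists_degrees (D : DGA 𝒜) (l : List (Letter 𝒜 (⊤ : Subalgebra k A)))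
    (hl : ∀ c ∈ l, ∃ n ≠ 0, c.val ∈ 𝒜 n ∧ c.par = n) : wd l = 0 ∨ ∃ ns : List ℕ,
      List.Forall₂ (fun n a => a ∈ 𝒜 n) ns (l.map Letter.val) ∧ 2 * l.length ≤ ns.sum ∧
      ((ns.sum + l.length : ℕ) : ZMod 2) = ep l := by
  induction l with
  | nil => exact Or.inr ⟨[], by simp⟩
  | cons c l ih =>
    obtain h | ⟨ns, h1, h2, h3⟩ := ih fun c hc => hl c (List.mem_cons_of_mem _ hc)
    · left; rw [wd_cons, h, mul_zero]
    obtain ⟨n, hn, hc, hp⟩ := hl c List.mem_cons_self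
    obtain rfl | hn1 := eq_or_ne n 1
    · left; rw [wd_cons, D.eq_zero_of_mem_one hc, map_zero, zero_mul]
    · refine Or.inr ⟨n :: ns, List.Forall₂.cons hc h1, ?_, ?_⟩
      · simp only [List.length_cons, List.sum_cons]; omega
      · rw [ep_cons, ← h3, hp, List.length_cons, List.sum_cons]
        push_cast; ring

variable {f : Bar 𝒜 →ₗ[k] A →ₗ[k] A'}

/-- An operation of degree `-p - r` preserves the parity up to `r`. -/
theorem operation_mem_homog (D : DGA 𝒜) (r : ℕ) (hr : r ≤ 1)
    (hf : ∀ (ns : List ℕ) (l : List A), List.Forall₂ (fun n a => a ∈ 𝒜 n) ns l →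
      ∀ (n : ℕ) (b : A), b ∈ 𝒜 n → l ≠ [] → ∀ m : ℕ, m + l.length + r = ns.sum + n →
        f (word 𝒜 l) b ∈ 𝒜' m)
    (hf1 : ∀ (p : ZMod 2) (b : A), b ∈ homog 𝒜 p → f 1 b ∈ homog 𝒜' (p + r))
    {R : Subalgebra k A} (l : List (Letter 𝒜 R)) {p : ZMod 2} {b : A} (hb : b ∈ homog 𝒜 p) :
    f (wd l) b ∈ homog 𝒜' (ep l + p + r) := by
  have key : ∀ (w : Bar 𝒜) (q : ZMod 2), f (parBar 𝒜 q w) b ∈ homog 𝒜' (q + p + r) := by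
    intro w q
    refine mem_of_wd_mem (S := (homog 𝒜' (q + p + r)).comap (f.flip b ∘ₗ parBar 𝒜 q))
      (fun l hl => ?_) w
    rw [Submodule.mem_comap, LinearMap.comp_apply, LinearMap.flip_apply, parBar_wd]
    split_ifs with h
    swap
    · simp
    subst h
    obtain h | ⟨ns, h1, h2, h3⟩ := D.exists_degrees l hl
    · rw [h]; simp
    rcases eq_or_ne l [] with rfl | hne
    · simpa using hf1 p b hb
    induction hb using homog_induction with
    | h0 => simp
    | ha a b _ _ h1 h2 => rw [map_add]; exact add_mem h1 h2
    | hm n b hb hn =>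
      have hlen : 0 < l.length := List.length_pos_iff.2 hne
      -- The subtraction does not truncate: the letters have degree at least two, so their degrees
      -- add up to at least twice the length, and `r ≤ 1 ≤ l.length`.
      have hm : f (wd l) b ∈ _ := hf ns _ h1 n b hb (by simpa using hne)
        (ns.sum + n - (l.length + r)) (by rw [List.length_map]; omega)
      convert mem_homog_of_mem hm using 2
      rw [← h3, ← hn]
      have e : (ns.sum + l.length + n + r) = (ns.sum + n - (l.length + r)) +
        2 * (l.length + r) := by omega
      have e2 := congrArg (Nat.cast (R := ZMod 2)) e
      push_cast at e2 ⊢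
      rw [e2, show (2 : ZMod 2) = 0 from rfl, zero_mul, add_zero]
  simpa [parBar_wd] using key (wd l) (ep l)

end Operations

/-! ### The axioms and the homotopies on words -/

section HGAlgebra

variable {k A A' : Type*} [CommRing k] [Ring A] [Algebra k A] [Ring A'] [Algebra k A']
variable {𝒜 : ℕ → Submodule k A} [GradedAlgebra 𝒜]
variable {𝒜' : ℕ → Submodule k A'} [GradedAlgebra 𝒜']

/-- `E(w; b)` has the degree-zero part of `b` if `w` is empty, and none otherwise. -/
theorem HGAlgebra.proj_E (X : HGAlgebra 𝒜) (w : Bar 𝒜) (b : A) :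
    GradedAlgebra.proj 𝒜 0 (X.E w b) =
      TensorAlgebra.algebraMapInv w • GradedAlgebra.proj 𝒜 0 b := by
  refine mem_of_wd_mem (S := LinearMap.eqLocus (GradedAlgebra.proj 𝒜 0 ∘ₗ X.E.flip b)
    (LinearMap.toSpanSingleton k A (GradedAlgebra.proj 𝒜 0 b) ∘ₗ
      TensorAlgebra.algebraMapInv.toLinearMap)) (fun l hl => ?_) w
  rw [LinearMap.mem_eqLocus]
  simp only [LinearMap.comp_apply, LinearMap.flip_apply, AlgHom.toLinearMap_apply,
    LinearMap.toSpanSingleton_apply, counit_wd]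
  rcases eq_or_ne l [] with rfl | hne
  · simp [X.E_one]
  rw [if_neg hne, zero_smul]
  obtain h | ⟨ns, h1, h2, h3⟩ := X.toDGA.exists_degrees l hl
  · rw [h]; simp
  have hlen : 0 < l.length := List.length_pos_iff.2 hne
  induction b using graded_induction (𝒜 := 𝒜) with
  | h0 => simp
  | ha a b h1 h2 => rw [map_add, map_add, h1, h2, add_zero]
  | hm n b hb =>
    have hm := X.E_mem ns _ h1 n b hb (ns.sum + n - l.length) (by rw [List.length_map]; omega)
    exact mem_pos_iff.1 (mem_pos_of_mem hm (by omega))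

theorem HGAlgebra.E_mem_homog (X : HGAlgebra 𝒜) {R : Subalgebra k A} (l : List (Letter 𝒜 R))
    {p : ZMod 2} {b : A} (hb : b ∈ homog 𝒜 p) : X.E (wd l) b ∈ homog 𝒜 (ep l + p) := by
  simpa using operation_mem_homog X.toDGA 0 zero_le_one
    (fun ns l h n b hb _ m hm => X.E_mem ns l h n b hb m hm)
    (fun p b hb => by simpa [X.E_one] using hb) l hb

theorem HGAlgebra.actsOn (X : HGAlgebra 𝒜) (R : Subalgebra k A) (hR : ∀ a ∈ R, X.d a ∈ R) :
    ActsOn X.toDGA X.E R where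
  d_mem := hR
  E_one b _ := X.E_one b
  E_homog l p b _ hb := X.E_mem_homog l hb
  E_pos l b _ hb := by
    rw [mem_pos_iff] at hb ⊢
    rw [X.proj_E, hb, smul_zero]
  d_E l p b hbR hb := by
    clear hbR
    induction hb using homog_induction with
    | h0 => simp [splitSum_zero]
    | ha a b _ _ h1 h2 =>
      simp only [map_add, mul_add, add_mul, smul_add, splitSum_add, h1, h2]
      abel
    | hm n b hb hn =>
      rw [X.d_E n b hb, cut_wd, cut_wd, sgnBar_wd, map_smul, LinearMap.smul_apply, ← splitSum_smul]
      simp only [LinearMap.compl₁₂_apply, LinearMap.comp_apply, LinearMap.flip_apply, sgnBar_wd,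
        sgnBar_pow_wd, map_smul, LinearMap.smul_apply, LinearMap.mul_apply', tau_wd, smul_smul,
        ← sign_natCast, ← sign_add, ← hn]
      congr 1
      refine splitSum_congr fun x y _ => ?_
      congr 2
      push_cast; ring
  E_mul l p b hbR hb c _ := by
    clear hbR
    induction hb using homog_induction with
    | h0 => simp [splitSum_zero]
    | ha a b _ _ h1 h2 => simp only [add_mul, map_add, smul_add, splitSum_add, h1, h2]
    | hm n b hb hn =>
      rw [X.E_mul n b hb, cut_wd]
      simp only [LinearMap.compl₁₂_apply, LinearMap.comp_apply, LinearMap.flip_apply,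
        sgnBar_pow_wd, map_smul, LinearMap.mul_apply', ← hn]

variable {X : HGAlgebra 𝒜} {X' : HGAlgebra 𝒜'} {f : DGAHom X.toDGA X'.toDGA}
  (H : EHomotopy X X' f) {R : Subalgebra k A} (l : List (Letter 𝒜 R)) {p : ZMod 2} {b : A}

theorem EHomotopy.s_mem_homog (hb : b ∈ homog 𝒜 p) :
    H.s (wd l) b ∈ homog 𝒜' (ep l + p + 1) := by
  simpa using operation_mem_homog X.toDGA 1 le_rfl
    (fun ns l h n b hb _ m hm => H.s_mem ns l h n b hb m hm)
    (fun p b hb => by simp [H.s_one]) l hb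

theorem EHomotopy.s_mul_wd (hb : b ∈ homog 𝒜 p) (c : A) : H.s (wd l) (b * c) =
    (splitSum l fun x y => sign k (p + ep x + p * ep y) •
      (X'.E (f.onBar (wd x)) (f.toFun b) * H.s (wd y) c)) +
    splitSum l fun x y => sign k (p * ep y) • (H.s (wd x) b * f.toFun (X.E (wd y) c)) := by
  induction hb using homog_induction with
  | h0 => simp [splitSum_zero]
  | ha a b _ _ h1 h2 => simp only [add_mul, map_add, smul_add, splitSum_add, h1, h2]; abel
  | hm n b hb hn =>
    rw [H.s_mul n b hb, cut_wd, cut_wd, ← splitSum_smul]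
    simp only [LinearMap.compl₁₂_apply, LinearMap.comp_apply, LinearMap.flip_apply, sgnBar_wd,
      sgnBar_pow_wd, map_smul, LinearMap.smul_apply, LinearMap.mul_apply', ← hn,
      AlgHom.toLinearMap_apply, smul_smul, ← sign_natCast, ← sign_add]
    congr 1
    refine splitSum_congr fun x y _ => ?_
    congr 2
    ring

theorem EHomotopy.homotopy_wd (hb : b ∈ homog 𝒜 p) :
    f.toFun (X.E (wd l) b) - X'.E (f.onBar (wd l)) (f.toFun b) =
      H.s (barD X.toDGA (wd l)) b - sign k (ep l) • H.s (wd l) (X.d b) - X'.d (H.s (wd l) b) -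
      (splitSum l fun x y => f.toFun (tl x) * H.s (wd y) b) -
      splitSum l fun x y => sign k (p + ep x + (p + 1) * ep y) •
        (H.s (wd x) b * f.toFun (tl y)) := by
  induction hb using homog_induction with
  | h0 => simp [splitSum_zero]
  | ha a b _ _ h1 h2 =>
    rw [map_add, map_add, map_add, map_add, add_sub_add_comm, h1, h2]
    simp only [map_add, mul_add, add_mul, smul_add, splitSum_add]
    abel
  | hm n b hb hn =>
    rw [H.homotopy n b hb, cut_wd, cut_wd, ← splitSum_smul]
    simp only [LinearMap.compl₁₂_apply, LinearMap.comp_apply, LinearMap.flip_apply, sgnBar_wd,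
      sgnBar_pow_wd, map_smul, LinearMap.smul_apply, LinearMap.mul_apply', ← hn, tau_wd,
      AlgHom.toLinearMap_apply, smul_smul, ← sign_natCast, ← sign_add]
    have e : (splitSum l fun x y => sign k ((n : ZMod 2) + (((n + 1 : ℕ) : ZMod 2) * ep y + ep x)) •
        (H.s (wd x) b * f.toFun (tl y))) = splitSum l fun x y =>
        sign k ((n : ZMod 2) + ep x + ((n : ZMod 2) + 1) * ep y) •
        (H.s (wd x) b * f.toFun (tl y)) := splitSum_congr fun x y _ => by
      congr 2; push_cast; ring
    rw [e]
    abel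

/-- Once shorter words are known to give zero, the product rule for `1 = 1 · 1` reads `s(w; 1) =
s(w; 1) + s(w; 1)`. -/
theorem EHomotopy.s_wd_one : H.s (wd l) 1 = 0 := by
  induction h : l.length using Nat.strong_induction_on generalizing l with
  | _ n ih =>
    rcases eq_or_ne l [] with rfl | hne
    · exact H.s_one 1
    have e := H.s_mul_wd l one_mem_homog 1
    rw [splitSum_eq_right, splitSum_eq_left] at e
    · simpa [X'.E_one, X.E_one] using e
    · intro x y hxy hy
      rw [ih x.length (by
        rw [← h, ← hxy, List.length_append]
        have := List.length_pos_iff.2 hy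
        omega) x rfl]
      simp
    · intro x y hxy hx
      rw [ih y.length (by
        rw [← h, ← hxy, List.length_append]
        have := List.length_pos_iff.2 hx
        omega) y rfl]
      simp

/-- For a nonempty word, letters of degree at least two make the degree of `s(w; b)` at least that
of `b`. Elements `b` of degree zero are scalars and are handled by `s_wd_one`. -/
theorem EHomotopy.s_mem_pos (w : Bar 𝒜) (b : A) : H.s w b ∈ Pos 𝒜' := by
  refine mem_of_wd_mem (S := (Pos 𝒜').comap (H.s.flip b)) (fun l hl => ?_) w
  rw [Submodule.mem_comap, LinearMap.flip_apply]
  rcases eq_or_ne l [] with rfl | hne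
  · rw [wd_nil, H.s_one]; exact zero_mem _
  obtain h | ⟨ns, h1, h2, h3⟩ := X.toDGA.exists_degrees l hl
  · rw [h]; simp
  have hlen : 0 < l.length := List.length_pos_iff.2 hne
  induction b using graded_induction (𝒜 := 𝒜) with
  | h0 => simp
  | ha a b h1 h2 => rw [map_add]; exact add_mem h1 h2
  | hm n b hb =>
    rcases eq_or_ne n 0 with rfl | hn
    · obtain ⟨c, rfl⟩ := X.degree_zero b hb
      rw [Algebra.algebraMap_eq_smul_one, map_smul, H.s_wd_one, smul_zero]
      exact zero_mem _
    · exact mem_pos_of_mem (H.s_mem ns _ h1 n b hb (ns.sum + n - (l.length + 1))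
        (by rw [List.length_map]; omega)) (by omega)

end HGAlgebra

/-! ### Products on homology -/

section HomologyProduct

variable {k M : Type*} [CommRing k] [AddCommGroup M] [Module k M] {d : M →ₗ[k] M}

theorem Homology.mk_eq_zero_iff (x : M) (hx : d x = 0) :
    Homology.mk d x hx = 0 ↔ ∃ y, d y = x := by
  rw [Homology.mk, Submodule.Quotient.mk_eq_zero]
  exact Iff.rfl

theorem Homology.mk_eq_mk_iff {x y : M} (hx : d x = 0) (hy : d y = 0) :
    Homology.mk d x hx = Homology.mk d y hy ↔ ∃ z, d z = x - y := by
  rw [Homology.mk, Homology.mk, Submodule.Quotient.eq]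
  exact Iff.rfl

theorem Homology.exists_mk (a : Homology d) : ∃ x hx, a = Homology.mk d x hx := by
  obtain ⟨⟨x, hx⟩, rfl⟩ := Submodule.Quotient.mk_surjective _ a
  exact ⟨x, hx, rfl⟩

/-- A bilinear product on a complex that preserves cycles and boundaries induces a unique product
on homology. -/
theorem existsUnique_homology_product (B : M →ₗ[k] M →ₗ[k] M)
    (h : ∀ x y, d x = 0 → d y = 0 → d (B x y) = 0)
    (hl : ∀ x y, d y = 0 → ∃ z, d z = B (d x) y) (hr : ∀ x y, d x = 0 → ∃ z, d z = B x (d y)) :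
    ∃! m : Homology d →ₗ[k] Homology d →ₗ[k] Homology d,
      ∀ (x y : M) (hx : d x = 0) (hy : d y = 0), ∃ h : d (B x y) = 0,
        m (Homology.mk _ x hx) (Homology.mk _ y hy) = Homology.mk _ (B x y) h := by
  let φ : LinearMap.ker d →ₗ[k] LinearMap.ker d →ₗ[k] Homology d :=
    LinearMap.mk₂ k (fun x y => Homology.mk d (B x y) (h _ _ x.2 y.2))
      (fun x x' y => by
        refine (Homology.mk_eq_mk_iff (d := d) (y := B x y + B x' y) _ ?_).2 ⟨0, by simp⟩ |>.trans ?_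
        · simp [h _ _ x.2 y.2, h _ _ x'.2 y.2]
        · rfl)
      (fun c x y => by
        refine (Homology.mk_eq_mk_iff (d := d) (y := c • B x y) _ ?_).2 ⟨0, by simp⟩ |>.trans ?_
        · simp [h _ _ x.2 y.2]
        · rfl)
      (fun x y y' => by
        refine (Homology.mk_eq_mk_iff (d := d) (y := B x y + B x y') _ ?_).2 ⟨0, by simp⟩ |>.trans ?_
        · simp [h _ _ x.2 y.2, h _ _ x.2 y'.2]
        · rfl)
      (fun c x y => by
        refine (Homology.mk_eq_mk_iff (d := d) (y := c • B x y) _ ?_).2 ⟨0, by simp⟩ |>.trans ?_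
        · simp [h _ _ x.2 y.2]
        · rfl)
  let ψ : Homology d →ₗ[k] LinearMap.ker d →ₗ[k] Homology d :=
    Submodule.liftQ _ φ (by
      rintro ⟨x, hx⟩ ⟨y, hy⟩
      refine LinearMap.ext fun z => ?_
      have hy : d y = x := hy
      subst hy
      exact (Homology.mk_eq_zero_iff (B (d y) z) (h _ _ hx z.2)).2 (hl y z z.2))
  let m : Homology d →ₗ[k] Homology d →ₗ[k] Homology d :=
    (Submodule.liftQ _ ψ.flip (by
      rintro ⟨x, hx⟩ ⟨y, hy⟩
      refine LinearMap.ext fun a => ?_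
      obtain ⟨z, hz, rfl⟩ := Homology.exists_mk a
      have hy : d y = x := hy
      subst hy
      exact (Homology.mk_eq_zero_iff (B z (d y)) (h _ _ hz hx)).2 (hr z y hz))).flip
  refine ⟨m, fun x y hx hy => ⟨h x y hx hy, rfl⟩, fun m' hm' => ?_⟩
  refine LinearMap.ext fun a => LinearMap.ext fun b => ?_
  obtain ⟨x, hx, rfl⟩ := Homology.exists_mk a
  obtain ⟨y, hy, rfl⟩ := Homology.exists_mk b
  obtain ⟨_, e⟩ := hm' x y hx hy
  exact e

end HomologyProduct

/-! ### The product on Hochschild homology -/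

section Product

variable {k A : Type*} [CommRing k] [Ring A] [Algebra k A]
variable {𝒜 : ℕ → Submodule k A} [GradedAlgebra 𝒜]

/-- The identity as a dga map. -/
def DGAHom.id (D : DGA 𝒜) : DGAHom D D where
  toFun := AlgHom.id k A
  map_mem _ _ h := h
  map_d _ := rfl

theorem DGAHom.onBar_id (D : DGA 𝒜) (w : Bar 𝒜) : (DGAHom.id D).onBar w = w := by
  induction w using bar_induction with
  | h1 => simp
  | hl a w h => rw [map_mul, DGAHom.onBar_letter, h]; rfl
  | hadd x y hx hy => rw [map_add, hx, hy]
  | hsmul c x hx => rw [map_smul, hx]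

theorem DGAHom.onHoch_id (D : DGA 𝒜) (z : Hoch 𝒜) : (DGAHom.id D).onHoch z = z := by
  induction z using TensorProduct.induction_on with
  | zero => simp
  | add x y hx hy => rw [map_add, hx, hy]
  | tmul u w => rw [DGAHom.onHoch_tmul, DGAHom.onBar_id]; rfl

/-- The Leibniz rule for the identity map of `A`, whose image is all of `A`, shows that `λ_E`
preserves cycles and boundaries. -/
theorem HGAlgebra.existsUnique_product (X : HGAlgebra 𝒜) : ∃! m, IsInducedProduct X m := by
  have hE := X.actsOn (DGAHom.id X.toDGA).toFun.range (by
    rintro _ ⟨a, rfl⟩; exact ⟨X.d a, rfl⟩)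
  refine existsUnique_homology_product (lam X.E) (fun x y hx hy => ?_) (fun x y hy => ?_)
    (fun x y hx => ?_)
  · simpa only [DGAHom.onHoch_id] using (DGAHom.id X.toDGA).hochD_lam_of_cycle hE hx hy
  · have := (DGAHom.id X.toDGA).lam_hochD_left hE x hy
    simp only [DGAHom.onHoch_id] at this
    exact ⟨_, this.symm⟩
  · have := (DGAHom.id X.toDGA).lam_hochD_right hE y hx
    simp only [DGAHom.onHoch_id] at this
    exact ⟨_, this.symm⟩

end Product

/-! ### Naturality of the product under strict maps -/

section Naturality

variable {k A P Q : Type*} [CommRing k] [Ring A] [Algebra k A] [Ring P] [Algebra k P]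
  [Ring Q] [Algebra k Q]
variable {𝒜 : ℕ → Submodule k A} [GradedAlgebra 𝒜]
variable {𝒞 : ℕ → Submodule k P} [GradedAlgebra 𝒞]
variable {𝒬 : ℕ → Submodule k Q} [GradedAlgebra 𝒬]
variable {DA : DGA 𝒜} {DP : DGA 𝒞} {DQ : DGA 𝒬}

/-- The composition of dga maps. -/
def DGAHom.comp (g : DGAHom DP DQ) (f : DGAHom DA DP) : DGAHom DA DQ where
  toFun := g.toFun.comp f.toFun
  map_mem n a h := g.map_mem n _ (f.map_mem n a h)
  map_d a := by rw [AlgHom.comp_apply, f.map_d, g.map_d]; rfl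

variable (g : DGAHom DP DQ) (f : DGAHom DA DP)

theorem DGAHom.onBar_comp (w : Bar 𝒜) : (g.comp f).onBar w = g.onBar (f.onBar w) := by
  induction w using bar_induction with
  | h1 => simp
  | hl a w h => rw [map_mul, DGAHom.onBar_letter, h, map_mul, map_mul, f.onBar_letter,
      g.onBar_letter]; rfl
  | hadd x y hx hy => rw [map_add, map_add, map_add, hx, hy]
  | hsmul c x hx => rw [map_smul, map_smul, map_smul, hx]

theorem DGAHom.onHoch_comp (z : Hoch 𝒜) : (g.comp f).onHoch z = g.onHoch (f.onHoch z) := by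
  induction z using TensorProduct.induction_on with
  | zero => simp
  | add x y hx hy => rw [map_add, map_add, map_add, hx, hy]
  | tmul u w => rw [DGAHom.onHoch_tmul, DGAHom.onBar_comp]; rfl

theorem DGAHom.onHH_mk (x : Hoch 𝒜) (hx : hochD DA x = 0) :
    f.onHH (Homology.mk _ x hx) = Homology.mk _ (f.onHoch x) (by rw [← f.hochD_map, hx, map_zero]) :=
  rfl

variable {EP : Bar 𝒞 →ₗ[k] P →ₗ[k] P} {EQ : Bar 𝒬 →ₗ[k] Q →ₗ[k] Q}

variable (h : ∀ (l : List (Letter 𝒜 (⊤ : Subalgebra k A))) (b : A),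
    g.toFun (EP (f.onBar (wd l)) (f.toFun b)) =
      EQ (g.onBar (f.onBar (wd l))) (g.toFun (f.toFun b)))
include h

/-- Compatibility of the operations is assumed only for arguments coming from `A`. This suffices,
because `μ_E` and `λ_E` evaluate `E` on the entries of the given words and never on values of `E`.
-/
theorem DGAHom.onBar_mu (l m : List (Letter 𝒜 (⊤ : Subalgebra k A))) :
    g.onBar (mu EP (wd (l.map f.mapLetter)) (wd (m.map f.mapLetter))) =
      mu EQ (wd (l.map (g.comp f).mapLetter)) (wd (m.map (g.comp f).mapLetter)) := by
  induction m generalizing l with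
  | nil => simp only [List.map_nil, wd_nil, mu_one_right, f.wd_map, (g.comp f).wd_map,
      DGAHom.onBar_comp]
  | cons b m ih =>
    rw [List.map_cons, List.map_cons, mu_cons, mu_cons]
    simp only [splitSum₃, splitSum_map, map_splitSum, map_smul, map_mul, ih, g.onBar_letter,
      f.ep_map, (g.comp f).ep_map]
    refine splitSum_congr fun x _ _ => splitSum_congr fun y z _ => ?_
    have hb : g.toFun (EP (wd (y.map f.mapLetter)) (f.mapLetter b).val) =
        EQ (wd (y.map (g.comp f).mapLetter)) ((g.comp f).mapLetter b).val := by
      rw [f.wd_map, (g.comp f).wd_map, DGAHom.onBar_comp]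
      exact h y b.val
    rw [hb]
    simp only [f.wd_map, (g.comp f).wd_map, DGAHom.onBar_comp]
    rfl

theorem DGAHom.onHoch_lamK {v : A} {p : ZMod 2} (hv : v ∈ homog 𝒜 p)
    (l m : List (Letter 𝒜 (⊤ : Subalgebra k A))) :
    g.onHoch (lamK EP (wd (l.map f.mapLetter)) (f.toFun v) (wd (m.map f.mapLetter))) =
      lamK EQ (wd (l.map (g.comp f).mapLetter)) ((g.comp f).toFun v)
        (wd (m.map (g.comp f).mapLetter)) := by
  rw [lamK_wd EP (f.map_mem_homog hv), lamK_wd EQ ((g.comp f).map_mem_homog hv)]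
  simp only [splitSum_map, map_splitSum, map_smul, g.onHoch_tmul, g.onBar_mu f h, f.ep_map,
    (g.comp f).ep_map]
  refine splitSum_congr fun x y _ => ?_
  congr 2
  rw [f.wd_map, (g.comp f).wd_map, DGAHom.onBar_comp]
  exact h x v

theorem DGAHom.onHoch_lam (x y : Hoch 𝒜) :
    g.onHoch (lam EP (f.onHoch x) (f.onHoch y)) =
      lam EQ ((g.comp f).onHoch x) ((g.comp f).onHoch y) := by
  let Φ : Hoch 𝒜 →ₗ[k] Hoch 𝒜 →ₗ[k] Hoch 𝒬 :=
    ((lam EP).compl₁₂ f.onHoch f.onHoch).compr₂ g.onHoch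
  let Ψ : Hoch 𝒜 →ₗ[k] Hoch 𝒜 →ₗ[k] Hoch 𝒬 :=
    (lam EQ).compl₁₂ (g.comp f).onHoch (g.comp f).onHoch
  refine hoch_mem_of_tmul_wd_mem DA (S := LinearMap.eqLocus (Φ x) (Ψ x)) (fun v p hv m => ?_) y
  refine hoch_mem_of_tmul_wd_mem DA (S := LinearMap.eqLocus (Φ.flip (v ⊗ₜ wd m))
    (Ψ.flip (v ⊗ₜ wd m))) (fun u q hu l => ?_) x
  have hu' := homog_of_eq_one_or hu
  have hv' := homog_of_eq_one_or hv
  rw [LinearMap.mem_eqLocus]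
  simp only [LinearMap.flip_apply, Φ, Ψ, LinearMap.compl₁₂_apply, LinearMap.compr₂_apply,
    DGAHom.onHoch_tmul, ← DGAHom.wd_map]
  rw [lam_wd EP (f.map_mem_homog hu') (f.map_mem_homog hv'),
    lam_wd EQ ((g.comp f).map_mem_homog hu') ((g.comp f).map_mem_homog hv')]
  simp only [splitSum₃, splitSum_map, map_splitSum, map_smul, map_add, g.act_map,
    g.onHoch_lamK f h hv', f.ep_map, (g.comp f).ep_map]
  congr 1
  refine splitSum_congr fun x _ _ => splitSum_congr fun y z _ => splitSum_congr fun s t _ => ?_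
  congr 3
  -- For `u = 1` both words contain a zero letter. Otherwise `z u x` is a word in letters coming
  -- from `A`, and the hypothesis applies to it.
  obtain ⟨rfl, rfl⟩ | ⟨c, rfl, rfl⟩ := hu
  · simp [letter_one]
  · have h' := h (z ++ c :: x) (tl t)
    simp only [wd_append, wd_cons, map_mul, DGAHom.onBar_letter] at h'
    simp only [f.tl_map, f.wd_map, (g.comp f).wd_map, (g.comp f).tl_map, DGAHom.onBar_comp,
      mul_assoc]
    exact h'

end Naturality

/-! ### Quasi-isomorphisms -/

section QuasiIso

variable {k L L' L'' : Type*} [CommRing k] [AddCommGroup L] [Module k L]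
  [AddCommGroup L'] [Module k L'] [AddCommGroup L''] [Module k L'']

/-- The mapping cone of `φ : (L, d) → (L', d')` is acyclic. -/
def IsQuasiIso (d : Module.End k L) (d' : Module.End k L') (φ : L →ₗ[k] L') : Prop :=
  ∀ x y, d x = 0 → d' y = φ x → ∃ z w, d z = x ∧ φ z + d' w = y

variable {d : Module.End k L} {d' : Module.End k L'} {d'' : Module.End k L''}
  {φ : L →ₗ[k] L'} {ψ : L' →ₗ[k] L''}

theorem IsQuasiIso.bijective (h : IsQuasiIso d d' φ) (hφ : ∀ x, φ (d x) = d' (φ x)) :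
    Function.Bijective (Homology.map φ hφ) := by
  constructor
  · refine (injective_iff_map_eq_zero _).2 fun a ha => ?_
    obtain ⟨x, hx, rfl⟩ := Homology.exists_mk a
    obtain ⟨y, hy⟩ := (Homology.mk_eq_zero_iff (φ x) (by rw [← hφ, hx, map_zero])).1 ha
    obtain ⟨z, w, hz, -⟩ := h x y hx hy
    exact (Homology.mk_eq_zero_iff x hx).2 ⟨z, hz⟩
  · intro b
    obtain ⟨y, hy, rfl⟩ := Homology.exists_mk b
    obtain ⟨z, w, hz, hw⟩ := h 0 y (map_zero _) (by rw [hy, map_zero])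
    refine ⟨Homology.mk d z hz, ?_⟩
    refine (Homology.mk_eq_mk_iff (d := d') (x := φ z) (by rw [← hφ, hz, map_zero]) hy).2
      ⟨-w, by rw [map_neg, ← hw]; abel⟩

theorem isQuasiIso_of_bijective (hφ : ∀ x, φ (d x) = d' (φ x))
    (h : Function.Bijective (Homology.map φ hφ)) : IsQuasiIso d d' φ := by
  intro x y hx hy
  have h0 : Homology.mk d x hx = 0 := h.1 (by
    rw [map_zero]
    exact (Homology.mk_eq_zero_iff (φ x) (by rw [← hφ, hx, map_zero])).2 ⟨y, hy⟩)
  obtain ⟨z, hz⟩ := (Homology.mk_eq_zero_iff x hx).1 h0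
  have hc : d' (y - φ z) = 0 := by rw [map_sub, hy, ← hφ, hz, sub_self]
  obtain ⟨a, ha⟩ := h.2 (Homology.mk d' _ hc)
  obtain ⟨t, ht, rfl⟩ := Homology.exists_mk a
  obtain ⟨w, hw⟩ := (Homology.mk_eq_mk_iff (d := d') (x := φ t)
    (by rw [← hφ, ht, map_zero]) hc).1 ha
  exact ⟨z + t, -w, by rw [map_add, ht, hz, add_zero], by rw [map_neg, hw, map_add]; abel⟩

/-- A quasi-isomorphism of complexes stays one after tensoring with a flat module. -/
theorem IsQuasiIso.rTensor (h : IsQuasiIso d d' φ) (hφ : ∀ x, φ (d x) = d' (φ x))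
    (hd : ∀ x, d (d x) = 0) (hd' : ∀ y, d' (d' y) = 0) (C : Type*) [AddCommGroup C] [Module k C]
    [Module.Flat k C] :
    IsQuasiIso (LinearMap.rTensor C d) (LinearMap.rTensor C d') (φ.rTensor C) := by
  -- The differential of the mapping cone. Its exactness is the quasi-isomorphism property, with `w`
  -- entering with the opposite sign, and tensoring with a flat module preserves exactness.
  let D : Module.End k (L × L') :=
    (d ∘ₗ LinearMap.fst k L L').prod (φ ∘ₗ LinearMap.fst k L L' - d' ∘ₗ LinearMap.snd k L L')
  have hD : Function.Exact D D := by
    rintro ⟨x, y⟩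
    constructor
    · intro e
      obtain ⟨z, w, hz, hw⟩ := h x y (congrArg Prod.fst e) (sub_eq_zero.1 (congrArg Prod.snd e)).symm
      exact ⟨(z, -w), Prod.ext hz (by rw [← hw]; simp [D])⟩
    · rintro ⟨⟨z, w⟩, e⟩
      rw [← e]
      exact Prod.ext (by simp [D, hd]) (by simp [D, hφ, hd'])
  have hDC := Module.Flat.rTensor_exact C hD
  intro x y hx hy
  have e1 : D ∘ₗ LinearMap.inl k L L' = LinearMap.inl k L L' ∘ₗ d + LinearMap.inr k L L' ∘ₗ φ := by
    ext <;> simp [D]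
  have e2 : D ∘ₗ LinearMap.inr k L L' = -(LinearMap.inr k L L' ∘ₗ d') := by
    ext <;> simp [D]
  have e3 : LinearMap.fst k L L' ∘ₗ D = d ∘ₗ LinearMap.fst k L L' := by
    ext <;> simp [D]
  have e4 : LinearMap.snd k L L' ∘ₗ D = φ ∘ₗ LinearMap.fst k L L' - d' ∘ₗ LinearMap.snd k L L' := by
    ext <;> simp [D]
  obtain ⟨Z, hZ⟩ := (hDC ((LinearMap.inl k L L').rTensor C x +
    (LinearMap.inr k L L').rTensor C y)).1 (by
      rw [map_add, ← LinearMap.comp_apply, ← LinearMap.rTensor_comp, ← LinearMap.comp_apply,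
        ← LinearMap.rTensor_comp, e1, e2, LinearMap.rTensor_add, LinearMap.rTensor_neg,
        LinearMap.rTensor_comp, LinearMap.rTensor_comp, LinearMap.rTensor_comp]
      simp [hx, hy])
  have h1 := congrArg ((LinearMap.fst k L L').rTensor C) hZ
  have h2 := congrArg ((LinearMap.snd k L L').rTensor C) hZ
  rw [← LinearMap.comp_apply, ← LinearMap.rTensor_comp, e3, map_add, ← LinearMap.comp_apply,
    ← LinearMap.rTensor_comp, ← LinearMap.comp_apply, ← LinearMap.rTensor_comp] at h1
  rw [← LinearMap.comp_apply, ← LinearMap.rTensor_comp, e4, map_add, ← LinearMap.comp_apply,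
    ← LinearMap.rTensor_comp, ← LinearMap.comp_apply, ← LinearMap.rTensor_comp,
    LinearMap.rTensor_sub, LinearMap.rTensor_comp, LinearMap.rTensor_comp] at h2
  rw [LinearMap.rTensor_comp] at h1
  simp only [LinearMap.fst_comp_inl, LinearMap.fst_comp_inr, LinearMap.rTensor_id,
    LinearMap.rTensor_zero, LinearMap.id_apply, LinearMap.zero_apply, add_zero] at h1
  simp only [LinearMap.snd_comp_inl, LinearMap.snd_comp_inr, LinearMap.rTensor_id,
    LinearMap.rTensor_zero, LinearMap.id_apply, LinearMap.zero_apply, zero_add] at h2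
  refine ⟨_, -((LinearMap.snd k L L').rTensor C Z), h1, ?_⟩
  rw [← h2, map_neg]
  simp [sub_eq_add_neg]

theorem IsQuasiIso.lTensor (h : IsQuasiIso d d' φ) (hφ : ∀ x, φ (d x) = d' (φ x))
    (hd : ∀ x, d (d x) = 0) (hd' : ∀ y, d' (d' y) = 0) (C : Type*) [AddCommGroup C] [Module k C]
    [Module.Flat k C] :
    IsQuasiIso (LinearMap.lTensor C d) (LinearMap.lTensor C d') (φ.lTensor C) := by
  have h' := h.rTensor hφ hd hd' C
  intro x y hx hy
  obtain ⟨z, w, hz, hw⟩ := h' (TensorProduct.comm k C L x) (TensorProduct.comm k C L' y)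
    (by rw [← LinearMap.comm_comp_lTensor_comp_comm_eq]; simpa using hx)
    (by rw [← LinearMap.comm_comp_lTensor_comp_comm_eq, ← LinearMap.comm_comp_lTensor_comp_comm_eq]
        simpa using hy)
  refine ⟨TensorProduct.comm k L C z, TensorProduct.comm k L' C w, ?_, ?_⟩
  · apply (TensorProduct.comm k C L).injective
    rw [← hz, ← LinearMap.comm_comp_lTensor_comp_comm_eq]; simp
  · apply (TensorProduct.comm k C L').injective
    rw [← hw, ← LinearMap.comm_comp_lTensor_comp_comm_eq, ← LinearMap.comm_comp_lTensor_comp_comm_eq]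
    simp

/-- Twisting the differentials by commuting involutions preserves quasi-isomorphisms. -/
theorem IsQuasiIso.twist (h : IsQuasiIso d d' φ) (S : Module.End k L) (S' : Module.End k L')
    (hS : ∀ x, S (S x) = x) (hS' : ∀ x, S' (S' x) = x) (hSd : ∀ x, S (d x) = d (S x))
    (hSd' : ∀ x, S' (d' x) = d' (S' x)) (hSφ : ∀ x, S' (φ x) = φ (S x)) :
    IsQuasiIso (d ∘ₗ S) (d' ∘ₗ S') φ := by
  intro x y hx hy
  simp only [LinearMap.comp_apply] at hx hy ⊢
  obtain ⟨z, w, hz, hw⟩ := h x (S' y) (by rw [← hS (d x), hSd, hx, map_zero]) hy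
  refine ⟨S z, w, by rw [hS, hz], ?_⟩
  rw [← hS' y, ← hw, map_add, hSφ, hSd']

end QuasiIso

/-! ### Weights and leading terms -/

section Weight

/-- An exhaustive decomposition of a module, indexed by the natural numbers, given by its
projections. -/
structure Weight (k L : Type*) [CommRing k] [AddCommGroup L] [Module k L] where
  -- Integer indices, with zero projections in negative weights, permit shifts in both directions.
  q : ℤ → Module.End k L
  q_neg : ∀ j < 0, q j = 0
  orth : ∀ i j x, q i (q j x) = if i = j then q i x else 0
  complete : ∀ x, ∃ N : ℕ, ∀ n ≥ N, ∑ j ∈ Finset.range n, q j x = x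

variable {k L L' : Type*} [CommRing k] [AddCommGroup L] [Module k L]
  [AddCommGroup L'] [Module k L']

namespace Weight

theorem q_self (W : Weight k L) (j : ℤ) (x : L) : W.q j (W.q j x) = W.q j x := by
  rw [W.orth, if_pos rfl]

theorem bounded (W : Weight k L) (x : L) : ∃ N : ℕ, ∀ j : ℤ, N ≤ j → W.q j x = 0 := by
  obtain ⟨N, hN⟩ := W.complete x
  refine ⟨N, fun j hj => ?_⟩
  rw [← hN N le_rfl, map_sum]
  refine Finset.sum_eq_zero fun i hi => ?_
  rw [W.orth, if_neg]
  have := Finset.mem_range.1 hi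
  omega

theorem eq_zero (W : Weight k L) {x : L} (h : ∀ j ≥ 0, W.q j x = 0) : x = 0 := by
  obtain ⟨N, hN⟩ := W.complete x
  rw [← hN N le_rfl]
  exact Finset.sum_eq_zero fun i _ => h _ (by positivity)

/-- The weight of the second factor of a tensor product. -/
def lTensor (W : Weight k L) (M : Type*) [AddCommGroup M] [Module k M] : Weight k (M ⊗[k] L) where
  q j := LinearMap.lTensor M (W.q j)
  q_neg j hj := by rw [W.q_neg j hj, LinearMap.lTensor_zero]
  orth i j x := by
    rw [← LinearMap.comp_apply, ← LinearMap.lTensor_comp]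
    split_ifs with h
    · subst h
      rw [show W.q i ∘ₗ W.q i = W.q i from LinearMap.ext fun x => W.q_self i x]
    · rw [show W.q i ∘ₗ W.q j = 0 from LinearMap.ext fun x => by
        rw [LinearMap.comp_apply, W.orth, if_neg h]; rfl, LinearMap.lTensor_zero]
      rfl
  complete x := by
    induction x using TensorProduct.induction_on with
    | zero => exact ⟨0, by simp⟩
    | tmul m x =>
      obtain ⟨N, hN⟩ := W.complete x
      exact ⟨N, fun n hn => by
        simp only [LinearMap.lTensor_tmul, ← TensorProduct.tmul_sum, hN n hn]⟩
    | add x y hx hy =>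
      obtain ⟨N, hN⟩ := hx
      obtain ⟨N', hN'⟩ := hy
      exact ⟨max N N', fun n hn => by
        simp only [map_add, Finset.sum_add_distrib, hN n ((le_max_left _ _).trans hn),
          hN' n ((le_max_right _ _).trans hn)]⟩

/-- The weight of the first factor of a tensor product. -/
def rTensor (W : Weight k L) (M : Type*) [AddCommGroup M] [Module k M] : Weight k (L ⊗[k] M) where
  q j := LinearMap.rTensor M (W.q j)
  q_neg j hj := by rw [W.q_neg j hj, LinearMap.rTensor_zero]
  orth i j x := by
    rw [← LinearMap.comp_apply, ← LinearMap.rTensor_comp]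
    split_ifs with h
    · subst h
      rw [show W.q i ∘ₗ W.q i = W.q i from LinearMap.ext fun x => W.q_self i x]
    · rw [show W.q i ∘ₗ W.q j = 0 from LinearMap.ext fun x => by
        rw [LinearMap.comp_apply, W.orth, if_neg h]; rfl, LinearMap.rTensor_zero]
      rfl
  complete x := by
    induction x using TensorProduct.induction_on with
    | zero => exact ⟨0, by simp⟩
    | tmul x m =>
      obtain ⟨N, hN⟩ := W.complete x
      exact ⟨N, fun n hn => by
        simp only [LinearMap.rTensor_tmul, ← TensorProduct.sum_tmul, hN n hn]⟩
    | add x y hx hy =>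
      obtain ⟨N, hN⟩ := hx
      obtain ⟨N', hN'⟩ := hy
      exact ⟨max N N', fun n hn => by
        simp only [map_add, Finset.sum_add_distrib, hN n ((le_max_left _ _).trans hn),
          hN' n ((le_max_right _ _).trans hn)]⟩

/-- The projection to a homogeneous part, zero in negative degrees. -/
def decompositionProj (ℳ : ℕ → Submodule k L) [DirectSum.Decomposition ℳ] (j : ℤ) :
    Module.End k L :=
  if 0 ≤ j then (ℳ j.toNat).subtype ∘ₗ DirectSum.component k ℕ (fun i => ℳ i) j.toNat ∘ₗ
    (DirectSum.decomposeLinearEquiv ℳ).toLinearMap else 0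

variable (ℳ : ℕ → Submodule k L) [DirectSum.Decomposition ℳ]

theorem decompositionProj_natCast (j : ℕ) (x : L) :
    decompositionProj ℳ j x = (DirectSum.decompose ℳ x j : L) := by
  rw [decompositionProj, if_pos (by positivity)]
  rfl

theorem decompositionProj_of_neg {j : ℤ} (hj : j < 0) : decompositionProj ℳ j = 0 :=
  if_neg (by omega)

variable {ℳ} in
theorem decompositionProj_of_mem {n : ℕ} {x : L} (hx : x ∈ ℳ n) (j : ℤ) :
    decompositionProj ℳ j x = if j = n then x else 0 := by
  rcases lt_or_ge j 0 with hj | hj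
  · rw [decompositionProj_of_neg ℳ hj, if_neg (by omega)]; rfl
  lift j to ℕ using hj
  rw [decompositionProj_natCast]
  split_ifs with h
  · rw [Nat.cast_inj] at h
    rw [h, DirectSum.decompose_of_mem_same ℳ hx]
  · rw [Nat.cast_inj] at h
    rw [DirectSum.decompose_of_mem_ne ℳ hx (Ne.symm h)]

/-- The weight given by an internal grading. -/
def ofDecomposition : Weight k L where
  q := decompositionProj ℳ
  q_neg _ hj := decompositionProj_of_neg ℳ hj
  orth i j x := by
    rcases lt_or_ge j 0 with hj | hj
    · rw [decompositionProj_of_neg ℳ hj]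
      split_ifs with h
      · rw [h, decompositionProj_of_neg ℳ hj]; simp
      · simp
    lift j to ℕ using hj
    have h : decompositionProj ℳ j x ∈ ℳ j := by
      rw [decompositionProj_natCast]; exact SetLike.coe_mem _
    rw [decompositionProj_of_mem h]
    split_ifs with h
    · rw [h]
    · rfl
  complete x := by
    induction x using DirectSum.Decomposition.inductionOn ℳ with
    | zero => exact ⟨0, by simp⟩
    | @homogeneous i x =>
      refine ⟨i + 1, fun n hn => ?_⟩
      simp only [decompositionProj_of_mem x.2, Nat.cast_inj]
      rw [Finset.sum_ite_eq' (Finset.range n) i fun _ => (x : L), if_pos]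
      exact Finset.mem_range.2 (by omega)
    | add x y hx hy =>
      obtain ⟨N, hN⟩ := hx
      obtain ⟨N', hN'⟩ := hy
      exact ⟨max N N', fun n hn => by
        simp only [map_add, Finset.sum_add_distrib, hN n ((le_max_left _ _).trans hn),
          hN' n ((le_max_right _ _).trans hn)]⟩

end Weight

/-- A quasi-isomorphism for the leading part `δ`, which raises the weight by `a ≥ 0`, is one for
`δ + ε` if `ε` raises the weight by `a - 1` only. -/
theorem IsQuasiIso.of_leading (W : Weight k L) (W' : Weight k L') {δ ε : Module.End k L}
    {δ' ε' : Module.End k L'} {φ : L →ₗ[k] L'} {a : ℤ} (ha : 0 ≤ a)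
    (hδ : ∀ j x, W.q (j + a) (δ x) = δ (W.q j x)) (hδ' : ∀ j x, W'.q (j + a) (δ' x) = δ' (W'.q j x))
    (hε : ∀ j x, W.q (j + a - 1) (ε x) = ε (W.q j x))
    (hε' : ∀ j x, W'.q (j + a - 1) (ε' x) = ε' (W'.q j x))
    (hφq : ∀ j x, W'.q j (φ x) = φ (W.q j x))
    (hd : ∀ x, (δ + ε) ((δ + ε) x) = 0) (hd' : ∀ x, (δ' + ε') ((δ' + ε') x) = 0)
    (hφ : ∀ x, φ ((δ + ε) x) = (δ' + ε') (φ x)) (h : IsQuasiIso δ δ' φ) :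
    IsQuasiIso (δ + ε) (δ' + ε') φ := by
  have hδs : ∀ j x, W.q j (δ x) = δ (W.q (j - a) x) := fun j x => by
    rw [← hδ, sub_add_cancel]
  have hδs' : ∀ j x, W'.q j (δ' x) = δ' (W'.q (j - a) x) := fun j x => by
    rw [← hδ', sub_add_cancel]
  have hεs : ∀ j x, W.q j (ε x) = ε (W.q (j - a + 1) x) := fun j x => by
    rw [← hε]; congr 2; ring
  have hεs' : ∀ j x, W'.q j (ε' x) = ε' (W'.q (j - a + 1) x) := fun j x => by
    rw [← hε']; congr 2; ring
  -- Induction on a bound for the top weight. The bound for `y` is lower by `a`, in accordance with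
  -- the equation `d' y = φ x`. Solving the problem for `δ` in top weight and subtracting the
  -- resulting boundary lowers the bound by one.
  have key : ∀ (n : ℕ) (x : L) (y : L'), (∀ j : ℤ, n ≤ j → W.q j x = 0) →
      (∀ j : ℤ, n ≤ j + a → W'.q j y = 0) → (δ + ε) x = 0 → (δ' + ε') y = φ x →
      ∃ z w, (δ + ε) z = x ∧ φ z + (δ' + ε') w = y := by
    intro n
    induction n with
    | zero =>
      intro x y hx hy _ _
      rw [W.eq_zero fun j hj => hx j (by exact_mod_cast hj),
        W'.eq_zero fun j hj => hy j (by push_cast; omega)]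
      exact ⟨0, 0, by simp, by simp⟩
    | succ n ih =>
      intro x y hx hy hdx hdy
      have e1 : δ (W.q n x) = 0 := by
        have := congrArg (W.q (n + a)) hdx
        rwa [LinearMap.add_apply, map_add, map_zero, hδ, hεs, hx (n + a - a + 1) (by push_cast; omega), map_zero,
          add_zero] at this
      have e2 : δ' (W'.q (n - a) y) = φ (W.q n x) := by
        have := congrArg (W'.q n) hdy
        rwa [LinearMap.add_apply, map_add, hφq, hδs', hεs', hy (n - a + 1) (by push_cast; omega), map_zero,
          add_zero] at this
      obtain ⟨z, w, hz, hw⟩ := h _ _ e1 e2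
      -- Only the components of `z` and `w` in the weights dictated by `δ` are kept, so that `ε`
      -- contributes one weight lower than the part that is removed.
      have hz' : δ (W.q (n - a) z) = W.q n x := by rw [← hδs, hz, W.q_self]
      have hw' : φ (W.q (n - a) z) + δ' (W'.q (n - a - a) w) = W'.q (n - a) y := by
        rw [← hφq, ← hδs', ← map_add, hw, W'.q_self]
      obtain ⟨z', w', h1, h2⟩ := ih (x - (δ + ε) (W.q (n - a) z))
        (y - φ (W.q (n - a) z) - (δ' + ε') (W'.q (n - a - a) w)) (fun j hj => by
          rw [LinearMap.add_apply, hz', map_sub, map_add, W.orth, hεs, W.orth,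
            if_neg (by omega : ¬ j - a + 1 = n - a), map_zero, add_zero]
          split_ifs with hjn
          · rw [sub_self]
          · rw [hx j (by push_cast; omega), sub_zero]) (fun j hj => by
          rw [LinearMap.add_apply, sub_sub, ← add_assoc, hw', map_sub, map_add, W'.orth, hεs',
            W'.orth, if_neg (by omega : ¬ j - a + 1 = n - a - a), map_zero, add_zero]
          split_ifs with hjn
          · rw [sub_self]
          · rw [hy j (by push_cast; omega), sub_zero]) (by rw [map_sub, hdx, hd, sub_zero])
        (by rw [map_sub, map_sub, hd', hdy, ← hφ, map_sub, sub_zero])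
      refine ⟨W.q (n - a) z + z', W'.q (n - a - a) w + w', by rw [map_add, h1]; abel, ?_⟩
      rw [map_add, map_add, add_add_add_comm, h2]
      abel
  intro x y hx hy
  obtain ⟨N, hN⟩ := W.bounded x
  obtain ⟨N', hN'⟩ := W'.bounded y
  lift a to ℕ using ha
  exact key (N + N' + a) x y (fun j hj => hN j (by push_cast at hj; omega))
    (fun j hj => hN' j (by push_cast at hj; omega)) hx hy

end Weight

/-! ### Tensor products of complexes -/

/-- A complex with a sign involution. -/
structure SignedComplex (k M : Type*) [CommRing k] [AddCommGroup M] [Module k M] where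
  d : Module.End k M
  σ : Module.End k M
  d_d : ∀ x, d (d x) = 0
  σ_σ : ∀ x, σ (σ x) = x
  d_σ : ∀ x, d (σ x) = - σ (d x)

section SignedComplex

variable {k M N N' C : Type*} [CommRing k] [AddCommGroup M] [Module k M]
  [AddCommGroup N] [Module k N] [AddCommGroup N'] [Module k N'] [AddCommGroup C] [Module k C]

namespace SignedComplex

/-- The tensor product of complexes, with differential `d ⊗ 1 + σ ⊗ d`. -/
def tensor (X : SignedComplex k M) (Y : SignedComplex k N) : SignedComplex k (M ⊗[k] N) where
  d := LinearMap.rTensor N X.d + TensorProduct.map X.σ Y.d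
  σ := TensorProduct.map X.σ Y.σ
  d_d z := by
    induction z using TensorProduct.induction_on with
    | zero => simp
    | add x y hx hy => rw [map_add, map_add, hx, hy, add_zero]
    | tmul x y => simp [X.d_d, Y.d_d, X.d_σ, TensorProduct.neg_tmul]
  σ_σ z := by
    induction z using TensorProduct.induction_on with
    | zero => simp
    | add x y hx hy => rw [map_add, map_add, hx, hy]
    | tmul x y => simp [X.σ_σ, Y.σ_σ]
  d_σ z := by
    induction z using TensorProduct.induction_on with
    | zero => simp
    | add x y hx hy => simp only [map_add, hx, hy, neg_add]
    | tmul x y =>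
      simp only [TensorProduct.map_tmul, LinearMap.add_apply, LinearMap.rTensor_tmul, X.d_σ, Y.d_σ,
        TensorProduct.neg_tmul, TensorProduct.tmul_neg, map_add, neg_add]

theorem tensor_d_tmul (X : SignedComplex k M) (Y : SignedComplex k N) (x : M) (y : N) :
    (X.tensor Y).d (x ⊗ₜ y) = X.d x ⊗ₜ y + X.σ x ⊗ₜ Y.d y := rfl

end SignedComplex

/-- A quasi-isomorphism for the leading part of the differential remains one after tensoring with
a flat complex. -/
theorem IsQuasiIso.tensor_of_leading (X : SignedComplex k N) (X' : SignedComplex k N')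
    (Y : SignedComplex k C) [Module.Flat k C] (W : Weight k N) (W' : Weight k N')
    {φ : N →ₗ[k] N'} {δ ε : Module.End k N} {δ' ε' : Module.End k N'}
    (hX : X.d = δ + ε) (hX' : X'.d = δ' + ε')
    (hδ : ∀ j x, W.q (j + 1) (δ x) = δ (W.q j x)) (hδ' : ∀ j x, W'.q (j + 1) (δ' x) = δ' (W'.q j x))
    (hε : ∀ j x, W.q j (ε x) = ε (W.q j x)) (hε' : ∀ j x, W'.q j (ε' x) = ε' (W'.q j x))
    (hσ : ∀ j x, W.q j (X.σ x) = X.σ (W.q j x)) (hσ' : ∀ j x, W'.q j (X'.σ x) = X'.σ (W'.q j x))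
    (hφq : ∀ j x, W'.q j (φ x) = φ (W.q j x)) (hφσ : ∀ x, φ (X.σ x) = X'.σ (φ x))
    (hφd : ∀ x, φ (X.d x) = X'.d (φ x)) (hφδ : ∀ x, φ (δ x) = δ' (φ x))
    (hd : ∀ x, δ (δ x) = 0) (hd' : ∀ x, δ' (δ' x) = 0) (h : IsQuasiIso δ δ' φ) :
    IsQuasiIso (X.tensor Y).d (X'.tensor Y).d (φ.rTensor C) := by
  -- The leading part `δ ⊗ 1` raises the weight of the first factor by one, while the other terms
  -- preserve it.
  have e : (X.tensor Y).d = LinearMap.rTensor C δ + (LinearMap.rTensor C ε +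
      TensorProduct.map X.σ Y.d) := by
    rw [← add_assoc, ← LinearMap.rTensor_add, ← hX]; rfl
  have e' : (X'.tensor Y).d = LinearMap.rTensor C δ' + (LinearMap.rTensor C ε' +
      TensorProduct.map X'.σ Y.d) := by
    rw [← add_assoc, ← LinearMap.rTensor_add, ← hX']; rfl
  have hc : ∀ x, φ.rTensor C ((X.tensor Y).d x) = (X'.tensor Y).d (φ.rTensor C x) := fun x => by
    induction x using TensorProduct.induction_on with
    | zero => simp
    | add x y hx hy => simp only [map_add, hx, hy]
    | tmul x y =>
      simp only [SignedComplex.tensor_d_tmul, map_add, LinearMap.rTensor_tmul, hφd, hφσ]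
  have h1 := (X.tensor Y).d_d
  have h2 := (X'.tensor Y).d_d
  rw [e] at h1 hc ⊢
  rw [e'] at h2 hc ⊢
  refine IsQuasiIso.of_leading (W.rTensor C) (W'.rTensor C) zero_le_one ?_ ?_ ?_ ?_ ?_ h1 h2 hc
    (h.rTensor hφδ hd hd' C)
  all_goals
    intro j x
    induction x using TensorProduct.induction_on with
    | zero => simp only [map_zero]
    | add x y hx hy => simp only [map_add, hx, hy]
    | tmul x y =>
      simp only [Weight.rTensor, LinearMap.rTensor_tmul, LinearMap.add_apply, map_add,
        TensorProduct.map_tmul, hδ, hδ', hε, hε', hσ, hσ', hφq, add_sub_cancel_right]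

end SignedComplex

/-! ### Tensor algebras of complexes -/

section TensorAlgebra

variable {k V N : Type*} [CommRing k] [AddCommGroup V] [Module k V] [AddCommGroup N] [Module k N]

theorem tensorAlgebra_induction {P : TensorAlgebra k V → Prop} (h1 : P 1)
    (hι : ∀ v w, P w → P (TensorAlgebra.ι k v * w)) (ha : ∀ x y, P x → P y → P (x + y))
    (hs : ∀ (c : k) x, P x → P (c • x)) (w : TensorAlgebra k V) : P w := by
  suffices h : ∀ x, P x → P (w * x) by simpa using h 1 h1
  induction w using TensorAlgebra.induction with
  | algebraMap r => intro x hx; rw [← Algebra.smul_def]; exact hs _ _ hx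
  | ι v => exact hι v
  | mul a b ha hb => intro x hx; rw [mul_assoc]; exact ha _ (hb _ hx)
  | add a b h1 h2 => intro x hx; rw [add_mul]; exact ha _ _ (h1 _ hx) (h2 _ hx)

theorem tensorAlgebra_hom_ext {f g : TensorAlgebra k V →ₗ[k] N} (h1 : f 1 = g 1)
    (hι : ∀ v w, f (TensorAlgebra.ι k v * w) = g (TensorAlgebra.ι k v * w)) : f = g := by
  refine LinearMap.ext fun w => ?_
  induction w using tensorAlgebra_induction with
  | h1 => exact h1
  | hι v w _ => exact hι v w
  | ha x y hx hy => rw [map_add, map_add, hx, hy]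
  | hs c x hx => rw [map_smul, map_smul, hx]

theorem tmul_tensorAlgebra_hom_ext {M : Type*} [AddCommGroup M] [Module k M]
    {f g : M ⊗[k] TensorAlgebra k V →ₗ[k] N} (h1 : ∀ m, f (m ⊗ₜ 1) = g (m ⊗ₜ 1))
    (hι : ∀ m v w, f (m ⊗ₜ (TensorAlgebra.ι k v * w)) = g (m ⊗ₜ (TensorAlgebra.ι k v * w))) :
    f = g := by
  refine TensorProduct.ext (LinearMap.ext fun m => ?_)
  exact tensorAlgebra_hom_ext (h1 m) (hι m)

/-- The linear map out of the tensor algebra given by a value at `1` and values at `v w` that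
depend bilinearly on `v` and `w` and its value at `w`. -/
def tensorAlgebraRec (g : V →ₗ[k] TensorAlgebra k V →ₗ[k] N) (h : V →ₗ[k] Module.End k N) :
    TensorAlgebra k V →ₗ[k] N :=
  -- The recursion runs on pairs of a word and its value, because `g` needs the word itself and not
  -- only the value attached to it.
  LinearMap.snd k _ _ ∘ₗ LinearMap.applyₗ ((1 : TensorAlgebra k V), (0 : N)) ∘ₗ
    (TensorAlgebra.lift k (LinearMap.mk₂ k
      (fun v (x : TensorAlgebra k V × N) => (TensorAlgebra.ι k v * x.1, g v x.1 + h v x.2))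
      (fun v v' x => by ext <;> simp [add_mul]; abel)
      (fun c v x => by ext <;> simp)
      (fun v x x' => by ext <;> simp [mul_add]; abel)
      (fun c v x => by ext <;> simp))).toLinearMap

variable (g : V →ₗ[k] TensorAlgebra k V →ₗ[k] N) (h : V →ₗ[k] Module.End k N)

@[simp] theorem tensorAlgebraRec_one : tensorAlgebraRec g h 1 = 0 := by
  simp [tensorAlgebraRec]

theorem tensorAlgebraRec_ι_mul (v : V) (w : TensorAlgebra k V) :
    tensorAlgebraRec g h (TensorAlgebra.ι k v * w) = g v w + h v (tensorAlgebraRec g h w) := by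
  have key : ∀ (w : TensorAlgebra k V) (x : TensorAlgebra k V × N),
      (TensorAlgebra.lift k (LinearMap.mk₂ k
      (fun v (x : TensorAlgebra k V × N) => (TensorAlgebra.ι k v * x.1, g v x.1 + h v x.2))
      (fun v v' x => by ext <;> simp [add_mul]; abel)
      (fun c v x => by ext <;> simp)
      (fun v x x' => by ext <;> simp [mul_add]; abel)
      (fun c v x => by ext <;> simp)) w x).1 = w * x.1 := by
    intro w x
    induction w using tensorAlgebra_induction with
    | h1 => simp
    | hι v w hw =>
      rw [map_mul, Module.End.mul_apply, TensorAlgebra.lift_ι_apply, LinearMap.mk₂_apply, hw,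
        mul_assoc]
    | ha a b ha hb => rw [map_add, LinearMap.add_apply, Prod.fst_add, ha, hb, add_mul]
    | hs c a ha => rw [map_smul, LinearMap.smul_apply, Prod.smul_fst, ha, smul_mul_assoc]
  simp only [tensorAlgebraRec, LinearMap.comp_apply, AlgHom.toLinearMap_apply,
    LinearMap.applyₗ_apply_apply, LinearMap.snd_apply, map_mul, Module.End.mul_apply,
    TensorAlgebra.lift_ι_apply]
  rw [LinearMap.mk₂_apply]
  simp only [key, mul_one]

/-- Splitting off the first letter of a word. -/
def peel : TensorAlgebra k V →ₗ[k] V ⊗[k] TensorAlgebra k V :=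
  tensorAlgebraRec (TensorProduct.mk k V (TensorAlgebra k V)) 0

theorem peel_ι_mul (v : V) (w : TensorAlgebra k V) :
    peel (TensorAlgebra.ι k v * w) = v ⊗ₜ[k] w := by
  rw [peel, tensorAlgebraRec_ι_mul]; simp

@[simp] theorem peel_one : peel (1 : TensorAlgebra k V) = 0 := tensorAlgebraRec_one _ _

namespace SignedComplex

/-- The tensor algebra of a complex, with the derivation that extends the differential. -/
def tensorAlgebra (X : SignedComplex k V) : SignedComplex k (TensorAlgebra k V) where
  d := tensorAlgebraRec (LinearMap.mul k _ ∘ₗ TensorAlgebra.ι k ∘ₗ X.d)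
    (LinearMap.mul k _ ∘ₗ TensorAlgebra.ι k ∘ₗ X.σ)
  σ := (TensorAlgebra.lift k (TensorAlgebra.ι k ∘ₗ X.σ)).toLinearMap
  d_d w := by
    induction w using tensorAlgebra_induction with
    | h1 => simp
    | ha x y hx hy => rw [map_add, map_add, hx, hy, add_zero]
    | hs c x hx => rw [map_smul, map_smul, hx, smul_zero]
    | hι v w hw =>
      simp [tensorAlgebraRec_ι_mul, X.d_d, X.d_σ, hw]
  σ_σ w := by
    induction w using tensorAlgebra_induction with
    | h1 => simp
    | ha x y hx hy => rw [map_add, map_add, hx, hy]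
    | hs c x hx => rw [map_smul, map_smul, hx]
    | hι v w hw =>
      simp only [AlgHom.toLinearMap_apply] at hw ⊢
      simp [X.σ_σ, hw]
  d_σ w := by
    induction w using tensorAlgebra_induction with
    | h1 => simp
    | ha x y hx hy => simp only [map_add, hx, hy, neg_add]
    | hs c x hx => simp only [map_smul, hx, smul_neg]
    | hι v w hw =>
      simp only [AlgHom.toLinearMap_apply] at hw ⊢
      simp [tensorAlgebraRec_ι_mul, X.d_σ, hw, add_comm]

variable (X : SignedComplex k V)

@[simp] theorem tensorAlgebra_d_one : X.tensorAlgebra.d 1 = 0 := tensorAlgebraRec_one _ _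

theorem tensorAlgebra_d_ι_mul (v : V) (w : TensorAlgebra k V) :
    X.tensorAlgebra.d (TensorAlgebra.ι k v * w) = TensorAlgebra.ι k (X.d v) * w +
      TensorAlgebra.ι k (X.σ v) * X.tensorAlgebra.d w := tensorAlgebraRec_ι_mul _ _ v w

theorem tensorAlgebra_σ_ι_mul (v : V) (w : TensorAlgebra k V) :
    X.tensorAlgebra.σ (TensorAlgebra.ι k v * w) = TensorAlgebra.ι k (X.σ v) * X.tensorAlgebra.σ w := by
  simp [tensorAlgebra]

@[simp] theorem tensorAlgebra_σ_one : X.tensorAlgebra.σ 1 = 1 := by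
  simp [tensorAlgebra]

end SignedComplex

/-- The word length. -/
def lengthWeight (k V : Type*) [CommRing k] [AddCommGroup V] [Module k V] :
    Weight k (TensorAlgebra k V) :=
  Weight.ofDecomposition ((LinearMap.range (TensorAlgebra.ι k : V →ₗ[k] _)) ^ · : ℕ → Submodule k _)

theorem lengthWeight_of_mem {n : ℕ} {w : TensorAlgebra k V}
    (hw : w ∈ LinearMap.range (TensorAlgebra.ι k : V →ₗ[k] _) ^ n) (j : ℤ) :
    (lengthWeight k V).q j w = if j = n then w else 0 :=
  Weight.decompositionProj_of_mem (ℳ := ((LinearMap.range (TensorAlgebra.ι k : V →ₗ[k] _)) ^ ·)) hw j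

theorem ι_mul_mem_length {n : ℕ} {w : TensorAlgebra k V} (v : V)
    (hw : w ∈ LinearMap.range (TensorAlgebra.ι k : V →ₗ[k] _) ^ n) :
    TensorAlgebra.ι k v * w ∈ LinearMap.range (TensorAlgebra.ι k : V →ₗ[k] _) ^ (n + 1) := by
  rw [pow_succ']
  exact Submodule.mul_mem_mul ⟨v, rfl⟩ hw

theorem lengthWeight_one (j : ℤ) : (lengthWeight k V).q j 1 = if j = 0 then 1 else 0 := by
  have h := lengthWeight_of_mem (k := k) (V := V) (n := 0) (w := 1) (by
    rw [pow_zero]; exact Submodule.one_le.1 le_rfl) j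
  exact_mod_cast h

theorem lengthWeight_ι_mul (v : V) (w : TensorAlgebra k V) (j : ℤ) :
    (lengthWeight k V).q (j + 1) (TensorAlgebra.ι k v * w) =
      TensorAlgebra.ι k v * (lengthWeight k V).q j w := by
  induction w using DirectSum.Decomposition.inductionOn
    ((LinearMap.range (TensorAlgebra.ι k : V →ₗ[k] _)) ^ · : ℕ → Submodule k _) with
  | zero => simp
  | add x y hx hy => simp only [mul_add, map_add, hx, hy]
  | @homogeneous n w =>
    rw [lengthWeight_of_mem w.2, lengthWeight_of_mem (ι_mul_mem_length v w.2), mul_ite, mul_zero]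
    push_cast
    simp only [add_left_inj]

end TensorAlgebra

/-! ### Splitting off the first letter -/

section Recursion

variable {k V M N : Type*} [CommRing k] [AddCommGroup V] [Module k V] [AddCommGroup M] [Module k M]

variable (k V M) in
/-- The map `M ⊗ T(V) → (M ⊗ V) ⊗ T(V)` that splits off the first letter. -/
def peelTensor : M ⊗[k] TensorAlgebra k V →ₗ[k] (M ⊗[k] V) ⊗[k] TensorAlgebra k V :=
  (TensorProduct.assoc k M V (TensorAlgebra k V)).symm.toLinearMap ∘ₗ LinearMap.lTensor M peel

variable (k V M) in
/-- The map `(M ⊗ V) ⊗ T(V) → M ⊗ T(V)` that prepends a letter. -/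
def consTensor : (M ⊗[k] V) ⊗[k] TensorAlgebra k V →ₗ[k] M ⊗[k] TensorAlgebra k V :=
  LinearMap.lTensor M (TensorProduct.lift (LinearMap.mul k _ ∘ₗ TensorAlgebra.ι k)) ∘ₗ
    (TensorProduct.assoc k M V (TensorAlgebra k V)).toLinearMap

variable (k V M) in
/-- The projection of `M ⊗ T(V)` to the words of length zero. -/
def emptyWord : M ⊗[k] TensorAlgebra k V →ₗ[k] M :=
  (TensorProduct.rid k M).toLinearMap ∘ₗ LinearMap.lTensor M TensorAlgebra.algebraMapInv.toLinearMap

theorem peelTensor_one (m : M) : peelTensor k V M (m ⊗ₜ 1) = 0 := by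
  simp [peelTensor]

theorem peelTensor_ι_mul (m : M) (v : V) (w : TensorAlgebra k V) :
    peelTensor k V M (m ⊗ₜ (TensorAlgebra.ι k v * w)) = (m ⊗ₜ v) ⊗ₜ w := by
  simp [peelTensor, peel_ι_mul]

theorem consTensor_tmul (m : M) (v : V) (w : TensorAlgebra k V) :
    consTensor k V M ((m ⊗ₜ v) ⊗ₜ w) = m ⊗ₜ (TensorAlgebra.ι k v * w) := by
  simp [consTensor]

theorem emptyWord_one (m : M) : emptyWord k V M (m ⊗ₜ 1) = m := by
  simp [emptyWord]

theorem emptyWord_ι_mul (m : M) (v : V) (w : TensorAlgebra k V) :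
    emptyWord k V M (m ⊗ₜ (TensorAlgebra.ι k v * w)) = 0 := by
  simp [emptyWord, TensorAlgebra.algebraMapInv]

/-- The decomposition `M ⊗ T(V) = M ⊕ (M ⊗ V) ⊗ T(V)` on which the induction over the word length is
based. The lemmas below show that it respects the differentials and that it lowers the length by
one. -/
theorem emptyWord_add_consTensor (x : M ⊗[k] TensorAlgebra k V) :
    emptyWord k V M x ⊗ₜ 1 + consTensor k V M (peelTensor k V M x) = x := by
  suffices h : (TensorProduct.mk k M (TensorAlgebra k V)).flip 1 ∘ₗ emptyWord k V M +
      consTensor k V M ∘ₗ peelTensor k V M = LinearMap.id from LinearMap.congr_fun h x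
  refine tmul_tensorAlgebra_hom_ext (fun m => ?_) (fun m v w => ?_)
  · simp [emptyWord_one, peelTensor_one]
  · simp [emptyWord_ι_mul, peelTensor_ι_mul, consTensor_tmul]

theorem lengthWeight_peelTensor (j : ℤ) (x : M ⊗[k] TensorAlgebra k V) :
    ((lengthWeight k V).lTensor (M ⊗[k] V)).q j (peelTensor k V M x) =
      peelTensor k V M (((lengthWeight k V).lTensor M).q (j + 1) x) := by
  suffices h : ((lengthWeight k V).lTensor (M ⊗[k] V)).q j ∘ₗ peelTensor k V M =
      peelTensor k V M ∘ₗ ((lengthWeight k V).lTensor M).q (j + 1) from LinearMap.congr_fun h x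
  refine tmul_tensorAlgebra_hom_ext (fun m => ?_) (fun m v w => ?_)
  · simp only [Weight.lTensor, LinearMap.comp_apply, peelTensor_one, LinearMap.lTensor_tmul,
      lengthWeight_one, map_zero]
    split_ifs
    · rw [peelTensor_one]
    · simp
  · simp only [Weight.lTensor, LinearMap.comp_apply, peelTensor_ι_mul, LinearMap.lTensor_tmul,
      lengthWeight_ι_mul]

variable (X : SignedComplex k M) (Y : SignedComplex k V)

theorem d_emptyWord (x : M ⊗[k] TensorAlgebra k V) :
    emptyWord k V M ((X.tensor Y.tensorAlgebra).d x) = X.d (emptyWord k V M x) := by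
  suffices h : emptyWord k V M ∘ₗ (X.tensor Y.tensorAlgebra).d = X.d ∘ₗ emptyWord k V M from
    LinearMap.congr_fun h x
  refine tmul_tensorAlgebra_hom_ext (fun m => ?_) (fun m v w => ?_)
  · simp [SignedComplex.tensor_d_tmul, emptyWord_one]
  · simp [SignedComplex.tensor_d_tmul, emptyWord_ι_mul, Y.tensorAlgebra_d_ι_mul,
      TensorProduct.tmul_add]

theorem d_peelTensor (x : M ⊗[k] TensorAlgebra k V) :
    peelTensor k V M ((X.tensor Y.tensorAlgebra).d x) =
      ((X.tensor Y).tensor Y.tensorAlgebra).d (peelTensor k V M x) := by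
  suffices h : peelTensor k V M ∘ₗ (X.tensor Y.tensorAlgebra).d =
      ((X.tensor Y).tensor Y.tensorAlgebra).d ∘ₗ peelTensor k V M from LinearMap.congr_fun h x
  refine tmul_tensorAlgebra_hom_ext (fun m => ?_) (fun m v w => ?_)
  · simp [SignedComplex.tensor_d_tmul, peelTensor_one]
  · simp only [LinearMap.comp_apply, SignedComplex.tensor_d_tmul, peelTensor_ι_mul,
      Y.tensorAlgebra_d_ι_mul, TensorProduct.tmul_add, map_add, TensorProduct.add_tmul, add_assoc]
    rfl

theorem d_consTensor (x : (M ⊗[k] V) ⊗[k] TensorAlgebra k V) :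
    consTensor k V M (((X.tensor Y).tensor Y.tensorAlgebra).d x) =
      (X.tensor Y.tensorAlgebra).d (consTensor k V M x) := by
  suffices h : consTensor k V M ∘ₗ ((X.tensor Y).tensor Y.tensorAlgebra).d =
      (X.tensor Y.tensorAlgebra).d ∘ₗ consTensor k V M from LinearMap.congr_fun h x
  refine TensorProduct.ext_threefold fun m v w => ?_
  simp only [LinearMap.comp_apply, SignedComplex.tensor_d_tmul, consTensor_tmul,
    Y.tensorAlgebra_d_ι_mul, TensorProduct.tmul_add, map_add, TensorProduct.add_tmul, add_assoc]
  congr 2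

end Recursion

/-! ### Quasi-isomorphisms of tensor algebras -/

section TensorQuasiIso

universe u

variable {k V : Type*} {V' : Type u} [CommRing k] [AddCommGroup V] [Module k V]
  [AddCommGroup V'] [Module k V']

/-- A quasi-isomorphism that raises degrees by one, compatibly with the signs and gradings. -/
structure GradedQuasiIso (X : SignedComplex k V) (X' : SignedComplex k V') (g : V →ₗ[k] V') where
  W : Weight k V
  W' : Weight k V'
  q_d : ∀ j x, W.q (j + 1) (X.d x) = X.d (W.q j x)
  q_d' : ∀ j x, W'.q (j + 1) (X'.d x) = X'.d (W'.q j x)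
  q_σ : ∀ j x, W.q j (X.σ x) = X.σ (W.q j x)
  q_σ' : ∀ j x, W'.q j (X'.σ x) = X'.σ (W'.q j x)
  q_g : ∀ j x, W'.q j (g x) = g (W.q j x)
  g_σ : ∀ x, g (X.σ x) = X'.σ (g x)
  g_d : ∀ x, g (X.d x) = X'.d (g x)
  isQuasiIso : IsQuasiIso X.d X'.d g

variable {X : SignedComplex k V} {X' : SignedComplex k V'} {g : V →ₗ[k] V'}

/-- The weight is the degree in the first factor, so `d ⊗ 1` is the leading part. -/
theorem GradedQuasiIso.rTensor (G : GradedQuasiIso X X' g) {C : Type*} [AddCommGroup C]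
    [Module k C] [Module.Flat k C] (Y : SignedComplex k C) :
    IsQuasiIso (X.tensor Y).d (X'.tensor Y).d (g.rTensor C) :=
  IsQuasiIso.tensor_of_leading X X' Y G.W G.W' (ε := 0) (ε' := 0) (add_zero _).symm
    (add_zero _).symm G.q_d G.q_d' (by simp) (by simp) G.q_σ G.q_σ' G.q_g G.g_σ G.g_d G.g_d X.d_d
    X'.d_d G.isQuasiIso

/-- The weight is the degree in the middle factor. The leading part is `σ ⊗ d ⊗ 1`, and its sign `σ`
is absorbed by `IsQuasiIso.twist`. -/
theorem GradedQuasiIso.lTensor_rTensor (G : GradedQuasiIso X X' g) {M C : Type*} [AddCommGroup M]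
    [Module k M] [Module.Flat k M] (Z : SignedComplex k M) [AddCommGroup C] [Module k C]
    [Module.Flat k C] (Y : SignedComplex k C) :
    IsQuasiIso ((Z.tensor X).tensor Y).d ((Z.tensor X').tensor Y).d
      ((g.lTensor M).rTensor C) := by
  have h0 : IsQuasiIso (TensorProduct.map Z.σ X.d) (TensorProduct.map Z.σ X'.d) (g.lTensor M) := by
    have h := G.isQuasiIso.lTensor G.g_d X.d_d X'.d_d M
    rw [show TensorProduct.map Z.σ X.d = LinearMap.lTensor M X.d ∘ₗ LinearMap.rTensor V Z.σ by
        rw [LinearMap.lTensor_comp_rTensor],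
      show TensorProduct.map Z.σ X'.d = LinearMap.lTensor M X'.d ∘ₗ LinearMap.rTensor V' Z.σ by
        rw [LinearMap.lTensor_comp_rTensor]]
    refine h.twist _ _ ?_ ?_ ?_ ?_ ?_
    all_goals
      intro x
      induction x using TensorProduct.induction_on with
      | zero => simp
      | add x y hx hy => simp only [map_add, hx, hy]
      | tmul x y => simp [Z.σ_σ]
  refine IsQuasiIso.tensor_of_leading (Z.tensor X) (Z.tensor X') Y (G.W.lTensor M)
    (G.W'.lTensor M) (δ := TensorProduct.map Z.σ X.d) (ε := LinearMap.rTensor V Z.d)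
    (δ' := TensorProduct.map Z.σ X'.d) (ε' := LinearMap.rTensor V' Z.d) (add_comm _ _)
    (add_comm _ _) ?_ ?_ ?_ ?_ ?_ ?_ ?_ ?_ ?_ ?_ ?_ ?_ h0
  iterate 7
    intro j x
    induction x using TensorProduct.induction_on with
    | zero => simp only [map_zero]
    | add x y hx hy => simp only [map_add, hx, hy]
    | tmul x y => simp only [Weight.lTensor, SignedComplex.tensor, LinearMap.lTensor_tmul,
        LinearMap.rTensor_tmul, TensorProduct.map_tmul, G.q_d, G.q_d', G.q_σ, G.q_σ', G.q_g]
  all_goals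
    intro x
    induction x using TensorProduct.induction_on with
    | zero => simp only [map_zero]
    | add x y hx hy => simp only [map_add, hx, hy, add_zero]
    | tmul x y => simp only [SignedComplex.tensor, LinearMap.lTensor_tmul, LinearMap.add_apply,
        LinearMap.rTensor_tmul, TensorProduct.map_tmul, G.g_σ, G.g_d, X.d_d, X'.d_d, map_add,
        TensorProduct.tmul_zero]

variable [Module.Flat k V'] [Module.Flat k (TensorAlgebra k V)]
  (T : TensorAlgebra k V →ₐ[k] TensorAlgebra k V')

/-- Induction on a bound for the word length, for all coefficient complexes at once, because
splitting off a letter replaces `M` by `M ⊗ V'`; for this `M` and `V'` share a universe. On the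
empty word the map is the identity of `M`. On the other words it is `g` on the first letter followed
by `T` on the rest. -/
theorem GradedQuasiIso.exists_of_length (G : GradedQuasiIso X X' g)
    (hT : ∀ v, T (TensorAlgebra.ι k v) = TensorAlgebra.ι k (g v)) (n : ℕ) :
    ∀ (M : Type u) [AddCommGroup M] [Module k M] [Module.Flat k M] (Z : SignedComplex k M)
      (x : M ⊗[k] TensorAlgebra k V) (y : M ⊗[k] TensorAlgebra k V'),
      (∀ j : ℤ, n ≤ j → ((lengthWeight k V).lTensor M).q j x = 0) →
      (∀ j : ℤ, n ≤ j → ((lengthWeight k V').lTensor M).q j y = 0) →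
      (Z.tensor X.tensorAlgebra).d x = 0 →
      (Z.tensor X'.tensorAlgebra).d y = LinearMap.lTensor M T.toLinearMap x →
      ∃ z w, (Z.tensor X.tensorAlgebra).d z = x ∧
        LinearMap.lTensor M T.toLinearMap z + (Z.tensor X'.tensorAlgebra).d w = y := by
  induction n with
  | zero =>
    intro M _ _ _ Z x y hx hy _ _
    rw [Weight.eq_zero _ fun j hj => hx j (by exact_mod_cast hj),
      Weight.eq_zero _ fun j hj => hy j (by exact_mod_cast hj)]
    exact ⟨0, 0, by simp, by simp⟩
  | succ n ih =>
    intro M _ _ _ Z x y hx hy hdx hdy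
    have he : ∀ x, emptyWord k V' M (LinearMap.lTensor M T.toLinearMap x) = emptyWord k V M x := by
      intro x
      suffices h : emptyWord k V' M ∘ₗ LinearMap.lTensor M T.toLinearMap = emptyWord k V M from
        LinearMap.congr_fun h x
      refine tmul_tensorAlgebra_hom_ext (fun m => ?_) (fun m v w => ?_)
      · simp [emptyWord_one]
      · simp [emptyWord_ι_mul, hT]
    have hp : ∀ x, peelTensor k V' M (LinearMap.lTensor M T.toLinearMap x) =
        LinearMap.lTensor (M ⊗[k] V') T.toLinearMap
          ((g.lTensor M).rTensor (TensorAlgebra k V) (peelTensor k V M x)) := by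
      intro x
      suffices h : peelTensor k V' M ∘ₗ LinearMap.lTensor M T.toLinearMap =
          LinearMap.lTensor (M ⊗[k] V') T.toLinearMap ∘ₗ
          (g.lTensor M).rTensor (TensorAlgebra k V) ∘ₗ peelTensor k V M from
        LinearMap.congr_fun h x
      refine tmul_tensorAlgebra_hom_ext (fun m => ?_) (fun m v w => ?_)
      · simp [peelTensor_one]
      · simp [peelTensor_ι_mul, hT]
    have hc : ∀ x, consTensor k V' M (LinearMap.lTensor (M ⊗[k] V') T.toLinearMap
          ((g.lTensor M).rTensor (TensorAlgebra k V) x)) =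
        LinearMap.lTensor M T.toLinearMap (consTensor k V M x) := by
      intro x
      suffices h : consTensor k V' M ∘ₗ LinearMap.lTensor (M ⊗[k] V') T.toLinearMap ∘ₗ
          (g.lTensor M).rTensor (TensorAlgebra k V) =
          LinearMap.lTensor M T.toLinearMap ∘ₗ consTensor k V M from LinearMap.congr_fun h x
      refine TensorProduct.ext_threefold fun m v w => ?_
      simp [consTensor_tmul, hT]
    have hφd : ∀ x, (g.lTensor M).rTensor (TensorAlgebra k V)
        (((Z.tensor X).tensor X.tensorAlgebra).d x) = ((Z.tensor X').tensor X.tensorAlgebra).d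
        ((g.lTensor M).rTensor (TensorAlgebra k V) x) := by
      intro x
      suffices h : (g.lTensor M).rTensor (TensorAlgebra k V) ∘ₗ
          ((Z.tensor X).tensor X.tensorAlgebra).d = ((Z.tensor X').tensor X.tensorAlgebra).d ∘ₗ
          (g.lTensor M).rTensor (TensorAlgebra k V) from LinearMap.congr_fun h x
      refine TensorProduct.ext_threefold fun m v w => ?_
      simp only [SignedComplex.tensor, LinearMap.comp_apply, LinearMap.lTensor_tmul,
        LinearMap.add_apply, LinearMap.rTensor_tmul, TensorProduct.map_tmul, G.g_σ, G.g_d, map_add]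
    have hTd : ∀ x, LinearMap.lTensor (M ⊗[k] V') T.toLinearMap
        (((Z.tensor X').tensor X.tensorAlgebra).d x) = ((Z.tensor X').tensor X'.tensorAlgebra).d
        (LinearMap.lTensor (M ⊗[k] V') T.toLinearMap x) := by
      have hd : ∀ w, T (X.tensorAlgebra.d w) = X'.tensorAlgebra.d (T w) := by
        intro w
        induction w using tensorAlgebra_induction with
        | h1 => simp
        | ha x y hx hy => simp only [map_add, hx, hy]
        | hs c x hx => simp only [map_smul, hx]
        | hι v w hw => simp only [X.tensorAlgebra_d_ι_mul, map_add, map_mul, hT, hw,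
            X'.tensorAlgebra_d_ι_mul, G.g_d, G.g_σ]
      intro x
      induction x using TensorProduct.induction_on with
      | zero => simp only [map_zero]
      | add x y hx hy => simp only [map_add, hx, hy]
      | tmul x y => simp only [SignedComplex.tensor_d_tmul, LinearMap.lTensor_tmul, map_add,
          AlgHom.toLinearMap_apply, hd]
    have hBx : ((Z.tensor X).tensor X.tensorAlgebra).d (peelTensor k V M x) = 0 := by
      rw [← d_peelTensor, hdx, map_zero]
    have hBy : ((Z.tensor X').tensor X'.tensorAlgebra).d (peelTensor k V' M y) =
        LinearMap.lTensor (M ⊗[k] V') T.toLinearMap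
          ((g.lTensor M).rTensor (TensorAlgebra k V) (peelTensor k V M x)) := by
      rw [← d_peelTensor, hdy, hp]
    -- The two factors of the map on nonempty words are treated in reverse order: the induction
    -- hypothesis lifts along `T` with coefficients `M ⊗ V'`, and then `lTensor_rTensor` lifts along
    -- `g` on the first letter.
    obtain ⟨z₁, w₁, hz₁, hw₁⟩ := ih (M ⊗[k] V') (Z.tensor X')
      ((g.lTensor M).rTensor (TensorAlgebra k V) (peelTensor k V M x)) (peelTensor k V' M y)
      (fun j hj => by
        have h : ∀ x, ((lengthWeight k V).lTensor (M ⊗[k] V')).q j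
            ((g.lTensor M).rTensor (TensorAlgebra k V) x) = (g.lTensor M).rTensor _
            (((lengthWeight k V).lTensor (M ⊗[k] V)).q j x) := fun x => by
          simp only [Weight.lTensor, ← LinearMap.comp_apply, LinearMap.lTensor_comp_rTensor,
            LinearMap.rTensor_comp_lTensor]
        rw [h, lengthWeight_peelTensor, hx _ (by push_cast; omega), map_zero, map_zero])
      (fun j hj => by
        rw [lengthWeight_peelTensor, hy _ (by push_cast; omega), map_zero])
      (by rw [← hφd, hBx, map_zero]) hBy
    obtain ⟨z₂, w₂, hz₂, hw₂⟩ := G.lTensor_rTensor Z X.tensorAlgebra _ _ hBx hz₁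
    -- The empty words of `x` and `y` form a cycle in the cone of the identity of `M`, which the
    -- empty-word part of `y` bounds.
    refine ⟨emptyWord k V' M y ⊗ₜ 1 + consTensor k V M z₂,
      consTensor k V' M (LinearMap.lTensor (M ⊗[k] V') T.toLinearMap w₂ + w₁), ?_, ?_⟩
    · rw [map_add, ← d_consTensor, hz₂, SignedComplex.tensor_d_tmul, ← d_emptyWord Z X', hdy, he]
      simp only [SignedComplex.tensorAlgebra_d_one, TensorProduct.tmul_zero, add_zero]
      exact emptyWord_add_consTensor x
    · rw [map_add, ← hc, ← d_consTensor, add_assoc, ← map_add, map_add _ _ w₁, ← hTd, ← add_assoc,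
        ← map_add (LinearMap.lTensor (M ⊗[k] V') T.toLinearMap), hw₂, hw₁]
      simp only [LinearMap.lTensor_tmul, AlgHom.toLinearMap_apply, map_one]
      exact emptyWord_add_consTensor y

theorem GradedQuasiIso.tensorAlgebra (G : GradedQuasiIso X X' g)
    (hT : ∀ v, T (TensorAlgebra.ι k v) = TensorAlgebra.ι k (g v)) (M : Type u) [AddCommGroup M]
    [Module k M] [Module.Flat k M] (Z : SignedComplex k M) :
    IsQuasiIso (Z.tensor X.tensorAlgebra).d (Z.tensor X'.tensorAlgebra).d
      (LinearMap.lTensor M T.toLinearMap) := by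
  intro x y hx hy
  obtain ⟨N, hN⟩ := ((lengthWeight k V).lTensor M).bounded x
  obtain ⟨N', hN'⟩ := ((lengthWeight k V').lTensor M).bounded y
  exact G.exists_of_length T hT (N + N') M Z x y (fun j hj => hN j (by push_cast at hj; omega))
    (fun j hj => hN' j (by push_cast at hj; omega)) hx hy

end TensorQuasiIso

/-! ### The differentials square to zero -/

section SquareZero

variable {k A : Type*} [CommRing k] [Ring A] [Algebra k A]
variable {𝒜 : ℕ → Submodule k A} [GradedAlgebra 𝒜] (D : DGA 𝒜)

theorem sgn_sgn (a : A) : sgn 𝒜 (sgn 𝒜 a) = a := by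
  induction a using graded_induction (𝒜 := 𝒜) with
  | h0 => simp
  | ha a b h1 h2 => simp only [map_add, h1, h2]
  | hm n a ha =>
    rw [sgn_of_homog (mem_homog_of_mem ha), map_smul, sgn_of_homog (mem_homog_of_mem ha), smul_smul,
      sign_mul_self, one_smul]

theorem sgn_mul (a b : A) : sgn 𝒜 (a * b) = sgn 𝒜 a * sgn 𝒜 b := by
  induction a using graded_induction (𝒜 := 𝒜) with
  | h0 => simp
  | ha a a' h1 h2 => simp only [map_add, add_mul, h1, h2]
  | hm n a ha =>
    induction b using graded_induction (𝒜 := 𝒜) with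
    | h0 => simp
    | ha b b' h1 h2 => simp only [map_add, mul_add, h1, h2]
    | hm m b hb =>
      rw [sgn_of_homog (mul_mem_homog (mem_homog_of_mem ha) (mem_homog_of_mem hb)),
        sgn_of_homog (mem_homog_of_mem ha), sgn_of_homog (mem_homog_of_mem hb), sign_add,
        smul_mul_smul_comm]

theorem DGA.d_sgn (a : A) : D.d (sgn 𝒜 a) = - sgn 𝒜 (D.d a) := by
  induction a using graded_induction (𝒜 := 𝒜) with
  | h0 => simp
  | ha a b h1 h2 => simp only [map_add, h1, h2, neg_add]
  | hm n a ha =>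
    rw [sgn_of_homog (mem_homog_of_mem ha), map_smul,
      sgn_of_homog (D.d_mem_homog (mem_homog_of_mem ha)), sign_add_one, neg_smul, neg_neg]

theorem sgn_mem_pos {a : A} (ha : a ∈ Pos 𝒜) : sgn 𝒜 a ∈ Pos 𝒜 :=
  sub_mem (par_mem_pos ha 0) (par_mem_pos ha 1)

variable (𝒜) in
/-- Multiplication of the first letter of a word by `a` on the left. -/
def mulFirst : A →ₗ[k] Bar 𝒜 →ₗ[k] Bar 𝒜 :=
  LinearMap.mk₂ k (fun a w => cut 𝒜 (LinearMap.mul k _ ∘ₗ letter 𝒜 ∘ₗ LinearMap.mulLeft k a ∘ₗ tau 𝒜) w)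
    (fun a b w => by
      rw [← LinearMap.add_apply, ← map_add]
      congr 2
      ext; simp [add_mul])
    (fun c a w => by
      rw [← LinearMap.smul_apply, ← map_smul]
      congr 2
      ext; simp)
    (fun a x y => map_add _ _ _) (fun c a x => map_smul _ _ _)

theorem mulFirst_wd {R : Subalgebra k A} (a : A) (l : List (Letter 𝒜 R)) :
    mulFirst 𝒜 a (wd l) = splitSum l fun x y => letter 𝒜 (a * tl x) * wd y := by
  rw [mulFirst, LinearMap.mk₂_apply, cut_wd]
  simp only [LinearMap.comp_apply, LinearMap.mulLeft_apply, LinearMap.mul_apply', tau_wd]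

theorem mulFirst_one (a : A) : mulFirst 𝒜 a 1 = 0 := by
  simpa using mulFirst_wd a ([] : List (Letter 𝒜 (⊤ : Subalgebra k A)))

theorem mulFirst_letter_mul (a : A) {b : A} (hb : b ∈ Pos 𝒜) (w : Bar 𝒜) :
    mulFirst 𝒜 a (letter 𝒜 b * w) = letter 𝒜 (a * b) * w := by
  rw [mulFirst, LinearMap.mk₂_apply, cut_letter_mul]
  have h : ∀ w : Bar 𝒜, cut 𝒜 ((LinearMap.mul k (Bar 𝒜) ∘ₗ letter 𝒜 ∘ₗ LinearMap.mulLeft k a ∘ₗ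
      tau 𝒜) ∘ₗ LinearMap.mulLeft k (letter 𝒜 b)) w = letter 𝒜 (a * b) * w := by
    intro w
    refine mem_of_wd_mem (S := LinearMap.eqLocus (cut 𝒜 ((LinearMap.mul k (Bar 𝒜) ∘ₗ letter 𝒜 ∘ₗ
      LinearMap.mulLeft k a ∘ₗ tau 𝒜) ∘ₗ LinearMap.mulLeft k (letter 𝒜 b)))
      (LinearMap.mulLeft k (letter 𝒜 (a * b)))) (fun l _ => ?_) w
    rw [LinearMap.mem_eqLocus, cut_wd, splitSum_eq_right]
    · simp [tau_letter hb]
    · intro x y _ hx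
      simp [tau_letter_mul hb, counit_wd, hx]
  rw [h]
  simp [tau_one]

theorem barD_one : barD D 1 = 0 := by
  have := barD_wd D (R := (⊤ : Subalgebra k A)) (fun _ _ => trivial) []
  simpa [bdry, splitSum₃, letter, barDelta, tau_one, cut_one, delta] using this

/-- The first letter is differentiated, passed over, or multiplied with its neighbour. This
recursion replaces sums over cuts by an induction on words. -/
theorem barD_letter_mul {a : A} (ha : a ∈ Pos 𝒜) (w : Bar 𝒜) : barD D (letter 𝒜 a * w) =
    - letter 𝒜 (D.d a) * w - letter 𝒜 (sgn 𝒜 a) * barD D w + mulFirst 𝒜 (sgn 𝒜 a) w := by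
  have hR : ∀ a ∈ (⊤ : Subalgebra k A), D.d a ∈ (⊤ : Subalgebra k A) := fun _ _ => trivial
  have key : ∀ (c : Letter 𝒜 (⊤ : Subalgebra k A)) (l : List (Letter 𝒜 (⊤ : Subalgebra k A))),
      barD D (wd (c :: l)) = - letter 𝒜 (D.d c.val) * wd l -
        letter 𝒜 (sgn 𝒜 c.val) * barD D (wd l) + mulFirst 𝒜 (sgn 𝒜 c.val) (wd l) := by
    intro c l
    rw [barD_wd D hR, barD_wd D hR, mulFirst_wd, sgn_of_homog c.mem_homog]
    simp only [bdry, splitSum₃]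
    rw [splitSum_cons, splitSum_cons]
    have h0 : (delta D hR ([] : List (Letter 𝒜 (⊤ : Subalgebra k A)))).val = 0 := by
      simp [delta_val]
    have h1 : ∀ x, (delta D hR (c :: x)).val = - D.d (tl (c :: x)) +
        sign k c.par • (c.val * tl x) := by
      intro x
      rw [delta_val, splitSum_tl_left _ _ _ (fun x y hx => by simp [hx])]
      simp [sign_add]
    have h2 : (splitSum l fun x y => letter 𝒜 (D.d (tl (c :: x))) * wd y) =
        letter 𝒜 (D.d c.val) * wd l := by
      rw [splitSum_eq_right]
      · rfl
      · rintro (_ | ⟨b, x⟩) y - hx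
        · exact (hx rfl).elim
        · simp
    simp only [ep_nil, sign_zero, one_smul, List.nil_append, wd_cons, h0, h1, map_add,
      map_neg, add_mul, neg_mul, splitSum_add, splitSum_neg, h2, List.cons_append, ep_cons, map_smul,
      map_zero, zero_mul, zero_add, smul_mul_assoc, mul_splitSum, mul_smul_comm,
      smul_smul, sign_add, sign_one, mul_neg_one, neg_smul]
    simp only [mul_comm (sign k c.par)]
    abel
  refine mem_of_wd_mem (S := LinearMap.eqLocus (barD D ∘ₗ LinearMap.mulLeft k (letter 𝒜 a))
    (LinearMap.mulLeft k (-letter 𝒜 (D.d a)) - LinearMap.mulLeft k (letter 𝒜 (sgn 𝒜 a)) ∘ₗ barD D +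
      mulFirst 𝒜 (sgn 𝒜 a))) (fun l _ => ?_) w
  rw [LinearMap.mem_eqLocus]
  simp only [LinearMap.comp_apply, LinearMap.add_apply, LinearMap.sub_apply,
    LinearMap.mulLeft_apply]
  have hs : ∀ p : ZMod 2, barD D (letter 𝒜 (par 𝒜 p a) * wd l) =
      - letter 𝒜 (D.d (par 𝒜 p a)) * wd l - letter 𝒜 (sgn 𝒜 (par 𝒜 p a)) * barD D (wd l) +
        mulFirst 𝒜 (sgn 𝒜 (par 𝒜 p a)) (wd l) := fun p => by
    have := key ⟨par 𝒜 p a, p, par_mem_homog p a, par_mem_pos ha p, trivial⟩ l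
    rwa [wd_cons] at this
  have e := congrArg₂ (· + ·) (hs 0) (hs 1)
  have ea : a = par 𝒜 0 a + par 𝒜 1 a := by
    have := par_add_par (𝒜 := 𝒜) 0 a
    rw [zero_add] at this
    exact this.symm
  conv_lhs => rw [ea]
  conv_rhs => rw [ea]
  simp only [map_add, add_mul, LinearMap.add_apply] at e ⊢
  rw [e]
  noncomm_ring

/-- Multiplying the first letter by `a` commutes with the bar differential up to a Leibniz term.
Associativity of `A` enters through `hm`. -/
theorem barD_mulFirst (a : A) (w : Bar 𝒜) : barD D (mulFirst 𝒜 (sgn 𝒜 a) w) =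
    mulFirst 𝒜 (sgn 𝒜 (D.d a)) w + mulFirst 𝒜 a (barD D w) := by
  suffices h : barD D ∘ₗ mulFirst 𝒜 (sgn 𝒜 a) = mulFirst 𝒜 (sgn 𝒜 (D.d a)) +
    mulFirst 𝒜 a ∘ₗ barD D from LinearMap.congr_fun h w
  have hm : ∀ a b (w : Bar 𝒜), mulFirst 𝒜 a (mulFirst 𝒜 b w) = mulFirst 𝒜 (a * b) w := by
    intro a b w
    suffices h : mulFirst 𝒜 a ∘ₗ mulFirst 𝒜 b = mulFirst 𝒜 (a * b) from LinearMap.congr_fun h w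
    refine tensorAlgebra_hom_ext (by simp [mulFirst_one]) (fun v w => ?_)
    rw [← letter_coe, LinearMap.comp_apply, mulFirst_letter_mul _ v.2,
      mulFirst_letter_mul _ (mul_mem_pos' v.2 b), mulFirst_letter_mul _ v.2, mul_assoc]
  refine tensorAlgebra_hom_ext (by simp [mulFirst_one, barD_one]) (fun v w => ?_)
  rw [← letter_coe]
  simp only [LinearMap.comp_apply, LinearMap.add_apply]
  rw [mulFirst_letter_mul _ v.2, barD_letter_mul D (mul_mem_pos' v.2 _), mulFirst_letter_mul _ v.2,
    barD_letter_mul D v.2]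
  simp only [neg_mul, map_add, map_sub, map_neg]
  rw [mulFirst_letter_mul _ (D.d_mem_pos _), mulFirst_letter_mul _ (sgn_mem_pos v.2), hm, sgn_mul,
    sgn_sgn, D.d_mul, D.d_sgn, sgn_sgn]
  simp only [map_add, add_mul, neg_mul, map_neg]
  abel

theorem barD_barD (w : Bar 𝒜) : barD D (barD D w) = 0 := by
  induction w using bar_induction with
  | h1 => rw [barD_one, map_zero]
  | hadd x y hx hy => rw [map_add, map_add, hx, hy, add_zero]
  | hsmul c x hx => rw [map_smul, map_smul, hx, smul_zero]
  | hl a w hw =>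
    obtain ⟨b, hb, e⟩ : ∃ b ∈ Pos 𝒜, letter 𝒜 a = letter 𝒜 b :=
      ⟨toPos 𝒜 a, (toPos 𝒜 a).2, (letter_coe (toPos 𝒜 a)).symm⟩
    rw [e, barD_letter_mul D hb]
    simp only [neg_mul, map_add, map_sub, map_neg]
    rw [barD_letter_mul D (D.d_mem_pos b), barD_letter_mul D (sgn_mem_pos hb), barD_mulFirst, hw,
      D.d_d, D.d_sgn, sgn_sgn]
    simp only [map_zero, map_neg, mul_zero, zero_mul, neg_mul, neg_zero]
    abel

variable {D} in
theorem bdry_bdry {R : Subalgebra k A} (hR : ∀ a ∈ R, D.d a ∈ R) {M : Type*} [AddCommGroup M]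
    [Module k M] (g : Bar 𝒜 →ₗ[k] M) (l : List (Letter 𝒜 R)) :
    bdry D hR (fun m => bdry D hR (fun l => g (wd l)) m) l = 0 := by
  have h : ∀ m, bdry D hR (fun l => g (wd l)) m = (g ∘ₗ barD D) (wd m) := fun m =>
    (map_barD_wd D hR g m).symm
  simp only [h]
  rw [← map_barD_wd, LinearMap.comp_apply, barD_barD, map_zero]

theorem hochD_wd {R : Subalgebra k A} (hR : ∀ a ∈ R, D.d a ∈ R) {u : A} {p : ZMod 2}
    (hu : u ∈ homog 𝒜 p) (l : List (Letter 𝒜 R)) :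
    hochD D (u ⊗ₜ wd l) = D.d u ⊗ₜ wd l + sign k p • bdry D hR (fun l => u ⊗ₜ[k] wd l) l
      - (sign k p • splitSum l fun x y => (u * tl x) ⊗ₜ[k] wd y) +
      splitSum l fun x y => sign k (ep y * (p + ep x)) • ((tl y * u) ⊗ₜ[k] wd x) := by
  rw [hochD_eq, hochD₁_wd D hR hu, hochTheta₂_wd hu]

theorem hochD_hochD (z : Hoch 𝒜) : hochD D (hochD D z) = 0 := by
  have hR : ∀ a ∈ (⊤ : Subalgebra k A), D.d a ∈ (⊤ : Subalgebra k A) := fun _ _ => trivial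
  refine hoch_mem_of_tmul_wd_mem D (S := LinearMap.ker (hochD D ∘ₗ hochD D))
    (fun u p hg l => ?_) z
  have hu := homog_of_eq_one_or hg
  rw [LinearMap.mem_ker, LinearMap.comp_apply, hochD_wd D hR hu]
  have bsub : ∀ F G : List (Letter 𝒜 (⊤ : Subalgebra k A)) → Hoch 𝒜,
      bdry D hR (fun l => F l - G l) l = bdry D hR F l - bdry D hR G l := fun F G => by
    simp only [bdry, splitSum₃, smul_sub, splitSum_sub]
  have sq : ∀ z : Hoch 𝒜, sign k p • sign k p • z = z := fun z => by
    rw [smul_smul, sign_mul_self, one_smul]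
  -- The square consists of these ten expressions. Each occurs twice, with opposite signs, in the
  -- differentials `e1` to `e4` of the four terms of `hochD`.
  let B := bdry D hR (fun l => D.d u ⊗ₜ[k] wd l) l
  let P₁ := splitSum l fun x y => (D.d u * tl x) ⊗ₜ[k] wd y
  let P₂ := splitSum l fun x y => sign k (ep y * (p + 1 + ep x)) • ((tl y * D.d u) ⊗ₜ[k] wd x)
  let Q₁ := splitSum l fun x y => (u * D.d (tl x)) ⊗ₜ[k] wd y
  let Q₂ := splitSum l fun x w => splitSum w fun y z =>
    sign k (ep x) • ((u * tl x * tl y) ⊗ₜ[k] wd z)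
  let Q₃ := splitSum l fun x y => sign k (ep x) • bdry D hR (fun y => (u * tl x) ⊗ₜ[k] wd y) y
  let Q₄ := splitSum l fun x y => sign k (ep y * (p + ep x + 1)) •
    bdry D hR (fun x => (tl y * u) ⊗ₜ[k] wd x) x
  let Q₅ := splitSum l fun x y => sign k (ep y * (p + ep x)) • ((D.d (tl y) * u) ⊗ₜ[k] wd x)
  let Q₆ := splitSum l fun x w => splitSum w fun y z =>
    sign k ((ep y + ep z) * (p + ep x) + ep y) • ((tl y * tl z * u) ⊗ₜ[k] wd x)
  let Q₇ := splitSum l fun x w => splitSum w fun y z =>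
    sign k (ep z * (p + ep x + 1 + ep y)) • ((tl z * u * tl x) ⊗ₜ[k] wd y)
  have e1 : hochD D (D.d u ⊗ₜ wd l) = - (sign k p • B) + sign k p • P₁ + P₂ := by
    rw [hochD_wd D hR (D.d_mem_homog hu), D.d_d, TensorProduct.zero_tmul, sign_add_one]
    simp only [neg_smul, B, P₁, P₂]
    abel
  have e2 : hochD D (bdry D hR (fun l => u ⊗ₜ[k] wd l) l) =
      B + sign k p • Q₁ + sign k p • Q₂ - sign k p • Q₃ + Q₄ - sign k p • Q₅ - sign k p • Q₆ := by
    have h0 : bdry D hR (fun m => bdry D hR (fun l => u ⊗ₜ[k] wd l) m) l = 0 :=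
      bdry_bdry hR (TensorProduct.mk k A (Bar 𝒜) u) l
    have h1 : ∀ x y : List (Letter 𝒜 (⊤ : Subalgebra k A)),
        bdry D hR (fun x => (u * tl x) ⊗ₜ[k] wd y) x = (u * barDelta D (wd x)) ⊗ₜ wd y := by
      intro x y
      rw [← bdry_tl hR]
      exact (map_bdry D hR ((TensorProduct.mk k A (Bar 𝒜)).flip (wd y) ∘ₗ LinearMap.mulLeft k u)
        tl x).symm
    have h2 : ∀ x y : List (Letter 𝒜 (⊤ : Subalgebra k A)),
        bdry D hR (fun x => sign k (ep y * (p + ep x)) • ((tl y * u) ⊗ₜ[k] wd x)) x =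
        sign k (ep y * (p + ep x + 1)) • bdry D hR (fun x => (tl y * u) ⊗ₜ[k] wd x) x := by
      intro x y
      rw [← bdry_smul]
      refine bdry_congr D hR fun m hm => ?_
      rw [hm, add_assoc]
    have h3 : ∀ x y : List (Letter 𝒜 (⊤ : Subalgebra k A)),
        bdry D hR (fun y => sign k (ep y * (p + ep x)) • ((tl y * u) ⊗ₜ[k] wd x)) y =
        sign k ((ep y + 1) * (p + ep x)) • ((barDelta D (wd y) * u) ⊗ₜ wd x) := by
      intro x y
      rw [bdry_congr D hR (G := fun y' => sign k ((ep y + 1) * (p + ep x)) •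
        ((tl y' * u) ⊗ₜ[k] wd x)) (fun m hm => by rw [hm]), bdry_smul, ← bdry_tl hR]
      congr 1
      exact (map_bdry D hR ((TensorProduct.mk k A (Bar 𝒜)).flip (wd x) ∘ₗ LinearMap.mulRight k u)
        tl y).symm
    rw [map_bdry]
    simp only [hochD_wd D hR hu, bdry_add, bsub, bdry_smul, h0, smul_zero, add_zero, bdry_splitSum,
      h1, h2, h3, barDelta_wd, splitSum_add, smul_add, mul_sub, sub_mul, mul_neg, neg_mul,
      TensorProduct.sub_tmul, TensorProduct.neg_tmul, smul_sub, smul_neg, splitSum_sub,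
      splitSum_neg, mul_splitSum, splitSum_mul, splitSum_tmul, mul_smul_comm, smul_mul_assoc,
      ← TensorProduct.smul_tmul']
    have h4 : (splitSum l fun x y => splitSum x fun x₁ x₂ => sign k (ep x₁) •
        ((u * (tl x₁ * tl x₂)) ⊗ₜ[k] wd y)) = Q₂ := by
      rw [splitSum_assoc]
      simp only [← mul_assoc, Q₂]
    have h5 : (splitSum l fun x y => sign k (ep x) • sign k ((ep y + 1) * (p + ep x)) •
        ((D.d (tl y) * u) ⊗ₜ[k] wd x)) = sign k p • Q₅ := by
      simp only [Q₅, ← splitSum_smul, smul_smul, ← sign_add]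
      refine splitSum_congr fun x y _ => ?_
      congr 2
      generalize ep x = a, ep y = b, p = c
      decide +revert
    have h6 : (splitSum l fun x y => sign k (ep x) • sign k ((ep y + 1) * (p + ep x)) •
        splitSum y fun y z => sign k (ep y) • ((tl y * tl z * u) ⊗ₜ[k] wd x)) = sign k p • Q₆ := by
      simp only [Q₆, ← splitSum_smul, smul_smul, ← sign_add]
      refine splitSum_congr fun x w _ => splitSum_congr fun y z h => ?_
      rw [← h, ep_append]
      congr 2
      generalize ep x = a, ep y = b, ep z = d, p = c
      decide +revert
    rw [h4, h5, h6]
    simp only [B, Q₁, Q₃, Q₄]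
    abel
  have e3 : hochD D (splitSum l fun x y => (u * tl x) ⊗ₜ[k] wd y) =
      P₁ + sign k p • Q₁ - sign k p • Q₃ + sign k p • Q₂ + Q₇ := by
    rw [map_splitSum]
    have h : ∀ x y : List (Letter 𝒜 (⊤ : Subalgebra k A)), hochD D ((u * tl x) ⊗ₜ[k] wd y) =
        (D.d u * tl x) ⊗ₜ wd y + sign k p • ((u * D.d (tl x)) ⊗ₜ wd y) -
        sign k p • sign k (ep x) • bdry D hR (fun y => (u * tl x) ⊗ₜ[k] wd y) y +
        sign k p • (splitSum y fun y z => sign k (ep x) • ((u * tl x * tl y) ⊗ₜ[k] wd z)) +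
        splitSum y fun y z => sign k (ep z * (p + ep x + 1 + ep y)) •
          ((tl z * u * tl x) ⊗ₜ[k] wd y) := by
      intro x y
      rw [hochD_wd D hR (mul_mem_homog hu (tl_mem_homog x)), D.d_mul_homog hu]
      simp only [← add_assoc, sign_add_one, sign_add p, neg_smul, mul_smul, TensorProduct.add_tmul,
        ← TensorProduct.smul_tmul', splitSum_smul, sub_neg_eq_add, mul_assoc]
      abel
    simp only [h, splitSum_add, splitSum_sub, splitSum_smul, P₁, Q₁, Q₂, Q₃, Q₇]
  have e4 : hochD D (splitSum l fun x y => sign k (ep y * (p + ep x)) • ((tl y * u) ⊗ₜ[k] wd x)) =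
      Q₅ - P₂ - sign k p • Q₄ + sign k p • Q₇ + Q₆ := by
    rw [map_splitSum]
    have h : ∀ x y : List (Letter 𝒜 (⊤ : Subalgebra k A)),
        hochD D (sign k (ep y * (p + ep x)) • ((tl y * u) ⊗ₜ[k] wd x)) =
        sign k (ep y * (p + ep x)) • ((D.d (tl y) * u) ⊗ₜ[k] wd x) -
        sign k (ep y * (p + 1 + ep x)) • ((tl y * D.d u) ⊗ₜ[k] wd x) -
        sign k p • sign k (ep y * (p + ep x + 1)) •
          bdry D hR (fun x => (tl y * u) ⊗ₜ[k] wd x) x +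
        sign k p • (splitSum x fun x₁ x₂ => sign k (ep y * (p + ep x₁ + 1 + ep x₂)) •
          ((tl y * u * tl x₁) ⊗ₜ[k] wd x₂)) +
        splitSum x fun x₁ x₂ => sign k ((ep x₂ + ep y) * (p + ep x₁) + ep x₂) •
          ((tl x₂ * tl y * u) ⊗ₜ[k] wd x₁) := by
      intro x y
      rw [map_smul, hochD_wd D hR (mul_mem_homog (tl_mem_homog y) hu),
        D.d_mul_homog (tl_mem_homog y)]
      simp only [smul_add, smul_sub, TensorProduct.add_tmul, ← TensorProduct.smul_tmul',
        ← splitSum_smul, smul_smul, ← sign_add]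
      have s1 : sign k (ep y * (p + ep x) + (ep y + 1)) = - sign k (ep y * (p + 1 + ep x)) := by
        rw [← sign_add_one]
        congr 1
        ring
      have s2 : sign k (ep y * (p + ep x) + (ep y + 1 + p)) =
          - sign k (p + ep y * (p + ep x + 1)) := by
        rw [← sign_add_one]
        congr 1
        ring
      have s3 : (splitSum x fun x₁ x₂ => sign k (ep y * (p + ep x) + (ep y + 1 + p)) •
          ((tl y * u * tl x₁) ⊗ₜ[k] wd x₂)) = - splitSum x fun x₁ x₂ =>
          sign k (p + ep y * (p + ep x₁ + 1 + ep x₂)) • ((tl y * u * tl x₁) ⊗ₜ[k] wd x₂) := by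
        rw [← splitSum_neg]
        refine splitSum_congr fun x₁ x₂ h => ?_
        rw [s2, ← h, ep_append, neg_smul]
        congr 3
        ring
      have s4 : (splitSum x fun x₁ x₂ => sign k (ep y * (p + ep x) +
          ep x₂ * (ep y + 1 + p + ep x₁)) • ((tl x₂ * (tl y * u)) ⊗ₜ[k] wd x₁)) =
          splitSum x fun x₁ x₂ => sign k ((ep x₂ + ep y) * (p + ep x₁) + ep x₂) •
          ((tl x₂ * tl y * u) ⊗ₜ[k] wd x₁) := by
        refine splitSum_congr fun x₁ x₂ h => ?_
        rw [← h, ep_append, mul_assoc]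
        congr 2
        generalize ep x₁ = a, ep x₂ = b, ep y = d, p = c
        decide +revert
      rw [s3, s4, s1, s2]
      simp only [neg_smul]
      abel
    simp only [h, splitSum_add, splitSum_sub, splitSum_smul, P₂, Q₄, Q₅]
    rw [splitSum_assoc, splitSum_assoc]
  rw [map_add, map_sub, map_add, map_smul, map_smul, e1, e2, e3, e4]
  simp only [smul_add, smul_sub, sq]
  abel

end SquareZero

/-- The restriction of a weight to an invariant submodule. -/
def Weight.restrict {k L : Type*} [CommRing k] [AddCommGroup L] [Module k L] (W : Weight k L)
    (p : Submodule k L) (hp : ∀ j, ∀ x ∈ p, W.q j x ∈ p) : Weight k p where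
  q j := (W.q j).restrict (hp j)
  q_neg j hj := by ext x; simp [W.q_neg j hj]
  orth i j x := by
    ext
    simp only [LinearMap.coe_restrict_apply, W.orth]
    split_ifs <;> simp
  complete x := by
    obtain ⟨N, hN⟩ := W.complete x
    refine ⟨N, fun n hn => Subtype.ext ?_⟩
    rw [AddSubmonoidClass.coe_finsetSum]
    exact hN n hn

theorem IsQuasiIso.comp {k L L' L'' : Type*} [CommRing k] [AddCommGroup L] [Module k L]
    [AddCommGroup L'] [Module k L'] [AddCommGroup L''] [Module k L''] {d : Module.End k L}
    {d' : Module.End k L'} {d'' : Module.End k L''} {φ : L →ₗ[k] L'} {ψ : L' →ₗ[k] L''}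
    (h' : IsQuasiIso d' d'' ψ) (h : IsQuasiIso d d' φ) (hφ : ∀ x, φ (d x) = d' (φ x))
    (hψ : ∀ x, ψ (d' x) = d'' (ψ x)) : IsQuasiIso d d'' (ψ ∘ₗ φ) := by
  intro x y hx hy
  obtain ⟨z', w', hz', hw'⟩ := h' (φ x) y (by rw [← hφ, hx, map_zero]) hy
  obtain ⟨z, w, hz, hw⟩ := h x z' hx hz'
  refine ⟨z, ψ w + w', hz, ?_⟩
  rw [← hw', ← hw, map_add, map_add, hψ, LinearMap.comp_apply]
  abel

/-! ### The part of the Hochschild differential that preserves the word length -/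

section Linear

variable {k A : Type*} [CommRing k] [Ring A] [Algebra k A]
variable {𝒜 : ℕ → Submodule k A} [GradedAlgebra 𝒜] (D : DGA 𝒜)

/-- A dg algebra as a complex. -/
def DGA.complex : SignedComplex k A where
  d := D.d
  σ := sgn 𝒜
  d_d := D.d_d
  σ_σ := sgn_sgn
  d_σ := D.d_sgn

/-- The complex `s⁻¹ A_{>0}`. -/
def DGA.letterComplex : SignedComplex k (Pos 𝒜) where
  d := -D.d.restrict fun a _ => D.d_mem_pos a
  σ := -(sgn 𝒜).restrict fun _ => sgn_mem_pos
  d_d a := by ext; simp [D.d_d]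
  σ_σ a := by ext; simp [sgn_sgn]
  d_σ a := by ext; simp [D.d_sgn]

theorem letterComplex_d_letter {a : A} (ha : a ∈ Pos 𝒜) (w : Bar 𝒜) :
    D.letterComplex.tensorAlgebra.d (letter 𝒜 a * w) = - letter 𝒜 (D.d a) * w -
      letter 𝒜 (sgn 𝒜 a) * D.letterComplex.tensorAlgebra.d w := by
  have h1 := letter_coe (⟨a, ha⟩ : Pos 𝒜)
  have h2 := letter_coe (⟨D.d a, D.d_mem_pos a⟩ : Pos 𝒜)
  have h3 := letter_coe (⟨sgn 𝒜 a, sgn_mem_pos ha⟩ : Pos 𝒜)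
  rw [h1, h2, h3, SignedComplex.tensorAlgebra_d_ι_mul, sub_eq_add_neg, ← neg_mul, ← map_neg,
    ← map_neg]
  rfl

variable {R : Subalgebra k A}

theorem letterComplex_d_wd (l : List (Letter 𝒜 R)) : D.letterComplex.tensorAlgebra.d (wd l) =
    - splitSum₃ l fun x y z => sign k (ep x) • (wd x * letter 𝒜 (D.d (tl y)) * wd z) := by
  induction l with
  | nil => simp [splitSum₃]
  | cons c l ih =>
    rw [wd_cons, letterComplex_d_letter D c.mem_pos, ih, sgn_of_homog c.mem_homog]
    simp only [splitSum₃]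
    rw [splitSum_cons, splitSum_tl_left _ _ _ (fun x y hx => by simp [hx])]
    simp only [ep_nil, sign_zero, one_smul, wd_nil, one_mul, tl_singleton, ep_cons, wd_cons,
      sign_add, mul_neg, map_smul, smul_mul_assoc, mul_splitSum, mul_smul_comm, smul_smul, sign_one,
      neg_mul, neg_smul, splitSum_neg, mul_assoc]
    simp only [mul_comm (sign k c.par)]
    abel

theorem wd_mem_length (l : List (Letter 𝒜 R)) :
    wd l ∈ LinearMap.range (TensorAlgebra.ι k : Pos 𝒜 →ₗ[k] _) ^ l.length := by
  induction l with
  | nil => rw [wd_nil, List.length_nil, pow_zero]; exact Submodule.one_le.1 le_rfl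
  | cons c l ih => exact ι_mul_mem_length _ ih

theorem letter_mem_length (a : A) :
    letter 𝒜 a ∈ LinearMap.range (TensorAlgebra.ι k : Pos 𝒜 →ₗ[k] _) ^ 1 := by
  rw [pow_one]; exact ⟨_, rfl⟩

variable (𝒜) in
/-- The elements of `ΛA` that are supported on words of length `n`. -/
def hochLength (n : ℤ) : Submodule k (Hoch 𝒜) :=
  ⨅ j : ℤ, LinearMap.eqLocus (((lengthWeight k (Pos 𝒜)).lTensor A).q j)
    (if j = n then LinearMap.id else 0)

theorem mem_hochLength {n : ℤ} {z : Hoch 𝒜} : z ∈ hochLength 𝒜 n ↔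
    ∀ j, ((lengthWeight k (Pos 𝒜)).lTensor A).q j z = if j = n then z else 0 := by
  simp only [hochLength, Submodule.mem_iInf, LinearMap.mem_eqLocus]
  refine forall_congr' fun j => ?_
  split_ifs <;> rfl

theorem tmul_mem_hochLength {n : ℕ} (u : A) {w : Bar 𝒜}
    (hw : w ∈ LinearMap.range (TensorAlgebra.ι k : Pos 𝒜 →ₗ[k] _) ^ n) :
    u ⊗ₜ w ∈ hochLength 𝒜 n := by
  refine mem_hochLength.2 fun j => ?_
  change u ⊗ₜ ((lengthWeight k (Pos 𝒜)).q j w) = _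
  rw [lengthWeight_of_mem hw]
  split_ifs <;> simp

/-- The part of the Hochschild differential that preserves the word length. -/
def hochLin : Module.End k (Hoch 𝒜) := (D.complex.tensor D.letterComplex.tensorAlgebra).d

theorem length_hochLin (j : ℤ) (z : Hoch 𝒜) :
    ((lengthWeight k (Pos 𝒜)).lTensor A).q j (hochLin D z) =
      hochLin D (((lengthWeight k (Pos 𝒜)).lTensor A).q j z) := by
  have h : ∀ (w : Bar 𝒜) (j : ℤ), (lengthWeight k (Pos 𝒜)).q j (D.letterComplex.tensorAlgebra.d w) =
      D.letterComplex.tensorAlgebra.d ((lengthWeight k (Pos 𝒜)).q j w) := by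
    intro w
    induction w using tensorAlgebra_induction with
    | h1 => intro j; rw [lengthWeight_one]; split_ifs <;> simp
    | ha x y hx hy => intro j; simp only [map_add, hx, hy]
    | hs c x hx => intro j; simp only [map_smul, hx]
    | hι v w hw =>
      intro j
      obtain ⟨i, rfl⟩ : ∃ i, j = i + 1 := ⟨j - 1, by ring⟩
      simp only [SignedComplex.tensorAlgebra_d_ι_mul, map_add, lengthWeight_ι_mul, hw]
  induction z using TensorProduct.induction_on with
  | zero => simp only [map_zero]
  | add x y hx hy => simp only [map_add, hx, hy]
  | tmul u w => simp only [hochLin, SignedComplex.tensor_d_tmul, map_add, Weight.lTensor,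
      LinearMap.lTensor_tmul, h]

/-- The terms outside the linear part multiply two adjacent letters, or a letter with `u`, and so
lose exactly one letter. For the empty word the difference vanishes, in accordance with the length
`-1`. -/
theorem hochD_sub_hochLin_mem {u : A} {p : ZMod 2} (hu : u ∈ homog 𝒜 p)
    (l : List (Letter 𝒜 (⊤ : Subalgebra k A))) :
    hochD D (u ⊗ₜ wd l) - hochLin D (u ⊗ₜ wd l) ∈ hochLength 𝒜 (l.length - 1) := by
  have hlen : ∀ x : List (Letter 𝒜 (⊤ : Subalgebra k A)), tl x ≠ 0 → x.length = 1 := by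
    rintro (_ | ⟨a, _ | ⟨b, x⟩⟩) h
    · exact (h rfl).elim
    · rfl
    · exact (h rfl).elim
  have e : hochD D (u ⊗ₜ wd l) - hochLin D (u ⊗ₜ wd l) =
      - (sign k p • splitSum₃ l fun x y z => sign k (ep x) • (u ⊗ₜ[k] (wd x *
        letter 𝒜 (splitSum y fun s t => sign k (ep s) • (tl s * tl t)) * wd z)))
      - (sign k p • splitSum l fun x y => (u * tl x) ⊗ₜ[k] wd y) +
      splitSum l fun x y => sign k (ep y * (p + ep x)) • ((tl y * u) ⊗ₜ[k] wd x) := by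
    have hR : ∀ a ∈ (⊤ : Subalgebra k A), D.d a ∈ (⊤ : Subalgebra k A) := fun _ _ => trivial
    rw [hochD_eq, hochD₁_wd D hR hu, hochTheta₂_wd hu, hochLin,
      SignedComplex.tensor_d_tmul, letterComplex_d_wd]
    have h1 : D.complex.σ u = sign k p • u := sgn_of_homog hu
    have h2 : (bdry D hR (fun l => u ⊗ₜ[k] wd l) l : Hoch 𝒜) =
        - (splitSum₃ l fun x y z => sign k (ep x) •
          (u ⊗ₜ[k] (wd x * letter 𝒜 (D.d (tl y)) * wd z))) -
        splitSum₃ l fun x y z => sign k (ep x) • (u ⊗ₜ[k] (wd x *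
        letter 𝒜 (splitSum y fun s t => sign k (ep s) • (tl s * tl t)) * wd z)) := by
      simp only [bdry, splitSum₃, ← splitSum_neg, ← splitSum_sub]
      refine splitSum_congr fun x w _ => splitSum_congr fun y z _ => ?_
      rw [wd_append, wd_cons, delta_val, map_sub, map_neg, sub_mul, neg_mul, mul_sub, mul_neg,
        TensorProduct.tmul_sub, TensorProduct.tmul_neg, smul_sub, smul_neg, mul_assoc, mul_assoc]
    have h3 : D.complex.d u = D.d u := rfl
    rw [h1, h2, h3, TensorProduct.tmul_neg, smul_sub, smul_neg]
    simp only [splitSum₃, tmul_splitSum, TensorProduct.tmul_smul, ← TensorProduct.smul_tmul',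
      ← splitSum_smul, smul_comm (sign k p)]
    abel
  rw [e]
  refine add_mem (sub_mem (neg_mem (Submodule.smul_mem _ _ (splitSum_mem fun x w hx =>
    splitSum_mem fun y z hy => Submodule.smul_mem _ _ ?_))) (Submodule.smul_mem _ _
    (splitSum_mem fun x y hx => ?_))) (splitSum_mem fun x y hx => Submodule.smul_mem _ _ ?_)
  · rw [map_splitSum, mul_splitSum, splitSum_mul, tmul_splitSum]
    refine splitSum_mem fun s t hs => ?_
    by_cases h : tl s = 0 ∨ tl t = 0
    · have : tl s * tl t = 0 := by rcases h with h | h <;> simp [h]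
      rw [this]; simp
    · rw [not_or] at h
      have h1 := hlen _ h.1
      have h2 := hlen _ h.2
      have h3 : l.length = x.length + 1 + z.length + 1 := by
        rw [← hx, ← hy, ← hs]; simp only [List.length_append]; omega
      rw [h3]
      push_cast
      rw [add_sub_cancel_right, map_smul, mul_smul_comm, smul_mul_assoc, TensorProduct.tmul_smul]
      refine Submodule.smul_mem _ _ ?_
      have := tmul_mem_hochLength u (n := x.length + 1 + z.length)
        (w := wd x * letter 𝒜 (tl s * tl t) * wd z) (by
          rw [pow_add, pow_add]
          exact Submodule.mul_mem_mul (Submodule.mul_mem_mul (wd_mem_length x)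
            (letter_mem_length _)) (wd_mem_length z))
      exact_mod_cast this
  · by_cases h : tl x = 0
    · rw [h]; simp
    · have h3 : l.length = y.length + 1 := by
        rw [← hx, List.length_append, hlen _ h]; omega
      rw [h3]
      push_cast
      rw [add_sub_cancel_right]
      exact tmul_mem_hochLength _ (wd_mem_length y)
  · by_cases h : tl y = 0
    · rw [h]; simp
    · have h3 : l.length = x.length + 1 := by
        rw [← hx, List.length_append, hlen _ h]
      rw [h3]
      push_cast
      rw [add_sub_cancel_right]
      exact tmul_mem_hochLength _ (wd_mem_length x)

theorem length_hochD_sub_hochLin (j : ℤ) (z : Hoch 𝒜) :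
    ((lengthWeight k (Pos 𝒜)).lTensor A).q (j - 1) ((hochD D - hochLin D) z) =
      (hochD D - hochLin D) (((lengthWeight k (Pos 𝒜)).lTensor A).q j z) := by
  refine hoch_mem_of_tmul_wd_mem D (S := LinearMap.eqLocus
    (((lengthWeight k (Pos 𝒜)).lTensor A).q (j - 1) ∘ₗ (hochD D - hochLin D))
    ((hochD D - hochLin D) ∘ₗ ((lengthWeight k (Pos 𝒜)).lTensor A).q j)) (fun u q hu l => ?_) z
  rw [LinearMap.mem_eqLocus, LinearMap.comp_apply, LinearMap.comp_apply,
    mem_hochLength.1 (tmul_mem_hochLength u (wd_mem_length l)), LinearMap.sub_apply,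
    mem_hochLength.1 (hochD_sub_hochLin_mem D (homog_of_eq_one_or hu) l)]
  by_cases h : j = l.length
  · rw [if_pos (by rw [h]), if_pos h]; rfl
  · rw [if_neg (by omega), if_neg h, map_zero]

end Linear

/-! ### Hochschild homology preserves quasi-isomorphisms -/

section Main

variable {k A A' : Type*} [CommRing k] [Ring A] [Algebra k A] [Ring A'] [Algebra k A']
variable {𝒜 : ℕ → Submodule k A} [GradedAlgebra 𝒜] {𝒜' : ℕ → Submodule k A'} [GradedAlgebra 𝒜']
variable {D : DGA 𝒜} {D' : DGA 𝒜'} (f : DGAHom D D')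

/-- The weight of a graded algebra by degree. -/
def degreeWeight (𝒜 : ℕ → Submodule k A) [GradedAlgebra 𝒜] : Weight k A := Weight.ofDecomposition 𝒜

theorem degreeWeight_of_mem {n : ℕ} {a : A} (ha : a ∈ 𝒜 n) (j : ℤ) :
    (degreeWeight 𝒜).q j a = if j = n then a else 0 := Weight.decompositionProj_of_mem ha j

theorem DGA.degree_d (D : DGA 𝒜) (j : ℤ) (a : A) :
    (degreeWeight 𝒜).q (j + 1) (D.d a) = D.d ((degreeWeight 𝒜).q j a) := by
  induction a using graded_induction (𝒜 := 𝒜) with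
  | h0 => simp
  | ha a b h1 h2 => simp only [map_add, h1, h2]
  | hm n a ha =>
    rw [degreeWeight_of_mem ha, degreeWeight_of_mem (D.d_mem n a ha), Nat.cast_succ]
    simp only [add_left_inj]
    split_ifs <;> simp

theorem degree_sgn (j : ℤ) (a : A) :
    (degreeWeight 𝒜).q j (sgn 𝒜 a) = sgn 𝒜 ((degreeWeight 𝒜).q j a) := by
  induction a using graded_induction (𝒜 := 𝒜) with
  | h0 => simp
  | ha a b h1 h2 => simp only [map_add, h1, h2]
  | hm n a ha =>
    rw [sgn_of_homog (mem_homog_of_mem ha), map_smul, degreeWeight_of_mem ha]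
    split_ifs
    · rw [sgn_of_homog (mem_homog_of_mem ha)]
    · simp

theorem DGAHom.degree_map (j : ℤ) (a : A) :
    (degreeWeight 𝒜').q j (f.toFun a) = f.toFun ((degreeWeight 𝒜).q j a) := by
  induction a using graded_induction (𝒜 := 𝒜) with
  | h0 => simp
  | ha a b h1 h2 => simp only [map_add, h1, h2]
  | hm n a ha =>
    rw [degreeWeight_of_mem ha, degreeWeight_of_mem (f.map_mem n a ha)]
    split_ifs <;> simp

theorem degree_mem_pos (j : ℤ) {a : A} (ha : a ∈ Pos 𝒜) : (degreeWeight 𝒜).q j a ∈ Pos 𝒜 := by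
  have h : ∀ b : A, GradedAlgebra.proj 𝒜 0 b = (degreeWeight 𝒜).q 0 b := fun b =>
    (Weight.decompositionProj_natCast 𝒜 0 b).symm
  rw [mem_pos_iff, h] at ha ⊢
  rw [Weight.orth]
  split_ifs with hj
  · exact ha
  · rfl

variable (𝒜) in
/-- The weight of `A_{>0}` by degree. -/
def posWeight : Weight k (Pos 𝒜) := (degreeWeight 𝒜).restrict (Pos 𝒜) fun j _ => degree_mem_pos j

/-- The restriction of a dga map to positive degrees. -/
def DGAHom.onPos : Pos 𝒜 →ₗ[k] Pos 𝒜' := f.toFun.toLinearMap.restrict fun _ => f.map_mem_pos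

variable {f}

theorem DGAHom.sgn_map (f : DGAHom D D') (a : A) : f.toFun (sgn 𝒜 a) = sgn 𝒜' (f.toFun a) := by
  simpa using (f.sgn_pow_map 1 a).symm

/-- A quasi-isomorphism of dg algebras. -/
def DGAHom.gradedQuasiIso (h : IsQuasiIso D.d D'.d f.toFun.toLinearMap) :
    GradedQuasiIso D.complex D'.complex f.toFun.toLinearMap where
  W := degreeWeight 𝒜
  W' := degreeWeight 𝒜'
  q_d := D.degree_d
  q_d' := D'.degree_d
  q_σ := degree_sgn
  q_σ' := degree_sgn
  q_g := f.degree_map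
  g_σ := f.sgn_map
  g_d := f.map_d
  isQuasiIso := h

/-- The differential of the degree-zero part lies in `A¹ = 0`. -/
theorem DGA.d_toPos (D : DGA 𝒜) (a : A) : D.d (toPos 𝒜 a : A) = D.d a := by
  rw [coe_toPos, map_sub]
  obtain ⟨c, hc⟩ := D.degree_zero (GradedAlgebra.proj 𝒜 0 a) (by
    rw [GradedAlgebra.proj_apply]; exact SetLike.coe_mem _)
  have h1 : D.d (GradedAlgebra.proj 𝒜 0 a) = 0 := D.eq_zero_of_mem_one (D.d_mem 0 _ (by
    rw [GradedAlgebra.proj_apply]; exact SetLike.coe_mem _))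
  rw [h1, sub_zero]

/-- A quasi-isomorphism of dg algebras restricts to positive degrees. -/
def DGAHom.gradedQuasiIsoPos (h : IsQuasiIso D.d D'.d f.toFun.toLinearMap) :
    GradedQuasiIso D.letterComplex D'.letterComplex f.onPos where
  W := posWeight 𝒜
  W' := posWeight 𝒜'
  q_d j x := Subtype.ext ((map_neg _ _).trans (congrArg Neg.neg (D.degree_d j x)))
  q_d' j x := Subtype.ext ((map_neg _ _).trans (congrArg Neg.neg (D'.degree_d j x)))
  q_σ j x := Subtype.ext ((map_neg _ _).trans (congrArg Neg.neg (degree_sgn j (x : A))))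
  q_σ' j x := Subtype.ext ((map_neg _ _).trans (congrArg Neg.neg (degree_sgn j (x : A'))))
  q_g j x := Subtype.ext (f.degree_map j x)
  g_σ x := Subtype.ext ((map_neg _ _).trans (congrArg Neg.neg (f.sgn_map x)))
  g_d x := Subtype.ext ((map_neg _ _).trans (congrArg Neg.neg (f.map_d x)))
  isQuasiIso x y hx hy := by
    have hx : -D.d (x : A) = 0 := congrArg Subtype.val hx
    have hy : -D'.d (y : A') = f.toFun x := congrArg Subtype.val hy
    obtain ⟨z, w, hz, hw⟩ := h x (-y) (neg_eq_zero.1 hx) (by rw [map_neg, hy]; rfl)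
    -- A solution in the whole algebras is cut down to positive degrees. The differential ignores
    -- degree zero, and the degree-zero part of `f z` vanishes because `y` and all boundaries have
    -- positive degree. The minus sign compensates the sign of the shifted differential.
    refine ⟨-toPos 𝒜 z, toPos 𝒜' w, Subtype.ext ?_, Subtype.ext ?_⟩
    · change -D.d (-(toPos 𝒜 z : A)) = x
      rw [map_neg, neg_neg, D.d_toPos, hz]
    · have h1 : GradedAlgebra.proj 𝒜' 0 (f.toFun z) + GradedAlgebra.proj 𝒜' 0 (D'.d w) = 0 := by
        have e := congrArg (GradedAlgebra.proj 𝒜' 0) hw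
        rw [map_add, map_neg, mem_pos_iff.1 y.2, neg_zero] at e
        exact e
      rw [mem_pos_iff.1 (D'.d_mem_pos w), add_zero] at h1
      change f.toFun (-(toPos 𝒜 z : A)) + -D'.d (toPos 𝒜' w : A') = y
      rw [D'.d_toPos, coe_toPos, map_neg, map_sub, ← f.proj_map, h1, sub_zero]
      rw [← neg_add, neg_eq_iff_eq_neg]
      exact hw

theorem DGAHom.onBar_ι_eq (v : Pos 𝒜) :
    f.onBar (TensorAlgebra.ι k v) = TensorAlgebra.ι k (f.onPos v) := by
  rw [f.onBar_ι]; exact letter_coe (f.onPos v)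

theorem DGAHom.onBar_letterComplex_d (f : DGAHom D D') (w : Bar 𝒜) :
    f.onBar (D.letterComplex.tensorAlgebra.d w) = D'.letterComplex.tensorAlgebra.d (f.onBar w) := by
  have h1 : ∀ v, f.onPos (D.letterComplex.d v) = D'.letterComplex.d (f.onPos v) := fun x =>
    Subtype.ext ((map_neg _ _).trans (congrArg Neg.neg (f.map_d x)))
  have h2 : ∀ v, f.onPos (D.letterComplex.σ v) = D'.letterComplex.σ (f.onPos v) := fun x =>
    Subtype.ext ((map_neg _ _).trans (congrArg Neg.neg (f.sgn_map x)))
  induction w using tensorAlgebra_induction with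
  | h1 => simp
  | ha x y hx hy => simp only [map_add, hx, hy]
  | hs c x hx => simp only [map_smul, hx]
  | hι v w hw => simp only [SignedComplex.tensorAlgebra_d_ι_mul, map_add, map_mul, f.onBar_ι_eq, hw,
      h1, h2]

theorem DGAHom.length_onHoch (f : DGAHom D D') (j : ℤ) (z : Hoch 𝒜) :
    ((lengthWeight k (Pos 𝒜')).lTensor A').q j (f.onHoch z) =
      f.onHoch (((lengthWeight k (Pos 𝒜)).lTensor A).q j z) := by
  have h : ∀ (w : Bar 𝒜) (j : ℤ), (lengthWeight k (Pos 𝒜')).q j (f.onBar w) =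
      f.onBar ((lengthWeight k (Pos 𝒜)).q j w) := by
    intro w
    induction w using tensorAlgebra_induction with
    | h1 => intro j; rw [map_one, lengthWeight_one, lengthWeight_one]; split_ifs <;> simp
    | ha x y hx hy => intro j; simp only [map_add, hx, hy]
    | hs c x hx => intro j; simp only [map_smul, hx]
    | hι v w hw =>
      intro j
      obtain ⟨i, rfl⟩ : ∃ i, j = i + 1 := ⟨j - 1, by ring⟩
      simp only [map_mul, f.onBar_ι_eq, lengthWeight_ι_mul, hw]
  induction z using TensorProduct.induction_on with
  | zero => simp only [map_zero]
  | add x y hx hy => simp only [map_add, hx, hy]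
  | tmul u w => simp only [f.onHoch_tmul, Weight.lTensor, LinearMap.lTensor_tmul, h]

theorem hochD_eq_hochLin_add (D : DGA 𝒜) : hochD D = hochLin D + (hochD D - hochLin D) := by abel

variable (f) in
/-- Hochschild homology preserves quasi-isomorphisms. -/
theorem DGAHom.onHH_bijective [Module.Flat k A'] [Module.Flat k (Pos 𝒜')]
    [Module.Flat k (Bar 𝒜)] (h : IsQuasiIso D.d D'.d f.toFun.toLinearMap) :
    Function.Bijective f.onHH := by
  have h1 := (f.gradedQuasiIso h).rTensor (D.letterComplex.tensorAlgebra)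
  have h2 := (f.gradedQuasiIsoPos h).tensorAlgebra f.onBar (f.onBar_ι_eq) A' D'.complex
  -- For the linear part, `f ⊗ Bf` is `f ⊗ 1` followed by `1 ⊗ Bf`, and both are quasi-isomorphisms
  -- by flatness.
  have h0 : IsQuasiIso (hochLin D) (hochLin D') f.onHoch := by
    have e : f.onHoch = LinearMap.lTensor A' f.onBar.toLinearMap ∘ₗ
        LinearMap.rTensor (Bar 𝒜) f.toFun.toLinearMap := by
      rw [LinearMap.lTensor_comp_rTensor]; rfl
    rw [e]
    refine h2.comp h1 (fun x => ?_) (fun x => ?_)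
    · induction x using TensorProduct.induction_on with
      | zero => simp only [map_zero]
      | add x y hx hy => simp only [map_add, hx, hy]
      | tmul x y =>
        simp only [hochLin, SignedComplex.tensor_d_tmul, map_add, LinearMap.rTensor_tmul]
        congr 1
        · exact congrArg (· ⊗ₜ[k] y) (f.map_d x)
        · exact congrArg (· ⊗ₜ[k] _) (f.sgn_map x)
    · induction x using TensorProduct.induction_on with
      | zero => simp only [map_zero]
      | add x y hx hy => simp only [map_add, hx, hy]
      | tmul x y =>
        simp only [SignedComplex.tensor_d_tmul, map_add, LinearMap.lTensor_tmul]
        congr 2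
        exact f.onBar_letterComplex_d y
  have hl := hochD_hochD D
  have hl' := hochD_hochD D'
  have key : IsQuasiIso (hochD D) (hochD D') f.onHoch := by
    have e := hochD_eq_hochLin_add D
    have e' := hochD_eq_hochLin_add D'
    rw [e] at hl
    rw [e'] at hl'
    rw [e, e']
    -- Here the weight is the word length: the linear part preserves it, so `a = 0`, and the rest of
    -- the differential lowers it by one.
    refine h0.of_leading ((lengthWeight k (Pos 𝒜)).lTensor A) ((lengthWeight k (Pos 𝒜')).lTensor A')
      le_rfl (fun j x => by rw [add_zero, length_hochLin]) (fun j x => by rw [add_zero, length_hochLin])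
      (fun j x => by rw [add_zero, length_hochD_sub_hochLin])
      (fun j x => by rw [add_zero, length_hochD_sub_hochLin]) ?_ hl hl' ?_
    · exact f.length_onHoch
    · rw [← e, ← e']; exact f.hochD_map
  exact key.bijective _

end Main

/-! ### The mapping path algebra -/

section PathAlgebra

variable {k A A' : Type*} [CommRing k] [Ring A] [Algebra k A] [Ring A'] [Algebra k A']
variable {𝒜 : ℕ → Submodule k A} [GradedAlgebra 𝒜]
variable {𝒜' : ℕ → Submodule k A'} [GradedAlgebra 𝒜']
variable {D : DGA 𝒜} {D' : DGA 𝒜'} (f : DGAHom D D')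

/-- The underlying module of the mapping path algebra of `f`: the triples `(x, t, y)` with `x` and
`f y` of equal degree-zero part and `t` of positive degree. -/
def DGAHom.pathModule : Submodule k (A' × A' × A) where
  carrier := {p | p.1 - f.toFun p.2.2 ∈ Pos 𝒜' ∧ p.2.1 ∈ Pos 𝒜'}
  zero_mem' := by simp
  add_mem' := by
    rintro p q ⟨h1, h2⟩ ⟨h3, h4⟩
    refine ⟨?_, add_mem h2 h4⟩
    convert add_mem h1 h3 using 1
    simp only [Prod.fst_add, Prod.snd_add, map_add]
    abel
  smul_mem' := by
    rintro c p ⟨h1, h2⟩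
    refine ⟨?_, Submodule.smul_mem _ c h2⟩
    convert Submodule.smul_mem _ c h1 using 1
    simp only [Prod.smul_fst, Prod.smul_snd, map_smul, smul_sub]

/-- The mapping path algebra of a dga map `f : A → A'`. -/
def DGAHom.Path : Type _ := f.pathModule

namespace DGAHom.Path

instance : AddCommGroup f.Path := inferInstanceAs (AddCommGroup f.pathModule)
instance : Module k f.Path := inferInstanceAs (Module k f.pathModule)

variable {f}

/-- The component in `A'` of degree zero. -/
def fst : f.Path →ₗ[k] A' := LinearMap.fst k A' (A' × A) ∘ₗ f.pathModule.subtype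
/-- The component in `A'` of degree one. -/
def mid : f.Path →ₗ[k] A' :=
  LinearMap.fst k A' A ∘ₗ LinearMap.snd k A' (A' × A) ∘ₗ f.pathModule.subtype
/-- The component in `A`. -/
def snd : f.Path →ₗ[k] A :=
  LinearMap.snd k A' A ∘ₗ LinearMap.snd k A' (A' × A) ∘ₗ f.pathModule.subtype

/-- The element with given components. -/
def mk (x t : A') (y : A) (h : x - f.toFun y ∈ Pos 𝒜') (ht : t ∈ Pos 𝒜') : f.Path :=
  ⟨(x, t, y), h, ht⟩

@[simp] theorem fst_mk (x t : A') (y : A) (h : x - f.toFun y ∈ Pos 𝒜') (ht : t ∈ Pos 𝒜') :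
    fst (mk x t y h ht) = x := rfl
@[simp] theorem mid_mk (x t : A') (y : A) (h : x - f.toFun y ∈ Pos 𝒜') (ht : t ∈ Pos 𝒜') :
    mid (mk x t y h ht) = t := rfl
@[simp] theorem snd_mk (x t : A') (y : A) (h : x - f.toFun y ∈ Pos 𝒜') (ht : t ∈ Pos 𝒜') :
    snd (mk x t y h ht) = y := rfl

theorem fst_sub_mem (p : f.Path) : fst p - f.toFun (snd p) ∈ Pos 𝒜' := p.2.1
theorem mid_mem (p : f.Path) : mid p ∈ Pos 𝒜' := p.2.2

theorem ext {p q : f.Path} (h1 : fst p = fst q) (h2 : mid p = mid q) (h3 : snd p = snd q) :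
    p = q :=
  Subtype.ext (Prod.ext h1 (Prod.ext h2 h3))

theorem proj_fst (p : f.Path) :
    GradedAlgebra.proj 𝒜' 0 (fst p) = f.toFun (GradedAlgebra.proj 𝒜 0 (snd p)) := by
  have h := mem_pos_iff.1 (fst_sub_mem p)
  rwa [map_sub, f.proj_map, sub_eq_zero] at h

/-- The middle component is multiplied from the left by start points and from the right by images of
end points. The sign results from its shift in degree by one. -/
instance : Mul f.Path :=
  ⟨fun p q => mk (fst p * fst q) (sgn 𝒜' (fst p) * mid q + mid p * f.toFun (snd q))
    (snd p * snd q)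
    (by rw [mem_pos_iff, map_sub, f.proj_map, proj_zero_mul, proj_zero_mul, proj_fst, proj_fst,
      map_mul, sub_self])
    (add_mem (mul_mem_pos' (mid_mem q) _) (mul_mem_pos (mid_mem p) _))⟩

instance : One f.Path := ⟨mk 1 0 1 (by simp) (zero_mem _)⟩

@[simp] theorem fst_mul (p q : f.Path) : fst (p * q) = fst p * fst q := rfl
@[simp] theorem mid_mul (p q : f.Path) :
    mid (p * q) = sgn 𝒜' (fst p) * mid q + mid p * f.toFun (snd q) := rfl
@[simp] theorem snd_mul (p q : f.Path) : snd (p * q) = snd p * snd q := rfl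
@[simp] theorem fst_one : fst (1 : f.Path) = 1 := rfl
@[simp] theorem mid_one : mid (1 : f.Path) = 0 := rfl
@[simp] theorem snd_one : snd (1 : f.Path) = 1 := rfl

instance : Ring f.Path :=
  { (inferInstance : AddCommGroup f.Path), (inferInstance : Mul f.Path),
    (inferInstance : One f.Path) with
    left_distrib := fun p q r => by
      refine ext ?_ ?_ ?_ <;>
        simp only [fst_mul, mid_mul, snd_mul, map_add, mul_add]
      abel
    right_distrib := fun p q r => by
      refine ext ?_ ?_ ?_ <;>
        simp only [fst_mul, mid_mul, snd_mul, map_add, add_mul]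
      abel
    zero_mul := fun p => by
      refine ext ?_ ?_ ?_ <;> simp only [fst_mul, mid_mul, snd_mul, map_zero, zero_mul, add_zero]
    mul_zero := fun p => by
      refine ext ?_ ?_ ?_ <;> simp only [fst_mul, mid_mul, snd_mul, map_zero, mul_zero, add_zero]
    mul_assoc := fun p q r => by
      refine ext (mul_assoc _ _ _) ?_ (mul_assoc _ _ _)
      simp only [fst_mul, mid_mul, snd_mul, sgn_mul, map_mul, add_mul, mul_add, mul_assoc,
        add_assoc]
    one_mul := fun p => by
      have h : sgn 𝒜' (1 : A') = 1 := by
        rw [sgn_of_homog one_mem_homog, sign_zero, one_smul]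
      refine ext (one_mul _) ?_ (one_mul _)
      simp only [mid_mul, fst_one, mid_one, h, one_mul, zero_mul, add_zero]
    mul_one := fun p => by
      refine ext (mul_one _) ?_ (mul_one _)
      simp only [mid_mul, mid_one, snd_one, map_one, mul_one, mul_zero, zero_add]
    neg_add_cancel := neg_add_cancel }

instance : Algebra k f.Path :=
  Algebra.ofModule
    (fun c p q => by
      refine ext ?_ ?_ ?_ <;>
        simp only [fst_mul, mid_mul, snd_mul, map_smul, smul_mul_assoc, smul_add])
    (fun c p q => by
      refine ext ?_ ?_ ?_ <;>
        simp only [fst_mul, mid_mul, snd_mul, map_smul, mul_smul_comm, smul_add])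

theorem algebraMap_eq (c : k) : algebraMap k f.Path c = c • (1 : f.Path) :=
  Algebra.algebraMap_eq_smul_one c

/-- The elements of degree `n` of `A'`, shifted by one. -/
def shift (𝒜' : ℕ → Submodule k A') : ℕ → Submodule k A'
  | 0 => ⊥
  | n + 1 => 𝒜' n

variable (f) in
/-- The grading of the mapping path algebra. -/
def grading (n : ℕ) : Submodule k f.Path :=
  (𝒜' n).comap fst ⊓ (shift 𝒜' n).comap mid ⊓ (𝒜 n).comap snd

theorem mem_grading {n : ℕ} {p : f.Path} :
    p ∈ grading f n ↔ fst p ∈ 𝒜' n ∧ mid p ∈ shift 𝒜' n ∧ snd p ∈ 𝒜 n :=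
  and_assoc

theorem sgn_of_mem {n : ℕ} {a : A} (ha : a ∈ 𝒜 n) : sgn 𝒜 a = sign k n • a :=
  sgn_of_homog (mem_homog_of_mem ha)

instance : SetLike.GradedMonoid (grading f) where
  one_mem := mem_grading.2
    ⟨(SetLike.GradedOne.one_mem : (1 : A') ∈ 𝒜' 0), zero_mem (shift 𝒜' 0),
      (SetLike.GradedOne.one_mem : (1 : A) ∈ 𝒜 0)⟩
  mul_mem := by
    intro m n p q hp hq
    obtain ⟨hp1, hp2, hp3⟩ := mem_grading.1 hp
    obtain ⟨hq1, hq2, hq3⟩ := mem_grading.1 hq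
    rw [mem_grading, fst_mul, mid_mul, snd_mul]
    refine ⟨SetLike.GradedMul.mul_mem hp1 hq1, ?_, SetLike.GradedMul.mul_mem hp3 hq3⟩
    refine add_mem ?_ ?_
    · rcases n with _ | n
      · rw [show mid q = 0 from hq2, mul_zero]; exact zero_mem _
      · rw [sgn_of_mem hp1, smul_mul_assoc]
        exact Submodule.smul_mem (𝒜' (m + n)) _
          (SetLike.GradedMul.mul_mem hp1 (show mid q ∈ 𝒜' n from hq2))
    · rcases m with _ | m
      · rw [show mid p = 0 from hp2, zero_mul]; exact zero_mem _
      · rw [Nat.add_right_comm]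
        exact SetLike.GradedMul.mul_mem (A := 𝒜') (show mid p ∈ 𝒜' m from hp2) (f.map_mem n _ hq3)

/-- The projection onto the part of degree `n` of the shift. -/
def shiftProj (𝒜' : ℕ → Submodule k A') [GradedAlgebra 𝒜'] : ℕ → A' →ₗ[k] A'
  | 0 => 0
  | n + 1 => GradedAlgebra.proj 𝒜' n

theorem proj_of_mem {m : ℕ} {a : A} (ha : a ∈ 𝒜 m) (n : ℕ) :
    GradedAlgebra.proj 𝒜 n a = if m = n then a else 0 := by
  rw [GradedAlgebra.proj_apply, DirectSum.decompose_of_mem 𝒜 ha]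
  split_ifs with h
  · subst h; simp
  · rw [DirectSum.of_eq_of_ne _ _ _ (Ne.symm h)]; rfl

theorem shiftProj_of_mem {m : ℕ} {a : A'} (ha : a ∈ shift 𝒜' m) (n : ℕ) :
    shiftProj 𝒜' n a = if m = n then a else 0 := by
  rcases m with _ | m
  · rw [show a = 0 from ha, map_zero, ite_self]
  rcases n with _ | n
  · rfl
  · simp only [Nat.add_right_cancel_iff]; exact proj_of_mem (show a ∈ 𝒜' m from ha) n

variable (f) in
/-- The inclusion of the kernel of the projection to the other two components. -/
def inl : A' →ₗ[k] f.Path where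
  toFun x := mk (toPos 𝒜' x) 0 0 (by rw [map_zero, sub_zero]; exact (toPos 𝒜' x).2) (zero_mem _)
  map_add' x y := ext (by simp) (by simp) (by simp)
  map_smul' c x := ext (by simp) (by simp) (by simp)

variable (f) in
/-- The inclusion of the component of degree one. -/
def inm : A' →ₗ[k] f.Path where
  toFun x := mk 0 (toPos 𝒜' x) 0 (by simp) (toPos 𝒜' x).2
  map_add' x y := ext (by simp) (by simp) (by simp)
  map_smul' c x := ext (by simp) (by simp) (by simp)

variable (f) in
/-- The map `y ↦ (f y, 0, y)`. -/
def const : A →ₐ[k] f.Path :=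
  AlgHom.ofLinearMap
    { toFun := fun y => mk (f.toFun y) 0 y (by simp) (zero_mem _)
      map_add' := fun x y => ext (by simp) (by simp) (by simp)
      map_smul' := fun c x => ext (by simp) (by simp) (by simp) }
    (ext (map_one f.toFun) rfl rfl)
    (fun x y => ext (map_mul f.toFun x y) (by simp) rfl)

@[simp] theorem fst_const (y : A) : fst (const f y) = f.toFun y := rfl
@[simp] theorem mid_const (y : A) : mid (const f y) = 0 := rfl
@[simp] theorem snd_const (y : A) : snd (const f y) = y := rfl

theorem eq_sum (p : f.Path) :
    p = inl f (fst p - f.toFun (snd p)) + inm f (mid p) + const f (snd p) := by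
  have h (a : A') (ha : a ∈ Pos 𝒜') : (toPos 𝒜' a : A') = a := by
    rw [coe_toPos, mem_pos_iff.1 ha, sub_zero]
  refine ext ?_ ?_ ?_
  · change _ = (toPos 𝒜' (fst p - f.toFun (snd p)) : A') + 0 + f.toFun (snd p)
    rw [h _ (fst_sub_mem p)]; abel
  · change _ = 0 + (toPos 𝒜' (mid p) : A') + 0
    rw [h _ (mid_mem p)]; abel
  · change _ = 0 + 0 + snd p
    abel

theorem const_mem {n : ℕ} {a : A} (ha : a ∈ 𝒜 n) : const f a ∈ grading f n :=
  mem_grading.2 ⟨f.map_mem n a ha, zero_mem (shift 𝒜' n), ha⟩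

theorem toPos_mem {n : ℕ} {a : A} (ha : a ∈ 𝒜 n) : (toPos 𝒜 a : A) ∈ 𝒜 n := by
  rw [coe_toPos, proj_of_mem ha]
  split_ifs
  · rw [sub_self]; exact zero_mem _
  · rwa [sub_zero]

theorem inl_mem {n : ℕ} {a : A'} (ha : a ∈ 𝒜' n) : inl f a ∈ grading f n :=
  mem_grading.2 ⟨toPos_mem ha, zero_mem (shift 𝒜' n), zero_mem (𝒜 n)⟩

theorem inm_mem {n : ℕ} {a : A'} (ha : a ∈ 𝒜' n) : inm f a ∈ grading f (n + 1) := by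
  have h : (toPos 𝒜' a : A') ∈ 𝒜' n := toPos_mem ha
  exact mem_grading.2 ⟨zero_mem (𝒜' (n + 1)), h, zero_mem (𝒜 (n + 1))⟩

/-- Injectivity holds because the three components determine each homogeneous part. Surjectivity
follows from `eq_sum`, whose three summands decompose separately. -/
theorem isInternal : DirectSum.IsInternal (grading f) := by
  constructor
  · have key : ∀ (z : ⨁ n, grading f n) (n : ℕ),
        fst (z n : f.Path) = GradedAlgebra.proj 𝒜' n (fst (DirectSum.coeAddMonoidHom _ z)) ∧
        mid (z n : f.Path) = shiftProj 𝒜' n (mid (DirectSum.coeAddMonoidHom _ z)) ∧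
        snd (z n : f.Path) = GradedAlgebra.proj 𝒜 n (snd (DirectSum.coeAddMonoidHom _ z)) := by
      intro z n
      induction z using DirectSum.induction_on with
      | zero => simp
      | add x y hx hy => simp [hx.1, hx.2.1, hx.2.2, hy.1, hy.2.1, hy.2.2]
      | of m p =>
        obtain ⟨h1, h2, h3⟩ := mem_grading.1 p.2
        rw [DirectSum.coeAddMonoidHom_of, proj_of_mem h1, shiftProj_of_mem h2, proj_of_mem h3]
        split_ifs with h
        · subst h; simp
        · rw [DirectSum.of_eq_of_ne _ _ _ (Ne.symm h)]; simp
    refine (injective_iff_map_eq_zero _).2 fun z hz => DFinsupp.ext fun n => Subtype.ext ?_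
    obtain ⟨h1, h2, h3⟩ := key z n
    rw [hz] at h1 h2 h3
    simp only [map_zero] at h1 h2 h3
    exact ext h1 h2 h3
  · intro p
    change p ∈ AddMonoidHom.mrange (DirectSum.coeAddMonoidHom (grading f))
    have hm : ∀ {n : ℕ} {q : f.Path}, q ∈ grading f n →
        q ∈ AddMonoidHom.mrange (DirectSum.coeAddMonoidHom (grading f)) := fun {n q} hq =>
      ⟨DirectSum.of (fun n => grading f n) n ⟨q, hq⟩, DirectSum.coeAddMonoidHom_of _ _ _⟩
    rw [eq_sum p]
    refine add_mem (add_mem ?_ ?_) ?_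
    · generalize fst p - f.toFun (snd p) = a
      induction a using graded_induction (𝒜 := 𝒜') with
      | h0 => rw [map_zero]; exact zero_mem _
      | ha a b h1 h2 => rw [map_add]; exact add_mem h1 h2
      | hm n a ha => exact hm (inl_mem ha)
    · generalize mid p = a
      induction a using graded_induction (𝒜 := 𝒜') with
      | h0 => rw [map_zero]; exact zero_mem _
      | ha a b h1 h2 => rw [map_add]; exact add_mem h1 h2
      | hm n a ha => exact hm (inm_mem ha)
    · generalize snd p = a
      induction a using graded_induction (𝒜 := 𝒜) with
      | h0 => rw [map_zero]; exact zero_mem _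
      | ha a b h1 h2 => rw [map_add]; exact add_mem h1 h2
      | hm n a ha => exact hm (n := n) (q := const f a) (const_mem ha)

instance : GradedAlgebra (grading f) :=
  { (inferInstance : SetLike.GradedMonoid (grading f)), isInternal.chooseDecomposition with }

theorem par_components (p : ZMod 2) (c : f.Path) :
    fst (par (grading f) p c) = par 𝒜' p (fst c) ∧
    mid (par (grading f) p c) = par 𝒜' (p + 1) (mid c) ∧
    snd (par (grading f) p c) = par 𝒜 p (snd c) := by
  induction c using graded_induction (𝒜 := grading f) with
  | h0 => simp
  | ha a b h1 h2 => simp only [map_add, h1, h2, and_self]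
  | hm n c hc =>
    obtain ⟨h1, h2, h3⟩ := mem_grading.1 hc
    rw [par_of_mem hc, par_of_mem h1, par_of_mem h3]
    have h : par 𝒜' (p + 1) (mid c) = if (n : ZMod 2) = p then mid c else 0 := by
      rcases n with _ | n
      · rw [show mid c = 0 from h2, map_zero, ite_self]
      · rw [par_of_mem (show mid c ∈ 𝒜' n from h2)]
        congr 1
        rw [Nat.cast_add_one]
        generalize (n : ZMod 2) = m
        revert m p; decide
    rw [h]
    split_ifs <;> simp

theorem mem_homog_iff {p : ZMod 2} {c : f.Path} : c ∈ homog (grading f) p ↔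
    fst c ∈ homog 𝒜' p ∧ mid c ∈ homog 𝒜' (p + 1) ∧ snd c ∈ homog 𝒜 p := by
  obtain ⟨h1, h2, h3⟩ := par_components p c
  simp only [mem_homog]
  refine ⟨fun h => ?_, fun ⟨e1, e2, e3⟩ => ext (h1.trans e1) (h2.trans e2) (h3.trans e3)⟩
  rw [h] at h1 h2 h3
  exact ⟨h1.symm, h2.symm, h3.symm⟩

theorem fst_sgn (c : f.Path) : fst (sgn (grading f) c) = sgn 𝒜' (fst c) := by
  simp only [sgn, LinearMap.sub_apply, map_sub, (par_components _ c).1]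

theorem mid_sgn (c : f.Path) : mid (sgn (grading f) c) = - sgn 𝒜' (mid c) := by
  simp only [sgn, LinearMap.sub_apply, map_sub, (par_components _ c).2.1]
  rw [neg_sub]; rfl

theorem snd_sgn (c : f.Path) : snd (sgn (grading f) c) = sgn 𝒜 (snd c) := by
  simp only [sgn, LinearMap.sub_apply, map_sub, (par_components _ c).2.2]

theorem snd_proj (n : ℕ) (c : f.Path) :
    snd (GradedAlgebra.proj (grading f) n c) = GradedAlgebra.proj 𝒜 n (snd c) := by
  induction c using graded_induction (𝒜 := grading f) with
  | h0 => simp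
  | ha a b h1 h2 => simp only [map_add, h1, h2]
  | hm m c hc =>
    rw [proj_of_mem hc, proj_of_mem (mem_grading.1 hc).2.2]
    split_ifs <;> simp

/-- In degree zero a path is determined by its end point: there the middle component vanishes, and
the start point is the image of the end point. -/
theorem mem_pos {c : f.Path} : c ∈ Pos (grading f) ↔ snd c ∈ Pos 𝒜 := by
  rw [mem_pos_iff, mem_pos_iff, ← snd_proj]
  refine ⟨fun h => by rw [h, map_zero], fun h => ?_⟩
  have hm : GradedAlgebra.proj (grading f) 0 c ∈ grading f 0 := by
    rw [GradedAlgebra.proj_apply]; exact SetLike.coe_mem _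
  obtain ⟨e1, e2, -⟩ := mem_grading.1 hm
  have h1 := proj_fst (GradedAlgebra.proj (grading f) 0 c)
  rw [h, map_zero, map_zero, proj_of_mem e1, if_pos rfl] at h1
  exact ext h1 e2 h

variable (f) in
/-- The mapping path algebra as a dga, with `d (x, t, y) = (dx, -dt + x - f y, dy)`. -/
def dga : DGA (grading f) where
  d :=
    { toFun := fun p => mk (D'.d (fst p)) (-D'.d (mid p) + (fst p - f.toFun (snd p))) (D.d (snd p))
        (sub_mem (D'.d_mem_pos _) (by rw [f.map_d]; exact D'.d_mem_pos _))
        (add_mem (neg_mem (D'.d_mem_pos _)) (fst_sub_mem p))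
      map_add' := fun p q => ext (by simp) (by simp; abel) (by simp)
      map_smul' := fun c p => ext (by simp) (by simp [smul_sub]) (by simp) }
  d_mem n p hp := by
    obtain ⟨h1, h2, h3⟩ := mem_grading.1 hp
    refine mem_grading.2 ⟨D'.d_mem n _ h1, ?_, D.d_mem n _ h3⟩
    change -D'.d (mid p) + (fst p - f.toFun (snd p)) ∈ 𝒜' n
    refine add_mem (neg_mem ?_) (sub_mem h1 (f.map_mem n _ h3))
    rcases n with _ | n
    · rw [show mid p = 0 from h2, map_zero]; exact zero_mem _
    · exact D'.d_mem n _ h2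
  d_d p := by
    refine ext (D'.d_d _) ?_ (D.d_d _)
    change -D'.d (-D'.d (mid p) + (fst p - f.toFun (snd p))) +
      (D'.d (fst p) - f.toFun (D.d (snd p))) = 0
    simp only [map_add, map_neg, map_sub, D'.d_d, f.map_d]
    abel
  d_mul p q := by
    refine ext ?_ ?_ ?_
    · change D'.d (fst p * fst q) = D'.d (fst p) * fst q + fst (sgn (grading f) p) * D'.d (fst q)
      rw [fst_sgn, D'.d_mul]
    · change -D'.d (sgn 𝒜' (fst p) * mid q + mid p * f.toFun (snd q)) +
        (fst p * fst q - f.toFun (snd p * snd q)) =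
        (sgn 𝒜' (D'.d (fst p)) * mid q +
          (-D'.d (mid p) + (fst p - f.toFun (snd p))) * f.toFun (snd q)) +
        (sgn 𝒜' (fst (sgn (grading f) p)) * (-D'.d (mid q) + (fst q - f.toFun (snd q))) +
          mid (sgn (grading f) p) * f.toFun (D.d (snd q)))
      rw [fst_sgn, mid_sgn]
      simp only [map_add, D'.d_mul, D'.d_sgn, sgn_sgn, map_mul, f.map_d, mul_add, add_mul, mul_sub,
        sub_mul, neg_mul, mul_neg]
      abel
    · change D.d (snd p * snd q) = D.d (snd p) * snd q + snd (sgn (grading f) p) * D.d (snd q)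
      rw [snd_sgn, D.d_mul]
  algebraMap_injective c c' h := by
    have h' := congrArg snd h
    rw [algebraMap_eq, algebraMap_eq, map_smul, map_smul, snd_one,
      ← Algebra.algebraMap_eq_smul_one, ← Algebra.algebraMap_eq_smul_one] at h'
    exact D.algebraMap_injective h'
  degree_zero p hp := by
    obtain ⟨e1, e2, e3⟩ := mem_grading.1 hp
    obtain ⟨c, hc⟩ := D.degree_zero _ e3
    refine ⟨c, ?_⟩
    have h1 := proj_fst p
    rw [proj_of_mem e1, if_pos rfl, proj_of_mem e3, if_pos rfl] at h1
    rw [algebraMap_eq]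
    refine ext ?_ ?_ ?_
    · rw [map_smul, fst_one, h1, ← hc, AlgHom.commutes, Algebra.algebraMap_eq_smul_one]
    · rw [map_smul, mid_one, smul_zero]; exact (show mid p = 0 from e2).symm
    · rw [map_smul, snd_one, ← hc, Algebra.algebraMap_eq_smul_one]
  -- In degree one the middle component has degree zero, so it vanishes by the requirement that it
  -- be of positive degree.
  degree_one := by
    rw [Submodule.eq_bot_iff]
    intro p hp
    obtain ⟨e1, e2, e3⟩ := mem_grading.1 hp
    refine ext (D'.eq_zero_of_mem_one e1) ?_ (D.eq_zero_of_mem_one e3)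
    have h := mem_pos_iff.1 (mid_mem p)
    rwa [proj_of_mem (show mid p ∈ 𝒜' 0 from e2), if_pos rfl] at h

@[simp] theorem fst_d (p : f.Path) : fst ((dga f).d p) = D'.d (fst p) := rfl
@[simp] theorem mid_d (p : f.Path) :
    mid ((dga f).d p) = -D'.d (mid p) + (fst p - f.toFun (snd p)) := rfl
@[simp] theorem snd_d (p : f.Path) : snd ((dga f).d p) = D.d (snd p) := rfl

variable (f) in
/-- The constant paths. -/
def constHom : DGAHom D (dga f) where
  toFun := const f
  map_mem _ _ ha := const_mem ha
  map_d a := ext (f.map_d a) (by simp) rfl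

variable (f) in
/-- The start point of a path. -/
def fstHom : DGAHom (dga f) D' where
  toFun := AlgHom.ofLinearMap fst rfl fun _ _ => rfl
  map_mem _ _ h := (mem_grading.1 h).1
  map_d _ := rfl

variable (f) in
/-- The end point of a path. -/
def sndHom : DGAHom (dga f) D where
  toFun := AlgHom.ofLinearMap snd rfl fun _ _ => rfl
  map_mem _ _ h := (mem_grading.1 h).2.2
  map_d _ := rfl

theorem fstHom_comp_constHom : (fstHom f).comp (constHom f) = f := rfl

theorem sndHom_comp_constHom : (sndHom f).comp (constHom f) = DGAHom.id D := rfl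

/-- The kernel of the end point map consists of pairs (x, t) with differential (dx, -dt + x), a cone
of the identity of `A'_{>0}`, and hence is acyclic. -/
theorem isQuasiIso_sndHom :
    IsQuasiIso (dga f).d D.d (sndHom f).toFun.toLinearMap := by
  intro p a hp ha
  change D.d a = snd p at ha
  have h1 := congrArg mid hp
  rw [mid_d, map_zero] at h1
  have hc : mid p + f.toFun a - f.toFun a ∈ Pos 𝒜' := by
    rw [add_sub_cancel_right]; exact mid_mem p
  -- The middle component of the differential of (t + f a, 0, a) is t, as required. Its first
  -- component is d t + f y, which equals x because `p` is a cycle.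
  refine ⟨mk (mid p + f.toFun a) 0 a hc (zero_mem _), 0, ext ?_ ?_ ha, ?_⟩
  · rw [fst_d, fst_mk, map_add, ← f.map_d, ha]
    rw [neg_add_eq_sub, sub_eq_zero] at h1
    rw [← h1]; abel
  · rw [mid_d, fst_mk, mid_mk, snd_mk]
    simp
  · rw [map_zero, add_zero]; rfl

end DGAHom.Path

end PathAlgebra

/-! ### The operation on the path algebra -/

section PathOperations

variable {k A A' : Type*} [CommRing k] [Ring A] [Algebra k A] [Ring A'] [Algebra k A']
variable {𝒜 : ℕ → Submodule k A} [GradedAlgebra 𝒜]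
variable {𝒜' : ℕ → Submodule k A'} [GradedAlgebra 𝒜']

theorem DGAHom.counit_map {D : DGA 𝒜} {D' : DGA 𝒜'} (f : DGAHom D D') (w : Bar 𝒜) :
    TensorAlgebra.algebraMapInv (f.onBar w) = TensorAlgebra.algebraMapInv w := by
  have : TensorAlgebra.algebraMapInv.comp f.onBar =
      (TensorAlgebra.algebraMapInv : Bar 𝒜 →ₐ[k] k) := by
    refine TensorAlgebra.hom_ext (LinearMap.ext fun x => ?_)
    simp [f.onBar_ι, letter, TensorAlgebra.algebraMapInv]
  exact DFunLike.congr_fun this w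

variable {X : HGAlgebra 𝒜} {X' : HGAlgebra 𝒜'} {f : DGAHom X.toDGA X'.toDGA}
  (H : EHomotopy X X' f)

open DGAHom.Path

/-- The operation on the mapping path algebra with components `E'`, `s` and `E`. -/
def EHomotopy.pathE : Bar (grading f) →ₗ[k] f.Path →ₗ[k] f.Path :=
  LinearMap.mk₂ k (fun w b => DGAHom.Path.mk (X'.E ((fstHom f).onBar w) (fst b))
      (H.s ((sndHom f).onBar w) (snd b)) (X.E ((sndHom f).onBar w) (snd b))
      (by rw [mem_pos_iff, map_sub, f.proj_map, X.proj_E, X'.proj_E, proj_fst, DGAHom.counit_map,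
        DGAHom.counit_map, map_smul, sub_self])
      (H.s_mem_pos _ _))
    (fun w w' b => by refine DGAHom.Path.ext ?_ ?_ ?_ <;> simp)
    (fun c w b => by refine DGAHom.Path.ext ?_ ?_ ?_ <;> simp)
    (fun w b b' => by refine DGAHom.Path.ext ?_ ?_ ?_ <;> simp)
    (fun c w b => by refine DGAHom.Path.ext ?_ ?_ ?_ <;> simp)

theorem EHomotopy.fst_pathE (w : Bar (grading f)) (b : f.Path) :
    fst (H.pathE w b) = X'.E ((fstHom f).onBar w) (fst b) := rfl

theorem EHomotopy.mid_pathE (w : Bar (grading f)) (b : f.Path) :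
    mid (H.pathE w b) = H.s ((sndHom f).onBar w) (snd b) := rfl

theorem EHomotopy.snd_pathE (w : Bar (grading f)) (b : f.Path) :
    snd (H.pathE w b) = X.E ((sndHom f).onBar w) (snd b) := rfl

theorem onBar_fstHom_constHom (w : Bar 𝒜) :
    (fstHom f).onBar ((constHom f).onBar w) = f.onBar w := by
  rw [← DGAHom.onBar_comp, fstHom_comp_constHom]

theorem onBar_sndHom_constHom (w : Bar 𝒜) :
    (sndHom f).onBar ((constHom f).onBar w) = w := by
  rw [← DGAHom.onBar_comp, sndHom_comp_constHom, DGAHom.onBar_id]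

/-- A constant path is recovered from its end point. -/
theorem exists_map_mapLetter (l : List (Letter (grading f) (constHom f).toFun.range)) :
    ∃ m : List (Letter 𝒜 (⊤ : Subalgebra k A)), m.map (constHom f).mapLetter = l := by
  refine ⟨l.map fun c => ⟨snd c.val, c.par, (mem_homog_iff.1 c.mem_homog).2.2,
    DGAHom.Path.mem_pos.1 c.mem_pos, trivial⟩, ?_⟩
  rw [List.map_map]
  conv_rhs => rw [← List.map_id l]
  refine List.map_congr_left fun c _ => ?_
  obtain ⟨v, p, h1, h2, ⟨a, rfl⟩⟩ := c
  rfl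

theorem EHomotopy.pathE_homog (l : List (Letter 𝒜 (⊤ : Subalgebra k A))) {p : ZMod 2} {b : A}
    (hb : b ∈ homog 𝒜 p) :
    H.pathE ((constHom f).onBar (wd l)) (const f b) ∈ homog (grading f) (ep l + p) := by
  rw [mem_homog_iff, H.fst_pathE, H.mid_pathE, H.snd_pathE, onBar_fstHom_constHom,
    onBar_sndHom_constHom, ← f.wd_map, ← f.ep_map l]
  refine ⟨X'.E_mem_homog _ (f.map_mem_homog hb), ?_, ?_⟩
  · rw [f.ep_map]; exact H.s_mem_homog l hb
  · rw [f.ep_map]; exact X.E_mem_homog l hb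

/-- The outer components are the formulas for `d E'` on images under `f` and for `d E`. The middle
one is the homotopy identity for `s`: the difference of `E' f` and `f E` comes from the term x - f y
in the differential of a path. -/
theorem EHomotopy.d_pathE (l : List (Letter 𝒜 (⊤ : Subalgebra k A))) {p : ZMod 2} {b : A}
    (hb : b ∈ homog 𝒜 p) :
    (dga f).d (H.pathE ((constHom f).onBar (wd l)) (const f b)) =
      - H.pathE ((constHom f).onBar (barD X.toDGA (wd l))) (const f b)
      + sign k (ep l) • H.pathE ((constHom f).onBar (wd l)) (const f (X.d b))
      - (splitSum l fun x y => sign k (ep x) •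
          (const f (tl x) * H.pathE ((constHom f).onBar (wd y)) (const f b)))
      + splitSum l fun x y => sign k (p + ep x + (p + 1) * ep y) •
          (H.pathE ((constHom f).onBar (wd x)) (const f b) * const f (tl y)) := by
  have h1 := (X'.actsOn f.toFun.range (by
    rintro _ ⟨a, rfl⟩; exact ⟨X.d a, f.map_d a⟩)).d_E (l.map f.mapLetter) p (f.toFun b) ⟨b, rfl⟩
      (f.map_mem_homog hb)
  have h2 := H.homotopy_wd l hb
  have h3 := (X.actsOn ⊤ fun _ _ => trivial).d_E l p b trivial hb
  simp only [splitSum_map, f.wd_map, f.ep_map, f.tl_map, f.barD_map] at h1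
  refine DGAHom.Path.ext ?_ ?_ ?_
  · simp only [fst_d, H.fst_pathE, map_add, map_sub, map_neg, map_smul, map_splitSum,
      onBar_fstHom_constHom, fst_mul, fst_const]
    rw [h1, f.map_d]
  · simp only [mid_d, H.fst_pathE, H.mid_pathE, H.snd_pathE, map_add, map_sub, map_neg, map_smul,
      map_splitSum, onBar_fstHom_constHom, onBar_sndHom_constHom, mid_mul, fst_const, mid_const,
      snd_const, mul_zero, zero_mul, zero_add, add_zero]
    -- The letter of a one-letter piece `x` has parity `ep x + 1`, so the two signs combine to `-1`.
    have e : (splitSum l fun x y => sign k (ep x) •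
        (sgn 𝒜' (f.toFun (tl x)) * H.s (wd y) b)) =
        - splitSum l fun x y => f.toFun (tl x) * H.s (wd y) b := by
      rw [← splitSum_neg]
      refine splitSum_congr fun x y _ => ?_
      rw [sgn_of_homog (f.map_mem_homog (tl_mem_homog x)), smul_mul_assoc, smul_smul, ← sign_add,
        ← add_assoc, show ep x + ep x = 0 from CharTwo.add_self_eq_zero _, zero_add, sign_one,
        neg_one_smul]
    rw [e, ← neg_sub (f.toFun _) (X'.E _ _), h2]
    abel
  · simp only [snd_d, H.snd_pathE, map_add, map_sub, map_neg, map_smul, map_splitSum,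
      onBar_sndHom_constHom, snd_mul, snd_const]
    exact h3

/-- The middle component is the product rule for `s`; its two sums are the two terms in the middle
component of a product of paths. -/
theorem EHomotopy.pathE_mul (l : List (Letter 𝒜 (⊤ : Subalgebra k A))) {p : ZMod 2} {b : A}
    (hb : b ∈ homog 𝒜 p) (c : A) :
    H.pathE ((constHom f).onBar (wd l)) (const f (b * c)) =
      splitSum l fun x y => sign k (p * ep y) •
        (H.pathE ((constHom f).onBar (wd x)) (const f b) *
          H.pathE ((constHom f).onBar (wd y)) (const f c)) := by
  have h1 := (X'.actsOn f.toFun.range (by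
    rintro _ ⟨a, rfl⟩; exact ⟨X.d a, f.map_d a⟩)).E_mul (l.map f.mapLetter) p (f.toFun b) ⟨b, rfl⟩
      (f.map_mem_homog hb) (f.toFun c) ⟨c, rfl⟩
  have h3 := (X.actsOn ⊤ fun _ _ => trivial).E_mul l p b trivial hb c trivial
  simp only [splitSum_map, f.wd_map, f.ep_map] at h1
  refine DGAHom.Path.ext ?_ ?_ ?_
  · simp only [H.fst_pathE, map_smul, map_splitSum, onBar_fstHom_constHom, fst_mul, fst_const,
      map_mul]
    exact h1
  · simp only [H.fst_pathE, H.mid_pathE, H.snd_pathE, map_smul, map_splitSum,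
      onBar_fstHom_constHom, onBar_sndHom_constHom, mid_mul, fst_const, snd_const]
    rw [H.s_mul_wd l hb, ← splitSum_add]
    refine splitSum_congr fun x y _ => ?_
    have hs := X'.E_mem_homog (x.map f.mapLetter) (f.map_mem_homog hb)
    rw [f.wd_map, f.ep_map] at hs
    rw [sgn_of_homog hs, smul_mul_assoc, smul_add, smul_smul, ← sign_add]
    congr 3
    ring
  · simp only [H.snd_pathE, map_smul, map_splitSum, onBar_sndHom_constHom, snd_mul, snd_const]
    exact h3

/-- Only constant paths are admitted as arguments: `s` compares `E` with `E'` evaluated on images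
under `f`, so start points must be the images of end points. -/
theorem EHomotopy.actsOn_pathE : ActsOn (dga f) H.pathE (constHom f).toFun.range where
  d_mem := by
    rintro _ ⟨a, rfl⟩; exact ⟨X.d a, (constHom f).map_d a⟩
  E_one := by
    rintro _ ⟨a, rfl⟩
    refine DGAHom.Path.ext ?_ ?_ ?_
    · rw [H.fst_pathE, map_one, X'.E_one]
    · rw [H.mid_pathE, map_one, H.s_one]; rfl
    · rw [H.snd_pathE, map_one, X.E_one]
  E_homog := by
    rintro l p _ ⟨b, rfl⟩ hb
    obtain ⟨l, rfl⟩ := exists_map_mapLetter l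
    rw [DGAHom.wd_map, DGAHom.ep_map]
    exact H.pathE_homog l (mem_homog_iff.1 hb).2.2
  E_pos := by
    rintro l _ ⟨b, rfl⟩ hb
    rw [DGAHom.Path.mem_pos] at hb ⊢
    rw [H.snd_pathE, mem_pos_iff, X.proj_E, mem_pos_iff.1 hb, smul_zero]
  d_E := by
    rintro l p _ ⟨b, rfl⟩ hb
    obtain ⟨l, rfl⟩ := exists_map_mapLetter l
    have e := H.d_pathE l (mem_homog_iff.1 hb).2.2
    simp only [splitSum_map, DGAHom.wd_map, DGAHom.ep_map, DGAHom.tl_map, DGAHom.barD_map]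
    have hd : (dga f).d ((constHom f).toFun.toRingHom b) = (constHom f).toFun.toRingHom (X.d b) :=
      ((constHom f).map_d b).symm
    rw [hd]
    exact e
  E_mul := by
    rintro l p _ ⟨b, rfl⟩ hb _ ⟨c, rfl⟩
    obtain ⟨l, rfl⟩ := exists_map_mapLetter l
    simp only [splitSum_map, DGAHom.wd_map, DGAHom.ep_map]
    rw [← map_mul]
    exact H.pathE_mul l (mem_homog_iff.1 hb).2.2 c

end PathOperations

/-! ### Projectivity -/

section Flatness

variable {k A A' : Type*} [CommRing k] [Ring A] [Algebra k A] [Ring A'] [Algebra k A']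
variable {𝒜 : ℕ → Submodule k A} [GradedAlgebra 𝒜]
variable {𝒜' : ℕ → Submodule k A'} [GradedAlgebra 𝒜']

/-- The tensor algebra of a projective module is projective. -/
instance tensorAlgebra_projective {M : Type*} [AddCommGroup M] [Module k M]
    [Module.Projective k M] : Module.Projective k (TensorAlgebra k M) := by
  obtain ⟨s, hs⟩ := Module.projective_def'.1 (inferInstance : Module.Projective k M)
  -- A projective module is a retract of a free one, and the tensor algebra functor preserves
  -- retracts.
  let i : TensorAlgebra k M →ₐ[k] TensorAlgebra k (M →₀ k) :=
    TensorAlgebra.lift k (TensorAlgebra.ι k ∘ₗ s)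
  let r : TensorAlgebra k (M →₀ k) →ₐ[k] TensorAlgebra k M :=
    TensorAlgebra.lift k (TensorAlgebra.ι k ∘ₗ Finsupp.linearCombination k id)
  have h : r.comp i = AlgHom.id k _ := by
    refine TensorAlgebra.hom_ext (LinearMap.ext fun x => ?_)
    have hx := LinearMap.congr_fun hs x
    simp only [LinearMap.comp_apply, LinearMap.id_apply] at hx
    simp [i, r, hx]
  exact Module.Projective.of_split i.toLinearMap r.toLinearMap
    (LinearMap.ext fun x => DFunLike.congr_fun h x)

theorem projective_of_grading (h : ∀ n, Module.Free k (𝒜 n)) : Module.Projective k A :=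
  Module.Projective.of_equiv (DirectSum.decomposeLinearEquiv 𝒜).symm

theorem toPos_comp_subtype : toPos 𝒜 ∘ₗ (Pos 𝒜).subtype = LinearMap.id := by
  refine LinearMap.ext fun a => Subtype.ext ?_
  simp [coe_toPos, mem_pos_iff.1 a.2]

theorem projective_pos [Module.Projective k A] : Module.Projective k (Pos 𝒜) :=
  Module.Projective.of_split (Pos 𝒜).subtype (toPos 𝒜) toPos_comp_subtype

/-- The path algebra is a direct summand of `A' × A' × A` by way of (x, t, y) ↦ (x - f y, t, y). -/
theorem DGAHom.Path.projective_pos {D : DGA 𝒜} {D' : DGA 𝒜'} (f : DGAHom D D')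
    [Module.Projective k A] [Module.Projective k A'] :
    Module.Projective k (Pos (DGAHom.Path.grading f)) := by
  have : Module.Projective k f.Path := by
    refine Module.Projective.of_split (M := A' × A' × A)
      ((fst - f.toFun.toLinearMap ∘ₗ snd).prod (mid.prod snd))
      ((inl f).coprod ((inm f).coprod (const f).toLinearMap)) (LinearMap.ext fun p => ?_)
    conv_rhs => rw [LinearMap.id_apply, eq_sum p, add_assoc]
    rfl
  exact HGA.projective_pos

end Flatness

/-! ### Multiplicativity on Hochschild homology -/

section Multiplicativity

variable {k A A' : Type*} [CommRing k] [Ring A] [Algebra k A] [Ring A'] [Algebra k A']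
variable {𝒜 : ℕ → Submodule k A} [GradedAlgebra 𝒜]
variable {𝒜' : ℕ → Submodule k A'} [GradedAlgebra 𝒜']
variable {X : HGAlgebra 𝒜} {X' : HGAlgebra 𝒜'} {f : DGAHom X.toDGA X'.toDGA}

open DGAHom.Path

/-- The map on Hochschild homology is multiplicative in the presence of the homotopies `s`. -/
theorem EHomotopy.exists_onHoch_lam_sub (H : EHomotopy X X' f) [Module.Projective k A]
    [Module.Projective k A'] {x y : Hoch 𝒜} (hx : hochD X.toDGA x = 0)
    (hy : hochD X.toDGA y = 0) (h : hochD X.toDGA (lam X.E x y) = 0) :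
    ∃ z, hochD X'.toDGA z = f.onHoch (lam X.E x y) - lam X'.E (f.onHoch x) (f.onHoch y) := by
  have : Module.Projective k (Pos 𝒜) := projective_pos
  have : Module.Projective k (Pos (grading f)) := DGAHom.Path.projective_pos f
  have hj := (sndHom f).onHH_bijective isQuasiIso_sndHom
  have hz := (constHom f).hochD_lam_of_cycle H.actsOn_pathE hx hy
  have hz' : hochD (dga f) ((constHom f).onHoch (lam X.E x y)) = 0 := by
    rw [← DGAHom.hochD_map, h, map_zero]
  have h1 := (sndHom f).onHoch_lam (EP := H.pathE) (EQ := X.E) (constHom f)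
    (fun l b => H.snd_pathE _ _) x y
  have h0 := (fstHom f).onHoch_lam (EP := H.pathE) (EQ := X'.E) (constHom f)
    (fun l b => H.fst_pathE _ _) x y
  rw [sndHom_comp_constHom, DGAHom.onHoch_id, DGAHom.onHoch_id] at h1
  rw [fstHom_comp_constHom] at h0
  -- The constant paths do not respect the operations strictly, but both cycles have end point
  -- `λ_E(x, y)`, and the end point map is injective on Hochschild homology.
  have key : Homology.mk (hochD (dga f)) _ hz' = Homology.mk (hochD (dga f)) _ hz := by
    apply hj.1
    rw [DGAHom.onHH_mk, DGAHom.onHH_mk, Homology.mk_eq_mk_iff]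
    refine ⟨0, ?_⟩
    rw [h1, ← DGAHom.onHoch_comp, sndHom_comp_constHom, DGAHom.onHoch_id, sub_self, map_zero]
  obtain ⟨z, e⟩ := (Homology.mk_eq_mk_iff _ _).1 key
  -- The start point map carries the two homologous cycles to the two cycles to be compared.
  refine ⟨(fstHom f).onHoch z, ?_⟩
  rw [← DGAHom.hochD_map, e, map_sub, h0, ← DGAHom.onHoch_comp, fstHom_comp_constHom]

theorem DGAHom.onHH_one {D : DGA 𝒜} {D' : DGA 𝒜'} (f : DGAHom D D') :
    f.onHH (HH.one D) = HH.one D' := by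
  rw [HH.one, HH.one, f.onHH_mk, Homology.mk_eq_mk_iff]
  refine ⟨0, ?_⟩
  rw [f.onHoch_tmul, map_one, map_one, sub_self, map_zero]

end Multiplicativity

end HGA
end

theorem mainTheorem4 {k A A' : Type*} [CommRing k] [Ring A] [Algebra k A] [Ring A'] [Algebra k A']
    {𝒜 : ℕ → Submodule k A} [GradedAlgebra 𝒜] {𝒜' : ℕ → Submodule k A'} [GradedAlgebra 𝒜']
    (X : HGA.HGAlgebra 𝒜) (X' : HGA.HGAlgebra 𝒜')
    (hA : ∀ n, Module.Free k (𝒜 n)) (hA' : ∀ n, Module.Free k (𝒜' n))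
    (f : HGA.DGAHom X.toDGA X'.toDGA) (s : HGA.EHomotopy X X' f) :
    (∃! m, HGA.IsInducedProduct X m) ∧ (∃! m', HGA.IsInducedProduct X' m') ∧
    (∀ m m', HGA.IsInducedProduct X m → HGA.IsInducedProduct X' m' →
      f.onHH (HGA.HH.one X.toDGA) = HGA.HH.one X'.toDGA ∧
      ∀ x y, f.onHH (m x y) = m' (f.onHH x) (f.onHH y)) ∧
    (Function.Bijective f.onH → Function.Bijective f.onHH) := by
  -- Freeness enters through projectivity, which passes to `A_{>0}`, to tensor algebras and to the
  -- path algebra, and which supplies the flatness used for quasi-isomorphisms.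
  have : Module.Projective k A := HGA.projective_of_grading hA
  have : Module.Projective k A' := HGA.projective_of_grading hA'
  have : Module.Projective k (HGA.Pos 𝒜) := HGA.projective_pos
  have : Module.Projective k (HGA.Pos 𝒜') := HGA.projective_pos
  refine ⟨X.existsUnique_product, X'.existsUnique_product, fun m m' hm hm' => ⟨f.onHH_one, ?_⟩,
    fun h => f.onHH_bijective (HGA.isQuasiIso_of_bijective f.map_d h)⟩
  intro a b
  obtain ⟨x, hx, rfl⟩ := HGA.Homology.exists_mk a
  obtain ⟨y, hy, rfl⟩ := HGA.Homology.exists_mk b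
  obtain ⟨h, e⟩ := hm x y hx hy
  obtain ⟨h', e'⟩ := hm' (f.onHoch x) (f.onHoch y) (by rw [← f.hochD_map, hx, map_zero])
    (by rw [← f.hochD_map, hy, map_zero])
  rw [e, HGA.DGAHom.onHH_mk, HGA.DGAHom.onHH_mk, HGA.DGAHom.onHH_mk, e', HGA.Homology.mk_eq_mk_iff]
  exact s.exists_onHoch_lam_sub hx hy h
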